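/- Let $S$ be a closed connected oriented surface, let $Z\subset S$ be a finite set, and let $\kappa: Z\to\mathbb{Z}_{\ge 0}$. **The stratum.** A *translation surface* $(X,\omega)$ on $(S,Z)$ with multiplicities $\kappa$ is a Riemann surface structure $X$ on $S$, compatible with its topology and orientation, with a holomorphic $1$-form $\omega$ that vanishes to order exactly $\kappa(z)$ at each $z\in Z$ and nowhere outside $Z$. Two of them, $(X,\omega)$ and $(X',\omega')$, are *Teichmüller equivalent* if there is a biholomorphism $\psi:X\to X'$ with $\psi^*\omega'=\omega$ that is isotopic to the identity of $S$ rel $Z$. The Teichmüller stratum $\Omega\mathcal T(\kappa)$ is the set of equivalence classes, with the weakest topology that makes all period maps $[(X,\omega)]\mapsto\int_\gamma\omega$, $\gamma\in H_1(S,Z;\mathbb{Z})$, continuous. $\mathbb{P}\Omega\mathcal T(\kappa)$ is its quotient by the action $\lambda\cdot[(X,\omega)]=[(X,\lambda\omega)]$ of $\mathbb{C}^*$, with the quotient topology. **Iso-Delaunay regions.** A *topological triangulation* $\tau$ of $(S,Z)$ is a finite decomposition of $S$ into triangles glued along their sides in pairs, with vertex set $Z$ (sides or vertices of one triangle may be identified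 in $S$). It is a *geometric triangulation* of $(X,\omega)$ if each face is a nondegenerate Euclidean triangle for the flat metric $|\omega|$. It is a *nondegenerate Delaunay triangulation* of $(X,\omega)$ if moreover for each face $f$ there are an open Euclidean disk $D\subset\mathbb{R}^2$ and a continuous map $d:\overline D\to X$ such that $d|_D$ is an isometric immersion, $d(D)\cap Z=\emptyset$, $d^{-1}(Z)$ consists of exactly three points, and $f$ is the image under $d$ of the triangle with these three points as vertices. The *iso-Delaunay region* $\Delta_{\mathcal D}(\tau)\subset\mathbb{P}\Omega\mathcal T(\kappa)$ is the set of classes of those $(X,\omega)$ for which $\tau$ is a nondegenerate Delaunay triangulation. **Angle coordinates.** Let $A$ be the set of corners of the faces of $\tau$, and let $\mathcal A\subset\mathbb{R}^A$ be the set of all $\theta:A\to(0,\pi)$ whose three values in each face add up to $\pi$. The *angle map* $\Theta:\Delta_{\mathcal D}(\tau)\to\mathcal A$ sends the class of $(X,\omega)$, where $\tau$ is a geometric triangulation of $(X,\omega)$, to the interior angles of the Euclidean triangles of $\tau$. **Hyperelliptic components.** $(X,\omega)$ *lies in a hyperelliptic component* if there is an orientation-preserving homeomorphism $\iota:S\to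 S$ acting as $-1$ on $H_1(S;\mathbb{Z})$ that is a biholomorphism of $X$ with $\iota^*\omega=-\omega$, and either $\#Z=1$, or $\#Z=2$ and $\iota$ interchanges the two points of $Z$. **Corollary B.** Every iso-Delaunay region in a hyperelliptic stratum component is convex in angle coordinates: if $\tau$ is a topological triangulation of $(S,Z)$ and $\Delta_{\mathcal D}(\tau)$ contains the class of a translation surface that lies in a hyperelliptic component, then $\Theta$ is a homeomorphism from $\Delta_{\mathcal D}(\tau)$ onto a convex subset of $\mathbb{R}^A$ contained in $\mathcal A$. -/

import Mathlib

open Set Filter Topology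
open scoped Manifold ContDiff

noncomputable section

namespace IsoDelaunay

/-! ### Oriented topological surfaces -/

/-- The map `h` has local degree `+1` at `a`: on a punctured disk, `h (a + z) - h a` does not vanish
and `(h (a + z) - h a) / z` has a continuous logarithm, that is, the image of a small circle around
`a` winds exactly once, counterclockwise, around `h a`. -/
def IsPositiveAt (h : ℂ → ℂ) (a : ℂ) : Prop :=
  ∃ r : ℝ, 0 < r ∧ ∃ L : ℂ → ℂ, ContinuousOn L (Metric.ball 0 r \ {0}) ∧
    ∀ z ∈ Metric.ball (0 : ℂ) r \ {0}, h (a + z) - h a = z * Complex.exp (L z)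

/-- An oriented atlas of a topological surface `S`. -/
structure SurfaceOrientation (S : Type) [TopologicalSpace S] where
  charts : Set (OpenPartialHomeomorph S ℂ)
  cover : ∀ p : S, ∃ φ ∈ charts, p ∈ φ.source
  coherent : ∀ φ ∈ charts, ∀ φ' ∈ charts, ∀ p ∈ φ.source ∩ φ'.source,
    IsPositiveAt (φ' ∘ φ.symm) (φ p)

/-- A homeomorphism of an oriented surface that preserves the orientation. -/
def SurfaceOrientation.IsPreservedBy {S : Type} [TopologicalSpace S] (o : SurfaceOrientation S)
    (f : S ≃ₜ S) : Prop :=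
  ∀ φ ∈ o.charts, ∀ φ' ∈ o.charts, ∀ p ∈ φ.source, f p ∈ φ'.source →
    IsPositiveAt (φ' ∘ f ∘ φ.symm) (φ p)

/-! ### Translation surfaces -/

/-- A translation surface structure `(X, ω)` on the oriented surface `S` with zero multiplicities
`κ` on `Z`: a Riemann surface structure `X` on `S` (inducing the given topology and orientation)
together with a holomorphic `1`-form `ω`, written as `coeff φ (z) dz` in each chart `φ` of the
atlas, which vanishes to order `κ z` at each `z ∈ Z` and vanishes nowhere else. -/
structure TranslationSurface {S : Type} [TopologicalSpace S] (o : SurfaceOrientation S)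
    (Z : Finset S) (κ : Z → ℕ) where
  [chartedSpace : ChartedSpace ℂ S]
  [isManifold : IsManifold 𝓘(ℂ) ω S]
  coeff : OpenPartialHomeomorph S ℂ → ℂ → ℂ
  holomorphic : ∀ φ ∈ atlas ℂ S, DifferentiableOn ℂ (coeff φ) φ.target
  coeff_change : ∀ φ ∈ atlas ℂ S, ∀ φ' ∈ atlas ℂ S, ∀ p ∈ φ.source ∩ φ'.source,
    coeff φ (φ p) = coeff φ' (φ' p) * deriv (φ' ∘ φ.symm) (φ p)
  order_eq : ∀ φ ∈ atlas ℂ S, ∀ z : Z, (z : S) ∈ φ.source →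
    analyticOrderAt (coeff φ) (φ z) = κ z
  ne_zero : ∀ φ ∈ atlas ℂ S, ∀ p ∈ φ.source, p ∉ Z → coeff φ (φ p) ≠ 0
  positive : ∀ φ ∈ o.charts, ∀ φ' ∈ atlas ℂ S, ∀ p ∈ φ.source ∩ φ'.source,
    IsPositiveAt (φ' ∘ φ.symm) (φ p)

namespace TranslationSurface

variable {S : Type} [TopologicalSpace S] {o : SurfaceOrientation S} {Z : Finset S} {κ : Z → ℕ}

/-- The charts of the Riemann surface `X`. -/
def charts (X : TranslationSurface o Z κ) : Set (OpenPartialHomeomorph S ℂ) :=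
  X.chartedSpace.atlas

/-- `f : X → Y` is holomorphic and pulls `ω_Y` back to `ω_X`. -/
def PullsBack (X Y : TranslationSurface o Z κ) (f : S → S) : Prop :=
  ∀ φ ∈ X.charts, ∀ φ' ∈ Y.charts, ∀ p ∈ φ.source, f p ∈ φ'.source →
    ∃ c : ℂ, HasDerivAt (φ' ∘ f ∘ φ.symm) c (φ p) ∧
      X.coeff φ (φ p) = Y.coeff φ' (φ' (f p)) * c

/-- `f : X → Y` is a biholomorphism with `f^* ω_Y = ω_X`. -/
def IsIso (X Y : TranslationSurface o Z κ) (f : S ≃ₜ S) : Prop :=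
  PullsBack X Y f ∧ PullsBack Y X f.symm

/-- The action of `λ ∈ ℂ^*`: `(X, ω) ↦ (X, λ ω)`. -/
instance : SMul ℂˣ (TranslationSurface o Z κ) where
  smul c X :=
    letI := X.chartedSpace
    haveI := X.isManifold
    { coeff := fun φ z => (c : ℂ) * X.coeff φ z
      holomorphic := fun φ hφ => (X.holomorphic φ hφ).const_mul _
      coeff_change := fun φ hφ φ' hφ' p hp => by
        rw [X.coeff_change φ hφ φ' hφ' p hp, mul_assoc]
      order_eq := fun φ hφ z hz => by
        rw [← X.order_eq φ hφ z hz]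
        have h1 : AnalyticAt ℂ (X.coeff φ) (φ z) :=
          (X.holomorphic φ hφ).analyticAt (φ.open_target.mem_nhds (φ.map_source hz))
        have h2 : analyticOrderAt (fun _ : ℂ => (c : ℂ)) (φ z) = 0 :=
          analyticAt_const.analyticOrderAt_eq_zero.2 c.ne_zero
        have h3 := analyticOrderAt_mul (analyticAt_const (v := (c : ℂ)) (x := φ z)) h1
        rw [h2, zero_add] at h3
        exact h3
      ne_zero := fun φ hφ p hp hpZ => mul_ne_zero c.ne_zero (X.ne_zero φ hφ p hp hpZ)
      positive := X.positive }

theorem smul_charts (c : ℂˣ) (X : TranslationSurface o Z κ) : (c • X).charts = X.charts := rfl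

theorem smul_coeff (c : ℂˣ) (X : TranslationSurface o Z κ) (φ : OpenPartialHomeomorph S ℂ)
    (z : ℂ) : (c • X).coeff φ z = c * X.coeff φ z := rfl

/-- `F` is a primitive of `ω` on the set `U`: it is holomorphic with `dF = ω`. -/
def IsPrimitiveOn (X : TranslationSurface o Z κ) (F : S → ℂ) (U : Set S) : Prop :=
  ∀ φ ∈ X.charts, ∀ p ∈ φ.source ∩ U, HasDerivAt (F ∘ φ.symm) (X.coeff φ (φ p)) (φ p)

/-- `D` is a primitive of `ω` along the map `f`: locally, `D = F ∘ f` for a local primitive `F`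
of `ω`. -/
def IsPrimitiveAlong (X : TranslationSurface o Z κ) {T : Type} [TopologicalSpace T]
    (f : T → S) (D : T → ℂ) : Prop :=
  ∀ t : T, ∃ U : Set S, IsOpen U ∧ f t ∈ U ∧ ∃ F : S → ℂ, X.IsPrimitiveOn F U ∧
    ∀ᶠ s in 𝓝 t, D s = F (f s)

open Classical in
/-- The period `∫_γ ω` along a continuous path `γ`, computed from any primitive of `ω` along `γ`. -/
def period (X : TranslationSurface o Z κ) (γ : C(unitInterval, S)) : ℂ :=
  if h : ∃ D : unitInterval → ℂ, X.IsPrimitiveAlong γ D then h.choose 1 - h.choose 0 else 0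

/-! ### The Teichmüller stratum -/

/-- `f` is isotopic to the identity relative to `Z`. -/
def IsotopicToIdRel (Z : Finset S) (f : S ≃ₜ S) : Prop :=
  ∃ H : unitInterval → (S ≃ₜ S), Continuous (fun q : unitInterval × S => H q.1 q.2) ∧
    H 0 = Homeomorph.refl S ∧ H 1 = f ∧ ∀ t, ∀ z ∈ Z, H t z = z

/-- Teichmüller equivalence. Every translation surface here lives on `S` itself, marked by the
identity. -/
def TeichEquiv (X Y : TranslationSurface o Z κ) : Prop :=
  ∃ f : S ≃ₜ S, IsIso X Y f ∧ IsotopicToIdRel Z f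

theorem PullsBack.refl (X : TranslationSurface o Z κ) : PullsBack X X id := by
  intro φ hφ φ' hφ' p hp hp'
  let := X.chartedSpace
  have := X.isManifold
  refine ⟨deriv (φ' ∘ φ.symm) (φ p), ?_, X.coeff_change φ hφ φ' hφ' p ⟨hp, hp'⟩⟩
  have hg := HasGroupoid.compatible (G := contDiffGroupoid ω 𝓘(ℂ)) hφ hφ'
  rw [contDiffGroupoid, mem_groupoid_of_pregroupoid] at hg
  have h1 : ContDiffOn ℂ ω (φ' ∘ φ.symm) (φ.symm ≫ₕ φ').source := by
    simpa [contDiffPregroupoid] using hg.1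
  have hmem : φ p ∈ (φ.symm ≫ₕ φ').source := by
    simpa [hp] using hp'
  have h2 : DifferentiableAt ℂ (φ' ∘ φ.symm) (φ p) :=
    ((h1.differentiableOn (by simp)) _ hmem).differentiableAt
      ((φ.symm ≫ₕ φ').open_source.mem_nhds hmem)
  exact h2.hasDerivAt

theorem PullsBack.comp {X Y W : TranslationSurface o Z κ} {f g : S → S} (hfc : Continuous f)
    (hg : PullsBack Y W g) (hf : PullsBack X Y f) : PullsBack X W (g ∘ f) := by
  intro φ hφ φ'' hφ'' p hp hp''
  let := Y.chartedSpace
  obtain ⟨c, hc, hc'⟩ := hf φ hφ (chartAt ℂ (f p)) (chart_mem_atlas ℂ (f p)) p hp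
    (mem_chart_source ℂ (f p))
  obtain ⟨d, hd, hd'⟩ := hg (chartAt ℂ (f p)) (chart_mem_atlas ℂ (f p)) φ'' hφ'' (f p)
    (mem_chart_source ℂ (f p)) hp''
  refine ⟨d * c, ?_, by rw [hc', hd', mul_assoc]; rfl⟩
  have hd2 : HasDerivAt (φ'' ∘ g ∘ (chartAt ℂ (f p)).symm) d
      ((chartAt ℂ (f p) ∘ f ∘ φ.symm) (φ p)) := by
    simpa [φ.left_inv hp] using hd
  refine (hd2.comp (φ p) hc).congr_of_eventuallyEq ?_
  have hcont : ContinuousAt (f ∘ φ.symm) (φ p) :=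
    hfc.continuousAt.comp (φ.continuousAt_symm (φ.map_source hp))
  have hev : ∀ᶠ z in 𝓝 (φ p), (f ∘ φ.symm) z ∈ (chartAt ℂ (f p)).source := by
    refine hcont.eventually_mem ((chartAt ℂ (f p)).open_source.mem_nhds ?_)
    simp [φ.left_inv hp]
  filter_upwards [hev] with z hz
  simp only [Function.comp_apply] at hz ⊢
  rw [(chartAt ℂ (f p)).left_inv hz]

theorem PullsBack.smul {X Y : TranslationSurface o Z κ} {f : S → S} (c : ℂˣ)
    (h : PullsBack X Y f) : PullsBack (c • X) (c • Y) f := by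
  intro φ hφ φ' hφ' p hp hp'
  obtain ⟨d, hd, hd'⟩ := h φ hφ φ' hφ' p hp hp'
  exact ⟨d, hd, by rw [smul_coeff, smul_coeff, hd', mul_assoc]⟩

theorem teichEquiv_equivalence :
    Equivalence (TeichEquiv : TranslationSurface o Z κ → TranslationSurface o Z κ → Prop) where
  refl X := ⟨Homeomorph.refl S, ⟨PullsBack.refl X, PullsBack.refl X⟩,
    fun _ => Homeomorph.refl S, continuous_snd, rfl, rfl, fun _ _ _ => rfl⟩
  symm := by
    rintro X Y ⟨f, ⟨h1, h2⟩, H, hH, h0, hf, hZ⟩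
    refine ⟨f.symm, ⟨h2, h1⟩, fun t => f.symm.trans (H (unitInterval.symm t)), ?_, ?_, ?_, ?_⟩
    · exact hH.comp ((unitInterval.continuous_symm.comp continuous_fst).prodMk
        (f.symm.continuous.comp continuous_snd))
    · simp [hf]
    · simp only [unitInterval.symm_one, h0]
      rfl
    · intro t z hz
      have : f.symm z = z := by
        rw [Homeomorph.symm_apply_eq, ← hf]
        exact (hZ 1 z hz).symm
      simp only [Homeomorph.trans_apply, this]
      exact hZ _ z hz
  trans := by
    rintro X Y W ⟨f, ⟨h1, h2⟩, H, hH, h0, hf, hZ⟩ ⟨g, ⟨k1, k2⟩, K, hK, k0, hg, kZ⟩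
    refine ⟨f.trans g, ⟨PullsBack.comp (f := f) (g := g) f.continuous k1 h1,
      PullsBack.comp (f := g.symm) (g := f.symm) g.symm.continuous h2 k2⟩, fun t => (H t).trans (K t), ?_, ?_, ?_, ?_⟩
    · exact hK.comp (continuous_fst.prodMk hH)
    · simp only [h0, k0]
      rfl
    · simp only [hf, hg]
    · intro t z hz
      simp only [Homeomorph.trans_apply, hZ t z hz]
      exact kZ t z hz

instance teichSetoid (o : SurfaceOrientation S) (Z : Finset S) (κ : Z → ℕ) :
    Setoid (TranslationSurface o Z κ) := ⟨TeichEquiv, teichEquiv_equivalence⟩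

end TranslationSurface

section Stratum

variable {S : Type} [TopologicalSpace S]

/-- The Teichmüller stratum `ΩT(κ)` of the marked surface `(S, Z)`. -/
def Stratum (o : SurfaceOrientation S) (Z : Finset S) (κ : Z → ℕ) : Type :=
  Quotient (TranslationSurface.teichSetoid o Z κ)

variable {o : SurfaceOrientation S} {Z : Finset S} {κ : Z → ℕ}

/-- The Teichmüller class of a translation surface. -/
def Stratum.mk (X : TranslationSurface o Z κ) : Stratum o Z κ := Quotient.mk _ X

/-- The period map `Φ_γ` (the period does not depend on the representative when both endpoints of
`γ` lie in `Z`). -/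
def Stratum.period (γ : C(unitInterval, S)) (M : Stratum o Z κ) : ℂ :=
  (Quotient.out M : TranslationSurface o Z κ).period γ

/-- The weakest topology that makes the period maps `Φ_γ` continuous, where `γ` runs through the
paths with endpoints in `Z`; their classes generate `H_1(S, Z; ℤ)`. -/
instance : TopologicalSpace (Stratum o Z κ) :=
  ⨅ γ : {γ : C(unitInterval, S) // γ 0 ∈ Z ∧ γ 1 ∈ Z},
    TopologicalSpace.induced (Stratum.period γ.1) inferInstance

/-- The action of `ℂ^*` on the stratum by rescaling the differential. -/
instance : MulAction ℂˣ (Stratum o Z κ) where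
  smul c := Quotient.map (fun X => c • X) (by
    rintro X Y ⟨f, ⟨h1, h2⟩, hf⟩
    exact ⟨f, ⟨h1.smul c, h2.smul c⟩, hf⟩)
  one_smul := by
    rintro ⟨X⟩
    refine congrArg (Quotient.mk _) ?_
    cases X
    simp [HSMul.hSMul, SMul.smul]
  mul_smul := by
    rintro c d ⟨X⟩
    refine congrArg (Quotient.mk _) ?_
    cases X
    simp [HSMul.hSMul, SMul.smul, mul_assoc]

/-- The projectivized Teichmüller stratum `PΩT(κ)`, with the quotient topology. -/
def PStratum (o : SurfaceOrientation S) (Z : Finset S) (κ : Z → ℕ) : Type :=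
  MulAction.orbitRel.Quotient ℂˣ (Stratum o Z κ)

instance : TopologicalSpace (PStratum o Z κ) :=
  inferInstanceAs (TopologicalSpace (Quotient (MulAction.orbitRel ℂˣ (Stratum o Z κ))))

/-- The projectivized Teichmüller class of a translation surface. -/
def PStratum.mk (X : TranslationSurface o Z κ) : PStratum o Z κ :=
  Quotient.mk (MulAction.orbitRel ℂˣ (Stratum o Z κ)) (Stratum.mk X)

end Stratum

/-! ### Triangulations -/

/-- The standard triangle. -/
abbrev Tri : Type := stdSimplex ℝ (Fin 3)

/-- The vertices of the standard triangle. -/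
def vtx (i : Fin 3) : Tri := stdSimplex.vertex i

/-- The side opposite to vertex `i`, parametrized affinely from vertex `i + 1` to vertex `i + 2`. -/
def side (i : Fin 3) (t : unitInterval) : Tri :=
  ⟨fun j => if j = i + 1 then 1 - (t : ℝ) else if j = i + 2 then (t : ℝ) else 0, by
    refine ⟨fun j => ?_, ?_⟩
    · have h0 := t.2.1
      have h1 := t.2.2
      dsimp only
      split_ifs <;> linarith
    · fin_cases i <;> simp [Fin.sum_univ_three]⟩

/-- A topological triangulation of `(S, Z)`: a finite cell structure on the closed oriented surface
`S` with set of `0`-cells `Z`, whose `2`-cells are triangles, glued along their sides in pairs by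
affine maps. The open faces, the open edges and the points of `Z` partition `S`. Sides of the same
triangle, or vertices of the same triangle, may be identified in `S`. The characteristic
maps of the faces are coherently oriented, so the gluing maps reverse the direction of the sides. -/
structure Triangulation {S : Type} [TopologicalSpace S] (Z : Finset S) where
  Face : Type
  finite_face : Finite Face
  /-- the characteristic map of a face -/
  char : Face → C(Tri, S)
  /-- the half-edge `(f, i)`, i.e. the side `i` of the triangle `f`, is glued to `opp (f, i)` -/
  opp : Face × Fin 3 → Face × Fin 3
  opp_opp : ∀ h, opp (opp h) = h
  opp_ne : ∀ h, opp h ≠ h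
  cover : ∀ p : S, ∃ f x, char f x = p
  face_inj : ∀ f g (x y : Tri), (∀ i, 0 < x.1 i) → char f x = char g y → f = g ∧ x = y
  glue : ∀ h t, char h.1 (side h.2 t) = char (opp h).1 (side (opp h).2 (unitInterval.symm t))
  edge_inj : ∀ h k (s t : unitInterval), 0 < s → s < 1 →
    char h.1 (side h.2 s) = char k.1 (side k.2 t) →
      (k = h ∧ t = s) ∨ (k = opp h ∧ t = unitInterval.symm s)
  mem_iff : ∀ f (x : Tri), char f x ∈ Z ↔ ∃ i, x = vtx i

namespace Triangulation

variable {S : Type} [TopologicalSpace S] {o : SurfaceOrientation S} {Z : Finset S} {κ : Z → ℕ}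

/-- `D` develops the face `f` onto a (nondegenerate, closed) Euclidean triangle in `ℂ`, with sides
going to sides, by integrating `ω`. -/
def IsDevelopment (τ : Triangulation Z) (X : TranslationSurface o Z κ) (f : τ.Face)
    (D : Tri → ℂ) : Prop :=
  X.IsPrimitiveAlong (τ.char f) D ∧
  AffineIndependent ℝ (fun i => D (vtx i)) ∧
  Function.Injective D ∧
  range D = convexHull ℝ (range fun i => D (vtx i)) ∧
  ∀ i, range (fun t => D (side i t)) = segment ℝ (D (vtx (i + 1))) (D (vtx (i + 2)))

/-- `τ` is a geometric triangulation of `(X, ω)`: every face is a Euclidean triangle. -/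
def IsGeometric (τ : Triangulation Z) (X : TranslationSurface o Z κ) : Prop :=
  ∀ f, ∃ D, τ.IsDevelopment X f D

end Triangulation

/-! ### Delaunay triangulations -/

section Delaunay

variable {S : Type} [TopologicalSpace S] {o : SurfaceOrientation S} {Z : Finset S} {κ : Z → ℕ}

/-- `d`, restricted to the closed disk with center `c` and radius `r`, is an immersed empty disk of
`(X, ω)`. Away from `Z`, local primitives of `ω` are local isometries from the Euclidean metric of
`(X, ω)` to `ℂ`. -/
structure IsImmersedEmptyDisk (X : TranslationSurface o Z κ) (c : ℂ) (r : ℝ) (d : ℂ → S) :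
    Prop where
  pos : 0 < r
  continuousOn : ContinuousOn d (Metric.closedBall c r)
  empty : ∀ z ∈ Metric.ball c r, d z ∉ Z
  isometric : ∀ z ∈ Metric.ball c r, ∃ U : Set S, IsOpen U ∧ ∃ F : S → ℂ, X.IsPrimitiveOn F U ∧
    ∃ W ∈ 𝓝 z, MapsTo d W U ∧ ∀ w ∈ W, ∀ w' ∈ W, dist (F (d w)) (F (d w')) = dist w w'

/-- `τ` is a nondegenerate Delaunay triangulation of `(X, ω)`: it is geometric, and each face is the
image of a triangle under an immersed empty disk `d`, where the vertices of the triangle are exactly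
the three points of `d⁻¹(Z)`. -/
def Triangulation.IsNondegenerateDelaunay (τ : Triangulation Z) (X : TranslationSurface o Z κ) :
    Prop :=
  τ.IsGeometric X ∧ ∀ f : τ.Face, ∃ (c : ℂ) (r : ℝ) (d : ℂ → S), IsImmersedEmptyDisk X c r d ∧
    ∃ p : Fin 3 → ℂ, Function.Injective p ∧
      {z ∈ Metric.closedBall c r | d z ∈ Z} = range p ∧
      d '' convexHull ℝ (range p) = range (τ.char f)

/-- The iso-triangulable region `Δ(τ)` in the projectivized stratum. -/
def isoTriangulableRegion (o : SurfaceOrientation S) (κ : Z → ℕ) (τ : Triangulation Z) :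
    Set (PStratum o Z κ) :=
  {M | ∃ X, PStratum.mk X = M ∧ τ.IsGeometric X}

/-- The iso-Delaunay region `Δ_D(τ)` in the projectivized stratum. -/
def isoDelaunayRegion (o : SurfaceOrientation S) (κ : Z → ℕ) (τ : Triangulation Z) :
    Set (PStratum o Z κ) :=
  {M | ∃ X, PStratum.mk X = M ∧ τ.IsNondegenerateDelaunay X}

/-! ### Angle coordinates -/

/-- The combinatorial angles of `τ`: the corner `(f, i)` of the triangle `f` at its vertex `i` is the
angle between the two sides of `f` that meet there. -/
abbrev Triangulation.Corner (τ : Triangulation Z) : Type := τ.Face × Fin 3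

/-- The angle space: all angle assignments with values in `(0, π)` and angle sum `π` in each face. -/
def angleSpace (τ : Triangulation Z) : Set (τ.Corner → ℝ) :=
  {θ | (∀ a, θ a ∈ Ioo 0 Real.pi) ∧ ∀ f, ∑ i : Fin 3, θ (f, i) = Real.pi}

open Classical in
/-- The interior angles of the faces of a geometric triangulation of `(X, ω)`. -/
def Triangulation.angle (τ : Triangulation Z) (X : TranslationSurface o Z κ) (a : τ.Corner) : ℝ :=
  if h : ∃ D, τ.IsDevelopment X a.1 D then
    EuclideanGeometry.angle (h.choose (vtx (a.2 + 1))) (h.choose (vtx a.2))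
      (h.choose (vtx (a.2 + 2)))
  else 0

/-- The angle map `Θ` on the iso-triangulable region: choose a translation surface in the class for
which `τ` is geometric, and take its angles (which do not depend on the choice). -/
def angleMap (τ : Triangulation Z) (M : isoTriangulableRegion o κ τ) : τ.Corner → ℝ :=
  τ.angle M.2.choose

theorem isoDelaunayRegion_subset (τ : Triangulation Z) :
    isoDelaunayRegion o κ τ ⊆ isoTriangulableRegion o κ τ :=
  fun _ ⟨X, hX, h⟩ => ⟨X, hX, h.1⟩

/-- The restriction of the angle map `Θ` to the iso-Delaunay region. -/
def angleMapDelaunay (τ : Triangulation Z) (M : isoDelaunayRegion o κ τ) : τ.Corner → ℝ :=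
  angleMap τ (Set.inclusion (isoDelaunayRegion_subset τ) M)

/-! ### Hyperelliptic components -/

/-- An orientation-preserving homeomorphism that acts on `H_1(S; ℤ)` as `-1`. -/
def IsHyperellipticInvolution (o : SurfaceOrientation S) (f : S ≃ₜ S) : Prop :=
  o.IsPreservedBy f ∧
  ((AlgebraicTopology.singularHomologyFunctor (ModuleCat.{0} ℤ) 1).obj (ModuleCat.of ℤ ℤ)).map
    (TopCat.ofHom (f : C(S, S))) = -CategoryTheory.CategoryStruct.id _

/-- `(X, ω)` lies in a hyperelliptic component: there is a hyperelliptic involution that is a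
biholomorphism of `X` taking `ω` to `-ω`, and either `Z` has one point, or `Z` has two points and
the involution interchanges them. -/
def LiesInHyperellipticComponent (X : TranslationSurface o Z κ) : Prop :=
  ∃ f : S ≃ₜ S, IsHyperellipticInvolution o f ∧
    TranslationSurface.IsIso ((-1 : ℂˣ) • X) X f ∧
    (Z.card = 1 ∨ (Z.card = 2 ∧ ∀ z ∈ Z, f z ∈ Z ∧ f z ≠ z))

/-- The classes of translation surfaces that lie in a hyperelliptic component of the projectivized
stratum. -/
def hyperellipticLocus (o : SurfaceOrientation S) (Z : Finset S) (κ : Z → ℕ) :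
    Set (PStratum o Z κ) :=
  {M | ∃ X, PStratum.mk X = M ∧ LiesInHyperellipticComponent X}

end Delaunay

end IsoDelaunay

end

open Set Filter Topology
open scoped Manifold ContDiff

noncomputable section

namespace IsoDelaunay

open TranslationSurface
open scoped Real
open Complex (exp log normSq I add_im exp_add normSq_apply sub_re sub_im add_re ofReal_im exp_log ofReal_re im_ofReal_mul normSq_eq_norm_sq neg_im norm_real re_ofReal_mul I_re I_im real_smul neg_re slitPlane log_im normSq_pos slitPlane_ne_zero ofReal_zero exp_ne_zero mul_re mul_im exp_mul_I exp_nat_mul continuous_ofReal)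
open Metric (ball closedBall mem_ball_self ball_mem_nhds mem_ball isOpen_ball eventually_nhds_iff_ball mem_closedBall ball_subset_closedBall)
open stdSimplex (vertex)
open Real (sin cos sin_pos_of_pos_of_lt_pi pi_pos)
open Function (comp_apply Injective minimalPeriod iterate_succ_apply' Bijective)

local notation "𝕀" => unitInterval
local notation "σ₀" => unitInterval.symm

variable {S : Type} [TopologicalSpace S] {o : SurfaceOrientation S} {Z : Finset S} {κ : Z → ℕ}
variable {τ : Triangulation Z} {X Y : TranslationSurface o Z κ}

/-! ### Systems of local primitives -/

/-- A system of local primitives on `Y` with values in `E`: every point has an open neighbourhood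
with a primitive, and primitives are unique up to locally constant functions. -/
structure PrimSystem (Y E : Type) [TopologicalSpace Y] [AddCommGroup E] where
  prim : (Y → E) → Set Y → Prop
  exists_prim : ∀ y, ∃ U, IsOpen U ∧ y ∈ U ∧ ∃ F, prim F U
  sub_const : ∀ {F G U V}, prim F U → prim G V → IsOpen U → IsOpen V → ∀ y ∈ U ∩ V,
    ∀ᶠ x in 𝓝 y, F x - G x = F y - G y
  add_const : ∀ {F U}, prim F U → ∀ c, prim (fun y => F y + c) U

namespace PrimSystem

variable {Y E : Type} [TopologicalSpace Y] [AddCommGroup E] (P : PrimSystem Y E)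

/-- `D` is a primitive along the map `f`. -/
def Along {T : Type} [TopologicalSpace T] (f : T → Y) (D : T → E) : Prop :=
  ∀ t : T, ∃ U : Set Y, IsOpen U ∧ f t ∈ U ∧ ∃ F : Y → E, P.prim F U ∧ ∀ᶠ s in 𝓝 t, D s = F (f s)

variable {P} {T T' : Type} [TopologicalSpace T] [TopologicalSpace T']

lemma Along.comp {f : T → Y} {D : T → E} (h : P.Along f D) {g : T' → T} (hg : Continuous g) :
    P.Along (f ∘ g) (D ∘ g) := by
  intro t
  obtain ⟨U, hU, hm, F, hF, he⟩ := h (g t)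
  exact ⟨U, hU, hm, F, hF, hg.continuousAt.eventually he⟩

lemma along_const (y : Y) (c : E) : P.Along (fun _ : T => y) (fun _ => c) := by
  intro t
  obtain ⟨U, hU, hm, F, hF⟩ := P.exists_prim y
  exact ⟨U, hU, hm, _, P.add_const hF (c - F y), by simp⟩

lemma Along.sub_eventually {f : T → Y} (hf : Continuous f) {D D' : T → E} (h : P.Along f D)
    (h' : P.Along f D') (t : T) : ∀ᶠ s in 𝓝 t, D s - D' s = D t - D' t := by
  obtain ⟨U, hU, hm, F, hF, he⟩ := h t
  obtain ⟨V, hV, hm', G, hG, he'⟩ := h' t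
  have := hf.continuousAt.eventually (P.sub_const hF hG hU hV (f t) ⟨hm, hm'⟩)
  filter_upwards [he, he', this] with s h1 h2 h3
  rw [h1, h2, h3, he.self_of_nhds, he'.self_of_nhds]

lemma Along.sub_eq [PreconnectedSpace T] {f : T → Y} (hf : Continuous f) {D D' : T → E}
    (h : P.Along f D) (h' : P.Along f D') (s t : T) : D s - D' s = D t - D' t := by
  have : IsLocallyConstant (fun t => D t - D' t) :=
    (IsLocallyConstant.iff_eventually_eq _).2 (fun t => h.sub_eventually hf h' t)
  exact this.apply_eq_of_preconnectedSpace s t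

lemma exists_lift_near {H : 𝕀 × T → Y} (hH : Continuous H) {D₀ : T → E}
    (h0 : P.Along (fun t => H (0, t)) D₀) (t₁ : T) :
    ∃ D : 𝕀 × T → E, (∀ t, D (0, t) = D₀ t) ∧
      ∀ s, ∃ U : Set Y, IsOpen U ∧ H (s, t₁) ∈ U ∧ ∃ F, P.prim F U ∧
        ∀ᶠ p in 𝓝 (s, t₁), D p = F (H p) := by
  choose U hU hm F hF using fun s : 𝕀 => P.exists_prim (H (s, t₁))
  obtain ⟨τ, h00, hmono, ⟨N, hN⟩, hτ⟩ := exists_monotone_Icc_subset_open_cover_unitInterval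
    (c := fun s : 𝕀 => {s' | H (s', t₁) ∈ U s})
    (fun s => (hU s).preimage (hH.comp (by fun_prop)))
    (fun s _ => mem_iUnion.2 ⟨s, hm s⟩)
  have key : ∀ n, ∃ D : 𝕀 × T → E, (∀ t, D (0, t) = D₀ t) ∧
      ∀ s, s ≤ τ n → ∃ U : Set Y, IsOpen U ∧ H (s, t₁) ∈ U ∧ ∃ F, P.prim F U ∧
        ∀ᶠ p in 𝓝[{p | p.1 ≤ τ n}] (s, t₁), D p = F (H p) := by
    intro n
    induction n with
    | zero =>
      refine ⟨fun p => D₀ p.2, fun t => rfl, fun s hs => ?_⟩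
      rw [h00] at hs
      have hs0 : s = 0 := le_antisymm hs bot_le
      subst hs0
      obtain ⟨U, hU, hm, F, hF, he⟩ := h0 t₁
      refine ⟨U, hU, hm, F, hF, ?_⟩
      have h2 : ∀ᶠ p : 𝕀 × T in 𝓝 (0, t₁), D₀ p.2 = F (H (0, p.2)) :=
        (continuous_snd.tendsto ((0 : 𝕀), t₁)).eventually he
      filter_upwards [h2.filter_mono nhdsWithin_le_nhds, self_mem_nhdsWithin] with p hp hp'
      have : p.1 = 0 := le_antisymm (by simpa [h00] using hp') bot_le
      rw [hp, ← this]
    | succ n ih =>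
      obtain ⟨D, hD0, hD⟩ := ih
      obtain ⟨i, hi⟩ := hτ n
      have hle := hmono (Nat.le_succ n)
      obtain ⟨V, hV, hVm, G, hG, he⟩ := hD (τ n) le_rfl
      have hUa : H (τ n, t₁) ∈ U i := hi ⟨le_rfl, hle⟩
      have hc := P.sub_const hG (hF i) hV (hU i) _ ⟨hVm, hUa⟩
      set c := G (H (τ n, t₁)) - F i (H (τ n, t₁)) with hcdef
      have hc' : ∀ᶠ p in 𝓝 (τ n, t₁), G (H p) - F i (H p) = c := hH.continuousAt.eventually hc
      refine ⟨fun p => if p.1 ≤ τ n then D p else F i (H p) + c, fun t => by simp [hD0], ?_⟩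
      intro s hs
      rcases lt_trichotomy s (τ n) with hlt | heq | hgt
      · obtain ⟨U', hU', hm', F', hF', he'⟩ := hD s hlt.le
        refine ⟨U', hU', hm', F', hF', ?_⟩
        have h3 : {p : 𝕀 × T | p.1 < τ n} ∈ 𝓝 (s, t₁) :=
          (isOpen_lt continuous_fst continuous_const).mem_nhds hlt
        have h4 : ∀ᶠ p in 𝓝 (s, t₁), p.1 ≤ τ n → D p = F' (H p) := eventually_nhdsWithin_iff.1 he'
        filter_upwards [nhdsWithin_le_nhds h3, nhdsWithin_le_nhds h4] with p hp hp'
        have hp2 : p.1 ≤ τ n := le_of_lt hp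
        rw [if_pos hp2, hp' hp2]
      · subst heq
        refine ⟨U i, hU i, hUa, _, P.add_const (hF i) c, ?_⟩
        have h4 := eventually_nhdsWithin_iff.1 he
        filter_upwards [nhdsWithin_le_nhds h4, nhdsWithin_le_nhds hc'] with p hp hp'
        by_cases hple : p.1 ≤ τ n
        · rw [if_pos hple, hp hple, ← hp']; abel
        · rw [if_neg hple]
      · refine ⟨U i, hU i, hi ⟨hgt.le, hs⟩, _, P.add_const (hF i) c, ?_⟩
        have h3 : {p : 𝕀 × T | τ n < p.1} ∈ 𝓝 (s, t₁) :=
          (isOpen_lt continuous_const continuous_fst).mem_nhds hgt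
        filter_upwards [nhdsWithin_le_nhds h3] with p hp
        rw [if_neg (not_le.2 hp)]
  obtain ⟨D, hD0, hD⟩ := key N
  refine ⟨D, hD0, fun s => ?_⟩
  have hone : τ N = 1 := hN N le_rfl
  obtain ⟨U', hU', hm', F', hF', he'⟩ := hD s (hone ▸ le_top)
  refine ⟨U', hU', hm', F', hF', ?_⟩
  have : {p : 𝕀 × T | p.1 ≤ τ N} = univ := by
    ext p; refine ⟨fun _ => trivial, fun _ => ?_⟩; change p.1 ≤ τ N; rw [hone]; exact le_top
  rwa [this, nhdsWithin_univ] at he'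

/-- Primitives along a homotopy extend a given primitive along its start. -/
lemma exists_lift {H : 𝕀 × T → Y} (hH : Continuous H) {D₀ : T → E}
    (h0 : P.Along (fun t => H (0, t)) D₀) :
    ∃ D : 𝕀 × T → E, (∀ t, D (0, t) = D₀ t) ∧ P.Along H D := by
  choose L hL0 hL using exists_lift_near hH h0
  have hpath : ∀ t, P.Along (fun s => H (s, t)) (fun s => L t (s, t)) := by
    intro t s
    obtain ⟨U, hU, hm, F, hF, he⟩ := hL t s
    refine ⟨U, hU, hm, F, hF, ?_⟩
    have hc : ContinuousAt (fun s : 𝕀 => (s, t)) s := by fun_prop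
    exact hc.eventually he
  refine ⟨fun p => L p.2 p, fun t => hL0 t t, ?_⟩
  rintro ⟨s₁, t₁⟩
  have hW : ∀ᶠ t in 𝓝 t₁, ∀ s : 𝕀, ∃ U : Set Y, IsOpen U ∧ H (s, t) ∈ U ∧
      ∃ F, P.prim F U ∧ ∀ᶠ p in 𝓝 (s, t), L t₁ p = F (H p) := by
    let W : Set (𝕀 × T) := {q | ∃ U : Set Y, IsOpen U ∧ H q ∈ U ∧
      ∃ F, P.prim F U ∧ ∀ᶠ p in 𝓝 q, L t₁ p = F (H p)}
    have hWo : IsOpen W := by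
      rw [isOpen_iff_mem_nhds]
      rintro q ⟨U, hU, hm, F, hF, he⟩
      filter_upwards [eventually_eventually_nhds.2 he, hH.continuousAt.preimage_mem_nhds
        (hU.mem_nhds hm)] with q' h1 h2
      exact ⟨U, hU, h2, F, hF, h1⟩
    obtain ⟨u, v, hu, hv, hu1, hv1, huv⟩ := generalized_tube_lemma
      (isCompact_univ : IsCompact (univ : Set 𝕀)) (isCompact_singleton (x := t₁))
      hWo (by rintro ⟨s, t⟩ ⟨-, ht⟩; obtain rfl : t = t₁ := ht; exact hL t s)
    filter_upwards [hv.mem_nhds (hv1 rfl)] with t ht s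
    exact huv ⟨hu1 (mem_univ s), ht⟩
  obtain ⟨U, hU, hm, F, hF, he⟩ := hL t₁ s₁
  refine ⟨U, hU, hm, F, hF, ?_⟩
  filter_upwards [he, (continuous_snd.tendsto (s₁, t₁)).eventually hW] with p hp hp'
  rw [← hp]
  have hal : P.Along (fun s => H (s, p.2)) (fun s => L t₁ (s, p.2)) := by
    intro s
    obtain ⟨U, hU, hm, F, hF, he⟩ := hp' s
    refine ⟨U, hU, hm, F, hF, ?_⟩
    have hc : ContinuousAt (fun s : 𝕀 => (s, p.2)) s := by fun_prop
    exact hc.eventually he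
  have := (hpath p.2).sub_eq (hH.comp (by fun_prop)) hal p.1 0
  rw [hL0, hL0, sub_self, sub_eq_zero] at this
  exact this

lemma exists_along [ContractibleSpace T] {f : T → Y} (hf : Continuous f) : ∃ D, P.Along f D := by
  obtain ⟨t₀, ⟨h⟩⟩ := id_nullhomotopic T
  let H : 𝕀 × T → Y := fun p => f (h.symm (p.1, p.2))
  have hH : Continuous H := hf.comp h.symm.continuous
  obtain ⟨D, -, hD⟩ := exists_lift (P := P) hH (D₀ := fun _ => 0) (by
    have : (fun t => H (0, t)) = fun _ => f t₀ := by funext t; simp [H]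
    rw [this]; exact along_const _ _)
  refine ⟨fun t => D (1, t), ?_⟩
  have := hD.comp (g := fun t : T => ((1 : 𝕀), t)) (by fun_prop)
  have e : (H ∘ fun t : T => ((1 : 𝕀), t)) = f := by
    funext t
    simp [H]
  rwa [e] at this

/-- The increment of a primitive along the endpoints of a homotopy relative to the endpoints. -/
lemma Along.increment_eq {H : 𝕀 × 𝕀 → Y} (hH : Continuous H)
    {y z : Y} (hy : ∀ t, H (t, 0) = y) (hz : ∀ t, H (t, 1) = z) {D D' : 𝕀 → E}
    (hD : P.Along (fun s => H (0, s)) D) (hD' : P.Along (fun s => H (1, s)) D') :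
    D 1 - D 0 = D' 1 - D' 0 := by
  obtain ⟨L, hL0, hL⟩ := exists_lift hH hD
  have a : ∀ (s : 𝕀) (w : Y), (∀ t, H (t, s) = w) → L (0, s) = L (1, s) := by
    intro s w hw
    have h1 := hL.comp (g := fun t : 𝕀 => (t, s)) (by fun_prop)
    have h2 : P.Along (H ∘ fun t : 𝕀 => (t, s)) (fun _ => (0 : E)) := by
      have : (H ∘ fun t : 𝕀 => (t, s)) = fun _ => w := funext hw
      rw [this]; exact along_const _ _
    simpa using h1.sub_eq (hH.comp (by fun_prop)) h2 0 1
  have h1 := hL.comp (g := fun s : 𝕀 => ((1 : 𝕀), s)) (by fun_prop)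
  have h2 := h1.sub_eq (D' := D') (hH.comp (by fun_prop)) hD' 1 0
  simp only [comp_apply] at h2
  rw [← hL0, ← hL0, a 0 y hy, a 1 z hz, sub_eq_sub_iff_sub_eq_sub.1 h2]

end PrimSystem

/-! ### Local primitives on a translation surface -/

instance : ContractibleSpace 𝕀 := (convex_Icc (0 : ℝ) 1).contractibleSpace ⟨0, by simp⟩

instance (n : ℕ) : ContractibleSpace (stdSimplex ℝ (Fin (n + 1))) :=
  (convex_stdSimplex ℝ (Fin (n + 1))).contractibleSpace ⟨_, (vertex 0).2⟩

namespace TranslationSurface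

lemma exists_chart (X : TranslationSurface o Z κ) (p : S) : ∃ φ ∈ X.charts, p ∈ φ.source := by
  let := X.chartedSpace
  exact ⟨chartAt ℂ p, chart_mem_atlas ℂ p, mem_chart_source ℂ p⟩

lemma IsPrimitiveOn.mono {F : S → ℂ} {U V : Set S} (h : X.IsPrimitiveOn F U) (hV : V ⊆ U) :
    X.IsPrimitiveOn F V := fun φ hφ p hp => h φ hφ p ⟨hp.1, hV hp.2⟩

lemma IsPrimitiveOn.add_const {F : S → ℂ} {U : Set S} (h : X.IsPrimitiveOn F U) (c : ℂ) :
    X.IsPrimitiveOn (fun y => F y + c) U := fun φ hφ p hp => (h φ hφ p hp).add_const c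

lemma IsPrimitiveOn.continuousAt {F : S → ℂ} {U : Set S} (h : X.IsPrimitiveOn F U) {p : S}
    (hp : p ∈ U) : ContinuousAt F p := by
  obtain ⟨φ, hφ, hpφ⟩ := X.exists_chart p
  have h1 := (h φ hφ p ⟨hpφ, hp⟩).continuousAt
  have h2 : ContinuousAt ((F ∘ φ.symm) ∘ φ) p :=
    ContinuousAt.comp (g := F ∘ φ.symm) h1 (φ.continuousAt hpφ)
  refine h2.congr ?_
  filter_upwards [φ.open_source.mem_nhds hpφ] with q hq
  simp [φ.left_inv hq]

lemma IsPrimitiveOn.continuousOn {F : S → ℂ} {U : Set S} (h : X.IsPrimitiveOn F U) :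
    ContinuousOn F U := fun _ hp => (h.continuousAt hp).continuousWithinAt

/-- A function that is a primitive of `ω` in one chart is a primitive in all charts. -/
lemma isPrimitiveOn_of_chart {φ : OpenPartialHomeomorph S ℂ} (hφ : φ ∈ X.charts) {F : S → ℂ}
    {U : Set S} (hU : U ⊆ φ.source)
    (h : ∀ p ∈ U, HasDerivAt (F ∘ φ.symm) (X.coeff φ (φ p)) (φ p)) : X.IsPrimitiveOn F U := by
  intro φ' hφ' p hp
  obtain ⟨c, hc, hc'⟩ := PullsBack.refl X φ' hφ' φ hφ p hp.1 (hU hp.2)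
  have h1 : HasDerivAt (F ∘ φ.symm) (X.coeff φ (φ p)) ((φ ∘ id ∘ φ'.symm) (φ' p)) := by
    simpa [φ'.left_inv hp.1] using h p hp.2
  rw [hc']
  refine (h1.comp (φ' p) hc).congr_of_eventuallyEq ?_
  have hev : ∀ᶠ z in 𝓝 (φ' p), φ'.symm z ∈ φ.source := by
    refine (φ'.continuousAt_symm (φ'.map_source hp.1)).eventually_mem (φ.open_source.mem_nhds ?_)
    rw [φ'.left_inv hp.1]
    exact hU hp.2
  filter_upwards [hev] with z hz
  simp [φ.left_inv hz]

lemma exists_primitive (X : TranslationSurface o Z κ) (p : S) :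
    ∃ U, IsOpen U ∧ p ∈ U ∧ ∃ F, X.IsPrimitiveOn F U := by
  obtain ⟨φ, hφ, hpφ⟩ := X.exists_chart p
  let := X.chartedSpace
  obtain ⟨r, hr, hball⟩ := Metric.isOpen_iff.1 φ.open_target (φ p) (φ.map_source hpφ)
  obtain ⟨G, hG⟩ := ((X.holomorphic φ hφ).mono hball).isExactOn_ball
  refine ⟨φ.source ∩ φ ⁻¹' ball (φ p) r, φ.isOpen_inter_preimage isOpen_ball,
    ⟨hpφ, mem_ball_self hr⟩, fun q => G (φ q), isPrimitiveOn_of_chart hφ inter_subset_left ?_⟩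
  intro q hq
  refine (hG (φ q) hq.2).congr_of_eventuallyEq ?_
  filter_upwards [φ.open_target.mem_nhds (φ.map_source hq.1)] with z hz
  simp [φ.right_inv hz]

/-- A primitive read in a chart is differentiable near every point. -/
lemma IsPrimitiveOn.eventually_hasDerivAt {F : S → ℂ} {U : Set S} (h : X.IsPrimitiveOn F U)
    (hU : IsOpen U) {φ : OpenPartialHomeomorph S ℂ} (hφ : φ ∈ X.charts) {p : S}
    (hp : p ∈ φ.source) (hpU : p ∈ U) :
    ∀ᶠ z in 𝓝 (φ p), HasDerivAt (F ∘ φ.symm) (X.coeff φ z) z := by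
  have hev : ∀ᶠ z in 𝓝 (φ p), φ.symm z ∈ U := by
    refine (φ.continuousAt_symm (φ.map_source hp)).eventually_mem (hU.mem_nhds ?_)
    rwa [φ.left_inv hp]
  filter_upwards [hev, φ.open_target.mem_nhds (φ.map_source hp)] with z hz hz'
  have := h φ hφ (φ.symm z) ⟨φ.map_target hz', hz⟩
  rwa [φ.right_inv hz'] at this

lemma IsPrimitiveOn.analyticAt {F : S → ℂ} {U : Set S} (h : X.IsPrimitiveOn F U)
    (hU : IsOpen U) {φ : OpenPartialHomeomorph S ℂ} (hφ : φ ∈ X.charts) {p : S}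
    (hp : p ∈ φ.source) (hpU : p ∈ U) : AnalyticAt ℂ (F ∘ φ.symm) (φ p) :=
  Complex.analyticAt_iff_eventually_differentiableAt.2
    ((h.eventually_hasDerivAt hU hφ hp hpU).mono fun _ hz => hz.differentiableAt)

lemma IsPrimitiveOn.sub_const {F G : S → ℂ} {U V : Set S} (hF : X.IsPrimitiveOn F U)
    (hG : X.IsPrimitiveOn G V) (hU : IsOpen U) (hV : IsOpen V) (p : S) (hp : p ∈ U ∩ V) :
    ∀ᶠ q in 𝓝 p, F q - G q = F p - G p := by
  obtain ⟨φ, hφ, hpφ⟩ := X.exists_chart p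
  have h1 := hF.eventually_hasDerivAt hU hφ hpφ hp.1
  have h2 := hG.eventually_hasDerivAt hV hφ hpφ hp.2
  obtain ⟨r, hr, hball⟩ := eventually_nhds_iff_ball.1 (h1.and h2)
  have h3 : ∀ z ∈ ball (φ p) r, HasDerivAt (F ∘ φ.symm - G ∘ φ.symm) 0 z := by
    intro z hz
    simpa using (hball z hz).1.sub (hball z hz).2
  have h4 : ∀ z ∈ ball (φ p) r, (F ∘ φ.symm - G ∘ φ.symm) z = (F ∘ φ.symm - G ∘ φ.symm) (φ p) := by
    intro z hz
    exact isOpen_ball.is_const_of_deriv_eq_zero (convex_ball _ _).isPreconnected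
      (fun z hz => (h3 z hz).differentiableAt.differentiableWithinAt)
      (fun z hz => (h3 z hz).deriv) hz (mem_ball_self hr)
  filter_upwards [φ.open_source.mem_nhds hpφ,
    (φ.continuousAt hpφ).preimage_mem_nhds (ball_mem_nhds _ hr)] with q hq hq'
  have := h4 (φ q) hq'
  simpa [φ.left_inv hq, φ.left_inv hpφ] using this

/-- The local primitives of `ω`. -/
def primSystem (X : TranslationSurface o Z κ) : PrimSystem S ℂ where
  prim := X.IsPrimitiveOn
  exists_prim := X.exists_primitive
  sub_const := fun hF hG hU hV => hF.sub_const hG hU hV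
  add_const := fun hF c => hF.add_const c

/-- Off the zeros of `ω`, a primitive is a chart near each point. -/
lemma IsPrimitiveOn.exists_openPartialHomeomorph {F : S → ℂ} {U : Set S}
    (h : X.IsPrimitiveOn F U) (hU : IsOpen U) {p : S} (hp : p ∈ U) (hZ : p ∉ Z) :
    ∃ e : OpenPartialHomeomorph S ℂ, p ∈ e.source ∧ e.source ⊆ U ∧ ∀ q ∈ e.source, e q = F q := by
  obtain ⟨φ, hφ, hpφ⟩ := X.exists_chart p
  have h1 : HasStrictDerivAt (F ∘ φ.symm) (X.coeff φ (φ p)) (φ p) := by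
    have := (h.analyticAt hU hφ hpφ hp).hasStrictDerivAt
    rwa [(h φ hφ p ⟨hpφ, hp⟩).deriv] at this
  have h2 := h1.hasStrictFDerivAt_equiv (X.ne_zero φ hφ p hpφ hZ)
  let g := h2.toOpenPartialHomeomorph (F ∘ φ.symm)
  have hg : φ p ∈ g.source := h2.mem_toOpenPartialHomeomorph_source
  refine ⟨(φ.trans g).restrOpen U hU, ⟨⟨hpφ, hg⟩, hp⟩, fun q hq => hq.2, ?_⟩
  intro q hq
  change (F ∘ φ.symm) (φ q) = F q
  simp [φ.left_inv hq.1.1]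

lemma IsPrimitiveOn.analyticOrderAt_sub {F : S → ℂ} {U : Set S} (h : X.IsPrimitiveOn F U)
    (hU : IsOpen U) {z : Z} (hz : (z : S) ∈ U) {φ : OpenPartialHomeomorph S ℂ}
    (hφ : φ ∈ X.charts) (hzφ : (z : S) ∈ φ.source) :
    analyticOrderAt (fun w => F (φ.symm w) - F z) (φ z) = κ z + 1 := by
  have h1 := (h.analyticAt hU hφ hzφ hz).analyticOrderAt_deriv_add_one
  have h2 : deriv (F ∘ φ.symm) =ᶠ[𝓝 (φ z)] X.coeff φ :=
    (h.eventually_hasDerivAt hU hφ hzφ hz).mono fun w hw => hw.deriv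
  rw [analyticOrderAt_congr h2, X.order_eq φ hφ z hzφ] at h1
  rw [h1]
  simp [φ.left_inv hzφ]

/-! ### Pull-backs and periods -/

lemma PullsBack.isPrimitiveOn {f : S → S} (hf : Continuous f) (h : PullsBack X Y f) {F : S → ℂ}
    {V : Set S} (hF : Y.IsPrimitiveOn F V) : X.IsPrimitiveOn (F ∘ f) (f ⁻¹' V) := by
  intro φ hφ p hp
  obtain ⟨φ', hφ', hp'⟩ := Y.exists_chart (f p)
  obtain ⟨c, hc, hc'⟩ := h φ hφ φ' hφ' p hp.1 hp'
  have h1 : HasDerivAt (F ∘ φ'.symm) (Y.coeff φ' (φ' (f p))) ((φ' ∘ f ∘ φ.symm) (φ p)) := by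
    simpa [φ.left_inv hp.1] using hF φ' hφ' (f p) ⟨hp', hp.2⟩
  rw [hc']
  refine (h1.comp (φ p) hc).congr_of_eventuallyEq ?_
  have hcont : ContinuousAt (f ∘ φ.symm) (φ p) :=
    hf.continuousAt.comp (φ.continuousAt_symm (φ.map_source hp.1))
  have hev : ∀ᶠ z in 𝓝 (φ p), (f ∘ φ.symm) z ∈ φ'.source := by
    refine hcont.eventually_mem (φ'.open_source.mem_nhds ?_)
    simpa [φ.left_inv hp.1] using hp'
  filter_upwards [hev] with z hz
  have hz' : f (φ.symm z) ∈ φ'.source := hz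
  simp [φ'.left_inv hz']

lemma PullsBack.along {f : S → S} (hf : Continuous f) (h : PullsBack X Y f) {T : Type}
    [TopologicalSpace T] {g : T → S} {D : T → ℂ} (hD : Y.IsPrimitiveAlong (f ∘ g) D) :
    X.IsPrimitiveAlong g D := by
  intro t
  obtain ⟨U, hU, hm, F, hF, he⟩ := hD t
  exact ⟨f ⁻¹' U, hU.preimage hf, hm, F ∘ f, h.isPrimitiveOn hf hF, he⟩

lemma IsPrimitiveOn.smul {F : S → ℂ} {U : Set S} (h : X.IsPrimitiveOn F U) (c : ℂˣ) :
    (c • X).IsPrimitiveOn (fun q => c * F q) U := by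
  intro φ hφ p hp
  exact (h φ hφ p hp).const_mul (c : ℂ)

lemma IsPrimitiveAlong.smul {T : Type} [TopologicalSpace T] {g : T → S} {D : T → ℂ}
    (h : X.IsPrimitiveAlong g D) (c : ℂˣ) : (c • X).IsPrimitiveAlong g (fun t => c * D t) := by
  intro t
  obtain ⟨U, hU, hm, F, hF, he⟩ := h t
  exact ⟨U, hU, hm, _, hF.smul c, he.mono fun s hs => congrArg ((c : ℂ) * ·) hs⟩

lemma exists_isPrimitiveAlong (X : TranslationSurface o Z κ) {T : Type} [TopologicalSpace T]
    [ContractibleSpace T] {f : T → S} (hf : Continuous f) : ∃ D, X.IsPrimitiveAlong f D :=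
  PrimSystem.exists_along (P := X.primSystem) hf

lemma IsPrimitiveAlong.sub_eq {T : Type} [TopologicalSpace T] [PreconnectedSpace T] {f : T → S}
    (hf : Continuous f) {D D' : T → ℂ} (h : X.IsPrimitiveAlong f D) (h' : X.IsPrimitiveAlong f D')
    (s t : T) : D s - D' s = D t - D' t :=
  PrimSystem.Along.sub_eq (P := X.primSystem) hf h h' s t

lemma IsPrimitiveAlong.comp {T T' : Type} [TopologicalSpace T] [TopologicalSpace T'] {f : T → S}
    {D : T → ℂ} (h : X.IsPrimitiveAlong f D) {g : T' → T} (hg : Continuous g) :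
    X.IsPrimitiveAlong (f ∘ g) (D ∘ g) :=
  PrimSystem.Along.comp (P := X.primSystem) h hg

lemma IsPrimitiveAlong.continuous {T : Type} [TopologicalSpace T] {f : T → S}
    (hf : Continuous f) {D : T → ℂ} (h : X.IsPrimitiveAlong f D) : Continuous D := by
  rw [continuous_iff_continuousAt]
  intro t
  obtain ⟨U, hU, hm, F, hF, he⟩ := h t
  exact ((hF.continuousAt hm).comp hf.continuousAt).congr (he.mono fun s hs => hs.symm)

lemma period_eq {γ : C(𝕀, S)} {D : 𝕀 → ℂ}
    (h : X.IsPrimitiveAlong γ D) : X.period γ = D 1 - D 0 := by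
  have hex : ∃ D : 𝕀 → ℂ, X.IsPrimitiveAlong γ D := ⟨D, h⟩
  rw [period, dif_pos hex]
  have := hex.choose_spec.sub_eq γ.continuous h 1 0
  linear_combination this

lemma period_smul (c : ℂˣ) (γ : C(𝕀, S)) : (c • X).period γ = c * X.period γ := by
  obtain ⟨D, hD⟩ := X.exists_isPrimitiveAlong γ.continuous
  rw [period_eq hD, period_eq (hD.smul c), mul_sub]

lemma PullsBack.period {f : C(S, S)} (h : PullsBack X Y f) (γ : C(𝕀, S)) :
    X.period γ = Y.period (f.comp γ) := by
  obtain ⟨D, hD⟩ := Y.exists_isPrimitiveAlong (f.comp γ).continuous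
  rw [period_eq hD, period_eq (h.along f.continuous hD)]

lemma TeichEquiv.period_eq (h : TeichEquiv X Y) {γ : C(𝕀, S)} (h0 : γ 0 ∈ Z)
    (h1 : γ 1 ∈ Z) : X.period γ = Y.period γ := by
  obtain ⟨f, ⟨hf, -⟩, H, hH, hH0, hH1, hHZ⟩ := h
  rw [PullsBack.period (f := f) hf γ]
  let K : 𝕀 × 𝕀 → S := fun q => H q.1 (γ q.2)
  have hK : Continuous K := hH.comp (continuous_fst.prodMk (γ.continuous.comp continuous_snd))
  obtain ⟨D, hD⟩ := Y.exists_isPrimitiveAlong γ.continuous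
  obtain ⟨D', hD'⟩ := Y.exists_isPrimitiveAlong ((f : C(S, S)).comp γ).continuous
  rw [TranslationSurface.period_eq hD, TranslationSurface.period_eq hD']
  refine (PrimSystem.Along.increment_eq (P := Y.primSystem) hK (y := γ 0) (z := γ 1)
    (fun t => hHZ t _ h0) (fun t => hHZ t _ h1) (D := D) (D' := D') ?_ ?_).symm
  · have : (fun s => K (0, s)) = γ := by funext s; simp [K, hH0]
    rw [this]; exact hD
  · have : (fun s => K (1, s)) = (f : C(S, S)).comp γ := by funext s; simp [K, hH1]
    rw [this]; exact hD'

end TranslationSurface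

/-! ### The standard triangle -/

lemma fin3_ne_add_one (i : Fin 3) : i ≠ i + 1 := by decide +revert
lemma fin3_ne_add_two (i : Fin 3) : i ≠ i + 2 := by decide +revert
lemma fin3_add_two_ne_add_one (i : Fin 3) : i + 2 ≠ i + 1 := by decide +revert
lemma fin3_cases (i j : Fin 3) : j = i ∨ j = i + 1 ∨ j = i + 2 := by decide +revert

lemma fin3_add_one_add_one (i : Fin 3) : i + 1 + 1 = i + 2 := by decide +revert
lemma fin3_add_one_add_two (i : Fin 3) : i + 1 + 2 = i := by decide +revert
lemma fin3_add_two_add_one (i : Fin 3) : i + 2 + 1 = i := by decide +revert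
lemma fin3_add_two_add_two (i : Fin 3) : i + 2 + 2 = i + 1 := by decide +revert

lemma sum_fin3 {M : Type*} [AddCommMonoid M] (g : Fin 3 → M) (i : Fin 3) :
    ∑ j, g j = g i + g (i + 1) + g (i + 2) := by
  fin_cases i <;> simp [Fin.sum_univ_three] <;> abel

lemma Tri.nonneg (x : Tri) (i : Fin 3) : 0 ≤ x.1 i := x.2.1 i

lemma Tri.sum_eq (x : Tri) (i : Fin 3) : x.1 i + x.1 (i + 1) + x.1 (i + 2) = 1 := by
  rw [← sum_fin3]; exact x.2.2

lemma Tri.ext_of {x y : Tri} (i : Fin 3) (h1 : x.1 (i + 1) = y.1 (i + 1))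
    (h2 : x.1 (i + 2) = y.1 (i + 2)) : x = y := by
  apply Subtype.ext
  funext j
  have hx := x.sum_eq i
  have hy := y.sum_eq i
  rcases fin3_cases i j with rfl | rfl | rfl
  · linarith
  · exact h1
  · exact h2

lemma side_apply_self (i : Fin 3) (t : 𝕀) : (side i t).1 i = 0 := by simp [side]

lemma side_apply_add_one (i : Fin 3) (t : 𝕀) : (side i t).1 (i + 1) = 1 - t := by simp [side]

lemma side_apply_add_two (i : Fin 3) (t : 𝕀) : (side i t).1 (i + 2) = t := by simp [side]

lemma vtx_apply_self (i : Fin 3) : (vtx i).1 i = 1 := by simp [vtx, vertex]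

lemma vtx_apply_of_ne {i j : Fin 3} (h : j ≠ i) : (vtx i).1 j = 0 := by
  simp [vtx, vertex, h]

lemma vtx_apply_add_one (i : Fin 3) : (vtx i).1 (i + 1) = 0 :=
  vtx_apply_of_ne (fin3_ne_add_one i).symm

lemma vtx_apply_add_two (i : Fin 3) : (vtx i).1 (i + 2) = 0 :=
  vtx_apply_of_ne (fin3_ne_add_two i).symm

lemma vtx_injective : Injective vtx := by
  intro i j h
  by_contra hne
  have := vtx_apply_self i
  rw [h, vtx_apply_of_ne hne] at this
  exact zero_ne_one this

lemma side_zero (i : Fin 3) : side i 0 = vtx (i + 1) :=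
  Tri.ext_of i (by simp [side_apply_add_one, vtx_apply_self])
    (by rw [side_apply_add_two, vtx_apply_of_ne (fin3_add_two_ne_add_one i)]; rfl)

lemma side_one (i : Fin 3) : side i 1 = vtx (i + 2) := Tri.ext_of i (by
    rw [side_apply_add_one, vtx_apply_of_ne (fin3_add_two_ne_add_one i).symm]; simp)
    (by rw [side_apply_add_two, vtx_apply_self]; rfl)

lemma continuous_side (i : Fin 3) : Continuous (side i) := by
  refine Continuous.subtype_mk (continuous_pi fun j => ?_) _
  split_ifs <;> fun_prop

lemma side_injective (i : Fin 3) : Injective (side i) := by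
  intro s t h
  have := side_apply_add_two i s
  rw [h, side_apply_add_two] at this
  exact Subtype.ext this.symm

lemma exists_side {x : Tri} {i : Fin 3} (h : x.1 i = 0) : ∃ t, x = side i t := by
  have h1 := x.sum_eq i
  refine ⟨⟨x.1 (i + 2), x.nonneg _, by linarith [x.nonneg (i + 1)]⟩, Tri.ext_of i ?_ ?_⟩
  · rw [side_apply_add_one]; simp only; linarith
  · rw [side_apply_add_two]

lemma dist_side (i : Fin 3) (s t : 𝕀) : dist (side i s) (side i t) = |(s : ℝ) - t| := by
  rw [Subtype.dist_eq, dist_eq_norm]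
  apply le_antisymm
  · rw [pi_norm_le_iff_of_nonneg (abs_nonneg _)]
    intro j
    rcases fin3_cases i j with rfl | rfl | rfl
    · simp [side_apply_self]
    · rw [Pi.sub_apply, side_apply_add_one, side_apply_add_one, Real.norm_eq_abs, abs_sub_comm]
      apply le_of_eq; congr 1; ring
    · rw [Pi.sub_apply, side_apply_add_two, side_apply_add_two, Real.norm_eq_abs]
  · have := norm_le_pi_norm ((side i s).1 - (side i t).1) (i + 2)
    rwa [Pi.sub_apply, side_apply_add_two, side_apply_add_two, Real.norm_eq_abs] at this

lemma abs_coord_sub_le_dist (x y : Tri) (i : Fin 3) : |x.1 i - y.1 i| ≤ dist x y := by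
  rw [Subtype.dist_eq, dist_eq_norm]
  exact norm_le_pi_norm (x.1 - y.1) i

lemma side_eq_vtx {i j : Fin 3} {t : 𝕀} (h : side i t = vtx j) : t = 0 ∨ t = 1 := by
  have h2 := side_apply_add_two i t
  rw [h] at h2
  by_cases hj : i + 2 = j
  · right; subst hj; rw [vtx_apply_self] at h2; exact Subtype.ext h2.symm
  · left; rw [vtx_apply_of_ne hj] at h2; exact Subtype.ext h2.symm

lemma Tri.cases (x : Tri) : (∀ i, 0 < x.1 i) ∨
    (∃ i, ∃ s : 𝕀, 0 < s ∧ s < 1 ∧ x = side i s) ∨ ∃ i, x = vtx i := by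
  by_cases h : ∀ i, 0 < x.1 i
  · exact Or.inl h
  · push Not at h
    obtain ⟨i, hi⟩ := h
    obtain ⟨t, rfl⟩ := exists_side (le_antisymm hi (x.nonneg i))
    by_cases h0 : t = 0
    · subst h0; exact Or.inr (Or.inr ⟨_, side_zero i⟩)
    by_cases h1 : t = 1
    · subst h1; exact Or.inr (Or.inr ⟨_, side_one i⟩)
    exact Or.inr (Or.inl ⟨i, t, unitInterval.pos_iff_ne_zero.2 h0,
      unitInterval.lt_one_iff_ne_one.2 h1, rfl⟩)

lemma side_ne_vtx {i j : Fin 3} {s : 𝕀} (h0 : 0 < s) (h1 : s < 1) :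
    side i s ≠ vtx j := fun h => (side_eq_vtx h).elim h0.ne' h1.ne

lemma symm_pos {s : 𝕀} (h : s < 1) : 0 < σ₀ s := by
  rw [← Subtype.coe_lt_coe] at *
  simpa using h

lemma symm_lt_one {s : 𝕀} (h : 0 < s) : σ₀ s < 1 := by
  rw [← Subtype.coe_lt_coe] at *
  simpa using h

lemma side_apply_pos {i j : Fin 3} {s : 𝕀} (h0 : 0 < s) (h1 : s < 1) (hj : j ≠ i) :
    0 < (side i s).1 j := by
  rcases fin3_cases i j with rfl | rfl | rfl
  · exact absurd rfl hj
  · rw [side_apply_add_one]; exact sub_pos.2 h1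
  · rw [side_apply_add_two]; exact h0

lemma ne_vtx_of_pos {x : Tri} (hx : ∀ i, 0 < x.1 i) (i : Fin 3) : x ≠ vtx i := by
  rintro rfl
  exact (hx (i + 1)).ne' (vtx_apply_add_one i)

/-! ### Topology of a triangulated surface -/

namespace Triangulation

variable (τ)

instance : Finite τ.Face := τ.finite_face

lemma char_vtx_mem (f : τ.Face) (i : Fin 3) : τ.char f (vtx i) ∈ Z := (τ.mem_iff f _).2 ⟨i, rfl⟩

lemma char_eq_cases {f g : τ.Face} {x y : Tri} (h : τ.char f x = τ.char g y) : (f = g ∧ x = y) ∨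
    (∃ k : τ.Corner, ∃ s : 𝕀, 0 < s ∧ s < 1 ∧ f = k.1 ∧ x = side k.2 s ∧
      g = (τ.opp k).1 ∧ y = side (τ.opp k).2 (σ₀ s)) ∨
    ∃ i j, x = vtx i ∧ y = vtx j := by
  rcases x.cases with hx | ⟨i, s, h0, h1, rfl⟩ | ⟨i, rfl⟩
  · exact Or.inl (τ.face_inj f g x y hx h)
  · rcases y.cases with hy | ⟨j, t, -, -, rfl⟩ | ⟨j, rfl⟩
    · have := τ.face_inj g f y _ hy h.symm
      exact Or.inl ⟨this.1.symm, this.2.symm⟩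
    · rcases τ.edge_inj (f, i) (g, j) s t h0 h1 h with ⟨h2, h3⟩ | ⟨h2, h3⟩
      · simp only [Prod.mk.injEq] at h2
        exact Or.inl ⟨h2.1.symm, by rw [h2.2, h3]⟩
      · refine Or.inr (Or.inl ⟨(f, i), s, h0, h1, rfl, rfl, ?_, ?_⟩)
        · rw [← h2]
        · rw [← h2, h3]
    · exfalso
      have hm := τ.char_vtx_mem g j
      rw [← h, τ.mem_iff] at hm
      obtain ⟨k, hk⟩ := hm
      exact side_ne_vtx h0 h1 hk
  · have hm := τ.char_vtx_mem f i
    rw [h, τ.mem_iff] at hm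
    obtain ⟨j, rfl⟩ := hm
    exact Or.inr (Or.inr ⟨i, j, rfl, rfl⟩)

lemma finite_fiber (f : τ.Face) (p : S) : {x : Tri | τ.char f x = p}.Finite := by
  by_cases hne : ∃ x, τ.char f x = p
  swap
  · push Not at hne
    have : {x : Tri | τ.char f x = p} = ∅ := eq_empty_of_forall_notMem hne
    rw [this]; exact finite_empty
  obtain ⟨x₀, rfl⟩ := hne
  have hfin : ((range vtx : Set Tri) ∪ {x₀} ∪ {x | ∃ k : τ.Corner, ∃ s : 𝕀, x₀ = side k.2 s ∧
        x = side (τ.opp k).2 (σ₀ s)}).Finite := by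
    refine ((finite_range _).union (finite_singleton _)).union ?_
    have : {x : Tri | ∃ k : τ.Corner, ∃ s : 𝕀, x₀ = side k.2 s ∧ x = side (τ.opp k).2 (σ₀ s)} ⊆
        ⋃ k : τ.Corner, (fun s => side (τ.opp k).2 (σ₀ s)) ''
          {s | x₀ = side k.2 s} := by
      rintro x ⟨k, s, h1, h2⟩
      exact mem_iUnion.2 ⟨k, s, h1, h2.symm⟩
    refine Finite.subset (finite_iUnion fun k => Finite.image _ ?_) this
    refine Subsingleton.finite ?_
    intro s hs t ht
    exact side_injective k.2 (hs.symm.trans ht)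
  refine hfin.subset ?_
  intro x hx
  rcases τ.char_eq_cases (Eq.symm hx) with ⟨-, h⟩ | ⟨k, s, -, -, -, h1, -, h2⟩ | ⟨i, j, -, h⟩
  · exact Or.inl (Or.inr h.symm)
  · exact Or.inr ⟨k, s, h1, h2⟩
  · exact Or.inl (Or.inl ⟨j, h.symm⟩)

/-- The points all of whose preimages in triangles are `ε`-close to preimages of `p`. -/
def star (p : S) (ε : ℝ) : Set S := {q | ∀ f y, τ.char f y = q → ∃ x, τ.char f x = p ∧ dist y x < ε}

lemma mem_star (p : S) {ε : ℝ} (hε : 0 < ε) : p ∈ τ.star p ε :=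
  fun _ y hy => ⟨y, hy, by simpa using hε⟩

lemma isOpen_star [T2Space S] (p : S) (ε : ℝ) : IsOpen (τ.star p ε) := by
  rw [← isClosed_compl_iff]
  have : (τ.star p ε)ᶜ = ⋃ f, τ.char f '' {y | ∀ x, τ.char f x = p → ε ≤ dist y x} := by
    ext q
    simp only [star, mem_compl_iff, mem_iUnion, mem_image]
    constructor
    · intro hq
      simp only [mem_ofPred_eq] at hq
      push Not at hq
      obtain ⟨f, y, hy, h⟩ := hq
      exact ⟨f, y, h, hy⟩
    · rintro ⟨f, y, hy, rfl⟩ h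
      obtain ⟨x, hx, hd⟩ := h f y rfl
      exact absurd (hy x hx) (not_le.2 hd)
  rw [this]
  refine isClosed_iUnion_of_finite fun f => (IsClosed.isCompact ?_ |>.image
    (τ.char f).continuous).isClosed
  have h2 : {y : Tri | ∀ x, τ.char f x = p → ε ≤ dist y x} =
      ⋂ x, ⋂ _ : τ.char f x = p, {y : Tri | ε ≤ dist y x} := by
    ext y; simp
  rw [h2]
  exact isClosed_iInter fun x => isClosed_iInter fun _ => isClosed_le continuous_const (by fun_prop)

lemma eventually_of_char [T2Space S] {p : S} {Q : S → Prop}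
    (h : ∀ f x, τ.char f x = p → ∀ᶠ y in 𝓝 x, Q (τ.char f y)) : ∀ᶠ q in 𝓝 p, Q q := by
  let V : Set S := ⋂ f, (τ.char f '' {y | ¬ ∀ᶠ y' in 𝓝 y, Q (τ.char f y')})ᶜ
  have hV : IsOpen V := by
    refine isOpen_iInter_of_finite fun f => ?_
    rw [isOpen_compl_iff]
    have hc : IsClosed {y : Tri | ¬ ∀ᶠ y' in 𝓝 y, Q (τ.char f y')} := by
      rw [← isOpen_compl_iff]
      have : {y : Tri | ¬ ∀ᶠ y' in 𝓝 y, Q (τ.char f y')}ᶜ =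
          {y : Tri | ∀ᶠ y' in 𝓝 y, Q (τ.char f y')} := by ext; simp
      rw [this]
      exact isOpen_setOfPred_eventually_nhds
    exact (hc.isCompact.image (τ.char f).continuous).isClosed
  have hp : p ∈ V := by
    refine mem_iInter.2 fun f => ?_
    rintro ⟨x, hx, hxp⟩
    exact hx (h f x hxp)
  filter_upwards [hV.mem_nhds hp] with q hq
  obtain ⟨f, x, rfl⟩ := τ.cover q
  by_contra hn
  exact mem_iInter.1 hq f ⟨x, fun hx => hn hx.self_of_nhds, rfl⟩

lemma continuousAt_of_char [T2Space S] {E : Type*} [TopologicalSpace E] {F : S → E} {p : S}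
    (h : ∀ f x, τ.char f x = p → ContinuousAt (fun y => F (τ.char f y)) x) : ContinuousAt F p := by
  intro V hV
  refine τ.eventually_of_char (p := p) (Q := fun q => F q ∈ V) fun f x hx => ?_
  have := h f x hx
  rw [ContinuousAt, hx] at this
  exact this hV

lemma continuous_of_char [T2Space S] {E : Type*} [TopologicalSpace E] {F : S → E}
    (h : ∀ f, Continuous fun y => F (τ.char f y)) : Continuous F :=
  continuous_iff_continuousAt.2 fun _ => τ.continuousAt_of_char fun f _ _ => (h f).continuousAt

/-- A radius that separates the preimages of `p` and keeps away from the sides that do not contain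
them. -/
lemma exists_radius (p : S) : ∃ ε > 0, ∀ f x, τ.char f x = p →
    (∀ x', τ.char f x' = p → ∀ y, dist y x < ε → dist y x' < ε → x = x') ∧
    ∀ y, dist y x < ε → ∀ i, y.1 i = 0 → x.1 i = 0 := by
  have h1 : ∀ f, ∃ ε > 0, ∀ x, τ.char f x = p →
      (∀ x', τ.char f x' = p → ∀ y, dist y x < ε → dist y x' < ε → x = x') ∧
      ∀ y, dist y x < ε → ∀ i, y.1 i = 0 → x.1 i = 0 := by
    intro f
    have hfin := τ.finite_fiber f p
    have hev : ∀ᶠ ε in 𝓝[>] (0 : ℝ), ∀ x ∈ {x : Tri | τ.char f x = p},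
        (∀ x' ∈ {x : Tri | τ.char f x = p}, ∀ y, dist y x < ε → dist y x' < ε → x = x') ∧
        ∀ y, dist y x < ε → ∀ i, y.1 i = 0 → x.1 i = 0 := by
      rw [eventually_all_finite hfin]
      intro x _
      rw [eventually_and, eventually_all_finite hfin]
      refine ⟨fun x' _ => ?_, ?_⟩
      · by_cases hxx : x = x'
        · exact Eventually.of_forall fun ε y _ _ => hxx
        · have hd : 0 < dist x x' := dist_pos.2 hxx
          filter_upwards [nhdsWithin_le_nhds (Iio_mem_nhds (half_pos hd))] with ε hε y h1 h2
          have := dist_triangle_left x x' y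
          have hε' : ε < dist x x' / 2 := hε
          linarith
      · have : ∀ᶠ ε in 𝓝[>] (0 : ℝ), ∀ i, 0 < x.1 i → ε < x.1 i := by
          rw [eventually_all]
          intro i
          by_cases hi : 0 < x.1 i
          · filter_upwards [nhdsWithin_le_nhds (Iio_mem_nhds hi)] with ε hε _ using hε
          · exact Eventually.of_forall fun ε h => absurd h hi
        filter_upwards [this] with ε hε y hy i hi
        by_contra hne
        have h1 := hε i (lt_of_le_of_ne (x.nonneg i) (Ne.symm hne))
        have h2 := abs_coord_sub_le_dist y x i
        rw [hi, zero_sub, abs_neg, abs_of_nonneg (x.nonneg i)] at h2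
        linarith
    obtain ⟨ε, hε, hpos⟩ := (hev.and self_mem_nhdsWithin).exists
    exact ⟨ε, hpos, fun x hx => ⟨fun x' hx' => (hε x hx).1 x' hx', (hε x hx).2⟩⟩
  choose ε hε h using h1
  obtain ⟨δ, hδ, hδε⟩ : ∃ δ > 0, ∀ f, δ ≤ ε f := by
    by_cases hne : Nonempty τ.Face
    · obtain ⟨f₀, hf₀⟩ := Finite.exists_min ε
      exact ⟨ε f₀, hε f₀, hf₀⟩
    · exact ⟨1, one_pos, fun f => absurd ⟨f⟩ hne⟩
  refine ⟨δ, hδ, fun f x hx => ⟨fun x' hx' y h1 h2 => ?_, fun y hy => ?_⟩⟩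
  · exact (h f x hx).1 x' hx' y (h1.trans_le (hδε f)) (h2.trans_le (hδε f))
  · exact (h f x hx).2 y (hy.trans_le (hδε f))

open Classical in
/-- Functions given near the preimages of `p`, and compatible with the gluing, come from a function
near `p`. -/
lemma exists_glue {E : Type*} (p : S) (G : τ.Face → Tri → Tri → E) (e₀ : E)
    (hbase : ∀ f x, τ.char f x = p → G f x x = e₀)
    (hglue : ∀ (h : τ.Corner) (s₀ : 𝕀), τ.char h.1 (side h.2 s₀) = p → ∀ s,
      G h.1 (side h.2 s₀) (side h.2 s) = G (τ.opp h).1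
        (side (τ.opp h).2 (σ₀ s₀)) (side (τ.opp h).2 (σ₀ s))) :
    ∃ F : S → E, ∃ ε > 0, ∀ f x, τ.char f x = p → ∀ y, dist y x < ε → F (τ.char f y) = G f x y := by
  obtain ⟨ε, hε, hr⟩ := τ.exists_radius p
  have wd : ∀ f x, τ.char f x = p → ∀ y, dist y x < ε → ∀ g x', τ.char g x' = p → ∀ y',
      dist y' x' < ε → τ.char f y = τ.char g y' → G f x y = G g x' y' := by
    intro f x hx y hy g x' hx' y' hy' heq
    rcases τ.char_eq_cases heq with ⟨rfl, rfl⟩ | ⟨k, s, h0, h1, rfl, rfl, rfl, rfl⟩ | ⟨i, j, rfl, rfl⟩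
    · rw [(hr f x hx).1 x' hx' y hy hy']
    · obtain ⟨s₀, rfl⟩ := exists_side ((hr k.1 x hx).2 _ hy k.2 (side_apply_self _ _))
      have hx'' : τ.char (τ.opp k).1 (side (τ.opp k).2 (σ₀ s₀)) = p := by rw [← τ.glue]; exact hx
      have hd : dist (side (τ.opp k).2 (σ₀ s)) (side (τ.opp k).2 (σ₀ s₀)) < ε := by
        rw [dist_side] at hy ⊢
        rw [abs_sub_comm] at hy
        simpa using hy
      rw [← (hr _ _ hx'').1 x' hx' _ hd hy']
      exact hglue k s₀ hx s
    · have aux : ∀ (f : τ.Face) (x : Tri) (i : Fin 3), τ.char f x = p → dist (vtx i) x < ε →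
          x = vtx i := by
        intro f x i hx hd
        refine Tri.ext_of i ?_ ?_
        · rw [(hr f x hx).2 _ hd _ (vtx_apply_add_one i), vtx_apply_add_one]
        · rw [(hr f x hx).2 _ hd _ (vtx_apply_add_two i), vtx_apply_add_two]
      have e1 := aux f x i hx hy
      have e2 := aux g x' j hx' hy'
      subst e1 e2
      rw [hbase _ _ hx, hbase _ _ hx']
  refine ⟨fun q => if h : ∃ (f : τ.Face) (x y : Tri), τ.char f x = p ∧ dist y x < ε ∧
    τ.char f y = q then G h.choose h.choose_spec.choose h.choose_spec.choose_spec.choose else e₀,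
    ε, hε, ?_⟩
  intro f x hx y hy
  have h : ∃ (g : τ.Face) (x' y' : Tri), τ.char g x' = p ∧ dist y' x' < ε ∧
    τ.char g y' = τ.char f y := ⟨f, x, y, hx, hy, rfl⟩
  simp only [dif_pos h]
  obtain ⟨h1, h2, h3⟩ := h.choose_spec.choose_spec.choose_spec
  exact wd _ _ h1 _ h2 f x hx y hy h3

/-! ### Cochains and piecewise affine primitives -/

/-- Closed simplicial `1`-cochains with complex values. -/
structure IsCocycle (α : τ.Corner → ℂ) : Prop where
  opp : ∀ h, α (τ.opp h) = -α h
  sum : ∀ f, α (f, 0) + α (f, 1) + α (f, 2) = 0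

/-- The affine primitive of a cochain on a face. -/
def aff (α : τ.Corner → ℂ) (f : τ.Face) (x : Tri) : ℂ :=
  (x.1 1 : ℂ) * α (f, 2) - (x.1 2 : ℂ) * α (f, 1)

variable {τ} {α : τ.Corner → ℂ}

lemma IsCocycle.sum' (hα : τ.IsCocycle α) (f : τ.Face) (i : Fin 3) :
    α (f, i) + α (f, i + 1) + α (f, i + 2) = 0 := by
  have := hα.sum f
  rw [← sum_fin3 (fun i => α (f, i)), Fin.sum_univ_three]
  exact this

lemma continuous_aff (f : τ.Face) : Continuous (τ.aff α f) := by
  have h : ∀ i, Continuous fun x : Tri => (x.1 i : ℂ) := fun i =>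
    continuous_ofReal.comp ((continuous_apply i).comp continuous_subtype_val)
  exact ((h 1).mul continuous_const).sub ((h 2).mul continuous_const)

lemma aff_eq (hα : τ.IsCocycle α) (f : τ.Face) (i : Fin 3) (x : Tri) :
    τ.aff α f x = τ.aff α f (vtx i) + (x.1 (i + 1) : ℂ) * α (f, i + 2)
      - (x.1 (i + 2) : ℂ) * α (f, i + 1) := by
  have hs := hα.sum f
  have hx : (x.1 0 : ℂ) + x.1 1 + x.1 2 = 1 := by exact_mod_cast x.sum_eq 0
  unfold aff
  fin_cases i
  · simp [vtx_apply_of_ne]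
  · simp [vtx_apply_of_ne, vtx_apply_self]
    linear_combination (-(x.1 2 : ℂ)) * hs + α (f, 2) * hx
  · simp [vtx_apply_of_ne, vtx_apply_self]
    linear_combination (x.1 1 : ℂ) * hs - α (f, 1) * hx

lemma aff_vtx_add_one (hα : τ.IsCocycle α) (f : τ.Face) (i : Fin 3) :
    τ.aff α f (vtx (i + 1)) = τ.aff α f (vtx i) + α (f, i + 2) := by
  rw [aff_eq hα f i (vtx (i + 1)), vtx_apply_self, vtx_apply_of_ne (fin3_add_two_ne_add_one i)]
  simp

lemma aff_vtx_add_two (hα : τ.IsCocycle α) (f : τ.Face) (i : Fin 3) :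
    τ.aff α f (vtx (i + 2)) = τ.aff α f (vtx (i + 1)) + α (f, i) := by
  have := aff_vtx_add_one hα f (i + 1)
  rwa [fin3_add_one_add_one, fin3_add_one_add_two] at this

lemma aff_side (hα : τ.IsCocycle α) (h : τ.Corner) (t : 𝕀) :
    τ.aff α h.1 (side h.2 t) = τ.aff α h.1 (vtx (h.2 + 1)) + (t : ℝ) * α h := by
  rw [aff_eq hα h.1 h.2, side_apply_add_one, side_apply_add_two, aff_vtx_add_one hα]
  have := hα.sum' h.1 h.2
  push_cast
  linear_combination (-((t : ℝ) : ℂ)) * this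

/-- The piecewise affine functions with increments given by the cocycle `α`. -/
def IsPLPrimitive (τ : Triangulation Z) (α : τ.Corner → ℂ) (F : S → ℂ) (U : Set S) : Prop :=
  ∀ f y, τ.char f y ∈ U → ∀ᶠ y' in 𝓝 y,
    F (τ.char f y') - F (τ.char f y) = τ.aff α f y' - τ.aff α f y

lemma exists_glued_primitive (hα : τ.IsCocycle α) (p : S) :
    ∃ F : S → ℂ, ∃ ε > 0, ∀ f x, τ.char f x = p → ∀ y, dist y x < ε →
      F (τ.char f y) = τ.aff α f y - τ.aff α f x := by
  refine τ.exists_glue p (fun f x y => τ.aff α f y - τ.aff α f x) 0 (fun f x _ => sub_self _) ?_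
  intro h s₀ _ s
  have e1 := hα.opp h
  simp only [aff_side hα, e1, unitInterval.coe_symm_eq]
  push_cast
  ring

/-- The local primitives of a closed cochain. -/
def plSystem [T2Space S] (hα : τ.IsCocycle α) : PrimSystem S ℂ where
  prim := τ.IsPLPrimitive α
  exists_prim := by
    intro p
    obtain ⟨F, ε, hε, hF⟩ := exists_glued_primitive hα p
    refine ⟨τ.star p ε, τ.isOpen_star p ε, τ.mem_star p hε, F, ?_⟩
    intro f y hy
    obtain ⟨x, hx, hd⟩ := hy f y rfl
    have hev : ∀ᶠ y' in 𝓝 y, dist y' x < ε :=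
      (continuous_id.dist continuous_const).continuousAt.eventually_lt continuousAt_const hd
    filter_upwards [hev] with y' hy'
    rw [hF f x hx y hd, hF f x hx y' hy']
    ring
  sub_const := by
    intro F G U V hF hG hU hV p hp
    refine τ.eventually_of_char fun f x hx => ?_
    subst hx
    filter_upwards [hF f x hp.1, hG f x hp.2] with y h1 h2
    linear_combination h1 - h2
  add_const := by
    intro F U hF c f y hy
    filter_upwards [hF f y hy] with y' h
    linear_combination h

lemma along_char_aff [T2Space S] (hα : τ.IsCocycle α) (f : τ.Face) :
    (plSystem hα).Along (τ.char f) (τ.aff α f) := by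
  intro x
  obtain ⟨U, hU, hm, F, hF⟩ := (plSystem hα).exists_prim (τ.char f x)
  refine ⟨U, hU, hm, _, (plSystem hα).add_const hF (τ.aff α f x - F (τ.char f x)), ?_⟩
  filter_upwards [hF f x hm] with y hy
  linear_combination -hy

end Triangulation

open CategoryTheory Simplicial in
/-- If `f` acts as `-1` on `H₁` then every singular `1`-cocycle `A` changes sign under `f` on
cycles that consist of two singular `1`-simplices. -/
lemma cocycle_comp_of_homology_neg {S : Type} [TopologicalSpace S] (f : C(S, S))
    (hf : ((AlgebraicTopology.singularHomologyFunctor (ModuleCat.{0} ℤ) 1).obj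
      (ModuleCat.of ℤ ℤ)).map (TopCat.ofHom f) = -CategoryTheory.CategoryStruct.id _)
    (A : C(stdSimplex ℝ (Fin 2), S) → ℂ)
    (hA : ∀ σ : C(stdSimplex ℝ (Fin 3), S), ∑ i : Fin 3, (-1 : ℤ) ^ (i : ℕ) •
      A (σ.comp ⟨_, stdSimplex.continuous_map (Fin.succAbove i)⟩) = 0)
    (σ ρ : C(stdSimplex ℝ (Fin 2), S))
    (h1 : σ (vertex 1) = ρ (vertex 0))
    (h2 : ρ (vertex 1) = σ (vertex 0)) :
    A (f.comp σ) + A (f.comp ρ) = -(A σ + A ρ) := by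
  let X := TopCat.toSSet.obj (TopCat.of S)
  let F : X ⟶ X := TopCat.toSSet.map (TopCat.ofHom f)
  let R := ModuleCat.of ℤ ℤ
  let E := ModuleCat.of ℤ ℂ
  let e1 := TopCat.toSSetObjEquiv (TopCat.of S) (.op ⦋1⦌)
  let e2 := TopCat.toSSetObjEquiv (TopCat.of S) (.op ⦋2⦌)
  have hH : SSet.homologyMap F R 1 = -𝟙 _ := hf
  let a : (X.chainComplex R).X 1 ⟶ E := Limits.Sigma.desc
    (fun x : X _⦋1⦌ => ModuleCat.ofHom (LinearMap.toSpanSingleton ℤ ℂ (A (e1 x))))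
  have ha : ∀ x : X _⦋1⦌, X.ιChainComplex x ≫ a =
      ModuleCat.ofHom (LinearMap.toSpanSingleton ℤ ℂ (A (e1 x))) := by
    intro x
    exact Limits.Sigma.ι_desc _ _
  have hd : (X.chainComplex R).d 2 1 ≫ a = 0 := by
    apply SSet.chainComplex_hom_ext
    intro x
    rw [SSet.ιChainComplex_d_assoc, Limits.comp_zero]
    rw [Preadditive.sum_comp]
    simp only [Preadditive.zsmul_comp, ha]
    ext
    have := hA (e2 x)
    simp only [ModuleCat.hom_sum, LinearMap.sum_apply, ModuleCat.hom_zsmul, LinearMap.smul_apply, ModuleCat.hom_ofHom, LinearMap.toSpanSingleton_apply, one_smul, ModuleCat.hom_zero, LinearMap.zero_apply]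
    exact this
  let c : R ⟶ (X.chainComplex R).X 1 := X.ιChainComplex (e1.symm σ) + X.ιChainComplex (e1.symm ρ)
  have hvtx : ∀ (s t : C(stdSimplex ℝ (Fin 2), S)) (i j : Fin 2),
      s (vertex (i.succAbove 0)) = t (vertex (j.succAbove 0)) →
      X.δ i (e1.symm s) = X.δ j (e1.symm t) := by
    intro s t i j hst
    refine (TopCat.toSSetObjEquiv (TopCat.of S) (.op ⦋0⦌)).injective ?_
    refine ContinuousMap.ext fun x => ?_
    have hx : x = vertex 0 := Subsingleton.elim (α := stdSimplex ℝ (Fin 1)) _ _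
    subst hx
    change s (stdSimplex.map (Fin.succAbove i) (vertex 0)) =
      t (stdSimplex.map (Fin.succAbove j) (vertex 0))
    rw [stdSimplex.map_vertex, stdSimplex.map_vertex]
    exact hst
  have hc : c ≫ (X.chainComplex R).d 1 0 = 0 := by
    have e1' : X.δ 0 (e1.symm σ) = X.δ 1 (e1.symm ρ) := hvtx _ _ _ _ (by simpa using h1)
    have e2' : X.δ 0 (e1.symm ρ) = X.δ 1 (e1.symm σ) := hvtx _ _ _ _ (by simpa using h2)
    simp only [c, Preadditive.add_comp, SSet.ιChainComplex_d]
    simp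
    have e1'' := congrArg (X.ιChainComplex (R := R)) e1'
    have e2'' := congrArg (X.ιChainComplex (R := R)) e2'
    rw [← sub_eq_add_neg, ← sub_eq_add_neg, sub_add_sub_comm, sub_eq_zero]
    exact (congrArg₂ (· + ·) e1'' e2'').trans (add_comm _ _)
  let z : R ⟶ (X.chainComplex R).cycles 1 := (X.chainComplex R).liftCycles c 0 (by simp) hc
  let pr : (X.chainComplex R).homology 1 ⟶ E :=
    (X.chainComplex R).homologyι 1 ≫ (X.chainComplex R).descOpcycles a 2 (by simp) hd
  have key : z ≫ (X.chainComplex R).homologyπ 1 ≫ SSet.homologyMap F R 1 ≫ pr =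
      z ≫ (X.chainComplex R).homologyπ 1 ≫ (-𝟙 _) ≫ pr := by rw [hH]
  have hL : z ≫ (X.chainComplex R).homologyπ 1 ≫ SSet.homologyMap F R 1 ≫ pr =
      c ≫ (SSet.chainComplexMap F R).f 1 ≫ a := by
    simp [z, pr, SSet.homologyMap]
  have hR : z ≫ (X.chainComplex R).homologyπ 1 ≫ (-𝟙 _) ≫ pr = -(c ≫ a) := by simp [z, pr]
  rw [hL, hR] at key
  have h3 : c ≫ (SSet.chainComplexMap F R).f 1 ≫ a =
      X.ιChainComplex (e1.symm (f.comp σ)) ≫ a + X.ιChainComplex (e1.symm (f.comp ρ)) ≫ a := by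
    simp only [c, Preadditive.add_comp, SSet.ι_chainComplexMap_f_assoc]
    rfl
  rw [h3] at key
  simp only [c, Preadditive.add_comp, ha] at key
  have := congrArg (fun φ => φ.hom (1 : ℤ)) key
  have one : ∀ w : ℂ, (LinearMap.toSpanSingleton ℤ ℂ w) (1 : ℤ) = w := fun w => one_smul ℤ w
  simp only [e1] at this
  simp at this
  rw [neg_add, add_comm (-A σ)]
  exact (congrArg₂ (· + ·) (one _).symm (one _).symm).trans (Eq.trans this
    (congrArg₂ (· + ·) (congrArg Neg.neg (one _)) (congrArg Neg.neg (one _))))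

/-! ### Plane triangles -/

/-- The signed area form of the plane. -/
def cross (a b : ℂ) : ℝ := a.re * b.im - a.im * b.re

lemma cross_add_right (a b c : ℂ) : cross a (b + c) = cross a b + cross a c := by simp [cross]; ring

lemma cross_sub_right (a b c : ℂ) : cross a (b - c) = cross a b - cross a c := by simp [cross]; ring

lemma cross_self (a : ℂ) : cross a a = 0 := by simp [cross]; ring

lemma cross_smul_right (a b : ℂ) (t : ℝ) : cross a (t * b) = t * cross a b := by simp [cross]; ring

lemma continuous_cross_right (a : ℂ) : Continuous (cross a) := by unfold cross; fun_prop

/-- Twice the signed area of a triangle. -/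
def area (P : Fin 3 → ℂ) : ℝ := cross (P 1 - P 0) (P 2 - P 0)

lemma area_eq (P : Fin 3 → ℂ) (i : Fin 3) :
    area P = cross (P (i + 2) - P (i + 1)) (P i - P (i + 1)) := by
  fin_cases i <;> simp [area, cross] <;> ring

/-- Barycentric coordinates with respect to a triangle. -/
def bary (P : Fin 3 → ℂ) (i : Fin 3) (z : ℂ) : ℝ :=
  cross (P (i + 2) - P (i + 1)) (z - P (i + 1)) / area P

/-- The affine parametrization of a triangle. -/
def affTri (P : Fin 3 → ℂ) (x : Tri) : ℂ := ∑ i, (x.1 i : ℂ) * P i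

lemma continuous_affTri (P : Fin 3 → ℂ) : Continuous (affTri P) := by
  have h : ∀ i, Continuous fun x : Tri => (x.1 i : ℂ) := fun i =>
    continuous_ofReal.comp ((continuous_apply i).comp continuous_subtype_val)
  exact continuous_finsetSum _ fun i _ => (h i).mul continuous_const

lemma affTri_vtx (P : Fin 3 → ℂ) (i : Fin 3) : affTri P (vtx i) = P i := by
  rw [affTri, sum_fin3 _ i, vtx_apply_self, vtx_apply_add_one, vtx_apply_add_two]
  simp

lemma affTri_eq (P : Fin 3 → ℂ) (x : Tri) (i : Fin 3) :
    affTri P x = P i + (x.1 (i + 1) : ℂ) * (P (i + 1) - P i) +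
      (x.1 (i + 2) : ℂ) * (P (i + 2) - P i) := by
  have hx : (x.1 i : ℂ) + x.1 (i + 1) + x.1 (i + 2) = 1 := by exact_mod_cast x.sum_eq i
  rw [affTri, sum_fin3 _ i]
  linear_combination P i * hx

lemma affTri_side (P : Fin 3 → ℂ) (i : Fin 3) (t : 𝕀) :
    affTri P (side i t) = P (i + 1) + (t : ℝ) * (P (i + 2) - P (i + 1)) := by
  rw [affTri, sum_fin3 _ i, side_apply_self, side_apply_add_one, side_apply_add_two]
  push_cast
  ring

lemma continuous_bary (P : Fin 3 → ℂ) (i : Fin 3) : Continuous (bary P i) :=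
  ((continuous_cross_right _).comp (by fun_prop)).div_const _

section Bary

variable {P : Fin 3 → ℂ}

lemma bary_affTri (hP : area P ≠ 0) (x : Tri) (i : Fin 3) : bary P i (affTri P x) = x.1 i := by
  have h1 : affTri P x - P (i + 1) =
      (x.1 i : ℝ) * (P i - P (i + 1)) + (x.1 (i + 2) : ℝ) * (P (i + 2) - P (i + 1)) := by
    have := affTri_eq P x (i + 1)
    rw [fin3_add_one_add_one, fin3_add_one_add_two] at this
    rw [this]; ring
  rw [bary, h1, cross_add_right, cross_smul_right, cross_smul_right, cross_self, ← area_eq]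
  field_simp
  ring

lemma bary_sum (hP : area P ≠ 0) (z : ℂ) (i : Fin 3) : bary P i z + bary P (i + 1) z + bary P (i + 2) z = 1 := by
  rw [← sum_fin3 (fun i => bary P i z), Fin.sum_univ_three, bary, bary, bary, ← add_div, ← add_div,
    div_eq_one_iff_eq hP]
  simp [area, cross]
  ring

lemma eq_of_bary_eq (hP : area P ≠ 0) {z w : ℂ} (i : Fin 3) (h1 : bary P i z = bary P i w)
    (h2 : bary P (i + 1) z = bary P (i + 1) w) : z = w := by
  rw [bary, bary, div_left_inj' hP] at h1 h2
  have ha := area_eq P i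
  rw [fin3_add_one_add_two, fin3_add_one_add_one] at h2
  set a := P (i + 2) - P (i + 1) with hadef
  set b := P i - P (i + 2) with hb
  have hab : cross a b ≠ 0 := by
    have : cross a b = area P := by rw [ha, hb, hadef]; simp [cross]; ring
    rwa [this]
  have h3 : cross a (z - w) = 0 := by
    have : z - w = (z - P (i + 1)) - (w - P (i + 1)) := by ring
    rw [this, cross_sub_right, h1, sub_self]
  have h4 : cross b (z - w) = 0 := by
    have : z - w = (z - P (i + 2)) - (w - P (i + 2)) := by ring
    rw [this, cross_sub_right, h2, sub_self]
  have h5 : z - w = 0 := by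
    unfold cross at h3 h4 hab
    apply Complex.ext
    · have : (a.re * b.im - a.im * b.re) * (z - w).re = 0 := by
        linear_combination b.re * h3 - a.re * h4
      simpa using (mul_eq_zero.1 this).resolve_left hab
    · have : (a.re * b.im - a.im * b.re) * (z - w).im = 0 := by
        linear_combination b.im * h3 - a.im * h4
      simpa using (mul_eq_zero.1 this).resolve_left hab
  exact sub_eq_zero.1 h5

lemma affTri_injective (hP : area P ≠ 0) : Injective (affTri P) := by
  intro x y h
  apply Subtype.ext
  funext i
  rw [← bary_affTri hP x i, ← bary_affTri hP y i, h]

/-- The point of the standard triangle with given nonnegative barycentric coordinates. -/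
lemma exists_affTri (hP : area P ≠ 0) {z : ℂ} (hz : ∀ i, 0 ≤ bary P i z) : ∃ x, affTri P x = z := by
  refine ⟨⟨fun i => bary P i z, hz, ?_⟩, ?_⟩
  · rw [Fin.sum_univ_three]; exact bary_sum hP z 0
  · exact eq_of_bary_eq hP 0 (by rw [bary_affTri hP]) (by rw [bary_affTri hP])

lemma range_affTri (hP : area P ≠ 0) : range (affTri P) = {z | ∀ i, 0 ≤ bary P i z} := by
  ext z
  constructor
  · rintro ⟨x, rfl⟩ i
    rw [bary_affTri hP]; exact x.nonneg i
  · exact fun hz => exists_affTri hP hz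

lemma convexHull_eq_range_affTri : convexHull ℝ (range P) = range (affTri P) := by
  let L : (Fin 3 → ℝ) →ₗ[ℝ] ℂ := ∑ i, (LinearMap.proj i).smulRight (P i)
  have hL : ∀ x, L x = ∑ i, (x i : ℂ) * P i := fun x => by simp [L]
  have h : range P = L '' range fun i => Pi.single i 1 := by
    rw [← range_comp]
    exact congrArg range (funext fun i => by simp [hL, Pi.single_apply, apply_ite])
  rw [h, ← LinearMap.image_convexHull, convexHull_rangle_single_eq_stdSimplex, image_eq_range]
  exact congrArg range (funext fun x => hL x.1)

lemma affineIndependent_of_area (hP : area P ≠ 0) : AffineIndependent ℝ P := by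
  have hPeq : P = ![P 0, P 1, P 2] := by funext i; fin_cases i <;> rfl
  rw [hPeq, affineIndependent_iff_not_collinear_set]
  intro hc
  rw [collinear_iff_of_mem (p₀ := P 0) (by simp)] at hc
  obtain ⟨v, hv⟩ := hc
  obtain ⟨r1, h1⟩ := hv (P 1) (by simp)
  obtain ⟨r2, h2⟩ := hv (P 2) (by simp)
  apply hP
  simp only [vadd_eq_add] at h1 h2
  rw [area, h1, h2]
  simp [cross]; ring

end Bary

lemma area_ne_zero {P : Fin 3 → ℂ} (h : AffineIndependent ℝ P) : area P ≠ 0 := fun ha => by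
  rw [area, cross] at ha
  simp only [sub_re, sub_im] at ha
  have h1 := fun w h0 h1 => affineIndependent_iff.1 h Finset.univ w h0 h1 2 (Finset.mem_univ 2)
  have h2 := h1 ![(P 1).re - (P 2).re, (P 2).re - (P 0).re, (P 0).re - (P 1).re]
    (by simp [Fin.sum_univ_three]) (Complex.ext (by simp [Fin.sum_univ_three]; ring)
      (by simp [Fin.sum_univ_three]; linear_combination -ha))
  have h3 := h1 ![(P 1).im - (P 2).im, (P 2).im - (P 0).im, (P 0).im - (P 1).im]
    (by simp [Fin.sum_univ_three]) (Complex.ext (by simp [Fin.sum_univ_three]; linear_combination ha)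
      (by simp [Fin.sum_univ_three]; ring))
  exact absurd (h.injective (Complex.ext (sub_eq_zero.1 h2) (sub_eq_zero.1 h3))) (by decide)

/-- The homothety of the triangle with ratio `s` about its center. -/
def mix (s : 𝕀) (y : Tri) : Tri := ⟨fun i => 1 / 3 + s * (y.1 i - 1 / 3), fun i => by
    have h3 := mul_nonneg s.2.1 (y.nonneg i)
    dsimp only
    linarith [s.2.2], by
    rw [sum_fin3 _ 0]
    linear_combination (s : ℝ) * y.sum_eq 0⟩

lemma continuous_mix : Continuous fun q : 𝕀 × Tri => mix q.1 q.2 :=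
  Continuous.subtype_mk (continuous_pi fun i => continuous_const.add
    ((continuous_subtype_val.comp continuous_fst).mul
      (((continuous_apply i).comp (continuous_subtype_val.comp continuous_snd)).sub
        continuous_const))) _

lemma dense_interior : Dense {x : Tri | ∀ i, 0 < x.1 i} := fun x => by
  have h : mix 1 x = x := Subtype.ext (funext fun i => by simp [mix])
  rw [← h]
  refine map_mem_closure (f := fun s => mix s x) (s := Iio 1)
    (continuous_mix.comp (by fun_prop : Continuous fun s : 𝕀 => (s, x)))
    (by rw [closure_Iio' ⟨0, one_pos⟩]; exact le_refl (1 : 𝕀)) fun s hs i => ?_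
  have h3 := mul_nonneg s.2.1 (x.nonneg i)
  have h4 : (s : ℝ) < 1 := hs
  simp only [mix]
  linarith

lemma _root_.IsPreconnected.forall_of_clopen {A : Type*} [TopologicalSpace A] {K : Set A}
    (hK : IsPreconnected K) {Q : A → Prop} {z₀ : A} (hz₀ : z₀ ∈ K) (h0 : Q z₀)
    (hopen : ∀ z ∈ K, Q z → ∀ᶠ w in 𝓝[K] z, Q w)
    (hclosed : ∀ z ∈ K, (∃ᶠ w in 𝓝[K] z, Q w) → Q z) : ∀ z ∈ K, Q z := by
  have := isPreconnected_iff_preconnectedSpace.1 hK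
  have hc : IsClopen {z : K | Q z} := ⟨closure_subset_iff_isClosed.1 fun z hz => hclosed z z.2 (by
      rw [← map_nhds_subtype_val]; exact mem_closure_iff_frequently.1 hz),
    isOpen_iff_mem_nhds.2 fun z hz => by
      have := hopen z z.2 hz
      rwa [← map_nhds_subtype_val] at this⟩
  intro z hz
  have hm : (⟨z, hz⟩ : K) ∈ {z : K | Q z} := hc.eq_univ ⟨⟨z₀, hz₀⟩, h0⟩ ▸ mem_univ _
  exact hm

lemma _root_.Convex.shift {A : Set ℂ} (h : Convex ℝ A) (t : ℂ) : Convex ℝ {z | z - t ∈ A} :=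
  h.translate_preimage_left (-t)

/-! ### Translation maps from the plane to a translation surface -/

namespace TranslationSurface

/-- `d` is, on `W`, a continuous local inverse of primitives of `ω`. -/
def IsTranslationOn (X : TranslationSurface o Z κ) (d : ℂ → S) (W : Set ℂ) : Prop :=
  ContinuousOn d W ∧ ∀ z ∈ W, ∃ U : Set S, IsOpen U ∧ d z ∈ U ∧ ∃ F : S → ℂ, X.IsPrimitiveOn F U ∧
    ∀ᶠ w in 𝓝[W] z, F (d w) = w

lemma IsTranslationOn.mono {d : ℂ → S} {V W : Set ℂ} (h : X.IsTranslationOn d W) (hV : V ⊆ W) :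
    X.IsTranslationOn d V := by
  refine ⟨h.1.mono hV, fun z hz => ?_⟩
  obtain ⟨U, hU, hm, F, hF, he⟩ := h.2 z (hV hz)
  exact ⟨U, hU, hm, F, hF, he.filter_mono (nhdsWithin_mono _ hV)⟩

lemma IsTranslationOn.congr {d d' : ℂ → S} {W : Set ℂ} (h : X.IsTranslationOn d W)
    (hd : EqOn d' d W) : X.IsTranslationOn d' W := by
  refine ⟨h.1.congr hd, fun z hz => ?_⟩
  obtain ⟨U, hU, hm, F, hF, he⟩ := h.2 z hz
  refine ⟨U, hU, by rwa [hd hz], F, hF, ?_⟩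
  filter_upwards [he, self_mem_nhdsWithin] with w hw hw'
  rw [hd hw', hw]

lemma IsTranslationOn.eqOn [T2Space S] {d d' : ℂ → S} {W : Set ℂ} (hW : IsPreconnected W)
    (h : X.IsTranslationOn d W) (h' : X.IsTranslationOn d' W) (hZ : ∀ z ∈ W, d z ∉ Z) {z₀ : ℂ}
    (hz₀ : z₀ ∈ W) (heq : d z₀ = d' z₀) : EqOn d d' W := by
  refine hW.forall_of_clopen hz₀ heq (fun z hz ht => ?_) fun z hz =>
    tendsto_nhds_unique_of_frequently_eq (h.1 z hz) (h'.1 z hz)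
  obtain ⟨U, hU, hm, F, hF, he⟩ := h.2 z hz
  obtain ⟨U', hU', hm', F', hF', he'⟩ := h'.2 z hz
  obtain ⟨e, hpe, -, heF⟩ := hF.exists_openPartialHomeomorph hU hm (hZ z hz)
  have hc := hF.sub_const hF' hU hU' (d z) ⟨hm, ht ▸ hm'⟩
  have e0 : F (d z) = z := he.self_of_nhdsWithin hz
  have e0' : F' (d z) = z := by rw [ht]; exact he'.self_of_nhdsWithin hz
  have hs := e.open_source.mem_nhds hpe
  have hd' := h'.1 z hz
  rw [ContinuousWithinAt, ← ht] at hd'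
  filter_upwards [he, he', (h.1 z hz).eventually_mem hs, hd' hs, hd'.eventually hc]
    with w h1 h2 h3 h4 h5
  refine e.injOn h3 h4 ?_
  rw [heF _ h3, heF _ h4, h1]
  rw [h2, e0, e0', sub_self, sub_eq_zero] at h5
  exact h5.symm

lemma IsTranslationOn.shift {d : ℂ → S} {W : Set ℂ} (h : X.IsTranslationOn d W) (t : ℂ) :
    X.IsTranslationOn (fun z => d (z - t)) {z | z - t ∈ W} := by
  have hc : Continuous fun z : ℂ => z - t := by fun_prop
  refine ⟨h.1.comp hc.continuousOn fun z hz => hz, fun z hz => ?_⟩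
  obtain ⟨U, hU, hm, F, hF, he⟩ := h.2 (z - t) hz
  refine ⟨U, hU, hm, _, hF.add_const t, ?_⟩
  have h1 : Tendsto (fun z : ℂ => z - t) (𝓝[{z | z - t ∈ W}] z) (𝓝[W] (z - t)) :=
    hc.continuousWithinAt.tendsto_nhdsWithin fun z hz => hz
  filter_upwards [h1.eventually he] with w hw
  rw [hw]; ring

lemma IsTranslationOn.comp_pullsBack {d : ℂ → S} {W : Set ℂ} (h : X.IsTranslationOn d W)
    {f : S → S} (hf : Continuous f) (hp : PullsBack X Y f) :
    Y.IsTranslationOn (f ∘ d) W := by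
  refine ⟨hf.comp_continuousOn h.1, fun z hz => ?_⟩
  obtain ⟨U, hU, hm, F, hF, he⟩ := h.2 z hz
  obtain ⟨V, hV, hm', G, hG⟩ := Y.exists_primitive (f (d z))
  have hc := (hp.isPrimitiveOn hf hG).sub_const hF (hV.preimage hf) hU (d z) ⟨hm', hm⟩
  refine ⟨V, hV, hm', _, hG.add_const (z - G (f (d z))), ?_⟩
  filter_upwards [he, (h.1 z hz).tendsto.eventually hc] with w h1 h2
  have h0 : F (d z) = z := he.self_of_nhdsWithin hz
  simp only [comp_apply] at h2 ⊢
  rw [h1, h0] at h2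
  linear_combination h2

lemma IsTranslationOn.neg {d : ℂ → S} {W : Set ℂ} (h : X.IsTranslationOn d W) :
    ((-1 : ℂˣ) • X).IsTranslationOn (fun z => d (-z)) {z | -z ∈ W} := by
  have hc : Continuous fun z : ℂ => -z := by fun_prop
  refine ⟨h.1.comp hc.continuousOn fun z hz => hz, fun z hz => ?_⟩
  obtain ⟨U, hU, hm, F, hF, he⟩ := h.2 (-z) hz
  refine ⟨U, hU, hm, _, hF.smul (-1), ?_⟩
  have h1 : Tendsto (fun z : ℂ => -z) (𝓝[{z | -z ∈ W}] z) (𝓝[W] (-z)) :=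
    hc.continuousWithinAt.tendsto_nhdsWithin fun z hz => hz
  filter_upwards [h1.eventually he] with w hw
  rw [hw]; simp

/-- Off the zeros of `ω` there are local translation maps. -/
lemma exists_translation (X : TranslationSurface o Z κ) {p : S} (hp : p ∉ Z) (z₀ : ℂ) :
    ∃ r > 0, ∃ d : ℂ → S, X.IsTranslationOn d (ball z₀ r) ∧ d z₀ = p ∧
      (∀ V ⊆ ball z₀ r, IsOpen V → IsOpen (d '' V)) ∧ ∀ z ∈ ball z₀ r, d z ∉ Z := by
  obtain ⟨U, hU, hm, F, hF⟩ := X.exists_primitive p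
  have hF' := hF.add_const (z₀ - F p)
  obtain ⟨e, hpe, heU, heF⟩ := hF'.exists_openPartialHomeomorph hU hm hp
  have hep : e p = z₀ := by rw [heF p hpe]; ring
  have hne : ∀ᶠ z in 𝓝 z₀, e.symm z ∉ Z := by
    have hsm : e.symm z₀ = p := by rw [← hep, e.left_inv hpe]
    have hdiff : ∀ q ∈ Z, ∀ᶠ z in 𝓝 z₀, z ∈ e.target → e.symm z ≠ q := by
      intro q hq
      by_cases hqs : q ∈ e.source
      · have : e q ≠ z₀ := by
          intro h
          rw [← hep] at h
          exact hp (e.injOn hqs hpe h ▸ hq)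
        filter_upwards [isOpen_ne.mem_nhds this.symm] with z hz hzt h
        exact hz (by rw [← h, e.right_inv hzt])
      · exact Eventually.of_forall fun z hz h => hqs (h ▸ e.map_target hz)
    have h2 := (eventually_all_finset Z).2 hdiff
    filter_upwards [h2, e.open_target.mem_nhds (hep ▸ e.map_source hpe)] with z hz hzt hmem
    exact hz _ hmem hzt rfl
  have ht := e.open_target.mem_nhds (hep ▸ e.map_source hpe : z₀ ∈ e.target)
  obtain ⟨r, hr, hball⟩ := eventually_nhds_iff_ball.1 (hne.and ht)
  have hsub : ball z₀ r ⊆ e.target := fun z hz => (hball z hz).2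
  refine ⟨r, hr, e.symm, ⟨e.continuousOn_symm.mono hsub, fun z hz => ?_⟩, by
    rw [← hep, e.left_inv hpe], ?_, fun z hz => (hball z hz).1⟩
  · refine ⟨U, hU, heU (e.map_target (hsub hz)), _, hF', ?_⟩
    filter_upwards [self_mem_nhdsWithin] with w hw
    have := heF _ (e.map_target (hsub hw))
    rw [e.right_inv (hsub hw)] at this
    exact this.symm
  · exact fun V hV hVo => e.symm.isOpen_image_of_subset_source hVo (hV.trans hsub)

end TranslationSurface

/-! ### Developments of faces -/

namespace Triangulation

variable {f : τ.Face} {D : Tri → ℂ}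

/-- The vertices of a developed face. -/
def verts (D : Tri → ℂ) (i : Fin 3) : ℂ := D (vtx i)

namespace IsDevelopment

lemma continuous (hD : τ.IsDevelopment X f D) : Continuous D :=
  hD.1.continuous (τ.char f).continuous

lemma area_ne_zero (hD : τ.IsDevelopment X f D) : area (verts D) ≠ 0 :=
  IsoDelaunay.area_ne_zero hD.2.1

lemma range_eq (hD : τ.IsDevelopment X f D) : range D = range (affTri (verts D)) := by
  rw [← convexHull_eq_range_affTri]; exact hD.2.2.2.1

lemma bary_nonneg (hD : τ.IsDevelopment X f D) (x : Tri) (i : Fin 3) :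
    0 ≤ bary (verts D) i (D x) := by
  have : D x ∈ range (affTri (verts D)) := hD.range_eq ▸ mem_range_self x
  rw [range_affTri hD.area_ne_zero] at this
  exact this i

lemma mem_range_iff (hD : τ.IsDevelopment X f D) {z : ℂ} :
    z ∈ range D ↔ ∀ i, 0 ≤ bary (verts D) i z := by
  rw [hD.range_eq, range_affTri hD.area_ne_zero]; rfl

lemma convex_range (hD : τ.IsDevelopment X f D) : Convex ℝ (range D) := by
  rw [hD.2.2.2.1]; exact convex_convexHull ℝ _

lemma bary_eq_zero_iff (hD : τ.IsDevelopment X f D) (x : Tri) (i : Fin 3) :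
    bary (verts D) i (D x) = 0 ↔ x.1 i = 0 := by
  have hseg := hD.2.2.2.2 i
  constructor
  · intro h
    have : D x ∈ range (affTri (verts D)) := hD.range_eq ▸ mem_range_self x
    obtain ⟨y, hy⟩ := this
    rw [← hy, bary_affTri hD.area_ne_zero] at h
    obtain ⟨s, rfl⟩ := exists_side h
    have h2 : D x ∈ segment ℝ (D (vtx (i + 1))) (D (vtx (i + 2))) := by
      rw [← hy, affTri_side, segment_eq_image']
      exact ⟨s, s.2, by simp [verts]⟩
    rw [← hseg] at h2
    obtain ⟨t, ht⟩ := h2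
    rw [← hD.2.2.1 ht, side_apply_self]
  · intro h
    obtain ⟨t, rfl⟩ := exists_side h
    have h2 : D (side i t) ∈ segment ℝ (D (vtx (i + 1))) (D (vtx (i + 2))) :=
      hseg ▸ mem_range_self t
    rw [segment_eq_image'] at h2
    obtain ⟨s, hs, hs'⟩ := h2
    have : D (side i t) = affTri (verts D) (side i ⟨s, hs⟩) := by
      rw [affTri_side, ← hs']; simp [verts]
    rw [this, bary_affTri hD.area_ne_zero, side_apply_self]

lemma bary_pos (hD : τ.IsDevelopment X f D) {x : Tri} {i : Fin 3} (h : 0 < x.1 i) :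
    0 < bary (verts D) i (D x) :=
  lt_of_le_of_ne (hD.bary_nonneg x i) fun h' => h.ne' ((hD.bary_eq_zero_iff x i).1 h'.symm)

lemma pos_of_bary (hD : τ.IsDevelopment X f D) {x : Tri} {i : Fin 3}
    (h : 0 < bary (verts D) i (D x)) : 0 < x.1 i :=
  lt_of_le_of_ne (x.nonneg i) fun h' => h.ne' ((hD.bary_eq_zero_iff x i).2 h'.symm)

lemma sub_eq (hD : τ.IsDevelopment X f D) {D' : Tri → ℂ} (hD' : τ.IsDevelopment X f D')
    (x y : Tri) : D x - D' x = D y - D' y :=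
  hD.1.sub_eq (τ.char f).continuous hD'.1 x y

end IsDevelopment

/-- The inverse of a development. -/
def devInv (τ : Triangulation Z) (f : τ.Face) (D : Tri → ℂ) : ℂ → S :=
  haveI : Nonempty Tri := ⟨vtx 0⟩
  fun z => τ.char f (Function.invFun D z)

lemma IsDevelopment.devInv_apply (hD : τ.IsDevelopment X f D) (x : Tri) :
    τ.devInv f D (D x) = τ.char f x := by
  have : Nonempty Tri := ⟨vtx 0⟩
  exact congrArg (τ.char f) (Function.leftInverse_invFun hD.2.2.1 x)

lemma IsDevelopment.isTranslationOn (hD : τ.IsDevelopment X f D) :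
    X.IsTranslationOn (τ.devInv f D) (range D) := by
  have hemb : IsClosedEmbedding D := hD.continuous.isClosedEmbedding hD.2.2.1
  have hn : ∀ x, 𝓝[range D] (D x) = map D (𝓝 x) := fun x => (hemb.isEmbedding.map_nhds_eq x).symm
  constructor
  · rintro _ ⟨x, rfl⟩
    rw [ContinuousWithinAt, hn, tendsto_map'_iff, hD.devInv_apply]
    have : τ.devInv f D ∘ D = τ.char f := funext hD.devInv_apply
    rw [this]
    exact (τ.char f).continuous.continuousAt
  · rintro _ ⟨x, rfl⟩
    obtain ⟨U, hU, hm, F, hF, he⟩ := hD.1 x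
    refine ⟨U, hU, by rwa [hD.devInv_apply], F, hF, ?_⟩
    rw [hn, eventually_map]
    filter_upwards [he] with y hy
    rw [hD.devInv_apply, hy]

lemma IsDevelopment.devInv_mem_iff (hD : τ.IsDevelopment X f D) {z : ℂ} (hz : z ∈ range D) :
    τ.devInv f D z ∈ Z ↔ ∃ i, z = verts D i := by
  obtain ⟨x, rfl⟩ := hz
  rw [hD.devInv_apply, τ.mem_iff]
  constructor
  · rintro ⟨i, rfl⟩; exact ⟨i, rfl⟩
  · rintro ⟨i, hi⟩; exact ⟨i, hD.2.2.1 hi⟩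

lemma IsDevelopment.eqOn [T2Space S] (hD : τ.IsDevelopment X f D) {d : ℂ → S} {K : Set ℂ}
    (hK : Convex ℝ K) (hd : X.IsTranslationOn d K) (hZ : ∀ z ∈ K, d z ∉ Z) {z₀ : ℂ}
    (hz₀ : z₀ ∈ K) {x : Tri} (hx : d z₀ = τ.char f x) {t : ℂ} (ht : t = z₀ - D x) {z : ℂ}
    (hz : z ∈ K) (hzr : z - t ∈ range D) : d z = τ.devInv f D (z - t) := by
  have h0 : z₀ - t = D x := by rw [ht, sub_sub_cancel]
  refine IsTranslationOn.eqOn (hK.inter (hD.convex_range.shift t)).isPreconnected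
    (hd.mono inter_subset_left) ((hD.isTranslationOn.shift t).mono inter_subset_right)
    (fun z hz => hZ z hz.1) ⟨hz₀, x, h0.symm⟩ ?_ ⟨hz, hzr⟩
  rw [hx, h0, hD.devInv_apply]

/-- The edge vectors of a face. -/
def edgePath (τ : Triangulation Z) (h : τ.Corner) : C(𝕀, S) :=
  (τ.char h.1).comp ⟨side h.2, continuous_side h.2⟩

/-- The periods of the edges. -/
def edgeVec (τ : Triangulation Z) (X : TranslationSurface o Z κ) (h : τ.Corner) : ℂ :=
  X.period (τ.edgePath h)

lemma edgePath_zero_mem (h : τ.Corner) : τ.edgePath h 0 ∈ Z := by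
  change τ.char h.1 (side h.2 0) ∈ Z
  rw [side_zero]; exact τ.char_vtx_mem _ _

lemma edgePath_one_mem (h : τ.Corner) : τ.edgePath h 1 ∈ Z := by
  change τ.char h.1 (side h.2 1) ∈ Z
  rw [side_one]; exact τ.char_vtx_mem _ _

lemma IsDevelopment.edgeVec_eq (hD : τ.IsDevelopment X f D) (i : Fin 3) :
    τ.edgeVec X (f, i) = verts D (i + 2) - verts D (i + 1) := by
  have : X.IsPrimitiveAlong (τ.edgePath (f, i)) (D ∘ side i) := hD.1.comp (continuous_side i)
  rw [edgeVec, period_eq this]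
  simp [side_zero, side_one, verts]

lemma edgeVec_opp (h : τ.Corner) : τ.edgeVec X (τ.opp h) = -τ.edgeVec X h := by
  obtain ⟨D, hD⟩ := X.exists_isPrimitiveAlong (τ.edgePath h).continuous
  have h2 : X.IsPrimitiveAlong (τ.edgePath (τ.opp h)) (D ∘ σ₀) := by
    have := hD.comp unitInterval.continuous_symm
    have e : (τ.edgePath h ∘ σ₀ : 𝕀 → S) = τ.edgePath (τ.opp h) := by
      funext t
      have := τ.glue h (σ₀ t)
      rw [unitInterval.symm_symm] at this
      exact this
    rwa [e] at this
  rw [edgeVec, edgeVec, period_eq hD, period_eq h2]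
  simp

lemma isCocycle_edgeVec (hg : τ.IsGeometric X) : τ.IsCocycle (τ.edgeVec X) := by
  refine ⟨edgeVec_opp, fun f => ?_⟩
  obtain ⟨D, hD⟩ := hg f
  rw [hD.edgeVec_eq, hD.edgeVec_eq, hD.edgeVec_eq]
  simp

/-- The developments of two adjacent faces differ by a translation along the common side. -/
lemma IsDevelopment.sub_side_eq {h : τ.Corner} {D' : Tri → ℂ}
    (hD : τ.IsDevelopment X h.1 D) (hD' : τ.IsDevelopment X (τ.opp h).1 D') (s t : 𝕀) :
    D (side h.2 s) - D' (side (τ.opp h).2 (σ₀ s)) =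
      D (side h.2 t) - D' (side (τ.opp h).2 (σ₀ t)) := by
  have h1 := hD.1.comp (continuous_side h.2)
  have h2 := hD'.1.comp ((continuous_side (τ.opp h).2).comp unitInterval.continuous_symm)
  have e : (τ.char h.1 ∘ side h.2 : 𝕀 → S) =
      τ.char (τ.opp h).1 ∘ (side (τ.opp h).2 ∘ σ₀) := funext (τ.glue h)
  rw [← e] at h2
  exact h1.sub_eq ((τ.char h.1).continuous.comp (continuous_side h.2)) h2 s t

lemma IsDevelopment.eventually_bary_pos (hD : τ.IsDevelopment X f D) {x : Tri} {z₀ t : ℂ}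
    (h : t = z₀ - D x) : ∀ᶠ z in 𝓝 z₀, ∀ k, 0 < x.1 k → 0 < bary (verts D) k (z - t) :=
  eventually_all.2 fun k => eventually_imp_distrib_left.2 fun hk =>
    ((continuous_bary _ k).comp (by fun_prop : Continuous fun z : ℂ => z - t)
      ).continuousAt.eventually_const_lt (by simpa [h] using hD.bary_pos hk)

/-- A translation map near a point of a face. -/
lemma IsDevelopment.eventually_mem [T2Space S] (hD : τ.IsDevelopment X f D) {d : ℂ → S}
    {W : Set ℂ} (hW : IsOpen W) (hd : X.IsTranslationOn d W) (hZ : ∀ z ∈ W, d z ∉ Z) {z₀ : ℂ}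
    (hz₀ : z₀ ∈ W) {x : Tri} (hx : d z₀ = τ.char f x) {t : ℂ} (ht : t = z₀ - D x) :
    ∀ᶠ z in 𝓝 z₀, (∀ k, x.1 k = 0 → 0 ≤ bary (verts D) k (z - t)) →
      z - t ∈ range D ∧ d z = τ.devInv f D (z - t) := by
  obtain ⟨r, hr, hball⟩ := Metric.isOpen_iff.1 hW z₀ hz₀
  filter_upwards [hD.eventually_bary_pos ht, ball_mem_nhds z₀ hr] with z h1 hz h2
  have hzr := hD.mem_range_iff.2 fun k => (x.nonneg k).eq_or_lt.elim (fun h => h2 k h.symm)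
    fun h => (h1 k h).le
  exact ⟨hzr, hD.eqOn (convex_ball z₀ r) (hd.mono hball) (fun w hw => hZ w (hball hw))
    (mem_ball_self hr) hx ht hz hzr⟩

/-- A translation map near an interior point of a face. -/
lemma IsDevelopment.eventually_interior [T2Space S] (hD : τ.IsDevelopment X f D) {d : ℂ → S}
    {W : Set ℂ} (hW : IsOpen W) (hd : X.IsTranslationOn d W) (hZ : ∀ z ∈ W, d z ∉ Z) {z₀ : ℂ}
    (hz₀ : z₀ ∈ W) {x : Tri} (hx : d z₀ = τ.char f x) (hpos : ∀ i, 0 < x.1 i) :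
    ∀ᶠ z in 𝓝 z₀, z - (z₀ - D x) ∈ range D ∧ d z = τ.devInv f D (z - (z₀ - D x)) :=
  (hD.eventually_mem hW hd hZ hz₀ hx rfl).mono fun _ h => h fun k hk => absurd hk (hpos k).ne'

lemma IsDevelopment.bary_side {h : τ.Corner} {D' : Tri → ℂ} (hD : τ.IsDevelopment X h.1 D)
    (hD' : τ.IsDevelopment X (τ.opp h).1 D') (s : 𝕀) (z : ℂ) :
    bary (verts D') (τ.opp h).2 (z - (D (side h.2 s) - D' (side (τ.opp h).2 (σ₀ s)))) =
      -(area (verts D) / area (verts D') * bary (verts D) h.2 z) := by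
  have h0 := hD.sub_side_eq hD' s 0
  have h1 := hD.sub_side_eq hD' s 1
  simp only [unitInterval.symm_zero, unitInterval.symm_one, side_zero, side_one] at h0 h1
  set t := D (side h.2 s) - D' (side (τ.opp h).2 (σ₀ s))
  have e0 : verts D' ((τ.opp h).2 + 2) = verts D (h.2 + 1) - t := by rw [h0]; simp [verts]
  have e1 : verts D' ((τ.opp h).2 + 1) = verts D (h.2 + 2) - t := by rw [h1]; simp [verts]
  have := hD.area_ne_zero
  rw [bary, bary, e0, e1]
  field_simp
  simp [cross]; ring

lemma IsDevelopment.area_div_pos [T2Space S] {h : τ.Corner} {D' : Tri → ℂ}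
    (hD : τ.IsDevelopment X h.1 D) (hD' : τ.IsDevelopment X (τ.opp h).1 D') :
    0 < area (verts D) / area (verts D') := by
  by_contra hneg
  have hlt := (not_lt.1 hneg).lt_of_ne (div_ne_zero hD.area_ne_zero hD'.area_ne_zero)
  obtain ⟨m, hm0, hm1⟩ := exists_between (zero_lt_one' 𝕀)
  set x := side h.2 m with hx
  set x' := side (τ.opp h).2 (σ₀ m) with hx'
  set t := D x - D' x' with ht
  have hx0 : ∀ k, k ≠ h.2 → 0 < x.1 k := fun k => side_apply_pos hm0 hm1
  have hx0' : ∀ k, k ≠ (τ.opp h).2 → 0 < x'.1 k := fun k =>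
    side_apply_pos (symm_pos hm1) (symm_lt_one hm0)
  have c3 : ∀ᶠ z in 𝓝 (D x), ∀ k, z ≠ verts D k := eventually_all.2 fun k =>
    isOpen_ne.mem_nhds fun hk => side_ne_vtx hm0 hm1 (hD.2.2.1 hk)
  obtain ⟨r, hr, hball⟩ := eventually_nhds_iff_ball.1 ((hD'.eventually_bary_pos ht).and c3)
  obtain ⟨y, hy, hyb⟩ := ((mem_closure_iff_frequently.1 (dense_interior x)).and_eventually
    (hD.continuous.continuousAt.eventually (ball_mem_nhds _ hr))).exists
  obtain ⟨y', hy'⟩ := (hD'.mem_range_iff (z := D y - t)).2 fun k => by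
    by_cases hk : k = (τ.opp h).2
    · rw [hk, hD.bary_side hD' m]
      nlinarith [hD.bary_pos (hy h.2)]
    · exact ((hball _ hyb).1 k (hx0' k hk)).le
  have heq := hD'.eqOn (d := τ.devInv h.1 D) (hD.convex_range.inter (convex_ball (D x) r))
    (hD.isTranslationOn.mono inter_subset_left) (fun w hw hmem => by
      obtain ⟨k, hk⟩ := (hD.devInv_mem_iff hw.1).1 hmem
      exact (hball w hw.2).2 k hk) ⟨mem_range_self x, mem_ball_self hr⟩
    (by rw [hD.devInv_apply, hx, τ.glue h m]) ht ⟨mem_range_self y, hyb⟩ ⟨y', hy'⟩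
  rw [← hy', hD'.devInv_apply, hD.devInv_apply] at heq
  obtain ⟨hfg, rfl⟩ := τ.face_inj _ _ y y' hy heq
  have hDD' : τ.IsDevelopment X h.1 D' := hfg ▸ hD'
  have h3 := hD.sub_eq hDD' y x'
  rw [hy', sub_sub_cancel, ht] at h3
  have hxx : x = x' := hD.2.2.1 (by linear_combination h3)
  refine τ.opp_ne h (Prod.ext hfg.symm (not_not.1 fun hij => ?_))
  have := hx0 _ hij
  rw [hxx, hx', side_apply_self] at this
  exact this.false

lemma IsDevelopment.eventually_edge [T2Space S] {h : τ.Corner} {D' : Tri → ℂ}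
    (hD : τ.IsDevelopment X h.1 D) (hD' : τ.IsDevelopment X (τ.opp h).1 D') {d : ℂ → S}
    {W : Set ℂ} (hW : IsOpen W) (hd : X.IsTranslationOn d W) (hZ : ∀ z ∈ W, d z ∉ Z) {z₀ : ℂ}
    (hz₀ : z₀ ∈ W) {s : 𝕀} (hs0 : 0 < s) (hs1 : s < 1)
    (hx : d z₀ = τ.char h.1 (side h.2 s)) {t t' : ℂ} (ht : t = z₀ - D (side h.2 s))
    (ht' : t' = z₀ - D' (side (τ.opp h).2 (σ₀ s))) :
    ∀ᶠ z in 𝓝 z₀, (0 ≤ bary (verts D) h.2 (z - t) →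
        z - t ∈ range D ∧ d z = τ.devInv h.1 D (z - t)) ∧
      (bary (verts D) h.2 (z - t) ≤ 0 →
        z - t' ∈ range D' ∧ d z = τ.devInv (τ.opp h).1 D' (z - t')) := by
  filter_upwards [hD.eventually_mem hW hd hZ hz₀ hx ht, hD'.eventually_mem hW hd hZ hz₀
    (hx.trans (τ.glue h s)) ht'] with z h1 h2
  refine ⟨fun h0 => h1 fun k hk => ?_, fun h0 => h2 fun k hk => ?_⟩
  · rwa [not_not.1 fun h => (side_apply_pos hs0 hs1 h).ne' hk]
  · have hb := hD.bary_side hD' s (z - t)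
    have e : z - t - (D (side h.2 s) - D' (side (τ.opp h).2 (σ₀ s))) = z - t' := by rw [ht, ht']; ring
    rw [e] at hb
    rw [not_not.1 fun h => (side_apply_pos (symm_pos hs1) (symm_lt_one hs0) h).ne' hk, hb]
    nlinarith [hD.area_div_pos hD']

end Triangulation

/-! ### Connectivity of the dual graph -/

namespace Triangulation

/-- Small punctured neighbourhoods of a point are connected. -/
lemma exists_punctured_nhd [T2Space S] (o : SurfaceOrientation S) (p : S) {V : Set S}
    (hV : V ∈ 𝓝 p) : ∃ N, IsOpen N ∧ p ∈ N ∧ N ⊆ V ∧ IsPreconnected (N \ {p}) := by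
  obtain ⟨φ, -, hp⟩ := o.cover p
  have h1 : ∀ᶠ z in 𝓝 (φ p), z ∈ φ.target ∧ φ.symm z ∈ V := by
    have := φ.continuousAt_symm (φ.map_source hp)
    rw [ContinuousAt, φ.left_inv hp] at this
    exact inter_mem (φ.open_target.mem_nhds (φ.map_source hp)) (this hV)
  obtain ⟨r, hr, hball⟩ := eventually_nhds_iff_ball.1 h1
  have hs : ball (φ p) r ⊆ φ.symm.source := fun z hz => (hball z hz).1
  set u := OpenPartialHomeomorph.univBall (φ p) r
  have hu : u '' univ = ball (φ p) r := by
    rw [← OpenPartialHomeomorph.univBall_target _ hr, ← u.image_source_eq_target,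
      OpenPartialHomeomorph.univBall_source]
  have h0 : u 0 = φ p := OpenPartialHomeomorph.univBall_apply_zero _ _
  have hui : InjOn u univ := OpenPartialHomeomorph.univBall_source (φ p) r ▸ u.injOn
  refine ⟨φ.symm '' ball (φ p) r, φ.symm.isOpen_image_of_subset_source isOpen_ball hs,
    ⟨φ p, mem_ball_self hr, φ.left_inv hp⟩, ?_, ?_⟩
  · rintro _ ⟨z, hz, rfl⟩; exact (hball z hz).2
  · have : φ.symm '' ball (φ p) r \ {p} = φ.symm '' (u '' {0}ᶜ) := by
      rw [compl_eq_univ_sdiff, hui.image_sdiff_subset (subset_univ _), hu, image_singleton, h0,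
        (φ.symm.injOn.mono hs).image_sdiff_subset (by simpa using hr), image_singleton,
        φ.left_inv hp]
    rw [this]
    exact ((isConnected_compl_singleton_of_one_lt_rank (by simp [Complex.rank_real_complex])
      0).isPreconnected.image _ (OpenPartialHomeomorph.continuous_univBall _ _).continuousOn).image _
      (φ.continuousOn_symm.mono ((image_mono (subset_univ _)).trans (hu.trans_subset hs)))

/-- Two closed unions of corners that meet only in `p` cannot both be present at `p`. -/
lemma subset_of_punctured [T2Space S] (o : SurfaceOrientation S) {p : S} {A B : Set S}
    (hA : IsClosed A) (hB : IsClosed B) (hcov : ∀ᶠ q in 𝓝 p, q ∈ A ∪ B)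
    (hne : ∀ᶠ q in 𝓝[≠] p, q ∉ A ∩ B) (hpA : ∃ᶠ q in 𝓝[≠] p, q ∈ A) :
    ∀ᶠ q in 𝓝[≠] p, q ∈ A ∧ q ∉ B := by
  have hne' := eventually_nhdsWithin_iff.1 hne
  obtain ⟨N, hN, hpN, hNV, hconn⟩ := exists_punctured_nhd o p (hcov.and hne')
  have hsub : N \ {p} ⊆ A ∪ B := fun q hq => (hNV hq.1).1
  have hdisj : ¬ ((N \ {p}) ∩ (A ∩ B)).Nonempty := by
    rintro ⟨q, hq, hAB⟩
    exact (hNV hq.1).2 hq.2 hAB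
  have hnm : N \ {p} ∈ 𝓝[≠] p := by
    rw [sdiff_eq, inter_comm]
    exact inter_mem_nhdsWithin _ (hN.mem_nhds hpN)
  have hnB : ¬ ((N \ {p}) ∩ B).Nonempty := by
    intro hne
    refine hdisj (isPreconnected_closed_iff.1 hconn A B hA hB hsub ?_ hne)
    obtain ⟨q, hq, hq'⟩ := (hpA.and_eventually hnm).exists
    exact ⟨q, hq', hq⟩
  filter_upwards [hnm] with q hq
  have hqB : q ∉ B := fun h => hnB ⟨q, hq, h⟩
  exact ⟨(hsub hq).resolve_right hqB, hqB⟩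

lemma frequently_char_ne (f : τ.Face) (i : Fin 3) :
    ∃ᶠ q in 𝓝[≠] (τ.char f (vtx i)), q ∈ τ.char f '' {x | 0 < x.1 i ∧ x ≠ vtx i} := by
  have h1 : Tendsto (fun t : 𝕀 => τ.char f (side (i + 1) t)) (𝓝[<] 1)
      (𝓝[≠] (τ.char f (vtx i))) := by
    refine tendsto_nhdsWithin_iff.2 ⟨?_, ?_⟩
    · have : Continuous fun t : 𝕀 => τ.char f (side (i + 1) t) :=
        (τ.char f).continuous.comp (continuous_side _)
      have h2 := this.tendsto 1
      rw [side_one, fin3_add_one_add_two] at h2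
      exact h2.mono_left nhdsWithin_le_nhds
    · have hpos : ∀ᶠ t : 𝕀 in 𝓝[<] 1, 0 < t := nhdsWithin_le_nhds (Ioi_mem_nhds one_pos)
      filter_upwards [self_mem_nhdsWithin, hpos] with t ht ht0 h
      have hm := τ.char_vtx_mem f i
      rw [← (mem_singleton_iff.1 h), τ.mem_iff] at hm
      obtain ⟨j, hj⟩ := hm
      exact side_ne_vtx ht0 ht hj
  have : (𝓝[<] (1 : 𝕀)).NeBot := by
    refine mem_closure_iff_nhdsWithin_neBot.1 ?_
    rw [closure_Iio' ⟨0, one_pos⟩]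
    exact le_refl (1 : 𝕀)
  refine h1.frequently (Eventually.frequently ?_)
  have hpos : ∀ᶠ t : 𝕀 in 𝓝[<] 1, 0 < t := nhdsWithin_le_nhds (Ioi_mem_nhds one_pos)
  filter_upwards [self_mem_nhdsWithin, hpos] with t ht ht0
  refine ⟨_, ⟨?_, side_ne_vtx ht0 ht⟩, rfl⟩
  have := side_apply_add_two (i + 1) t
  rw [fin3_add_one_add_two] at this
  rw [this]; exact ht0

/-- A function on the faces that agrees on adjacent faces is constant. -/
lemma eq_of_adjacent [T2Space S] [ConnectedSpace S] (o : SurfaceOrientation S)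
    (τ : Triangulation Z) {A : Type*} (c : τ.Face → A)
    (hc : ∀ h, c (τ.opp h).1 = c h.1) (f g : τ.Face) : c f = c g := by
  let U : Set S := ⋃ k : {k // c k = c f}, range (τ.char k.1)
  let V : Set S := ⋃ k : {k // c k ≠ c f}, range (τ.char k.1)
  have hclosed : ∀ k, IsClosed (range (τ.char k)) := fun k =>
    (isCompact_range (τ.char k).continuous).isClosed
  have hU : IsClosed U := isClosed_iUnion_of_finite fun k => hclosed k
  have hV : IsClosed V := isClosed_iUnion_of_finite fun k => hclosed k
  have hcov : U ∪ V = univ := by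
    refine eq_univ_of_forall fun q => ?_
    obtain ⟨k, x, rfl⟩ := τ.cover q
    by_cases hk : c k = c f
    · exact Or.inl (mem_iUnion.2 ⟨⟨k, hk⟩, mem_range_self x⟩)
    · exact Or.inr (mem_iUnion.2 ⟨⟨k, hk⟩, mem_range_self x⟩)
  have hUV : ∀ q ∈ U ∩ V, q ∈ Z := by
    rintro q ⟨hq, hq'⟩
    obtain ⟨⟨k, hk⟩, x, rfl⟩ := mem_iUnion.1 hq
    obtain ⟨⟨l, hl⟩, y, hy⟩ := mem_iUnion.1 hq'
    dsimp only at hy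
    rcases τ.char_eq_cases hy.symm with ⟨h1, -⟩ | ⟨m, s, -, -, h1, -, h2, -⟩ | ⟨i, j, h1, -⟩
    · exact absurd (h1 ▸ hk) hl
    · exact absurd (by rw [h2, hc, ← h1, hk]) hl
    · change τ.char k x ∈ Z
      rw [h1]; exact τ.char_vtx_mem _ _
  have hUo : IsOpen U := by
    rw [isOpen_iff_mem_nhds]
    intro p hp
    by_cases hpZ : p ∈ Z
    · have hZev : ∀ᶠ q in 𝓝[≠] p, q ∉ Z := by
        have hfin : ((Z : Set S) \ {p}).Finite := Z.finite_toSet.sdiff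
        have : ∀ᶠ q in 𝓝 p, q ∉ ((Z : Set S) \ {p}) := hfin.isClosed.isOpen_compl.mem_nhds (by simp)
        filter_upwards [nhdsWithin_le_nhds this, self_mem_nhdsWithin] with q h1 h2 h3
        exact h1 ⟨h3, h2⟩
      have hfreq : ∃ᶠ q in 𝓝[≠] p, q ∈ U := by
        obtain ⟨⟨k, hk⟩, x, rfl⟩ := mem_iUnion.1 hp
        obtain ⟨i, rfl⟩ := (τ.mem_iff k x).1 hpZ
        refine (frequently_char_ne k i).mono ?_
        rintro q ⟨y, -, rfl⟩
        exact mem_iUnion.2 ⟨⟨k, hk⟩, mem_range_self y⟩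
      have := subset_of_punctured o hU hV (by simp [hcov])
        (hZev.mono fun q hq hq' => hq (hUV q hq')) hfreq
      have h2 := eventually_nhdsWithin_iff.1 this
      filter_upwards [h2] with q hq
      by_cases hqp : q = p
      · rw [hqp]; exact hp
      · exact (hq hqp).1
    · have : p ∈ Vᶜ := fun h => hpZ (hUV p ⟨hp, h⟩)
      filter_upwards [hV.isOpen_compl.mem_nhds this] with q hq
      have : q ∈ U ∪ V := hcov ▸ mem_univ q
      exact this.resolve_right hq
  have huniv : U = univ := IsClopen.eq_univ ⟨hU, hUo⟩
    ⟨τ.char f (vtx 0), mem_iUnion.2 ⟨⟨f, rfl⟩, mem_range_self _⟩⟩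
  by_contra hne
  obtain ⟨b, hb⟩ := dense_interior.nonempty
  have hq : τ.char g b ∈ U := huniv ▸ mem_univ _
  obtain ⟨⟨k, hk⟩, x, hx⟩ := mem_iUnion.1 hq
  have := τ.face_inj g k b x hb hx.symm
  exact hne (by rw [this.1, hk])

/-- The developed faces are coherently oriented. -/
lemma exists_sign [T2Space S] [ConnectedSpace S] (hg : τ.IsGeometric X) :
    ∃ ε : ℝ, (ε = 1 ∨ ε = -1) ∧ ∀ f D, τ.IsDevelopment X f D → 0 < ε * area (verts D) := by
  choose D hD using hg
  have hsame : ∀ f D', τ.IsDevelopment X f D' → area (verts D') = area (verts (D f)) := by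
    intro f D' hD'
    have h := fun i => sub_eq_sub_iff_sub_eq_sub.1 (hD'.sub_eq (hD f) (vtx i) (vtx 0))
    simp only [area, verts, h]
  by_cases hne : Nonempty τ.Face
  swap
  · exact ⟨1, Or.inl rfl, fun f => absurd ⟨f⟩ hne⟩
  obtain ⟨f₀⟩ := hne
  have hall : ∀ f, (0 < area (verts (D f))) = (0 < area (verts (D f₀))) := by
    intro f
    refine eq_of_adjacent o τ (fun f => 0 < area (verts (D f))) (fun h => ?_) f f₀
    have := (hD h.1).area_div_pos (hD (τ.opp h).1)
    rw [div_eq_mul_inv] at this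
    exact propext (inv_pos.symm.trans (pos_iff_pos_of_mul_pos this).symm)
  by_cases hpos : 0 < area (verts (D f₀))
  · refine ⟨1, Or.inl rfl, fun f D' hD' => ?_⟩
    rw [one_mul, hsame f D' hD', hall]; exact hpos
  · refine ⟨-1, Or.inr rfl, fun f D' hD' => ?_⟩
    have h2 := (not_lt.1 (hall f ▸ hpos)).lt_of_ne (hD f).area_ne_zero
    rw [hsame f D' hD']; linarith

end Triangulation

/-! ### Circles and triangles -/

lemma mem_ball_iff_normSq {c z : ℂ} {r : ℝ} (hr : 0 < r) :
    z ∈ ball c r ↔ normSq (z - c) < r ^ 2 := by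
  rw [mem_ball, dist_eq_norm, normSq_eq_norm_sq, sq_lt_sq₀ (norm_nonneg _) hr.le]

lemma mem_closedBall_iff_normSq {c z : ℂ} {r : ℝ} (hr : 0 < r) :
    z ∈ closedBall c r ↔ normSq (z - c) ≤ r ^ 2 := by
  rw [mem_closedBall, dist_eq_norm, normSq_eq_norm_sq, sq_le_sq₀ (norm_nonneg _) hr.le]

lemma normSq_affTri (P : Fin 3 → ℂ) (x : Tri) (c : ℂ) :
    normSq (affTri P x - c) = ∑ i, x.1 i * normSq (P i - c) -
      ∑ i, x.1 (i + 1) * x.1 (i + 2) * normSq (P (i + 2) - P (i + 1)) := by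
  have h0 : x.1 0 = 1 - x.1 1 - x.1 2 := by
    have : x.1 0 + x.1 1 + x.1 2 = 1 := x.sum_eq 0
    linarith
  simp [affTri, Fin.sum_univ_three, normSq_apply, h0]
  ring

lemma affTri_mem_ball {P : Fin 3 → ℂ} (hP : Injective P) {c : ℂ} {r : ℝ} (hr : 0 < r)
    (hc : ∀ i, normSq (P i - c) = r ^ 2) {x : Tri} (hx : ∀ i, x ≠ vtx i) :
    affTri P x ∈ ball c r := by
  rw [mem_ball_iff_normSq hr, normSq_affTri]
  have h1 : ∑ i, x.1 i * normSq (P i - c) = r ^ 2 := by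
    simp only [hc]
    rw [← Finset.sum_mul, x.2.2, one_mul]
  rw [h1]
  have hnn : ∀ i ∈ Finset.univ, 0 ≤ x.1 (i + 1) * x.1 (i + 2) *
      normSq (P (i + 2) - P (i + 1)) := fun i _ =>
    mul_nonneg (mul_nonneg (x.nonneg _) (x.nonneg _)) (Complex.normSq_nonneg _)
  have hpos : 0 < ∑ i, x.1 (i + 1) * x.1 (i + 2) * normSq (P (i + 2) - P (i + 1)) := by
    refine Finset.sum_pos' hnn ?_
    have hd : ∀ i, 0 < normSq (P (i + 2) - P (i + 1)) := fun i =>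
      normSq_pos.2 (sub_ne_zero.2 fun h => fin3_add_two_ne_add_one i (hP h))
    rcases x.cases with h | ⟨i, s, h0, hs1, rfl⟩ | ⟨i, hi⟩
    · exact ⟨0, Finset.mem_univ _, mul_pos (mul_pos (h _) (h _)) (hd _)⟩
    · refine ⟨i, Finset.mem_univ _, mul_pos (mul_pos ?_ ?_) (hd _)⟩
      · rw [side_apply_add_one]; have : (s : ℝ) < 1 := hs1; linarith
      · rw [side_apply_add_two]; exact h0
    · exact absurd hi (hx i)
  linarith

lemma convex_neighbor_mem_ball {c z w : ℂ} {r s : ℝ} (hz : z ∈ ball c r)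
    (hw : w ∈ closedBall c r) (hs0 : 0 < s) (hs1 : s ≤ 1) :
    w + s * (z - w) ∈ ball c r := by
  rw [mem_ball, dist_eq_norm] at *
  rw [mem_closedBall, dist_eq_norm] at hw
  have : w + s * (z - w) - c = ((1 - s : ℝ) : ℂ) * (w - c) + (s : ℂ) * (z - c) := by push_cast; ring
  rw [this]
  refine (norm_add_le _ _).trans_lt ?_
  rw [norm_mul, norm_mul, norm_real, norm_real, Real.norm_eq_abs, Real.norm_eq_abs,
    abs_of_nonneg (by linarith), abs_of_pos hs0]
  nlinarith

lemma eq_of_eqOn_segment {A : Type*} [TopologicalSpace A] [T2Space A] {d e : ℂ → A} {K : Set ℂ}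
    {z q : ℂ} (hd : ContinuousWithinAt d K z) (he : ContinuousWithinAt e K z)
    (h : ∀ s : ℝ, 0 < s → s ≤ 1 → z + s * (q - z) ∈ K ∧ d (z + s * (q - z)) = e (z + s * (q - z))) :
    d z = e z := by
  have hs : ∀ᶠ s : ℝ in 𝓝[>] 0, z + s * (q - z) ∈ K ∧ d (z + s * (q - z)) = e (z + s * (q - z)) := by
    filter_upwards [self_mem_nhdsWithin, nhdsWithin_le_nhds (Iic_mem_nhds one_pos)] with s
    exact h s
  have hl : Tendsto (fun s : ℝ => z + s * (q - z)) (𝓝[>] 0) (𝓝[K] z) := by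
    refine tendsto_nhdsWithin_iff.2 ⟨?_, hs.mono fun _ h => h.1⟩
    exact ((by fun_prop : Continuous fun s : ℝ => z + s * (q - z)).tendsto' 0 z
      (by simp)).mono_left nhdsWithin_le_nhds
  exact tendsto_nhds_unique_of_eventuallyEq (hd.tendsto.comp hl) (he.tendsto.comp hl)
    (hs.mono fun _ h => h.2)

/-- An affine real function on the plane that vanishes at the vertices of a triangle vanishes. -/
lemma circle_unique {P : Fin 3 → ℂ} (hP : area P ≠ 0) {c c' : ℂ} {r r' : ℝ} (hr : 0 < r)
    (hr' : 0 < r') (h : ∀ i, normSq (P i - c) = r ^ 2)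
    (h' : ∀ i, normSq (P i - c') = r' ^ 2) : c = c' ∧ r = r' := by
  have e : ∀ i, normSq (P i - c) - normSq (P i - c') = r ^ 2 - r' ^ 2 := fun i => by rw [h, h']
  simp only [normSq_apply, sub_re, sub_im] at e
  have e0 := e 0
  have e1 := e 1
  have e2 := e 2
  simp only [area, cross, sub_re, sub_im] at hP
  have k1 : (c.re - c'.re) * ((P 1).re - (P 0).re) + (c.im - c'.im) * ((P 1).im - (P 0).im) = 0 := by
    linear_combination (e0 - e1) / 2
  have k2 : (c.re - c'.re) * ((P 2).re - (P 0).re) + (c.im - c'.im) * ((P 2).im - (P 0).im) = 0 := by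
    linear_combination (e0 - e2) / 2
  have hre : c.re - c'.re = 0 := by
    refine (mul_eq_zero.1 ?_).resolve_right hP
    linear_combination ((P 2).im - (P 0).im) * k1 - ((P 1).im - (P 0).im) * k2
  have him : c.im - c'.im = 0 := by
    refine (mul_eq_zero.1 ?_).resolve_right hP
    linear_combination ((P 1).re - (P 0).re) * k2 - ((P 2).re - (P 0).re) * k1
  have hcc : c = c' := Complex.ext (by linarith) (by linarith)
  refine ⟨hcc, ?_⟩
  have := h 0
  rw [hcc, h' 0] at this
  nlinarith

/-! ### Immersed empty disks -/

section Disks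

/-- An immersed empty disk that preserves directions. -/
structure IsEmptyDisk (X : TranslationSurface o Z κ) (c : ℂ) (r : ℝ) (d : ℂ → S) : Prop where
  pos : 0 < r
  continuousOn : ContinuousOn d (closedBall c r)
  empty : ∀ z ∈ ball c r, d z ∉ Z
  translation : X.IsTranslationOn d (ball c r)

/-- Isometries of a plane disk into the plane. -/
lemma exists_linear_of_dist_eq {G : ℂ → ℂ} {z : ℂ} {ρ : ℝ} (hρ : 0 < ρ)
    (hG : ∀ w ∈ ball z ρ, ∀ w' ∈ ball z ρ, dist (G w) (G w') = dist w w') :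
    ∃ L : ℂ ≃ₗᵢ[ℝ] ℂ, ∀ w ∈ ball z ρ, G w = G z + L (w - z) := by
  have hz := mem_ball_self (x := z) hρ
  have hi : ∀ w ∈ ball z ρ, ∀ w' ∈ ball z ρ,
      inner ℝ (G w - G z) (G w' - G z) = inner ℝ (w - z) (w' - z) := fun w hw w' hw' => by
    simp only [real_inner_eq_norm_mul_self_add_norm_mul_self_sub_norm_sub_mul_self_div_two,
      sub_sub_sub_cancel_right, ← dist_eq_norm, hG _ hw _ hz, hG _ hw' _ hz, hG _ hw _ hw']
  obtain ⟨k, hk, hkρ⟩ := exists_between hρ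
  have hk0 := hk.ne'
  have hw1 : z + k ∈ ball z ρ := by simpa [abs_of_pos hk]
  have hw2 : z + k * I ∈ ball z ρ := by simpa [abs_of_pos hk]
  set a := k⁻¹ • (G (z + k) - G z) with ha
  set b := k⁻¹ • (G (z + k * I) - G z) with hb
  have hwa : ∀ w ∈ ball z ρ, inner ℝ (G w - G z) a = (w - z).re := fun w hw => by
    rw [ha, real_inner_smul_right, hi w hw _ hw1]
    simp [Complex.inner]; field_simp
  have hwb : ∀ w ∈ ball z ρ, inner ℝ (G w - G z) b = (w - z).im := fun w hw => by
    rw [hb, real_inner_smul_right, hi w hw _ hw2]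
    simp [Complex.inner]; field_simp; ring
  have haa : inner ℝ a a = (1 : ℝ) := by
    conv_lhs => rw [ha, real_inner_smul_left, hwa _ hw1]
    simp [hk0]
  have hba : inner ℝ b a = (0 : ℝ) := by
    rw [hb, real_inner_smul_left, hwa _ hw2]
    simp
  have hbb : inner ℝ b b = (1 : ℝ) := by
    conv_lhs => rw [hb, real_inner_smul_left, hwb _ hw2]
    simp [hk0]
  have hab : inner ℝ a b = (0 : ℝ) := by rw [real_inner_comm, hba]
  have hn : ∀ u : ℂ, ‖u.re • a + u.im • b‖ ^ 2 = ‖u‖ ^ 2 := fun u => by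
    rw [← real_inner_self_eq_norm_sq, ← normSq_eq_norm_sq, normSq_apply]
    simp only [inner_add_left, inner_add_right, real_inner_smul_left, real_inner_smul_right, haa,
      hba, hab, hbb]
    ring
  let L : ℂ →ₗᵢ[ℝ] ℂ := ⟨Complex.reLm.smulRight a + Complex.imLm.smulRight b, fun u =>
    (sq_eq_sq₀ (norm_nonneg _) (norm_nonneg _)).1 (hn u)⟩
  refine ⟨L.toLinearIsometryEquiv rfl, fun w hw => ?_⟩
  change G w = G z + ((w - z).re • a + (w - z).im • b)
  rw [← sub_eq_iff_eq_add', ← sub_eq_zero, ← norm_eq_zero, ← sq_eq_zero_iff, norm_sub_sq_real, hn,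
    inner_add_right, real_inner_smul_right _ a, real_inner_smul_right _ b, hwa w hw, hwb w hw,
    ← dist_eq_norm, ← dist_eq_norm, hG w hw z hz, dist_eq_norm, ← normSq_eq_norm_sq, normSq_apply]
  ring

lemma IsImmersedEmptyDisk.exists_linear {c : ℂ} {r : ℝ} {d : ℂ → S}
    (h : IsImmersedEmptyDisk X c r d) : ∃ L : ℂ ≃ₗᵢ[ℝ] ℂ, ∀ z ∈ ball c r,
      ∃ U : Set S, IsOpen U ∧ d z ∈ U ∧ ∃ F : S → ℂ, X.IsPrimitiveOn F U ∧
        ∀ᶠ w in 𝓝 z, F (d w) = F (d z) + L (w - z) := by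
  let Q : (ℂ ≃ₗᵢ[ℝ] ℂ) → ℂ → Prop := fun L z => ∃ U : Set S, IsOpen U ∧ d z ∈ U ∧ ∃ F : S → ℂ,
    X.IsPrimitiveOn F U ∧ ∀ᶠ w in 𝓝 z, F (d w) = F (d z) + L (w - z)
  have hdc : ∀ z ∈ ball c r, ContinuousAt d z := fun z hz =>
    h.continuousOn.continuousAt (mem_of_superset (isOpen_ball.mem_nhds hz) ball_subset_closedBall)
  have hex : ∀ z ∈ ball c r, ∃ L, Q L z := fun z hz => by
    obtain ⟨U, hU, F, hF, W, hW, hmaps, hdist⟩ := h.isometric z hz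
    obtain ⟨ρ, hρ, hball⟩ := Metric.mem_nhds_iff.1 hW
    obtain ⟨L, hG⟩ := exists_linear_of_dist_eq (G := fun w => F (d w)) hρ
      fun w hw w' hw' => hdist w (hball hw) w' (hball hw')
    exact ⟨L, U, hU, hmaps (mem_of_mem_nhds hW), F, hF, mem_of_superset (ball_mem_nhds z hρ) hG⟩
  have hopen : ∀ z ∈ ball c r, ∀ L, Q L z → ∀ᶠ z' in 𝓝 z, Q L z' := by
    rintro z hz L ⟨U, hU, hzU, F, hF, hev⟩
    filter_upwards [hev.eventually_nhds, (hdc z hz).eventually_mem (hU.mem_nhds hzU)] with z' h1 h2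
    refine ⟨U, hU, h2, F, hF, h1.mono fun w hw => ?_⟩
    rw [hw, h1.self_of_nhds, add_assoc, ← map_add, sub_add_sub_cancel']
  have huniq : ∀ z ∈ ball c r, ∀ L L', Q L z → Q L' z → L = L' := by
    rintro z hz L L' ⟨U, hU, hzU, F, hF, hev⟩ ⟨U', hU', hzU', F', hF', hev'⟩
    have hall : ∀ᶠ w in 𝓝 z, L (w - z) = L' (w - z) := by
      filter_upwards [hev, hev', (hdc z hz).eventually
        (hF.sub_const hF' hU hU' (d z) ⟨hzU, hzU'⟩)] with w h1 h2 h3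
      rw [h1, h2] at h3
      linear_combination h3
    refine LinearIsometryEquiv.ext fun u => ?_
    have ht := ((by fun_prop : Continuous fun s : ℝ => z + s • u).tendsto' 0 z
      (by simp)).mono_left (nhdsWithin_le_nhds (s := {0}ᶜ))
    obtain ⟨s, h1, h2⟩ := ((ht.eventually hall).and self_mem_nhdsWithin).exists
    rw [add_sub_cancel_left, map_smul, map_smul] at h1
    exact smul_right_injective ℂ h2 h1
  have hcc := mem_ball_self (x := c) h.pos
  obtain ⟨L, hL⟩ := hex c hcc
  refine ⟨L, (convex_ball c r).isPreconnected.forall_of_clopen hcc hL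
    (fun z hz hQ => nhdsWithin_le_nhds (hopen z hz L hQ)) fun z hz hfr => ?_⟩
  obtain ⟨L', hL'⟩ := hex z hz
  obtain ⟨w, ⟨h1, h2⟩, h3⟩ := ((hfr.and_eventually self_mem_nhdsWithin).and_eventually
    (nhdsWithin_le_nhds (hopen z hz L' hL'))).exists
  rwa [huniq w h2 L L' h1 h3]

/-- After an isometry of the plane, an immersed empty disk preserves directions. -/
lemma IsImmersedEmptyDisk.exists_isEmptyDisk {c : ℂ} {r : ℝ} {d : ℂ → S}
    (h : IsImmersedEmptyDisk X c r d) : ∃ L : ℂ ≃ₗᵢ[ℝ] ℂ, IsEmptyDisk X (L c) r (d ∘ L.symm) := by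
  obtain ⟨L, hQ⟩ := h.exists_linear
  have hball : ∀ z ∈ ball (L c) r, L.symm z ∈ ball c r := fun z hz => by
    rwa [mem_ball, ← L.dist_map, L.apply_symm_apply]
  have hcont : ContinuousOn (d ∘ L.symm) (closedBall (L c) r) :=
    h.continuousOn.comp L.symm.continuous.continuousOn fun z hz => by
      rwa [mem_closedBall, ← L.dist_map, L.apply_symm_apply]
  refine ⟨L, h.pos, hcont, fun z hz => h.empty _ (hball z hz), hcont.mono ball_subset_closedBall,
    fun z hz => ?_⟩
  obtain ⟨U, hU, hzU, F, hF, hev⟩ := hQ _ (hball z hz)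
  refine ⟨U, hU, hzU, _, hF.add_const (z - F (d (L.symm z))), nhdsWithin_le_nhds ?_⟩
  filter_upwards [L.symm.continuous.continuousAt.eventually hev] with w hw
  rw [comp_apply, hw, map_sub, L.apply_symm_apply, L.apply_symm_apply]
  ring

end Disks

namespace Triangulation

variable {f g : τ.Face} {D D' : Tri → ℂ}

/-- The circumscribed empty disk of a developed face. -/
structure IsFaceDisk (τ : Triangulation Z) (X : TranslationSurface o Z κ) (f : τ.Face)
    (D : Tri → ℂ) (c : ℂ) (r : ℝ) (d : ℂ → S) : Prop extends IsEmptyDisk X c r d where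
  circle : ∀ i, normSq (verts D i - c) = r ^ 2
  char_eq : ∀ x, d (D x) = τ.char f x
  mem_iff : ∀ z ∈ closedBall c r, d z ∈ Z ↔ ∃ i, z = verts D i

lemma IsDevelopment.verts_injective (hD : τ.IsDevelopment X f D) :
    Injective (verts D) := fun _ _ h => vtx_injective (hD.2.2.1 h)

lemma IsDevelopment.opp_fst_ne (hD : τ.IsDevelopment X f D) (i : Fin 3) : (τ.opp (f, i)).1 ≠ f := by
  intro h
  obtain ⟨j, hj⟩ : ∃ j, τ.opp (f, i) = (f, j) := ⟨(τ.opp (f, i)).2, Prod.ext h rfl⟩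
  have h1 := edgeVec_opp (X := X) (f, i)
  rw [hj, hD.edgeVec_eq, hD.edgeVec_eq] at h1
  have hij : j ≠ i := by
    rintro rfl
    exact τ.opp_ne _ hj
  have ha := hD.area_ne_zero
  rcases fin3_cases i j with rfl | rfl | rfl
  · exact hij rfl
  · rw [area_eq _ i] at ha
    rw [fin3_add_one_add_one, fin3_add_one_add_two] at h1
    apply ha
    have : verts D i - verts D (i + 1) = 0 := by linear_combination h1
    rw [this]; simp [cross]
  · rw [fin3_add_two_add_one, fin3_add_two_add_two] at h1
    have : verts D (i + 2) = verts D i := by linear_combination h1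
    exact fin3_ne_add_two i (hD.verts_injective this).symm

lemma isClosed_range_dev (hD : τ.IsDevelopment X f D) : IsClosed (range D) :=
  (isCompact_range hD.continuous).isClosed

lemma IsDevelopment.mem_ball (hD : τ.IsDevelopment X f D) {c : ℂ} {r : ℝ} (hr : 0 < r)
    (hc : ∀ i, normSq (verts D i - c) = r ^ 2) {x : Tri} (hx : ∀ i, x ≠ vtx i) :
    D x ∈ ball c r := by
  have : D x ∈ range (affTri (verts D)) := hD.range_eq ▸ mem_range_self x
  obtain ⟨y, hy⟩ := this
  rw [← hy]
  refine affTri_mem_ball hD.verts_injective hr hc ?_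
  rintro i rfl
  rw [affTri_vtx] at hy
  exact hx i (hD.2.2.1 hy).symm

lemma IsDevelopment.mem_closedBall (hD : τ.IsDevelopment X f D) {c : ℂ} {r : ℝ} (hr : 0 < r)
    (hc : ∀ i, normSq (verts D i - c) = r ^ 2) (x : Tri) :
    D x ∈ closedBall c r := by
  by_cases hx : ∃ i, x = vtx i
  · obtain ⟨i, rfl⟩ := hx
    rw [mem_closedBall_iff_normSq hr]
    exact (hc i).le
  · push Not at hx
    exact ball_subset_closedBall (hD.mem_ball hr hc hx)

/-- The face is carried into the developed triangle by an empty disk. -/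
lemma IsDevelopment.sub_mem_range [T2Space S] (hgeo : τ.IsGeometric X)
    (hD : τ.IsDevelopment X f D) {d : ℂ → S}
    {W K : Set ℂ} (hW : IsOpen W) (hWc : Convex ℝ W) (hd : X.IsTranslationOn d W)
    (hZ : ∀ z ∈ W, d z ∉ Z) (hK : IsPreconnected K) (hKW : K ⊆ W)
    (hKf : ∀ z ∈ K, d z ∈ range (τ.char f)) {q : ℂ} (hq : q ∈ K) {b : Tri}
    (hb : d q = τ.char f b) : ∀ z ∈ K, z - (q - D b) ∈ range D := by
  set t := q - D b with ht
  have hq0 : q - t = D b := by rw [ht]; ring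
  have heq : ∀ z ∈ W, z - t ∈ range D → d z = τ.devInv f D (z - t) := fun z =>
    hD.eqOn hWc hd hZ (hKW hq) hb ht
  refine hK.forall_of_clopen hq (by rw [hq0]; exact mem_range_self b) ?_ ?_
  · rintro z hz ⟨x, hx⟩
    have hzW := hKW hz
    have hdz := heq z hzW ⟨x, hx⟩
    rw [← hx, hD.devInv_apply] at hdz
    have htx : t = z - D x := by rw [hx]; ring
    rcases x.cases with hpos | ⟨i, s, hs0, hs1, rfl⟩ | ⟨i, rfl⟩
    · have := hD.eventually_interior hW hd hZ hzW hdz hpos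
      rw [← htx] at this
      exact nhdsWithin_le_nhds (this.mono fun w hw => hw.1)
    · obtain ⟨D', hD'⟩ := hgeo (τ.opp (f, i)).1
      set t' := z - D' (side (τ.opp (f, i)).2 (σ₀ s)) with ht'
      have hev := IsDevelopment.eventually_edge (h := (f, i)) hD hD' hW hd hZ hzW hs0 hs1 hdz
        htx ht'
      filter_upwards [nhdsWithin_le_nhds hev, nhdsWithin_le_nhds (hD'.eventually_bary_pos ht'),
        self_mem_nhdsWithin]
        with w h1 h2 hwK
      by_cases hw : 0 ≤ bary (verts D) i (w - t)
      · exact (h1.1 hw).1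
      push Not at hw
      exfalso
      obtain ⟨⟨y, hy⟩, hdw⟩ := h1.2 hw.le
      have hb := IsDevelopment.bary_side (h := (f, i)) hD hD' s (w - t)
      have hsub : w - t - (D (side i s) - D' (side (τ.opp (f, i)).2 (σ₀ s))) = w - t' := by
        rw [ht', htx]; ring
      rw [hsub] at hb
      have hypos : ∀ j, 0 < y.1 j := fun j => hD'.pos_of_bary (by
        rw [hy]
        by_cases hj : j = (τ.opp (f, i)).2
        · rw [hj, hb]
          nlinarith [IsDevelopment.area_div_pos (h := (f, i)) hD hD']
        · exact h2 j (side_apply_pos (symm_pos hs1) (symm_lt_one hs0) hj))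
      rw [← hy, hD'.devInv_apply] at hdw
      obtain ⟨x', hx'⟩ := hKf w hwK
      exact hD.opp_fst_ne i (τ.face_inj _ _ y x' hypos (hdw ▸ hx'.symm)).1
    · exact absurd (hdz ▸ τ.char_vtx_mem f i) (hZ z hzW)
  · intro z hz hfr
    have hcl : IsClosed {z | z - t ∈ range D} :=
      (isClosed_range_dev hD).preimage (continuous_id.sub continuous_const)
    exact hcl.mem_of_frequently_of_tendsto (hfr.filter_mono nhdsWithin_le_nhds) tendsto_id

lemma IsNondegenerateDelaunay.exists_isFaceDisk [T2Space S] (h : τ.IsNondegenerateDelaunay X)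
    (hD : τ.IsDevelopment X f D) : ∃ c r d, τ.IsFaceDisk X f D c r d := by
  obtain ⟨c₀, r, d₀, hd₀, p, hp, hpZ, himg⟩ := h.2 f
  obtain ⟨L, hL⟩ := hd₀.exists_isEmptyDisk
  set c := L c₀ with hc
  set d := d₀ ∘ L.symm with hd
  set P : Fin 3 → ℂ := fun i => L (p i) with hP
  have hPinj : Injective P := L.injective.comp hp
  have hmem : ∀ z ∈ closedBall c r, d z ∈ Z ↔ ∃ i, z = P i := by
    intro z hz
    have hz' : L.symm z ∈ closedBall c₀ r := by
      rw [mem_closedBall, ← L.dist_map, L.apply_symm_apply]; exact hz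
    have e : L.symm z ∈ range p ↔ d z ∈ Z := by rw [← hpZ]; exact ⟨fun h => h.2, fun h => ⟨hz', h⟩⟩
    rw [← e]
    constructor
    · rintro ⟨i, hi⟩; exact ⟨i, by rw [hP]; simp [hi]⟩
    · rintro ⟨i, hi⟩; exact ⟨i, by rw [hi]; simp [hP]⟩
  have hPcb : ∀ i, P i ∈ closedBall c r ∧ d (P i) ∈ Z := by
    intro i
    have : p i ∈ {z ∈ closedBall c₀ r | d₀ z ∈ Z} := hpZ ▸ mem_range_self i
    refine ⟨?_, by simpa [hd, hP] using this.2⟩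
    rw [mem_closedBall, hP, hc, L.dist_map]; exact this.1
  have hcirc : ∀ i, normSq (P i - c) = r ^ 2 := by
    intro i
    refine le_antisymm ((mem_closedBall_iff_normSq hL.pos).1 (hPcb i).1) (not_lt.1 fun hlt => ?_)
    exact hL.empty _ ((mem_ball_iff_normSq hL.pos).2 hlt) (hPcb i).2
  have himg' : d '' range (affTri P) = range (τ.char f) := by
    rw [← himg, ← convexHull_eq_range_affTri]
    have : range P = L '' range p := by rw [← range_comp]; rfl
    rw [this]
    have h2 : convexHull ℝ (L '' range p) = L '' convexHull ℝ (range p) :=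
      ((L : ℂ →ₗ[ℝ] ℂ).image_convexHull (range p)).symm
    rw [h2, ← image_comp]
    congr 1
    funext z; simp [hd]
  have hballP : ∀ x : Tri, d (affTri P x) ∉ Z → affTri P x ∈ ball c r := by
    intro x hx
    refine affTri_mem_ball hPinj hL.pos hcirc ?_
    rintro i rfl
    rw [affTri_vtx] at hx
    exact hx (hPcb i).2
  obtain ⟨b, hbpos⟩ := dense_interior.nonempty
  have hbZ : ∀ x : Tri, (∀ i, 0 < x.1 i) → τ.char f x ∉ Z := fun x hx hmemZ => by
    obtain ⟨i, hi⟩ := (τ.mem_iff f x).1 hmemZ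
    exact ne_vtx_of_pos hx i hi
  obtain ⟨q, ⟨xq, rfl⟩, hqb⟩ : τ.char f b ∈ d '' range (affTri P) := himg' ▸ mem_range_self b
  have hqball := hballP xq (hqb ▸ hbZ b hbpos)
  set t := affTri P xq - D b with ht
  set K : Set ℂ := range (affTri P) ∩ ball c r with hK
  have hKc : Convex ℝ K := by
    rw [hK, ← convexHull_eq_range_affTri]
    exact (convex_convexHull ℝ _).inter (convex_ball _ _)
  have hKf : ∀ z ∈ K, d z ∈ range (τ.char f) := fun z hz => himg' ▸ mem_image_of_mem d hz.1
  have hqK : affTri P xq ∈ K := ⟨mem_range_self _, hqball⟩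
  have hsub := hD.sub_mem_range h.1 isOpen_ball (convex_ball c r) hL.translation hL.empty
    hKc.isPreconnected inter_subset_right hKf hqK hqb
  have hK2 : ∀ z ∈ ball c r, z - t ∈ range D → d z = τ.devInv f D (z - t) := fun z =>
    hD.eqOn (convex_ball c r) hL.translation hL.empty hqball hqb ht
  have htP : ∀ x : Tri, D x + t ∈ range (affTri P) := by
    have hcl : IsClosed {x : Tri | D x + t ∈ range (affTri P)} :=
      (isCompact_range (continuous_affTri P)).isClosed.preimage
        (hD.continuous.add continuous_const)
    have hsubset : {x : Tri | ∀ i, 0 < x.1 i} ⊆ {x : Tri | D x + t ∈ range (affTri P)} := by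
      intro x hx
      obtain ⟨z, ⟨xz, rfl⟩, hz⟩ : τ.char f x ∈ d '' range (affTri P) := himg' ▸ mem_range_self x
      have hzb := hballP xz (hz ▸ hbZ x hx)
      have hzK : affTri P xz ∈ K := ⟨mem_range_self _, hzb⟩
      obtain ⟨y, hy⟩ := hsub _ hzK
      have h1 := hK2 _ hzb ⟨y, hy⟩
      rw [← hy, hD.devInv_apply, hz] at h1
      have h2 := (τ.face_inj f f x y hx h1).2
      refine ⟨xz, ?_⟩
      rw [h2, hy]; ring
    intro x
    exact hcl.closure_subset_iff.2 hsubset (dense_interior x)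
  have hvert : ∀ i, ∃ j, verts D i + t = P j := by
    intro i
    obtain ⟨y, hy⟩ := htP (vtx i)
    by_cases hyv : ∃ j, y = vtx j
    · obtain ⟨j, rfl⟩ := hyv
      exact ⟨j, by rw [← affTri_vtx P j, hy]; rfl⟩
    push Not at hyv
    exfalso
    have hyb := affTri_mem_ball hPinj hL.pos hcirc hyv
    have h1 := hK2 _ hyb (by rw [hy, add_sub_cancel_right]; exact mem_range_self _)
    have h2 := hL.empty _ hyb
    rw [h1, hy, add_sub_cancel_right, hD.devInv_apply] at h2
    exact h2 (τ.char_vtx_mem f i)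
  choose σ hσ using hvert
  have hσinj : Injective σ := by
    intro i j hij
    have : verts D i + t = verts D j + t := by rw [hσ, hσ, hij]
    exact hD.verts_injective (add_right_cancel this)
  have hσsurj := Finite.injective_iff_surjective.1 hσinj
  have hcirc' : ∀ i, normSq (verts D i - (c - t)) = r ^ 2 := by
    intro i
    rw [← hcirc (σ i), ← hσ]
    congr 1; ring
  have hshift : ∀ z, z + t ∈ closedBall c r ↔ z ∈ closedBall (c - t) r := by
    intro z
    rw [mem_closedBall, mem_closedBall, dist_eq_norm, dist_eq_norm]
    ring_nf
  have hshift' : ∀ z, z + t ∈ ball c r ↔ z ∈ ball (c - t) r := by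
    intro z
    rw [mem_ball, mem_ball, dist_eq_norm, dist_eq_norm]
    ring_nf
  have hcont : ContinuousOn (fun z => d (z + t)) (closedBall (c - t) r) :=
    hL.continuousOn.comp (by fun_prop) fun z hz => (hshift z).2 hz
  refine ⟨c - t, r, fun z => d (z + t), ⟨hL.pos, hcont, fun z hz => hL.empty _ ((hshift' z).2 hz),
    ?_⟩, hcirc', ?_, ?_⟩
  · have := hL.translation.shift (-t)
    simp only [sub_neg_eq_add] at this
    exact this.mono fun z hz => (hshift' z).2 hz
  · have hc1 : Continuous fun x => d (D x + t) :=
      hcont.comp_continuous hD.continuous fun x => hD.mem_closedBall hL.pos hcirc' x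
    have : (fun x => d (D x + t)) = τ.char f := by
      refine hc1.ext_on dense_interior (τ.char f).continuous fun x hx => ?_
      have hb := hD.mem_ball hL.pos hcirc' (x := x) (ne_vtx_of_pos hx)
      have := hK2 _ ((hshift' _).2 hb) (by rw [add_sub_cancel_right]; exact mem_range_self _)
      rw [add_sub_cancel_right, hD.devInv_apply] at this
      exact this
    exact congrFun this
  · intro z hz
    rw [hmem _ ((hshift z).2 hz)]
    constructor
    · rintro ⟨j, hj⟩
      obtain ⟨i, rfl⟩ := hσsurj j
      exact ⟨i, by rw [← hσ] at hj; exact add_right_cancel hj⟩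
    · rintro ⟨i, rfl⟩
      exact ⟨σ i, hσ i⟩

lemma IsFaceDisk.eqOn_dev [T2Space S] {c : ℂ} {r : ℝ} {d : ℂ → S} (hd : IsEmptyDisk X c r d)
    (hD' : τ.IsDevelopment X g D') {z₀ : ℂ} (hz₀ : z₀ ∈ ball c r) {y : Tri}
    (hy : d z₀ = τ.char g y) {z : ℂ} (hz : z ∈ closedBall c r)
    (hzr : z - (z₀ - D' y) ∈ range D') : d z = τ.devInv g D' (z - (z₀ - D' y)) := by
  set t := z₀ - D' y with ht
  refine eq_of_eqOn_segment (q := z₀) (K := closedBall c r ∩ {z | z - t ∈ range D'})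
    (e := fun z => τ.devInv g D' (z - t)) ((hd.continuousOn z hz).mono inter_subset_left)
    (((hD'.isTranslationOn.shift t).1 z hzr).mono inter_subset_right) fun s hs0 hs1 => ?_
  have hb := convex_neighbor_mem_ball hz₀ hz hs0 hs1
  have hin := hD'.convex_range.shift t hzr (⟨y, by rw [ht]; ring⟩ : z₀ - t ∈ range D')
    (sub_nonneg.2 hs1) hs0.le (by ring)
  have e : (1 - s) • z + s • z₀ = z + s * (z₀ - z) := by rw [real_smul, real_smul]; push_cast; ring
  rw [e] at hin
  exact ⟨⟨ball_subset_closedBall hb, hin⟩, hD'.eqOn (convex_ball c r) hd.translation hd.empty hz₀ hy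
    ht hb hin⟩

lemma bary_vertex {P : Fin 3 → ℂ} (hP : area P ≠ 0) (i j : Fin 3) :
    bary P i (P j) = (vtx j).1 i := by
  rw [← bary_affTri hP (vtx j) i, affTri_vtx]

/-- The apex of the adjacent face lies outside of the circumscribed circle. -/
lemma IsFaceDisk.lt_apex [T2Space S] {h : τ.Corner} {c : ℂ} {r : ℝ} {d : ℂ → S}
    (hF : τ.IsFaceDisk X h.1 D c r d) (hD : τ.IsDevelopment X h.1 D)
    (hD' : τ.IsDevelopment X (τ.opp h).1 D') (s : 𝕀) :
    r ^ 2 < normSq (verts D' (τ.opp h).2 +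
      (D (side h.2 s) - D' (side (τ.opp h).2 (σ₀ s))) - c) := by
  obtain ⟨s₀, h0, h1⟩ := exists_between (zero_lt_one' 𝕀)
  rw [hD.sub_side_eq hD' s s₀]
  set t := D (side h.2 s₀) - D' (side (τ.opp h).2 (σ₀ s₀)) with ht
  by_contra hcon
  rw [not_lt, ← mem_closedBall_iff_normSq hF.pos] at hcon
  have hm : D (side h.2 s₀) ∈ ball c r := hD.mem_ball hF.pos hF.circle fun i => side_ne_vtx h0 h1
  have hdm : d (D (side h.2 s₀)) = τ.char (τ.opp h).1 (side (τ.opp h).2 (σ₀ s₀)) := by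
    rw [hF.char_eq, τ.glue]
  have hw := IsFaceDisk.eqOn_dev hF.toIsEmptyDisk hD' hm hdm hcon
    (by rw [← ht, add_sub_cancel_right]; exact mem_range_self _)
  rw [← ht, add_sub_cancel_right] at hw
  have hZ : d (verts D' (τ.opp h).2 + t) ∈ Z := by
    rw [hw]
    exact (hD'.devInv_mem_iff (mem_range_self _)).2 ⟨_, rfl⟩
  obtain ⟨i, hi⟩ := (hF.mem_iff _ hcon).1 hZ
  have hb := hD.bary_side hD' s₀ (verts D' (τ.opp h).2 + t)
  rw [← ht, add_sub_cancel_right, hi, bary_vertex hD'.area_ne_zero, bary_vertex hD.area_ne_zero,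
    vtx_apply_self] at hb
  nlinarith [hD.area_div_pos hD', (vtx i).nonneg h.2]

/-- An empty disk inscribed with a triangle that passes through a point of a Delaunay face is a
translate of the disk of the face. -/
lemma IsFaceDisk.eq_of_common_point [T2Space S] {c' : ℂ} {r' : ℝ} {d' : ℂ → S}
    (hF : τ.IsFaceDisk X g D' c' r' d') (hD' : τ.IsDevelopment X g D') {c : ℂ} {r : ℝ} {e : ℂ → S}
    (he : IsEmptyDisk X c r e) {P : Fin 3 → ℂ} (hP : area P ≠ 0)
    (hPinj : Injective P)
    (hcirc : ∀ i, normSq (P i - c) = r ^ 2)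
    (hmem : ∀ z ∈ closedBall c r, e z ∈ Z ↔ ∃ i, z = P i)
    {x y : Tri} (hx : ∀ i, 0 < x.1 i) (hxy : e (affTri P x) = τ.char g y) {t : ℂ}
    (ht : t = affTri P x - D' y) :
    (∀ i, ∃ j, P i = verts D' j + t) ∧ ∀ z ∈ closedBall c r, e z = d' (z - t) := by
  set q := affTri P x with hq
  have hqb : q ∈ ball c r := affTri_mem_ball hPinj he.pos hcirc (ne_vtx_of_pos hx)
  have hyv : ∀ i, y ≠ vtx i := by
    rintro i rfl
    exact he.empty _ hqb (hxy ▸ τ.char_vtx_mem g i)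
  have hyb : q - t ∈ ball c' r' := by
    rw [ht, sub_sub_cancel]; exact hD'.mem_ball hF.pos hF.circle hyv
  have hagree : ∀ z ∈ closedBall c r, z - t ∈ closedBall c' r' → e z = d' (z - t) := by
    have hcv : Convex ℝ (ball c r ∩ {z | z - t ∈ ball c' r'}) :=
      (convex_ball c r).inter ((convex_ball c' r').shift t)
    have heq : EqOn e (fun z => d' (z - t)) (ball c r ∩ {z | z - t ∈ ball c' r'}) := by
      refine IsTranslationOn.eqOn hcv.isPreconnected (he.translation.mono inter_subset_left)
        ((hF.translation.shift t).mono inter_subset_right) (fun z hz => he.empty z hz.1)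
        (z₀ := q) ⟨hqb, hyb⟩ ?_
      rw [hxy, ht, sub_sub_cancel, hF.char_eq]
    intro z hz hz'
    refine eq_of_eqOn_segment (q := q) (K := closedBall c r ∩ {z | z - t ∈ closedBall c' r'})
      (e := fun z => d' (z - t)) ((he.continuousOn z hz).mono inter_subset_left)
      (ContinuousWithinAt.comp (hF.continuousOn _ hz') (by fun_prop) fun w hw => hw.2)
      fun s hs0 hs1 => ?_
    have h1 := convex_neighbor_mem_ball hqb hz hs0 hs1
    have h2 := convex_neighbor_mem_ball hyb hz' hs0 hs1
    rw [sub_sub_sub_cancel_right, sub_add_eq_add_sub] at h2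
    exact ⟨⟨ball_subset_closedBall h1, ball_subset_closedBall h2⟩, heq ⟨h1, h2⟩⟩
  have hPcb : ∀ i, P i ∈ closedBall c r := fun i =>
    (mem_closedBall_iff_normSq he.pos).2 (hcirc i).le
  have hPc : ∀ i, P i - t ∈ closedBall c' r' → ∃ j, P i = verts D' j + t := by
    intro i hi
    have h1 := hagree _ (hPcb i) hi
    have h2 : d' (P i - t) ∈ Z := h1 ▸ (hmem _ (hPcb i)).2 ⟨i, rfl⟩
    obtain ⟨j, hj⟩ := (hF.mem_iff _ hi).1 h2
    exact ⟨j, by rw [← hj]; ring⟩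
  have hPout : ∀ i, r' ^ 2 ≤ normSq (P i - t - c') := by
    intro i
    by_contra hcon
    have hi : P i - t ∈ closedBall c' r' := (mem_closedBall_iff_normSq hF.pos).2 (not_le.1 hcon).le
    obtain ⟨j, hj⟩ := hPc i hi
    apply hcon
    rw [hj, add_sub_cancel_right, hF.circle]
  have hQout : ∀ j, r ^ 2 ≤ normSq (verts D' j + t - c) := by
    intro j
    by_contra hcon
    have hjb : verts D' j + t ∈ ball c r := (mem_ball_iff_normSq he.pos).2 (not_le.1 hcon)
    have h1 := hagree _ (ball_subset_closedBall hjb) (by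
      rw [add_sub_cancel_right, mem_closedBall_iff_normSq hF.pos]; exact (hF.circle j).le)
    refine he.empty _ hjb ?_
    rw [h1, add_sub_cancel_right, hF.mem_iff _ (by
      rw [mem_closedBall_iff_normSq hF.pos]; exact (hF.circle j).le)]
    exact ⟨j, rfl⟩
  obtain ⟨w, hw⟩ : q - t ∈ range (affTri (verts D')) := by
    rw [← hD'.range_eq, ht, sub_sub_cancel]; exact mem_range_self y
  have e1 := normSq_affTri P x c
  have e2 := normSq_affTri P x (t + c')
  have e3 := normSq_affTri (verts D') w (c - t)
  have e4 := normSq_affTri (verts D') w c'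
  rw [← hq] at e1 e2
  rw [hw] at e3 e4
  have f1 : q - (t + c') = q - t - c' := by ring
  have f2 : q - t - (c - t) = q - c := by ring
  rw [f1] at e2
  rw [f2] at e3
  have hsum1 : ∑ i, x.1 i * normSq (P i - c) = r ^ 2 := by
    simp only [hcirc]; rw [← Finset.sum_mul, x.2.2, one_mul]
  have hsum4 : ∑ i, w.1 i * normSq (verts D' i - c') = r' ^ 2 := by
    simp only [hF.circle]; rw [← Finset.sum_mul, w.2.2, one_mul]
  have hsum3 : r ^ 2 ≤ ∑ i, w.1 i * normSq (verts D' i - (c - t)) := by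
    calc r ^ 2 = ∑ i, w.1 i * r ^ 2 := by rw [← Finset.sum_mul, w.2.2, one_mul]
      _ ≤ _ := Finset.sum_le_sum fun i _ => mul_le_mul_of_nonneg_left (by
        rw [← sub_add, sub_add_eq_add_sub]; exact hQout i) (w.nonneg i)
  have hle : ∑ i, x.1 i * (normSq (P i - (t + c')) - r' ^ 2) ≤ 0 := by
    have : ∑ i, x.1 i * (normSq (P i - (t + c')) - r' ^ 2) =
        ∑ i, x.1 i * normSq (P i - (t + c')) - r' ^ 2 := by
      simp only [mul_sub]
      rw [Finset.sum_sub_distrib, ← Finset.sum_mul, x.2.2, one_mul]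
    rw [this]
    linarith
  have hnn : ∀ i, 0 ≤ normSq (P i - (t + c')) - r' ^ 2 := fun i => by
    have := hPout i
    rw [sub_sub] at this
    linarith
  have hz : ∀ i, normSq (P i - t - c') = r' ^ 2 := by
    have hs : ∑ i, x.1 i * (normSq (P i - (t + c')) - r' ^ 2) = 0 :=
      le_antisymm hle (Finset.sum_nonneg fun i _ => mul_nonneg (x.nonneg i) (hnn i))
    intro i
    have h1 := (Finset.sum_eq_zero_iff_of_nonneg fun i _ => mul_nonneg (x.nonneg i) (hnn i)).1 hs i
      (Finset.mem_univ i)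
    have h2 := (mul_eq_zero.1 h1).resolve_left (hx i).ne'
    rw [sub_sub]; linarith
  have huniq := circle_unique hP he.pos hF.pos hcirc (c' := t + c') fun i => by
    rw [← sub_sub]; exact hz i
  refine ⟨fun i => hPc i ((mem_closedBall_iff_normSq hF.pos).2 (hz i).le), fun z hz => ?_⟩
  refine hagree z hz ?_
  rw [mem_closedBall_iff_normSq hF.pos, sub_sub, ← huniq.1, ← huniq.2]
  exact (mem_closedBall_iff_normSq he.pos).1 hz

end Triangulation

/-! ### Locally convex functions on an interval -/

/-- A locally convex function on an open interval is convex. -/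
lemma convexOn_Ioo_of_locally {a b : ℝ} {g : ℝ → ℝ}
    (h : ∀ s ∈ Ioo a b, ∃ ρ > 0, ConvexOn ℝ (ball s ρ) g) : ConvexOn ℝ (Ioo a b) g := by
  have hcont : ContinuousOn g (Ioo a b) := by
    intro s hs
    obtain ⟨ρ, hρ, hc⟩ := h s hs
    exact ((hc.continuousOn isOpen_ball).continuousAt
      (ball_mem_nhds s hρ)).continuousWithinAt
  refine convexOn_of_slope_mono_adjacent (convex_Ioo a b) ?_
  intro x y z hx hz hxy hyz
  have hxz : x < z := hxy.trans hyz
  set k := (g z - g x) / (z - x) with hk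
  set L : ℝ → ℝ := fun s => g s - (g x + k * (s - x)) with hL
  have hLx : L x = 0 := by simp [hL]
  have hLz : L z = 0 := by
    have : z - x ≠ 0 := by linarith
    simp only [hL, hk]; field_simp; ring
  have hsub : Icc x z ⊆ Ioo a b := fun s hs => ⟨hx.1.trans_le hs.1, hs.2.trans_lt hz.2⟩
  have hLc : ContinuousOn L (Icc x z) := (hcont.mono hsub).sub (by fun_prop)
  have hLloc : ∀ s ∈ Ioo a b, ∃ ρ > 0, ConvexOn ℝ (ball s ρ) L := by
    intro s hs
    obtain ⟨ρ, hρ, hc⟩ := h s hs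
    refine ⟨ρ, hρ, hc.sub ⟨convex_ball s ρ, fun u _ v _ p q _ _ hpq => le_of_eq ?_⟩⟩
    simp only [smul_eq_mul]
    linear_combination (g x - k * x) * hpq
  obtain ⟨m, hm, hmax⟩ := isCompact_Icc.exists_isMaxOn (nonempty_Icc.2 hxz.le) hLc
  have hle : L m ≤ 0 := by
    by_contra hpos
    push Not at hpos
    have hQ : ∀ s ∈ Icc x z, L s = L m := by
      refine isPreconnected_Icc.forall_of_clopen (Q := fun s => L s = L m) hm rfl ?_ ?_
      · intro s hs hsm
        obtain ⟨ρ, hρ, hc⟩ := hLloc s (hsub hs)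
        have hsx : x < s := lt_of_le_of_ne hs.1 fun h => by rw [← h, hLx] at hsm; linarith
        have hsz : s < z := lt_of_le_of_ne hs.2 fun h => by rw [h, hLz] at hsm; linarith
        have hev : ∀ᶠ u in 𝓝 s, u ∈ ball s ρ ∧ u ∈ Icc x z ∧ 2 * s - u ∈ ball s ρ ∧
            2 * s - u ∈ Icc x z := by
          have hc2 := (by fun_prop : Continuous fun u : ℝ => 2 * s - u).tendsto' s s (by ring)
          have n1 := ball_mem_nhds s hρ
          have n2 := Icc_mem_nhds hsx hsz
          filter_upwards [n1, n2, hc2 n1, hc2 n2] with u a1 a2 a3 a4 using ⟨a1, a2, a3, a4⟩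
        refine nhdsWithin_le_nhds (hev.mono fun u hu => ?_)
        have h1 := hc.2 hu.1 hu.2.2.1 (by norm_num : (0:ℝ) ≤ 1 / 2) (by norm_num : (0:ℝ) ≤ 1 / 2)
          (by norm_num)
        simp only [smul_eq_mul] at h1
        have e : (1 / 2 : ℝ) * u + 1 / 2 * (2 * s - u) = s := by ring
        rw [e] at h1
        have h2 : L u ≤ L m := hmax hu.2.1
        have h3 : L (2 * s - u) ≤ L m := hmax hu.2.2.2
        linarith
      · exact fun s hs => tendsto_nhds_unique_of_frequently_eq (hLc s hs) tendsto_const_nhds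
    have := hQ x (left_mem_Icc.2 hxz.le)
    rw [hLx] at this
    linarith
  have hy : L y ≤ 0 := (hmax ⟨hxy.le, hyz.le⟩ : L y ≤ L m).trans hle
  have hy' : g y ≤ g x + k * (y - x) := by simp only [hL] at hy; linarith
  have hkz : g z = g x + k * (z - x) := by simp only [hL] at hLz; linarith
  have d1 : 0 < y - x := by linarith
  have d2 : 0 < z - y := by linarith
  calc (g y - g x) / (y - x) ≤ k := by rw [div_le_iff₀ d1]; linarith
    _ ≤ (g z - g y) / (z - y) := by rw [le_div_iff₀ d2]; rw [hkz]; linarith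

/-! ### Affine functions -/

/-- The affine functions on the plane, up to a constant. -/
def powDiff (e : ℂ) (k : ℝ) (z : ℂ) : ℝ := normSq z - normSq (z - e) + k

lemma powDiff_apply (e : ℂ) (k : ℝ) (z : ℂ) :
    powDiff e k z = 2 * (z.re * e.re + z.im * e.im) - normSq e + k := by
  simp only [powDiff, normSq_apply, sub_re, sub_im]; ring

lemma powDiff_combo (e : ℂ) (k : ℝ) (x y : ℂ) {p q : ℝ} (h : p + q = 1) :
    powDiff e k (p • x + q • y) = p * powDiff e k x + q * powDiff e k y := by
  simp only [powDiff_apply, add_re, add_im, Complex.smul_re, Complex.smul_im, smul_eq_mul]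
  linear_combination (normSq e - k) * h

lemma convexOn_powDiff (e : ℂ) (k : ℝ) (A : Set ℂ) (hA : Convex ℝ A) : ConvexOn ℝ A (powDiff e k) :=
  ⟨hA, fun x _ y _ _ _ _ _ h => (powDiff_combo e k x y h).le⟩

lemma sum_bary_mul {P : Fin 3 → ℂ} (hP : area P ≠ 0) (z : ℂ) (i : Fin 3) :
    (bary P i z : ℂ) * P i + (bary P (i + 1) z : ℂ) * P (i + 1) +
      (bary P (i + 2) z : ℂ) * P (i + 2) = z := by
  have h0 : ∀ j, bary P j z * area P = cross (P (j + 2) - P (j + 1)) (z - P (j + 1)) := fun j => by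
    rw [bary, div_mul_cancel₀ _ hP]
  have e0 := h0 i
  have e1 := h0 (i + 1)
  have e2 := h0 (i + 2)
  rw [fin3_add_one_add_one, fin3_add_one_add_two] at e1
  rw [fin3_add_two_add_one, fin3_add_two_add_two] at e2
  have ha := area_eq P i
  have hP' : (area P : ℂ) ≠ 0 := by exact_mod_cast hP
  apply mul_left_cancel₀ hP'
  simp only [cross, sub_re, sub_im] at e0 e1 e2 ha
  apply Complex.ext
  · simp only [re_ofReal_mul, add_re]
    linear_combination (P i).re * e0 + (P (i + 1)).re * e1 + (P (i + 2)).re * e2 - z.re * ha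
  · simp only [im_ofReal_mul, add_im]
    linear_combination (P i).im * e0 + (P (i + 1)).im * e1 + (P (i + 2)).im * e2 - z.im * ha

lemma powDiff_bary {P : Fin 3 → ℂ} (hP : area P ≠ 0) (e : ℂ) (k : ℝ) (z : ℂ) (i : Fin 3) :
    powDiff e k z = bary P i z * powDiff e k (P i) + bary P (i + 1) z * powDiff e k (P (i + 1)) +
      bary P (i + 2) z * powDiff e k (P (i + 2)) := by
  have h := sum_bary_mul hP z i
  have hs := bary_sum hP z i
  conv_lhs => rw [← h]
  simp only [powDiff_apply, add_re, add_im, re_ofReal_mul, im_ofReal_mul]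
  linear_combination (normSq e - k) * hs

lemma exists_circumcircle {P : Fin 3 → ℂ} (hP : area P ≠ 0) :
    ∃ c : ℂ, ∃ r > 0, ∀ i, normSq (P i - c) = r ^ 2 := by
  set u := P 1 - P 0 with hu
  set w := P 2 - P 0 with hw
  have ha : u.re * w.im - u.im * w.re ≠ 0 := hP
  set k := u.re * w.im - u.im * w.re with hk
  set n := u.re ^ 2 + u.im ^ 2 with hn
  set m := w.re ^ 2 + w.im ^ 2 with hm
  set e : ℂ := ⟨(n * w.im - m * u.im) / (2 * k), (m * u.re - n * w.re) / (2 * k)⟩ with he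
  have e1 : 2 * (u.re * e.re + u.im * e.im) = n := by simp only [he]; field_simp; rw [hk]; ring
  have e2 : 2 * (w.re * e.re + w.im * e.im) = m := by simp only [he]; field_simp; rw [hk]; ring
  have hpos : 0 < normSq e := by
    rw [normSq_pos]
    intro h0
    rw [h0] at e1 e2
    simp at e1 e2
    have h1 : u.re = 0 ∧ u.im = 0 := by constructor <;> nlinarith [sq_nonneg u.re, sq_nonneg u.im]
    apply ha
    rw [hk, h1.1, h1.2]; ring
  refine ⟨P 0 + e, Real.sqrt (normSq e), Real.sqrt_pos.2 hpos, fun i => ?_⟩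
  rw [Real.sq_sqrt hpos.le]
  fin_cases i
  · simp
  · have : P 1 - (P 0 + e) = u - e := by rw [hu]; ring
    change normSq (P 1 - (P 0 + e)) = _
    rw [this]
    simp only [normSq_apply, sub_re, sub_im]
    linear_combination -e1
  · have : P 2 - (P 0 + e) = w - e := by rw [hw]; ring
    change normSq (P 2 - (P 0 + e)) = _
    rw [this]
    simp only [normSq_apply, sub_re, sub_im]
    linear_combination -e2

namespace Triangulation

/-- Developments of all faces, with circumscribed circles that do not contain the apex of an
adjacent face. -/
structure LocallyDelaunay (τ : Triangulation Z) (X : TranslationSurface o Z κ)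
    (D : τ.Face → Tri → ℂ) (C : τ.Face → ℂ) (R : τ.Face → ℝ) : Prop where
  dev : ∀ f, τ.IsDevelopment X f (D f)
  pos : ∀ f, 0 < R f
  circle : ∀ f i, normSq (verts (D f) i - C f) = R f ^ 2
  apex : ∀ h s, R h.1 ^ 2 < normSq (verts (D (τ.opp h).1) (τ.opp h).2 +
      (D h.1 (side h.2 s) - D (τ.opp h).1 (side (τ.opp h).2 (σ₀ s))) - C h.1)

/-- The negated power with respect to the circumscribed circles. -/
def negPow (τ : Triangulation Z) (D : τ.Face → Tri → ℂ) (C : τ.Face → ℂ) (R : τ.Face → ℝ)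
    (p : S) : ℝ :=
  R (τ.cover p).choose ^ 2 -
    normSq (D (τ.cover p).choose (τ.cover p).choose_spec.choose - C (τ.cover p).choose)

namespace LocallyDelaunay

variable {D : τ.Face → Tri → ℂ} {C : τ.Face → ℂ} {R : τ.Face → ℝ}

lemma power_side (hL : LocallyDelaunay τ X D C R) (h : τ.Corner) (s : 𝕀) : ∃ k : ℝ, 0 ≤ k ∧ k ≤ 1 ∧
      D h.1 (side h.2 s) = verts (D h.1) (h.2 + 1) + k * τ.edgeVec X h ∧
      R h.1 ^ 2 - normSq (D h.1 (side h.2 s) - C h.1) = k * (1 - k) * normSq (τ.edgeVec X h) := by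
  have hD := hL.dev h.1
  have hm : D h.1 (side h.2 s) ∈ segment ℝ (D h.1 (vtx (h.2 + 1))) (D h.1 (vtx (h.2 + 2))) :=
    (hD.2.2.2.2 h.2) ▸ mem_range_self s
  rw [segment_eq_image'] at hm
  obtain ⟨k, hk, hk'⟩ := hm
  have he : τ.edgeVec X h = verts (D h.1) (h.2 + 2) - verts (D h.1) (h.2 + 1) := hD.edgeVec_eq h.2
  have hk2 : D h.1 (side h.2 s) = verts (D h.1) (h.2 + 1) + k * τ.edgeVec X h := by
    rw [← hk', he, ← real_smul]; rfl
  refine ⟨k, hk.1, hk.2, hk2, ?_⟩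
  have c1 := hL.circle h.1 (h.2 + 1)
  have c2 := hL.circle h.1 (h.2 + 2)
  have hv : verts (D h.1) (h.2 + 2) = verts (D h.1) (h.2 + 1) + τ.edgeVec X h := by rw [he]; ring
  rw [hv] at c2
  rw [hk2]
  simp only [normSq_apply, add_re, add_im, sub_re, sub_im, re_ofReal_mul, im_ofReal_mul] at c1 c2 ⊢
  linear_combination -(1 - k) * c1 - k * c2

lemma negPow_char (hL : LocallyDelaunay τ X D C R) (f : τ.Face) (x : Tri) :
    negPow τ D C R (τ.char f x) = R f ^ 2 - normSq (D f x - C f) := by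
  have key : ∀ g y, τ.char g y = τ.char f x → R g ^ 2 - normSq (D g y - C g) =
      R f ^ 2 - normSq (D f x - C f) := by
    intro g y h
    rcases τ.char_eq_cases h with ⟨rfl, rfl⟩ | ⟨k, s, h0, h1, rfl, rfl, rfl, rfl⟩ | ⟨i, j, rfl, rfl⟩
    · rfl
    · obtain ⟨a, -, -, ha, ha'⟩ := hL.power_side k s
      obtain ⟨b, -, -, hb, hb'⟩ := hL.power_side (τ.opp k) (σ₀ s)
      rw [ha', hb', edgeVec_opp, Complex.normSq_neg]
      have hs := (hL.dev k.1).sub_side_eq (hL.dev (τ.opp k).1) s 0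
      rw [ha, hb, unitInterval.symm_zero, side_zero, side_one, edgeVec_opp] at hs
      have hv : verts (D (τ.opp k).1) ((τ.opp k).2 + 2) - verts (D (τ.opp k).1) ((τ.opp k).2 + 1) =
          -τ.edgeVec X k := by
        rw [← edgeVec_opp]; exact ((hL.dev (τ.opp k).1).edgeVec_eq (τ.opp k).2).symm
      have hne : τ.edgeVec X k ≠ 0 := by
        rw [show k = (k.1, k.2) from rfl, (hL.dev k.1).edgeVec_eq, sub_ne_zero]
        exact fun h => fin3_add_two_ne_add_one _ ((hL.dev k.1).verts_injective h)
      have hab : (a : ℂ) + b - 1 = 0 := by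
        apply (mul_eq_zero.1 (?_ : ((a : ℂ) + b - 1) * τ.edgeVec X k = 0)).resolve_right hne
        have e1 : D k.1 (vtx (k.2 + 1)) = verts (D k.1) (k.2 + 1) := rfl
        have e2 : D (τ.opp k).1 (vtx ((τ.opp k).2 + 2)) =
          verts (D (τ.opp k).1) ((τ.opp k).2 + 2) := rfl
        rw [e1, e2] at hs
        linear_combination hs - hv
      have hab' : b = 1 - a := by
        have : ((a + b - 1 : ℝ) : ℂ) = 0 := by push_cast; exact hab
        have := Complex.ofReal_eq_zero.1 this
        linarith
      rw [hab']; ring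
    · have e1 := hL.circle g i
      have e2 := hL.circle f j
      simp only [verts] at e1 e2
      rw [e1, e2, sub_self, sub_self]
  exact key _ _ (τ.cover (τ.char f x)).choose_spec.choose_spec

lemma continuous_negPow [T2Space S] (hL : LocallyDelaunay τ X D C R) :
    Continuous (negPow τ D C R) := by
  refine τ.continuous_of_char fun f => ?_
  simp only [hL.negPow_char]
  exact continuous_const.sub (Complex.continuous_normSq.comp ((hL.dev f).continuous.sub
    continuous_const))

lemma negPow_eq_zero (hL : LocallyDelaunay τ X D C R) {p : S} (hp : p ∈ Z) :
    negPow τ D C R p = 0 := by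
  obtain ⟨f, x, rfl⟩ := τ.cover p
  obtain ⟨i, rfl⟩ := (τ.mem_iff f x).1 hp
  rw [hL.negPow_char]
  have := hL.circle f i
  simp only [verts] at this
  rw [this, sub_self]

lemma lift_eq (hL : LocallyDelaunay τ X D C R) {f : τ.Face} {d : ℂ → S} {z t : ℂ}
    (h1 : z - t ∈ range (D f)) (h2 : d z = τ.devInv f (D f) (z - t)) :
    normSq z + negPow τ D C R (d z) = powDiff (t + C f) (R f ^ 2) z := by
  obtain ⟨x, hx⟩ := h1
  rw [h2, ← hx, (hL.dev f).devInv_apply, hL.negPow_char, hx, powDiff, sub_sub]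
  ring

/-- Across an edge, the affine function of the adjacent face is larger. -/
lemma powDiff_sub [T2Space S] (hL : LocallyDelaunay τ X D C R) (h : τ.Corner) (s : 𝕀)
    {t t' z₀ : ℂ} (ht : t = z₀ - D h.1 (side h.2 s))
    (ht' : t' = z₀ - D (τ.opp h).1 (side (τ.opp h).2 (σ₀ s))) :
    ∃ k > 0, ∀ z, powDiff (t' + C (τ.opp h).1) (R (τ.opp h).1 ^ 2) z -
      powDiff (t + C h.1) (R h.1 ^ 2) z = -k * bary (verts (D h.1)) h.2 (z - t) := by
  set g := (τ.opp h).1 with hg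
  set j := (τ.opp h).2 with hj
  have hD := hL.dev h.1
  have hD' := hL.dev g
  set P : Fin 3 → ℂ := fun i => verts (D g) i + t' with hP
  have hPa : area P = area (verts (D g)) := by simp [area, cross, hP]
  have hPne : area P ≠ 0 := hPa ▸ hD'.area_ne_zero
  have hPb : ∀ z, bary P j z = bary (verts (D g)) j (z - t') := by
    intro z
    rw [bary, bary, hPa]
    congr 1
    simp only [hP, cross, sub_re, sub_im, add_re, add_im]
    ring
  have hv : ∀ i, powDiff (t' + C g) (R g ^ 2) (P i) = normSq (P i) := by
    intro i
    have := hL.circle g i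
    have e : P i - (t' + C g) = verts (D g) i - C g := by simp only [hP]; ring
    rw [powDiff, e, this]; ring
  have hw : ∀ i, powDiff (t + C h.1) (R h.1 ^ 2) (verts (D h.1) i + t) =
      normSq (verts (D h.1) i + t) := by
    intro i
    have := hL.circle h.1 i
    have e : verts (D h.1) i + t - (t + C h.1) = verts (D h.1) i - C h.1 := by ring
    rw [powDiff, e, this]; ring
  have e1 : P (j + 1) = verts (D h.1) (h.2 + 2) + t := by
    have := hD.sub_side_eq hD' s 1
    rw [unitInterval.symm_one, side_one, side_zero] at this
    simp only [hP, ht', ht, verts]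
    linear_combination this
  have e2 : P (j + 2) = verts (D h.1) (h.2 + 1) + t := by
    have := hD.sub_side_eq hD' s 0
    rw [unitInterval.symm_zero, side_one, side_zero] at this
    simp only [hP, ht', ht, verts]
    linear_combination this
  have hap := hL.apex h s
  set p := normSq (verts (D g) j + (D h.1 (side h.2 s) -
    D g (side j (σ₀ s))) - C h.1) with hp
  have e3 : P j - (t + C h.1) = verts (D g) j + (D h.1 (side h.2 s) -
      D g (side j (σ₀ s))) - C h.1 := by
    simp only [hP, ht, ht']; ring
  refine ⟨(p - R h.1 ^ 2) * (area (verts (D h.1)) / area (verts (D g))),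
    mul_pos (sub_pos.2 hap) (hD.area_div_pos hD'), fun z => ?_⟩
  · have hb := hD.bary_side hD' s (z - t)
    have hzt : z - t - (D h.1 (side h.2 s) - D (τ.opp h).1 (side (τ.opp h).2
        (σ₀ s))) = z - t' := by rw [ht, ht']; ring
    rw [hzt] at hb
    rw [powDiff_bary hPne (t' + C g) _ z j, powDiff_bary hPne (t + C h.1) _ z j, hv, hv, hv, e1,
      e2, hw, hw, powDiff, e3, ← hp, hPb]
    linear_combination (p - R h.1 ^ 2) * hb

lemma exists_convexOn_ball [T2Space S] (hL : LocallyDelaunay τ X D C R) {d : ℂ → S} {W : Set ℂ}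
    (hW : IsOpen W) (hd : X.IsTranslationOn d W) (hZ : ∀ z ∈ W, d z ∉ Z) {z₀ : ℂ} (hz₀ : z₀ ∈ W) :
    ∃ ρ > 0, ConvexOn ℝ (ball z₀ ρ) fun z => normSq z + negPow τ D C R (d z) := by
  obtain ⟨f, x, hx⟩ := τ.cover (d z₀)
  rcases x.cases with hpos | ⟨i, s, h0, h1, rfl⟩ | ⟨i, rfl⟩
  · have hev := (hL.dev f).eventually_interior hW hd hZ hz₀ hx.symm hpos
    obtain ⟨ρ, hρ, hb⟩ := eventually_nhds_iff_ball.1 hev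
    refine ⟨ρ, hρ, (convexOn_powDiff (z₀ - D f x + C f) (R f ^ 2) _
      (convex_ball z₀ ρ)).congr fun z hz => ?_⟩
    exact (hL.lift_eq (hb z hz).1 (hb z hz).2).symm
  · have hev := IsDevelopment.eventually_edge (h := (f, i)) (hL.dev f) (hL.dev (τ.opp (f, i)).1) hW
      hd hZ hz₀ h0 h1 hx.symm rfl rfl
    obtain ⟨k, hk, hsub⟩ := hL.powDiff_sub (f, i) s (z₀ := z₀) rfl rfl
    obtain ⟨ρ, hρ, hb⟩ := eventually_nhds_iff_ball.1 hev
    refine ⟨ρ, hρ, ((convexOn_powDiff (z₀ - D f (side i s) + C f) (R f ^ 2) _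
      (convex_ball z₀ ρ)).sup (convexOn_powDiff (z₀ - D (τ.opp (f, i)).1
        (side (τ.opp (f, i)).2 (σ₀ s)) + C (τ.opp (f, i)).1)
          (R (τ.opp (f, i)).1 ^ 2) _ (convex_ball z₀ ρ))).congr fun z hz => ?_⟩
    · have h2 := hb z hz
      have h3 := hsub z
      rcases le_total 0 (bary (verts (D f)) i (z - (z₀ - D f (side i s)))) with hle | hle
      · obtain ⟨a1, a2⟩ := h2.1 hle
        simp only [hL.lift_eq a1 a2]
        exact sup_of_le_left (by nlinarith)
      · obtain ⟨a1, a2⟩ := h2.2 hle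
        simp only [hL.lift_eq a1 a2]
        exact sup_of_le_right (by nlinarith)
  · exact absurd (hx ▸ τ.char_vtx_mem f i) (hZ z₀ hz₀)

end LocallyDelaunay

end Triangulation

/-! ### Maximal star-shaped lifts -/

namespace TranslationSurface

/-- Local inverses of primitives are defined on balls of locally uniform radius. -/
lemma exists_section (X : TranslationSurface o Z κ) {p : S} (hp : p ∉ Z) :
    ∃ ρ > 0, ∀ᶠ q in 𝓝 p, ∀ w : ℂ, ∃ e : ℂ → S, X.IsTranslationOn e (ball w ρ) ∧
      (∀ z ∈ ball w ρ, e z ∉ Z) ∧ e w = q := by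
  obtain ⟨r, hr, d, hd, hd0, hopen, hZ⟩ := X.exists_translation hp 0
  have hsub : ball (0 : ℂ) (r / 2) ⊆ ball 0 r := Metric.ball_subset_ball (by linarith)
  refine ⟨r / 2, half_pos hr, ?_⟩
  have hN : d '' ball 0 (r / 2) ∈ 𝓝 p :=
    (hopen _ hsub isOpen_ball).mem_nhds ⟨0, mem_ball_self (half_pos hr), hd0⟩
  filter_upwards [hN]
  rintro q ⟨w₀, hw₀, rfl⟩ w
  have hmem : ∀ z ∈ ball w (r / 2), z - (w - w₀) ∈ ball (0 : ℂ) r := by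
    intro z hz
    rw [mem_ball, dist_eq_norm] at *
    have : z - (w - w₀) - 0 = (z - w) + (w₀ - 0) := by ring
    rw [this]
    exact (norm_add_le _ _).trans_lt (by linarith)
  refine ⟨fun z => d (z - (w - w₀)), (hd.shift (w - w₀)).mono hmem,
    fun z hz => hZ _ (hmem z hz), ?_⟩
  simp

/-- A lift of a translation map to an open star-shaped set. -/
structure IsStarLift (X : TranslationSurface o Z κ) (c₀ : ℂ) (p₀ : S) (U : Set ℂ) (d : ℂ → S) :
    Prop where
  isOpen : IsOpen U
  star : StarConvex ℝ c₀ U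
  mem : c₀ ∈ U
  base : d c₀ = p₀
  translation : X.IsTranslationOn d U
  empty : ∀ z ∈ U, d z ∉ Z

lemma IsTranslationOn.of_local {d : ℂ → S} {U : Set ℂ}
    (h : ∀ z ∈ U, ∃ V d', IsOpen V ∧ z ∈ V ∧ X.IsTranslationOn d' V ∧ ∀ᶠ w in 𝓝 z, d w = d' w) :
    X.IsTranslationOn d U := by
  constructor
  · intro z hz
    obtain ⟨V, d', hV, hzV, hd', hev⟩ := h z hz
    exact ((hd'.1.continuousAt (hV.mem_nhds hzV)).congr (hev.mono fun w hw => hw.symm)).continuousWithinAt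
  · intro z hz
    obtain ⟨V, d', hV, hzV, hd', hev⟩ := h z hz
    obtain ⟨N, hN, hm, F, hF, hFd⟩ := hd'.2 z hzV
    refine ⟨N, hN, hev.self_of_nhds ▸ hm, F, hF, nhdsWithin_le_nhds ?_⟩
    rw [hV.nhdsWithin_eq hzV] at hFd
    filter_upwards [hFd, hev] with w h1 h2
    rw [h2, h1]

lemma exists_max_starLift [T2Space S] (X : TranslationSurface o Z κ) {p₀ : S} (hp₀ : p₀ ∉ Z)
    (c₀ : ℂ) : ∃ U d, X.IsStarLift c₀ p₀ U d ∧ ∀ U' d', X.IsStarLift c₀ p₀ U' d' → U' ⊆ U := by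
  classical
  have hagree : ∀ U d U' d', X.IsStarLift c₀ p₀ U d → X.IsStarLift c₀ p₀ U' d' →
      EqOn d d' (U ∩ U') := by
    intro U d U' d' h h'
    have hc : IsPreconnected (U ∩ U') :=
      ((h.star.inter h'.star).isPathConnected ⟨h.mem, h'.mem⟩).isConnected.isPreconnected
    exact IsTranslationOn.eqOn hc (h.translation.mono inter_subset_left)
      (h'.translation.mono inter_subset_right) (fun z hz => h.empty z hz.1) ⟨h.mem, h'.mem⟩
      (h.base.trans h'.base.symm)
  obtain ⟨r, hr, d₁, hd₁, hd0, -, hZ₁⟩ := X.exists_translation hp₀ c₀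
  have h₁ : X.IsStarLift c₀ p₀ (ball c₀ r) d₁ :=
    ⟨isOpen_ball, (convex_ball c₀ r).starConvex (mem_ball_self hr), mem_ball_self hr, hd0, hd₁, hZ₁⟩
  set U : Set ℂ := {z | ∃ q : Set ℂ × (ℂ → S), X.IsStarLift c₀ p₀ q.1 q.2 ∧ z ∈ q.1} with hU
  set d : ℂ → S := fun z => if h : z ∈ U then h.choose.2 z else p₀ with hd
  have hdU : ∀ V e, X.IsStarLift c₀ p₀ V e → ∀ z ∈ V, d z = e z := by
    intro V e hV z hz
    have hzU : z ∈ U := ⟨(V, e), hV, hz⟩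
    simp only [hd, dif_pos hzU]
    exact hagree _ _ _ _ hzU.choose_spec.1 hV ⟨hzU.choose_spec.2, hz⟩
  have hmem : c₀ ∈ U := ⟨(_, d₁), h₁, h₁.mem⟩
  refine ⟨U, d, ⟨?_, ?_, hmem, ?_, ?_, ?_⟩, fun U' d' h' z hz => ⟨(U', d'), h', hz⟩⟩
  · rw [isOpen_iff_mem_nhds]
    rintro z ⟨q, hq, hz⟩
    exact mem_of_superset (hq.isOpen.mem_nhds hz) fun w hw => ⟨q, hq, hw⟩
  · rintro z ⟨q, hq, hz⟩ a b ha hb hab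
    exact ⟨q, hq, hq.star hz ha hb hab⟩
  · rw [hdU _ _ h₁ _ h₁.mem, h₁.base]
  · refine IsTranslationOn.of_local ?_
    rintro z ⟨q, hq, hz⟩
    exact ⟨q.1, q.2, hq.isOpen, hz, hq.translation,
      mem_of_superset (hq.isOpen.mem_nhds hz) fun w hw => hdU _ _ hq w hw⟩
  · rintro z ⟨q, hq, hz⟩
    rw [hdU _ _ hq z hz]
    exact hq.empty z hz

lemma IsStarLift.mem_of_segment [T2Space S] {c₀ : ℂ} {p₀ : S} {U : Set ℂ} {d : ℂ → S}
    (h : X.IsStarLift c₀ p₀ U d) (hmax : ∀ U' d', X.IsStarLift c₀ p₀ U' d' → U' ⊆ U)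
    {C V : Set ℂ} (hC : IsOpen C) (hCc : Convex ℝ C) (hCU : C ⊆ U) (hc₀ : c₀ ∈ C)
    (hV : IsOpen V) (hVc : Convex ℝ V) {e : ℂ → S} (he : X.IsTranslationOn e V)
    (heZ : ∀ z ∈ V, e z ∉ Z) {w : ℂ} (hwC : w ∈ C) (hwV : w ∈ V) (hw : d w = e w) {z : ℂ}
    (hz : segment ℝ c₀ z ⊆ C ∪ V) : z ∈ U := by
  classical
  have hagree : EqOn d e (C ∩ V) := IsTranslationOn.eqOn (hCc.inter hVc).isPreconnected
      (h.translation.mono (inter_subset_left.trans hCU)) (he.mono inter_subset_right)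
      (fun z hz => h.empty z (hCU hz.1)) ⟨hwC, hwV⟩ hw
  set d' : ℂ → S := fun z => if z ∈ C then d z else e z with hd'
  have hdC : ∀ z ∈ C, d' z = d z := fun z hz => by simp only [hd', if_pos hz]
  have hdV : ∀ z ∈ V, d' z = e z := fun z hz => by
    by_cases hzC : z ∈ C
    · rw [hdC z hzC, hagree ⟨hzC, hz⟩]
    · simp only [hd', if_neg hzC]
  have hcomp : IsCompact (segment ℝ c₀ z) := by
    rw [segment_eq_image]
    exact isCompact_Icc.image (by fun_prop)
  obtain ⟨δ, hδ, hsub⟩ := hcomp.exists_thickening_subset_open (hC.union hV) hz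
  have hself := Metric.self_subset_thickening hδ (segment ℝ c₀ z)
  have hN : X.IsStarLift c₀ p₀ (Metric.thickening δ (segment ℝ c₀ z)) d' := by
    refine ⟨Metric.isOpen_thickening, ((convex_segment c₀ z).thickening δ).starConvex
      (hself (left_mem_segment ℝ c₀ z)), hself (left_mem_segment ℝ c₀ z), ?_, ?_, ?_⟩
    · rw [hdC _ hc₀, h.base]
    · refine IsTranslationOn.of_local fun y hy => ?_
      rcases hsub hy with hyC | hyV
      · exact ⟨C, d, hC, hyC, h.translation.mono hCU, mem_of_superset (hC.mem_nhds hyC) hdC⟩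
      · exact ⟨V, e, hV, hyV, he, mem_of_superset (hV.mem_nhds hyV) hdV⟩
    · intro y hy
      rcases hsub hy with hyC | hyV
      · rw [hdC y hyC]; exact h.empty y (hCU hyC)
      · rw [hdV y hyV]; exact heZ y hyV
  exact hmax _ _ hN (hself (right_mem_segment ℝ c₀ z))

end TranslationSurface

namespace Triangulation

variable {D : τ.Face → Tri → ℂ} {C : τ.Face → ℂ} {R : τ.Face → ℝ}

lemma IsFaceDisk.exists_immersed {f : τ.Face} {D : Tri → ℂ} {c : ℂ} {r : ℝ} {d : ℂ → S}
    (hF : τ.IsFaceDisk X f D c r d) (hD : τ.IsDevelopment X f D) :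
    IsImmersedEmptyDisk X c r d ∧ ∃ p : Fin 3 → ℂ, Injective p ∧
      {z ∈ closedBall c r | d z ∈ Z} = range p ∧
      d '' convexHull ℝ (range p) = range (τ.char f) := by
  refine ⟨⟨hF.pos, hF.continuousOn, hF.empty, ?_⟩, verts D, hD.verts_injective, ?_, ?_⟩
  · intro z hz
    obtain ⟨U, hU, hzU, F, hF', hev⟩ := hF.translation.2 z hz
    rw [isOpen_ball.nhdsWithin_eq hz] at hev
    have hc := (hF.translation.1.continuousAt (isOpen_ball.mem_nhds hz)).eventually_mem
      (hU.mem_nhds hzU)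
    refine ⟨U, hU, F, hF', _, Filter.inter_mem hev hc, fun w hw => hw.2, fun w hw w' hw' => ?_⟩
    have e1 : F (d w) = w := hw.1
    have e2 : F (d w') = w' := hw'.1
    rw [e1, e2]
  · ext z
    constructor
    · rintro ⟨hz, hzZ⟩
      obtain ⟨i, rfl⟩ := (hF.mem_iff z hz).1 hzZ
      exact mem_range_self i
    · rintro ⟨i, rfl⟩
      have hm : verts D i ∈ closedBall c r := (mem_closedBall_iff_normSq hF.pos).2 (hF.circle i).le
      exact ⟨hm, (hF.mem_iff _ hm).2 ⟨i, rfl⟩⟩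
  · rw [convexHull_eq_range_affTri, ← hD.range_eq, ← range_comp]
    congr 1
    funext x
    exact hF.char_eq x

namespace LocallyDelaunay

lemma exists_convexOn_segment [T2Space S] (hL : LocallyDelaunay τ X D C R) {f : τ.Face} {b : Tri}
    (hb : ∀ i, 0 < b.1 i) {U : Set ℂ} {d : ℂ → S}
    (hU : X.IsStarLift (D f b) (τ.char f b) U d) {z : ℂ} {T : ℝ} (hT0 : 0 < T)
    (hT : ∀ s ∈ Ico 0 T, AffineMap.lineMap (D f b) z s ∈ U) :
    ∃ g : ℝ → ℝ, (∀ s, g s = negPow τ D C R (d (AffineMap.lineMap (D f b) z s)) -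
        (R f ^ 2 - normSq (AffineMap.lineMap (D f b) z s - C f))) ∧
      ∃ δ > 0, ConvexOn ℝ (Ioo (-δ) T) g ∧ g 0 = 0 ∧ ∀ s ∈ Ico 0 T, 0 ≤ g s := by
  set seg : ℝ →ᵃ[ℝ] ℂ := AffineMap.lineMap (D f b) z with hseg
  have hsegc : Continuous seg := AffineMap.lineMap_continuous
  have hseg0 : seg 0 = D f b := AffineMap.lineMap_apply_zero _ _
  refine ⟨_, fun s => rfl, ?_⟩
  set g : ℝ → ℝ := fun s => negPow τ D C R (d (seg s)) - (R f ^ 2 - normSq (seg s - C f))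
    with hg
  have hgQ : ∀ s, g s = (normSq (seg s) + negPow τ D C R (d (seg s))) -
      powDiff (C f) (R f ^ 2) (seg s) := by
    intro s; simp only [hg, powDiff]; ring
  have h0 := (hL.dev f).eventually_interior hU.isOpen hU.translation hU.empty hU.mem hU.base hb
  rw [sub_self] at h0
  have h1 : ∀ᶠ s in 𝓝 (0 : ℝ), seg s ∈ U ∧ g s = 0 := by
    have hc : Tendsto seg (𝓝 0) (𝓝 (D f b)) := hseg0 ▸ hsegc.tendsto 0
    filter_upwards [hc.eventually h0, hc.eventually (hU.isOpen.mem_nhds hU.mem)] with s h1 h2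
    refine ⟨h2, ?_⟩
    rw [hgQ, hL.lift_eq h1.1 h1.2, zero_add, sub_self]
  obtain ⟨δ, hδ, hδb⟩ := eventually_nhds_iff_ball.1 h1
  have hin : ∀ s ∈ Ioo (-δ) T, seg s ∈ U := by
    intro s hs
    by_cases hs0 : 0 ≤ s
    · exact hT s ⟨hs0, hs.2⟩
    · refine (hδb s ?_).1
      rw [mem_ball, Real.dist_eq, sub_zero, abs_lt]
      constructor
      · exact hs.1
      · linarith
  have hconv : ConvexOn ℝ (Ioo (-δ) T) g := by
    refine convexOn_Ioo_of_locally fun s hs => ?_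
    obtain ⟨ρ, hρ, hc⟩ := hL.exists_convexOn_ball hU.isOpen hU.translation hU.empty (hin s hs)
    have hn : seg ⁻¹' ball (seg s) ρ ∈ 𝓝 s :=
      hsegc.continuousAt.preimage_mem_nhds (ball_mem_nhds _ hρ)
    obtain ⟨ρ', hρ', hb'⟩ := Metric.mem_nhds_iff.1 hn
    refine ⟨ρ', hρ', ?_⟩
    have h2 := (hc.comp_affineMap seg).subset hb' (convex_ball s ρ')
    refine ⟨convex_ball s ρ', fun x hx y hy p q hp hq hpq => ?_⟩
    have h3 := h2.2 hx hy hp hq hpq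
    have h4 := powDiff_combo (C f) (R f ^ 2) (seg x) (seg y) hpq
    have h5 : seg (p • x + q • y) = p • seg x + q • seg y := Convex.combo_affine_apply hpq
    rw [hgQ, hgQ, hgQ]
    simp only [comp_apply, smul_eq_mul] at h3 h5 ⊢
    rw [h5] at h3 ⊢
    rw [h4]
    linarith
  have hg0 : g 0 = 0 := (hδb 0 (mem_ball_self hδ)).2
  refine ⟨δ, hδ, hconv, hg0, fun s hs => ?_⟩
  have hm1 : g (-(δ / 2)) = 0 := (hδb _ (by
    rw [mem_ball, Real.dist_eq, sub_zero, abs_neg, abs_of_pos (half_pos hδ)]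
    linarith)).2
  rcases hs.1.eq_or_lt with rfl | h0
  · exact hg0.ge
  have h2 : (0 : ℝ) ∈ openSegment ℝ (-(δ / 2)) s := by
    rw [openSegment_eq_Ioo (by linarith)]
    exact ⟨by linarith, h0⟩
  rw [← hg0]
  exact hconv.le_right_of_left_le ⟨by linarith, by linarith⟩ ⟨by linarith, hs.2⟩ h2
    (hm1.trans hg0.symm).le

lemma dev_mem_ball (hL : LocallyDelaunay τ X D C R) (f : τ.Face) {b : Tri}
    (hb : ∀ i, 0 < b.1 i) : D f b ∈ ball (C f) (R f) :=
  (hL.dev f).mem_ball (hL.pos f) (hL.circle f) (ne_vtx_of_pos hb)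

lemma ball_subset [T2Space S] [CompactSpace S] (hL : LocallyDelaunay τ X D C R) {f : τ.Face}
    {b : Tri} (hb : ∀ i, 0 < b.1 i) {U : Set ℂ} {d : ℂ → S}
    (hU : X.IsStarLift (D f b) (τ.char f b) U d)
    (hmax : ∀ U' d', X.IsStarLift (D f b) (τ.char f b) U' d' → U' ⊆ U) :
    ball (C f) (R f) ⊆ U := by
  intro z hz
  by_contra hzU
  set seg : ℝ →ᵃ[ℝ] ℂ := AffineMap.lineMap (D f b) z with hseg
  have hsegc : Continuous seg := AffineMap.lineMap_continuous
  have hseg0 : seg 0 = D f b := AffineMap.lineMap_apply_zero _ _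
  have hseg1 : seg 1 = z := AffineMap.lineMap_apply_one _ _
  have hcb := hL.dev_mem_ball f hb
  have hK : IsCompact (Icc (0 : ℝ) 1 ∩ seg ⁻¹' Uᶜ) :=
    isCompact_Icc.inter_right (hU.isOpen.isClosed_compl.preimage hsegc)
  obtain ⟨T, hTm, hTl⟩ := hK.exists_isLeast ⟨1, ⟨zero_le_one, le_rfl⟩, by
    rw [mem_preimage, hseg1]; exact hzU⟩
  have hTpos : 0 < T := lt_of_le_of_ne hTm.1.1 fun h => hTm.2 (by rw [← h, hseg0]; exact hU.mem)
  have hT : ∀ s ∈ Ico 0 T, seg s ∈ U := by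
    intro s hs
    by_contra hsU
    exact absurd (hTl ⟨⟨hs.1, hs.2.le.trans hTm.1.2⟩, hsU⟩) (not_le.2 hs.2)
  obtain ⟨g, hg, δ, hδ, hconv, hg0, hgnn⟩ := hL.exists_convexOn_segment hb hU hTpos hT
  have hTb : seg T ∈ ball (C f) (R f) := (convex_ball (C f) (R f)).lineMap_mem hcb hz hTm.1
  obtain ⟨p, hp⟩ : ∃ p, MapClusterPt p (𝓝[<] T) (fun s => d (seg s)) :=
    exists_clusterPt_of_compactSpace _
  have hlt : ∀ᶠ s in 𝓝[<] T, s ∈ Ico 0 T := by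
    filter_upwards [self_mem_nhdsWithin, nhdsWithin_le_nhds (Ioi_mem_nhds hTpos)] with s h1 h2
    exact ⟨h2.le, h1⟩
  have hsT : Tendsto seg (𝓝[<] T) (𝓝 (seg T)) := hsegc.continuousAt.mono_left nhdsWithin_le_nhds
  by_cases hpZ : p ∈ Z
  · have hP := hp.continuousAt_comp hL.continuous_negPow.continuousAt
    rw [hL.negPow_eq_zero hpZ] at hP
    set k := R f ^ 2 - normSq (seg T - C f) with hk
    have hkpos : 0 < k := sub_pos.2 ((mem_ball_iff_normSq (hL.pos f)).1 hTb)
    have h1 : ∀ᶠ s in 𝓝[<] T, k / 2 < R f ^ 2 - normSq (seg s - C f) := by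
      have : Tendsto (fun s => R f ^ 2 - normSq (seg s - C f)) (𝓝[<] T) (𝓝 k) :=
        tendsto_const_nhds.sub (Complex.continuous_normSq.continuousAt.tendsto.comp
          (hsT.sub_const _))
      exact this.eventually (lt_mem_nhds (half_lt_self hkpos))
    have h2 := hP.frequently (gt_mem_nhds (half_pos hkpos))
    obtain ⟨s, hs, h3, h4⟩ := (h2.and_eventually (h1.and hlt)).exists
    have h5 := hgnn s h4
    rw [hg s] at h5
    simp only [comp_apply] at hs
    linarith
  · obtain ⟨ρ, hρ, hsec⟩ := X.exists_section hpZ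
    have h2 := hp.frequently hsec
    obtain ⟨s, hs, h3, h4⟩ := (h2.and_eventually
      ((hsT.eventually (ball_mem_nhds _ hρ)).and hlt)).exists
    obtain ⟨e, he, heZ, hes⟩ := hs (seg s)
    have hcomp : IsCompact (segment ℝ (D f b) (seg s)) := by
      rw [segment_eq_image]; exact isCompact_Icc.image (by fun_prop)
    obtain ⟨η, hη, hsub⟩ := hcomp.exists_thickening_subset_open hU.isOpen
      (hU.star.segment_subset (hT s h4))
    have hself := Metric.self_subset_thickening hη (segment ℝ (D f b) (seg s))
    refine hTm.2 (hU.mem_of_segment hmax Metric.isOpen_thickening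
      ((convex_segment _ _).thickening η) hsub (hself (left_mem_segment ℝ _ _))
      (isOpen_ball) (convex_ball (seg s) ρ) he heZ (hself (right_mem_segment ℝ _ _))
      (mem_ball_self hρ) hes.symm ?_)
    have hT' : seg T ∈ ball (seg s) ρ := by rw [mem_ball, dist_comm]; exact h3
    have hsub2 : segment ℝ (D f b) (seg T) ⊆
        segment ℝ (D f b) (seg s) ∪ segment ℝ (seg s) (seg T) := by
      rw [← hseg0, ← image_segment, ← image_segment, ← image_segment,
        ← image_union, segment_eq_Icc hTpos.le, segment_eq_Icc h4.1, segment_eq_Icc h4.2.le,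
        Icc_union_Icc_eq_Icc h4.1 h4.2.le]
    refine hsub2.trans (union_subset_union hself ?_)
    exact (convex_ball (seg s) ρ).segment_subset (mem_ball_self hρ) hT'

lemma exists_tendsto [T2Space S] [CompactSpace S] (hL : LocallyDelaunay τ X D C R) {f : τ.Face}
    {b : Tri} (hb : ∀ i, 0 < b.1 i) {U : Set ℂ} {d : ℂ → S}
    (hU : X.IsStarLift (D f b) (τ.char f b) U d)
    (hmax : ∀ U' d', X.IsStarLift (D f b) (τ.char f b) U' d' → U' ⊆ U) {z : ℂ}
    (hz : z ∈ closedBall (C f) (R f)) :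
    ∃ p, Tendsto d (𝓝[ball (C f) (R f)] z) (𝓝 p) := by
  classical
  set B := ball (C f) (R f) with hB
  have hBU : B ⊆ U := hL.ball_subset hb hU hmax
  have hcb := hL.dev_mem_ball f hb
  by_cases hzU : z ∈ U
  · exact ⟨d z, (hU.translation.1.continuousAt (hU.isOpen.mem_nhds hzU)).mono_left
      nhdsWithin_le_nhds⟩
  have hclB : z ∈ closure B := by rw [hB, closure_ball _ (hL.pos f).ne']; exact hz
  have hne : (𝓝[B] z).NeBot := mem_closure_iff_nhdsWithin_neBot.1 hclB
  have hclZ : ∀ p, MapClusterPt p (𝓝[B] z) d → p ∈ Z := by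
    intro p hp
    by_contra hpZ
    obtain ⟨ρ, hρ, hsec⟩ := X.exists_section hpZ
    obtain ⟨w, hw, hwB, hwz⟩ := ((hp.frequently hsec).and_eventually
      (Filter.inter_mem (self_mem_nhdsWithin (a := z) (s := B))
        (nhdsWithin_le_nhds (ball_mem_nhds z hρ)))).exists
    obtain ⟨e, he, heZ, hew⟩ := hw w
    refine hzU (hU.mem_of_segment hmax isOpen_ball (convex_ball (C f) (R f)) hBU hcb
      isOpen_ball (convex_ball w ρ) he heZ hwB (mem_ball_self hρ) hew.symm ?_)
    rw [segment_eq_image']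
    rintro _ ⟨s, hs, rfl⟩
    rcases eq_or_lt_of_le hs.2 with rfl | hs1
    · right
      rw [mem_ball, dist_comm] at hwz
      simpa using hwz
    · left
      have := convex_neighbor_mem_ball hcb hz (sub_pos.2 hs1) (by linarith [hs.1])
      convert this using 1
      simp only [real_smul]
      push_cast; ring
  obtain ⟨p, hp⟩ : ∃ p, MapClusterPt p (𝓝[B] z) d := exists_clusterPt_of_compactSpace _
  refine ⟨p, le_nhds_of_unique_clusterPt fun p' hp' => ?_⟩
  change MapClusterPt p' (𝓝[B] z) d at hp'
  by_contra hpp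
  have hpZ := hclZ p hp
  have hpZ' := hclZ p' hp'
  obtain ⟨O₁, O₂, hO₁, hO₂, h1, h2, hdisj⟩ := SeparatedNhds.of_finset_finset {p} (Z.erase p) (by
    rw [Finset.disjoint_singleton_left]; exact Finset.notMem_erase p Z)
  have hZO : ∀ q ∈ Z, q ∈ O₁ ∪ O₂ := by
    intro q hq
    by_cases hqp : q = p
    · left; exact h1 (by simp [hqp])
    · right; exact h2 (by simp [hq, hqp])
  have hev : ∀ᶠ w in 𝓝[B] z, d w ∈ O₁ ∪ O₂ := by
    by_contra hcon
    have hfr : ∃ᶠ w in 𝓝[B] z, d w ∈ (O₁ ∪ O₂)ᶜ := Filter.not_eventually.1 hcon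
    obtain ⟨a, ha, hcl⟩ :=
      (hO₁.union hO₂).isClosed_compl.isCompact.exists_mapClusterPt_of_frequently hfr
    exact ha (hZO a (hclZ a hcl))
  obtain ⟨δ, hδ, hsub⟩ := Metric.mem_nhdsWithin_iff.1 hev
  have hpre : IsPreconnected (d '' (ball z δ ∩ B)) :=
    ((convex_ball z δ).inter (convex_ball _ _)).isPreconnected.image d
      (hU.translation.1.mono (inter_subset_right.trans hBU))
  have hsub' : d '' (ball z δ ∩ B) ⊆ O₁ ∪ O₂ := by rintro _ ⟨w, hw, rfl⟩; exact hsub hw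
  have hin : ∀ᶠ w in 𝓝[B] z, w ∈ ball z δ ∩ B :=
    Filter.inter_mem (nhdsWithin_le_nhds (ball_mem_nhds z hδ)) self_mem_nhdsWithin
  obtain ⟨w, hw, hwm⟩ := ((hp.frequently (hO₁.mem_nhds (h1 (by simp)))).and_eventually hin).exists
  have hpO : p' ∈ O₂ := h2 (by rw [Finset.mem_coe, Finset.mem_erase]; exact ⟨hpp, hpZ'⟩)
  obtain ⟨w', hw', hwm'⟩ := ((hp'.frequently (hO₂.mem_nhds hpO)).and_eventually hin).exists
  have hleft := hpre.subset_left_of_subset_union hO₁ hO₂ hdisj hsub'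
    ⟨d w, mem_image_of_mem d hwm, hw⟩
  exact disjoint_left.1 hdisj (hleft (mem_image_of_mem d hwm')) hw'

lemma exists_isFaceDisk [T2Space S] [CompactSpace S] (hL : LocallyDelaunay τ X D C R)
    (f : τ.Face) : ∃ d, τ.IsFaceDisk X f (D f) (C f) (R f) d := by
  obtain ⟨b, hb⟩ := dense_interior.nonempty
  have hbZ : τ.char f b ∉ Z := fun hmemZ => by
    obtain ⟨i, hi⟩ := (τ.mem_iff f b).1 hmemZ
    exact ne_vtx_of_pos hb i hi
  obtain ⟨U, d, hU, hmax⟩ := X.exists_max_starLift hbZ (D f b)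
  set B := ball (C f) (R f) with hB
  have hBU : B ⊆ U := hL.ball_subset hb hU hmax
  have hcb := hL.dev_mem_ball f hb
  have hD := hL.dev f
  have hcl : closure B = closedBall (C f) (R f) := closure_ball _ (hL.pos f).ne'
  set e := extendFrom B d with he
  have heB : ∀ z ∈ B, e z = d z := fun z hz => extendFrom_eq (subset_closure hz)
    ((hU.translation.1.continuousAt (hU.isOpen.mem_nhds (hBU hz))).mono_left nhdsWithin_le_nhds)
  have hcont : ContinuousOn e (closedBall (C f) (R f)) :=
    continuousOn_extendFrom hcl.ge fun z hz => hL.exists_tendsto hb hU hmax hz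
  have hE : IsEmptyDisk X (C f) (R f) e :=
    ⟨hL.pos f, hcont, fun z hz => by rw [heB z hz]; exact hU.empty z (hBU hz),
      (hU.translation.mono hBU).congr heB⟩
  have hchar : ∀ x, e (D f x) = τ.char f x := by
    intro x
    have := IsFaceDisk.eqOn_dev hE hD hcb (y := b) (by rw [heB _ hcb, hU.base])
      (hD.mem_closedBall (hL.pos f) (hL.circle f) x) (by
        rw [sub_self, sub_zero]; exact mem_range_self x)
    rwa [sub_self, sub_zero, hD.devInv_apply] at this
  refine ⟨e, hE, hL.circle f, hchar, fun z hz => ⟨fun hzZ => ?_, ?_⟩⟩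
  swap
  · rintro ⟨i, rfl⟩
    rw [verts, hchar]; exact τ.char_vtx_mem f i
  by_contra hnv
  push Not at hnv
  have hzB : z ∉ B := fun h => hE.empty z h hzZ
  have hzc : normSq (z - C f) = R f ^ 2 := le_antisymm ((mem_closedBall_iff_normSq (hL.pos f)).1 hz)
      (not_lt.1 fun h => hzB ((mem_ball_iff_normSq (hL.pos f)).2 h))
  set seg : ℝ →ᵃ[ℝ] ℂ := AffineMap.lineMap (D f b) z with hseg
  have hsegc : Continuous seg := AffineMap.lineMap_continuous
  have hseg0 : seg 0 = D f b := AffineMap.lineMap_apply_zero _ _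
  have hseg1 : seg 1 = z := AffineMap.lineMap_apply_one _ _
  have hsB : ∀ s ∈ Ico (0 : ℝ) 1, seg s ∈ B := by
    intro s hs
    have := convex_neighbor_mem_ball hcb hz (sub_pos.2 hs.2) (by linarith [hs.1])
    convert this using 1
    rw [hseg, AffineMap.lineMap_apply]
    simp only [vsub_eq_sub, vadd_eq_add, real_smul]
    push_cast; ring
  obtain ⟨g, hg, δ, hδ, hconv, hg0, hgnn⟩ :=
    hL.exists_convexOn_segment hb hU zero_lt_one fun s hs => hBU (hsB s hs)
  have hlim : Tendsto g (𝓝[<] 1) (𝓝 0) := by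
    have h1 : Tendsto (fun s => negPow τ D C R (e (seg s)) -
        (R f ^ 2 - normSq (seg s - C f))) (𝓝[<] 1) (𝓝 0) := by
      have hs1 : Tendsto seg (𝓝[<] 1) (𝓝 z) :=
        hseg1 ▸ hsegc.continuousAt.mono_left nhdsWithin_le_nhds
      have hin : ∀ᶠ s in 𝓝[<] (1 : ℝ), seg s ∈ closedBall (C f) (R f) := by
        filter_upwards [self_mem_nhdsWithin, nhdsWithin_le_nhds (Ioi_mem_nhds zero_lt_one)]
          with s h1 h2
        exact ball_subset_closedBall (hsB s ⟨le_of_lt h2, h1⟩)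
      have he1 : Tendsto (fun s => e (seg s)) (𝓝[<] 1) (𝓝 (e z)) :=
        (hcont z hz).tendsto.comp (tendsto_nhdsWithin_iff.2 ⟨hs1, hin⟩)
      have h2 := (hL.continuous_negPow.continuousAt.tendsto.comp he1).sub
        ((tendsto_const_nhds (x := R f ^ 2)).sub
          (Complex.continuous_normSq.continuousAt.tendsto.comp (hs1.sub_const (C f))))
      rw [hL.negPow_eq_zero hzZ, hzc, sub_self, sub_self] at h2
      exact h2
    refine h1.congr' ?_
    filter_upwards [self_mem_nhdsWithin, nhdsWithin_le_nhds (Ioi_mem_nhds zero_lt_one)]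
      with s h1 h2
    rw [hg s, heB _ (hsB s ⟨le_of_lt h2, h1⟩)]
  have hgz : ∀ s ∈ Ioo (0 : ℝ) 1, g s ≤ 0 := by
    refine fun s hs => ge_of_tendsto hlim ?_
    filter_upwards [self_mem_nhdsWithin, nhdsWithin_le_nhds (Ioi_mem_nhds hs.2)] with s' h1 h2
    refine hconv.le_right_of_left_le (x := 0) ⟨by linarith, one_pos⟩
      ⟨by linarith [hs.1, mem_Ioi.1 h2], h1⟩ ?_ (hg0.trans_le (hgnn s ⟨hs.1.le, hs.2⟩))
    rw [openSegment_eq_Ioo (hs.1.trans h2)]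
    exact ⟨hs.1, h2⟩
  have hzr : z ∉ range (D f) := by
    rintro ⟨x, rfl⟩
    refine hzB (hD.mem_ball (hL.pos f) (hL.circle f) ?_)
    rintro i rfl
    exact hnv i rfl
  have hK : IsCompact (Icc (0 : ℝ) 1 ∩ seg ⁻¹' range (D f)) :=
    isCompact_Icc.inter_right ((isClosed_range_dev hD).preimage hsegc)
  obtain ⟨T, hTm, hTg⟩ := hK.exists_isGreatest ⟨0, ⟨le_rfl, zero_le_one⟩, by
    rw [mem_preimage, hseg0]; exact mem_range_self b⟩
  have hT1 : T < 1 := lt_of_le_of_ne hTm.1.2 fun h => hzr (by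
    have := hTm.2
    rwa [mem_preimage, h, hseg1] at this)
  obtain ⟨x, hx⟩ := hTm.2
  have hTB := hsB T ⟨hTm.1.1, hT1⟩
  have hdx : e (seg T) = τ.char f x := by rw [← hx, hchar]
  have hout : ∀ s ∈ Ioc T 1, seg s ∉ range (D f) := by
    intro s hs hsr
    exact absurd (hTg ⟨⟨hTm.1.1.trans hs.1.le, hs.2⟩, hsr⟩) (not_le.2 hs.1)
  have hnear : Tendsto seg (𝓝[>] T) (𝓝 (seg T)) := hsegc.continuousAt.mono_left nhdsWithin_le_nhds
  have hlt1 : ∀ᶠ s in 𝓝[>] T, s ∈ Ioo T 1 := by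
    filter_upwards [self_mem_nhdsWithin, nhdsWithin_le_nhds (Iio_mem_nhds hT1)] with s h1 h2
    exact ⟨h1, h2⟩
  rcases x.cases with hpos | ⟨i, s₀, h0, h1, rfl⟩ | ⟨i, rfl⟩
  · have hev := hD.eventually_interior isOpen_ball hE.translation hE.empty hTB hdx hpos
    rw [hx, sub_self] at hev
    obtain ⟨s, hs, hs1⟩ := ((hnear.eventually hev).and hlt1).exists
    rw [sub_zero] at hs
    exact hout s ⟨hs1.1, hs1.2.le⟩ hs.1
  · have hev := IsDevelopment.eventually_edge (h := (f, i)) hD (hL.dev (τ.opp (f, i)).1)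
      isOpen_ball hE.translation hE.empty hTB h0 h1 hdx rfl rfl
    obtain ⟨k, hk, hsub⟩ := hL.powDiff_sub (f, i) s₀ (z₀ := seg T) rfl rfl
    obtain ⟨s, hs, hs1⟩ := ((hnear.eventually hev).and hlt1).exists
    have hsub := hsub (seg s)
    have ht0 : seg T - D f (side i s₀) = 0 := by rw [hx, sub_self]
    simp only [ht0, sub_zero, zero_add] at hs hsub
    have hneg : bary (verts (D f)) i (seg s) < 0 := by
      by_contra hcon
      exact hout s ⟨hs1.1, hs1.2.le⟩ (hs.1 (not_lt.1 hcon)).1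
    obtain ⟨a1, a2⟩ := hs.2 hneg.le
    have hlift := hL.lift_eq a1 a2
    have hs01 : s ∈ Ioo (0 : ℝ) 1 := ⟨hTm.1.1.trans_lt hs1.1, hs1.2⟩
    have hgs := hgz s hs01
    rw [hg s, ← heB _ (hsB s ⟨hs01.1.le, hs01.2⟩)] at hgs
    have hpd : powDiff (C f) (R f ^ 2) (seg s) = normSq (seg s) -
      normSq (seg s - C f) + R f ^ 2 := rfl
    have : 0 < -k * bary (verts (D f)) i (seg s) := by nlinarith
    linarith
  · exact hE.empty _ hTB (hdx ▸ τ.char_vtx_mem f i)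

lemma isNondegenerateDelaunay [T2Space S] [CompactSpace S] (hL : LocallyDelaunay τ X D C R) :
    τ.IsNondegenerateDelaunay X := by
  refine ⟨fun f => ⟨D f, hL.dev f⟩, fun f => ?_⟩
  obtain ⟨d, hd⟩ := hL.exists_isFaceDisk f
  exact ⟨C f, R f, d, hd.exists_immersed (hL.dev f)⟩

end LocallyDelaunay

end Triangulation

/-! ### Angles of plane triangles -/

lemma inner_eq_re_im (u w : ℂ) : inner ℝ u w = u.re * w.re + u.im * w.im := by
  rw [Complex.inner]; simp; ring

lemma cos_angle_mul (u w : ℂ) : cos (InnerProductGeometry.angle u w) * (‖u‖ * ‖w‖) =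
    u.re * w.re + u.im * w.im := by
  rw [InnerProductGeometry.cos_angle_mul_norm_mul_norm, inner_eq_re_im]

lemma sin_angle_mul (u w : ℂ) : sin (InnerProductGeometry.angle u w) * (‖u‖ * ‖w‖) =
    |cross u w| := by
  rw [InnerProductGeometry.sin_angle_mul_norm_mul_norm, inner_eq_re_im, inner_eq_re_im,
    inner_eq_re_im, ← Real.sqrt_sq_eq_abs]
  congr 1
  simp only [cross]; ring

lemma ne_zero_of_cross {u w : ℂ} {ε : ℝ} (h : 0 < ε * cross u w) : u ≠ 0 ∧ w ≠ 0 := by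
  constructor <;> (rintro rfl; simp [cross] at h)

lemma abs_cross {u w : ℂ} {ε : ℝ} (hε : ε = 1 ∨ ε = -1) (h : 0 < ε * cross u w) :
    |cross u w| = ε * cross u w := by
  rcases hε with rfl | rfl
  · rw [one_mul] at *; exact abs_of_pos h
  · rw [neg_one_mul] at *; exact abs_of_neg (neg_pos.1 h)

lemma angle_mem_Ioo {u w : ℂ} {ε : ℝ} (hε : ε = 1 ∨ ε = -1) (h : 0 < ε * cross u w) :
    InnerProductGeometry.angle u w ∈ Ioo 0 π := by
  have h1 := sin_angle_mul u w
  rw [abs_cross hε h] at h1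
  have hs : sin (InnerProductGeometry.angle u w) ≠ 0 := by
    intro h0
    rw [h0, zero_mul] at h1
    linarith
  refine ⟨lt_of_le_of_ne (InnerProductGeometry.angle_nonneg _ _) fun h0 => hs ?_,
    lt_of_le_of_ne (InnerProductGeometry.angle_le_pi _ _) fun h0 => hs ?_⟩
  · rw [← h0, Real.sin_zero]
  · rw [h0, Real.sin_pi]

lemma exp_I_mul_re_im (ε θ : ℝ) (hε : ε = 1 ∨ ε = -1) :
    exp (I * (ε * θ)) = cos θ + ε * sin θ * I := by
  rcases hε with rfl | rfl
  · rw [mul_comm, exp_mul_I]; push_cast; ring_nf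
  · rw [mul_comm, exp_mul_I]
    push_cast
    rw [neg_one_mul, Complex.cos_neg, Complex.sin_neg]; ring

lemma eq_exp_mul {u w : ℂ} {ε : ℝ} (hε : ε = 1 ∨ ε = -1) (h : 0 < ε * cross u w) :
    (‖u‖ : ℂ) * w = ‖w‖ * exp (I * (ε * InnerProductGeometry.angle u w)) * u := by
  obtain ⟨hu, hw⟩ := ne_zero_of_cross h
  have h1 := cos_angle_mul u w
  have h2 := sin_angle_mul u w
  rw [abs_cross hε h] at h2
  have hε2 : ε * ε = 1 := by rcases hε with rfl | rfl <;> norm_num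
  have hnu : ‖u‖ ^ 2 = u.re * u.re + u.im * u.im := by rw [← normSq_eq_norm_sq, normSq_apply]
  have hne : (‖u‖ : ℂ) ≠ 0 := by exact_mod_cast norm_ne_zero_iff.2 hu
  rw [exp_I_mul_re_im _ _ hε]
  apply mul_left_cancel₀ hne
  simp only [cross] at h2
  generalize cos (InnerProductGeometry.angle u w) = c at *
  generalize sin (InnerProductGeometry.angle u w) = s at *
  apply Complex.ext
  · simp only [mul_re, mul_im, add_re, add_im, ofReal_re, ofReal_im, I_re, I_im]
    linear_combination w.re * hnu - u.re * h1 + ε * u.im * h2 +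
      (u.im * (u.re * w.im - u.im * w.re)) * hε2
  · simp only [mul_re, mul_im, add_re, add_im, ofReal_re, ofReal_im, I_re, I_im]
    linear_combination w.im * hnu - u.im * h1 - ε * u.re * h2 -
      (u.re * (u.re * w.im - u.im * w.re)) * hε2

lemma cross_exp_mul {u : ℂ} {ε ρ θ : ℝ} (hε : ε = 1 ∨ ε = -1) :
    ε * cross u (ρ * exp (I * (ε * θ)) * u) = ρ * sin θ * normSq u := by
  have hε2 : ε * ε = 1 := by rcases hε with rfl | rfl <;> norm_num
  rw [exp_I_mul_re_im _ _ hε]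
  generalize sin θ = s
  generalize cos θ = c
  simp only [cross, normSq_apply, mul_re, mul_im, add_re, add_im, ofReal_re, ofReal_im, I_re, I_im]
  linear_combination (ρ * s * (u.re * u.re + u.im * u.im)) * hε2

lemma angle_exp_mul {u : ℂ} (hu : u ≠ 0) {ε ρ θ : ℝ} (hε : ε = 1 ∨ ε = -1) (hρ : 0 < ρ)
    (hθ : θ ∈ Ioo 0 π) :
    InnerProductGeometry.angle u (ρ * exp (I * (ε * θ)) * u) = θ := by
  refine Real.injOn_cos ⟨InnerProductGeometry.angle_nonneg _ _,
    InnerProductGeometry.angle_le_pi _ _⟩ ⟨hθ.1.le, hθ.2.le⟩ ?_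
  have h1 := cos_angle_mul u (ρ * exp (I * (ε * θ)) * u)
  have hn : ‖(ρ : ℂ) * exp (I * (ε * θ)) * u‖ = ρ * ‖u‖ := by
    rw [norm_mul, norm_mul, norm_real, Real.norm_eq_abs, abs_of_pos hρ, mul_comm I,
      ← Complex.ofReal_mul, Complex.norm_exp_ofReal_mul_I, mul_one]
  rw [hn, exp_I_mul_re_im _ _ hε] at h1
  rw [exp_I_mul_re_im _ _ hε]
  have hnu : ‖u‖ ^ 2 = u.re * u.re + u.im * u.im := by rw [← normSq_eq_norm_sq, normSq_apply]
  have hpos : 0 < ρ * ‖u‖ ^ 2 := by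
    have := norm_pos_iff.2 hu
    positivity
  generalize InnerProductGeometry.angle u _ = φ at *
  apply mul_right_cancel₀ hpos.ne'
  simp at h1
  rw [← Complex.ofReal_cos, ← Complex.ofReal_sin] at h1
  simp only [ofReal_re] at h1
  linear_combination h1 - ρ * cos θ * hnu

lemma sin_pos_iff_lt_pi {x : ℝ} (h0 : 0 < x) (h2 : x < 2 * π) : 0 < sin x ↔ x < π := by
  constructor
  · intro h
    by_contra hcon
    push Not at hcon
    have : 0 ≤ sin (x - π) := Real.sin_nonneg_of_nonneg_of_le_pi (by linarith) (by linarith)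
    rw [Real.sin_sub_pi] at this
    linarith
  · exact fun h => sin_pos_of_pos_of_lt_pi h0 h

/-- The incircle determinant. -/
lemma incircle_identity (A B C Q c : ℂ) {r : ℝ} (hA : normSq (A - c) = r ^ 2)
    (hB : normSq (B - c) = r ^ 2) (hC : normSq (C - c) = r ^ 2) :
    cross (B - A) (C - A) * ((C - Q).re * (B - Q).re + (C - Q).im * (B - Q).im) +
      cross (C - Q) (B - Q) * ((B - A).re * (C - A).re + (B - A).im * (C - A).im) =
    cross (B - A) (C - A) * (normSq (Q - c) - r ^ 2) := by
  simp only [cross, normSq_apply, sub_re, sub_im] at *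
  linear_combination
    ((C.re - Q.re) * (B.im - Q.im) - (C.im - Q.im) * (B.re - Q.re)) * hA -
    ((C.re - Q.re) * (A.im - Q.im) - (C.im - Q.im) * (A.re - Q.re)) * hB +
    ((B.re - Q.re) * (A.im - Q.im) - (B.im - Q.im) * (A.re - Q.re)) * hC

lemma angle_add_angle_lt_pi_iff (A B C Q c : ℂ) {r ε : ℝ} (hε : ε = 1 ∨ ε = -1)
    (hA : normSq (A - c) = r ^ 2)
    (hB : normSq (B - c) = r ^ 2) (hC : normSq (C - c) = r ^ 2)
    (h1 : 0 < ε * cross (B - A) (C - A)) (h2 : 0 < ε * cross (C - Q) (B - Q)) :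
    InnerProductGeometry.angle (B - A) (C - A) + InnerProductGeometry.angle (C - Q) (B - Q) <
      π ↔ r ^ 2 < normSq (Q - c) := by
  have m1 := angle_mem_Ioo hε h1
  have m2 := angle_mem_Ioo hε h2
  rw [← sin_pos_iff_lt_pi (by linarith [m1.1, m2.1]) (by linarith [m1.2, m2.2]), Real.sin_add]
  have c1 := cos_angle_mul (B - A) (C - A)
  have c2 := cos_angle_mul (C - Q) (B - Q)
  have s1 := sin_angle_mul (B - A) (C - A)
  have s2 := sin_angle_mul (C - Q) (B - Q)
  rw [abs_cross hε h1] at s1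
  rw [abs_cross hε h2] at s2
  obtain ⟨n1, n2⟩ := ne_zero_of_cross h1
  obtain ⟨n3, n4⟩ := ne_zero_of_cross h2
  have hN : 0 < (‖B - A‖ * ‖C - A‖) * (‖C - Q‖ * ‖B - Q‖) := by positivity
  have hid := incircle_identity A B C Q c hA hB hC
  set N1 := ‖B - A‖ * ‖C - A‖
  set N2 := ‖C - Q‖ * ‖B - Q‖
  generalize InnerProductGeometry.angle (B - A) (C - A) = α at *
  generalize InnerProductGeometry.angle (C - Q) (B - Q) = β at *
  have key : (sin α * cos β + cos α * sin β) * (N1 * N2) =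
      ε * cross (B - A) (C - A) * (normSq (Q - c) - r ^ 2) := by
    calc (sin α * cos β + cos α * sin β) * (N1 * N2) =
        (sin α * N1) * (cos β * N2) + (cos α * N1) * (sin β * N2) := by ring
      _ = _ := by rw [s1, s2, c1, c2]; linear_combination ε * hid
  constructor
  · intro h
    have h3 := mul_pos h hN
    rw [key] at h3
    have := (mul_pos_iff_of_pos_left h1).1 h3
    linarith
  · intro h
    have h3 := mul_pos h1 (sub_pos.2 h)
    rw [← key] at h3
    exact (mul_pos_iff_of_pos_right hN).1 h3

namespace Triangulation

variable {f : τ.Face} {D : Tri → ℂ}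

/-- The angle at the corner `a` of the triangles with edge vectors `v`. -/
def cornerAngle (τ : Triangulation Z) (v : τ.Corner → ℂ) (a : τ.Corner) : ℝ :=
  InnerProductGeometry.angle (v (a.1, a.2 + 2)) (-v (a.1, a.2 + 1))

/-- The triangles with edge vectors `v` are nondegenerate, with orientation `ε`. -/
def IsOriented (τ : Triangulation Z) (ε : ℝ) (v : τ.Corner → ℂ) : Prop :=
  ∀ a : τ.Corner, 0 < ε * cross (v (a.1, a.2 + 2)) (-v (a.1, a.2 + 1))

lemma IsDevelopment.edgeVec_add_two (hD : τ.IsDevelopment X f D) (i : Fin 3) :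
    τ.edgeVec X (f, i + 2) = verts D (i + 1) - verts D i := by
  rw [hD.edgeVec_eq, fin3_add_two_add_one, fin3_add_two_add_two]

lemma IsDevelopment.neg_edgeVec_add_one (hD : τ.IsDevelopment X f D) (i : Fin 3) :
    -τ.edgeVec X (f, i + 1) = verts D (i + 2) - verts D i := by
  rw [hD.edgeVec_eq, fin3_add_one_add_one, fin3_add_one_add_two, neg_sub]

lemma angle_eq_cornerAngle (hg : τ.IsGeometric X) (a : τ.Corner) :
    τ.angle X a = τ.cornerAngle (τ.edgeVec X) a := by
  have h := hg a.1
  rw [angle, dif_pos h, cornerAngle, h.choose_spec.edgeVec_add_two,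
    h.choose_spec.neg_edgeVec_add_one]
  rfl

lemma IsDevelopment.area_eq_cross (hD : τ.IsDevelopment X f D) (i : Fin 3) :
    area (verts D) = cross (τ.edgeVec X (f, i + 2)) (-τ.edgeVec X (f, i + 1)) := by
  rw [hD.edgeVec_add_two, hD.neg_edgeVec_add_one, area_eq _ i]
  simp only [cross, sub_re, sub_im]; ring

lemma exists_isOriented [T2Space S] [ConnectedSpace S] (hg : τ.IsGeometric X) :
    ∃ ε : ℝ, (ε = 1 ∨ ε = -1) ∧ τ.IsOriented ε (τ.edgeVec X) := by
  obtain ⟨ε, hε, h⟩ := exists_sign hg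
  refine ⟨ε, hε, fun a => ?_⟩
  obtain ⟨D, hD⟩ := hg a.1
  rw [← hD.area_eq_cross]
  exact h _ D hD

lemma angle_mem_angleSpace [T2Space S] [ConnectedSpace S] (hg : τ.IsGeometric X) :
    τ.angle X ∈ angleSpace τ := by
  obtain ⟨ε, hε, h⟩ := exists_isOriented hg
  refine ⟨fun a => ?_, fun f => ?_⟩
  · rw [angle_eq_cornerAngle hg]
    exact angle_mem_Ioo hε (h a)
  · obtain ⟨D, hD⟩ := hg f
    have h1 : ∀ i, τ.angle X (f, i) =
        EuclideanGeometry.angle (verts D (i + 1)) (verts D i) (verts D (i + 2)) := by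
      intro i
      rw [angle_eq_cornerAngle hg, cornerAngle, hD.edgeVec_add_two, hD.neg_edgeVec_add_one]
      rfl
    rw [Fin.sum_univ_three, h1, h1, h1]
    have h2 := EuclideanGeometry.angle_add_angle_add_angle_eq_pi (p₁ := verts D 1) (p₂ := verts D 0)
      (verts D 2) (fun h => absurd (hD.verts_injective h) (by decide))
    simp
    linarith

/-- Nondegenerate Delaunay triangulations are those with opposite angles of sum less than `π`. -/
lemma isNondegenerateDelaunay_iff [T2Space S] [CompactSpace S] [ConnectedSpace S]
    (hg : τ.IsGeometric X) :
    τ.IsNondegenerateDelaunay X ↔ ∀ h, τ.angle X h + τ.angle X (τ.opp h) < π := by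
  obtain ⟨ε, hε, hor⟩ := exists_isOriented hg
  choose D hD using hg
  have key : ∀ (h : τ.Corner) (s : 𝕀) (c : ℂ) (r : ℝ), (∀ i, normSq (verts (D h.1) i - c) = r ^ 2) →
      (τ.angle X h + τ.angle X (τ.opp h) < π ↔ r ^ 2 < normSq
        (verts (D (τ.opp h).1) (τ.opp h).2 + (D h.1 (side h.2 s) -
          D (τ.opp h).1 (side (τ.opp h).2 (σ₀ s))) - c)) := by
    intro h s c r hc
    set t := D h.1 (side h.2 s) - D (τ.opp h).1 (side (τ.opp h).2 (σ₀ s)) with ht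
    have h1 : verts (D (τ.opp h).1) ((τ.opp h).2 + 1) + t = verts (D h.1) (h.2 + 2) := by
      have := (hD h.1).sub_side_eq (hD (τ.opp h).1) s 1
      rw [← ht, unitInterval.symm_one, side_zero, side_one] at this
      rw [this, verts, verts]; ring
    have h2 : verts (D (τ.opp h).1) ((τ.opp h).2 + 2) + t = verts (D h.1) (h.2 + 1) := by
      have := (hD h.1).sub_side_eq (hD (τ.opp h).1) s 0
      rw [← ht, unitInterval.symm_zero, side_zero, side_one] at this
      rw [this, verts, verts]; ring
    have o1 := hor h
    have o2 := hor (τ.opp h)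
    have a1 := angle_eq_cornerAngle (fun f => ⟨D f, hD f⟩) h
    have a2 := angle_eq_cornerAngle (fun f => ⟨D f, hD f⟩) (τ.opp h)
    rw [cornerAngle, (hD _).edgeVec_add_two, (hD _).neg_edgeVec_add_one] at a1 a2
    rw [(hD _).edgeVec_add_two, (hD _).neg_edgeVec_add_one] at o1 o2
    have f1 : verts (D (τ.opp h).1) ((τ.opp h).2 + 1) - verts (D (τ.opp h).1) (τ.opp h).2 =
      verts (D h.1) (h.2 + 2) - (verts (D (τ.opp h).1) (τ.opp h).2 + t) := by rw [← h1]; ring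
    have f2 : verts (D (τ.opp h).1) ((τ.opp h).2 + 2) - verts (D (τ.opp h).1) (τ.opp h).2 =
      verts (D h.1) (h.2 + 1) - (verts (D (τ.opp h).1) (τ.opp h).2 + t) := by rw [← h2]; ring
    rw [f1, f2] at a2 o2
    rw [a1, a2]
    exact angle_add_angle_lt_pi_iff _ _ _ _ _ hε (hc _) (hc _) (hc _) o1 o2
  constructor
  · intro hN h
    obtain ⟨c, r, d, hF⟩ := hN.exists_isFaceDisk (hD h.1)
    rw [key h 0 c r hF.circle]
    exact hF.lt_apex (hD h.1) (hD (τ.opp h).1) 0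
  · intro hlt
    choose C R hR hC using fun f => exists_circumcircle (hD f).area_ne_zero
    exact LocallyDelaunay.isNondegenerateDelaunay (D := D) (C := C) (R := R)
      ⟨hD, hR, hC, fun h s => (key h s _ _ (hC h.1)).1 (hlt h)⟩

end Triangulation

/-! ### Symmetries of a Delaunay triangulation -/

lemma fin3_injective_cases (σ : Fin 3 → Fin 3) (h : Injective σ) :
    (∃ s, ∀ i, σ i = i + s) ∨ ∃ s, ∀ i, σ i = s - i := by
  revert h; revert σ; decide

lemma area_rotate (P : Fin 3 → ℂ) (s : Fin 3) : area (fun i => P (i + s)) = area P := by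
  fin_cases s <;> simp [area, cross] <;> ring

lemma area_reflect (P : Fin 3 → ℂ) (s : Fin 3) : area (fun i => P (s - i)) = -area P := by
  have e : (-1 : Fin 3) = 2 ∧ (-2 : Fin 3) = 1 := by decide
  fin_cases s <;> simp [area, cross, e] <;> ring

lemma area_neg_add (P : Fin 3 → ℂ) (t : ℂ) : area (fun i => -P i + t) = area P := by
  simp [area, cross]; ring

lemma bary_neg_add (P : Fin 3 → ℂ) (t : ℂ) (i : Fin 3) (z : ℂ) :
    bary (fun i => -P i + t) i (-z + t) = bary P i z := by
  rw [bary, bary, area_neg_add]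
  congr 1
  simp [cross]; ring

lemma bary_rotate (P : Fin 3 → ℂ) (s i : Fin 3) (z : ℂ) :
    bary (fun i => P (i + s)) i z = bary P (i + s) z := by
  rw [bary, bary, area_rotate]
  have h : ∀ k : Fin 3, i + k + s = i + s + k := fun k => by rw [add_right_comm]
  simp only [h]

namespace Triangulation

lemma IsNondegenerateDelaunay.exists_face_map [T2Space S] (hN : τ.IsNondegenerateDelaunay X)
    {F : S ≃ₜ S} (hF : IsIso ((-1 : ℂˣ) • X) X F) (hZ : ∀ p, F p ∈ Z ↔ p ∈ Z)
    {D : τ.Face → Tri → ℂ} (hD : ∀ f, τ.IsDevelopment X f (D f)) (φ : τ.Face) :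
    ∃ g t, ∃ y : Tri → Tri, Continuous y ∧ Bijective y ∧
      (∀ x, D g (y x) = -D φ x + t) ∧ ∀ x, F (τ.char φ x) = τ.char g (y x) := by
  obtain ⟨c, r, d, hd⟩ := hN.exists_isFaceDisk (hD φ)
  have hnb : ∀ z, z ∈ ball (-c) r ↔ -z ∈ ball c r := by
    intro z
    rw [mem_ball, mem_ball, ← dist_neg_neg, neg_neg]
  have hncb : ∀ z, z ∈ closedBall (-c) r ↔ -z ∈ closedBall c r := by
    intro z
    rw [mem_closedBall, mem_closedBall, ← dist_neg_neg, neg_neg]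
  set e : ℂ → S := fun z => F (d (-z)) with he
  have hE : IsEmptyDisk X (-c) r e := by
    refine ⟨hd.pos, F.continuous.comp_continuousOn (hd.continuousOn.comp continuous_neg.continuousOn
      fun z hz => (hncb z).1 hz), fun z hz => ?_, ?_⟩
    · rw [he, hZ]; exact hd.empty _ ((hnb z).1 hz)
    · exact (hd.translation.neg.comp_pullsBack F.continuous hF.1).mono fun z hz => (hnb z).1 hz
  set P : Fin 3 → ℂ := fun i => -verts (D φ) i with hP
  have hPa : area P = area (verts (D φ)) := by
    have := area_neg_add (verts (D φ)) 0
    simpa [hP] using this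
  have hPne : area P ≠ 0 := hPa ▸ (hD φ).area_ne_zero
  have hPinj : Injective P := neg_injective.comp (hD φ).verts_injective
  have hcirc : ∀ i, normSq (P i - -c) = r ^ 2 := by
    intro i
    rw [← hd.circle i, ← Complex.normSq_neg]
    congr 1; simp only [hP]; ring
  have hmem : ∀ z ∈ closedBall (-c) r, e z ∈ Z ↔ ∃ i, z = P i := by
    intro z hz
    rw [he, hZ, hd.mem_iff _ ((hncb z).1 hz)]
    simp only [hP, neg_eq_iff_eq_neg]
  obtain ⟨b, hb⟩ := dense_interior.nonempty
  obtain ⟨g, y₀, hy₀⟩ := τ.cover (e (affTri P b))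
  obtain ⟨c', r', d', hd'⟩ := hN.exists_isFaceDisk (hD g)
  obtain ⟨hv, heq⟩ := hd'.eq_of_common_point (hD g) hE hPne hPinj hcirc hmem hb hy₀.symm rfl
  set t := affTri P b - D g y₀ with ht
  choose σ hσ using hv
  have hσinj : Injective σ := fun i j hij => hPinj (by rw [hσ, hσ, hij])
  have hσsurj := Finite.injective_iff_surjective.1 hσinj
  have hPt : (fun i => P i - t) = verts (D g) ∘ σ := by funext i; rw [hσ]; simp
  have hrange : range (D g) = range (affTri fun i => P i - t) := by
    rw [(hD g).range_eq, ← convexHull_eq_range_affTri, ← convexHull_eq_range_affTri, hPt,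
      hσsurj.range_comp]
  have haff : ∀ w : Tri, affTri (fun i => P i - t) w = -affTri (verts (D φ)) w - t := by
    intro w
    rw [affTri_eq _ w 0, affTri_eq _ w 0]
    simp only [hP]; ring
  have hex : ∀ x, ∃ y, D g y = -D φ x + -t := by
    intro x
    obtain ⟨w, hw⟩ : D φ x ∈ range (affTri (verts (D φ))) := (hD φ).range_eq ▸ mem_range_self x
    have : -D φ x + -t ∈ range (D g) := by rw [hrange]; exact ⟨w, by rw [haff, hw]; ring⟩
    exact this
  choose y hy using hex
  refine ⟨g, -t, y, ?_, ⟨?_, ?_⟩, hy, fun x => ?_⟩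
  · have hce : IsClosedEmbedding (D g) := (hD g).continuous.isClosedEmbedding (hD g).2.2.1
    rw [hce.isEmbedding.isInducing.continuous_iff]
    have : D g ∘ y = fun x => -D φ x + -t := funext hy
    rw [this]
    exact (hD φ).continuous.neg.add continuous_const
  · intro x x' hxx
    have h1 := hy x
    rw [hxx, hy x'] at h1
    exact ((hD φ).2.2.1 (neg_injective (add_right_cancel h1))).symm
  · intro w
    obtain ⟨u, hu⟩ : D g w ∈ range (affTri fun i => P i - t) := hrange ▸ mem_range_self w
    obtain ⟨x, hx⟩ : affTri (verts (D φ)) u ∈ range (D φ) := (hD φ).range_eq ▸ mem_range_self u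
    refine ⟨x, (hD g).2.2.1 ?_⟩
    rw [hy, hx, ← hu, haff]; ring
  · have h1 : -D φ x ∈ closedBall (-c) r := by
      rw [hncb, neg_neg]; exact (hD φ).mem_closedBall hd.pos hd.circle x
    have h2 := heq _ h1
    rw [he] at h2
    simp only [neg_neg] at h2
    rw [hd.char_eq] at h2
    rw [h2, ← hd'.char_eq, hy]
    congr 1

/-- A combinatorial symmetry of the triangulation that acts as `-1` on cocycles. -/
structure IsSymmetry (τ : Triangulation Z) (ι : τ.Corner → τ.Corner) : Prop where
  bijective : Bijective ι
  rotate : ∀ f i j, ι (f, i + j) = ((ι (f, i)).1, (ι (f, i)).2 + j)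
  opp : ∀ h, ι (τ.opp h) = τ.opp (ι h)
  neg : ∀ α, τ.IsCocycle α → ∀ h, α (ι h) = -α h

/-- The integral of the cocycle `α` over a singular simplex. -/
def integral [T2Space S] {α : τ.Corner → ℂ} (hα : τ.IsCocycle α)
    (σ : C(stdSimplex ℝ (Fin 2), S)) : ℂ :=
  ((plSystem hα).exists_along σ.continuous).choose (vertex 1) -
    ((plSystem hα).exists_along σ.continuous).choose (vertex 0)

lemma integral_eq [T2Space S] {α : τ.Corner → ℂ} (hα : τ.IsCocycle α)
    (σ : C(stdSimplex ℝ (Fin 2), S)) {E : stdSimplex ℝ (Fin 2) → ℂ}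
    (hE : (plSystem hα).Along σ E) :
    integral hα σ = E (vertex 1) - E (vertex 0) := by
  have := PrimSystem.Along.sub_eq σ.continuous
    ((plSystem hα).exists_along σ.continuous).choose_spec hE (vertex 1)
    (vertex 0)
  rw [integral]
  linear_combination this

lemma integral_boundary [T2Space S] {α : τ.Corner → ℂ} (hα : τ.IsCocycle α)
    (σ : C(stdSimplex ℝ (Fin 3), S)) : ∑ i : Fin 3, (-1 : ℤ) ^ (i : ℕ) •
      integral hα (σ.comp ⟨_, stdSimplex.continuous_map (Fin.succAbove i)⟩) = 0 := by
  obtain ⟨E, hE⟩ := (plSystem hα).exists_along σ.continuous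
  have h : ∀ i : Fin 3, integral hα (σ.comp ⟨_, stdSimplex.continuous_map (Fin.succAbove i)⟩) =
      E (vertex (Fin.succAbove i 1)) - E (vertex (Fin.succAbove i 0)) := by
    intro i
    rw [integral_eq hα _ (hE.comp (stdSimplex.continuous_map (Fin.succAbove i)))]
    simp only [comp_apply, stdSimplex.map_vertex]
  rw [Fin.sum_univ_three, h, h, h]
  simp [Fin.succAbove, Fin.lt_def]

/-- The identification of the standard `1`-simplex with the unit interval. -/
def simplexToInterval : C(stdSimplex ℝ (Fin 2), 𝕀) := ⟨fun x => ⟨x.1 1, x.2.1 1, by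
    have h1 := x.2.2
    rw [Fin.sum_univ_two] at h1
    have := x.2.1 0
    linarith⟩, by
    refine Continuous.subtype_mk ?_ _
    exact (continuous_apply 1).comp continuous_subtype_val⟩

lemma simplexToInterval_zero : simplexToInterval (vertex 0) = 0 := by
  apply Subtype.ext
  simp [simplexToInterval, vertex]

lemma simplexToInterval_one : simplexToInterval (vertex 1) = 1 := by
  apply Subtype.ext
  simp [simplexToInterval, vertex]

/-- An edge as a singular simplex. -/
def edgeSimplex (τ : Triangulation Z) (h : τ.Corner) : C(stdSimplex ℝ (Fin 2), S) :=
  (τ.edgePath h).comp simplexToInterval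

lemma integral_path [T2Space S] {α : τ.Corner → ℂ} (hα : τ.IsCocycle α)
    {γ : C(𝕀, S)} {g : τ.Face} {y : 𝕀 → Tri} (hy : Continuous y)
    (h : ∀ s, γ s = τ.char g (y s)) :
    integral hα (γ.comp simplexToInterval) = τ.aff α g (y 1) - τ.aff α g (y 0) := by
  have h1 := ((along_char_aff hα g).comp hy).comp simplexToInterval.continuous
  have h2 : (plSystem hα).Along (γ.comp simplexToInterval)
      ((τ.aff α g ∘ y) ∘ simplexToInterval) := by
    convert h1 using 1
    funext x; exact h _
  rw [integral_eq hα _ h2]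
  simp only [comp_apply, simplexToInterval_zero, simplexToInterval_one]

lemma integral_edgeSimplex [T2Space S] {α : τ.Corner → ℂ} (hα : τ.IsCocycle α)
    (h : τ.Corner) : integral hα (τ.edgeSimplex h) = α h := by
  rw [edgeSimplex, integral_path hα (continuous_side h.2) (g := h.1) fun s => rfl, side_zero,
    side_one, aff_vtx_add_two hα]
  ring

end Triangulation

lemma exists_two_of_card {A : Type*} {Z : Finset A} (h : Z.card = 2) {a b c : A} (ha : a ∈ Z)
    (hb : b ∈ Z) (hc : c ∈ Z) (hab : a ≠ b) (hac : a ≠ c) : b = c := by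
  classical
  by_contra hbc
  have h3 : ({a, b, c} : Finset A).card ≤ Z.card := Finset.card_le_card (by
    intro x hx
    simp only [Finset.mem_insert, Finset.mem_singleton] at hx
    rcases hx with rfl | rfl | rfl <;> assumption)
  rw [Finset.card_eq_three.2 ⟨a, b, c, hab, hac, hbc, rfl⟩] at h3
  omega

namespace Triangulation

lemma IsNondegenerateDelaunay.exists_isSymmetry [T2Space S] [ConnectedSpace S]
    (hN : τ.IsNondegenerateDelaunay X)
    {F : S ≃ₜ S} (hF : IsIso ((-1 : ℂˣ) • X) X F) (hZ : ∀ p, F p ∈ Z ↔ p ∈ Z)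
    (hH : ((AlgebraicTopology.singularHomologyFunctor (ModuleCat.{0} ℤ) 1).obj
      (ModuleCat.of ℤ ℤ)).map (TopCat.ofHom (F : C(S, S))) = -CategoryTheory.CategoryStruct.id _)
    (hcard : Z.card = 1 ∨ (Z.card = 2 ∧ ∀ z ∈ Z, F z ∈ Z ∧ F z ≠ z)) :
    ∃ ι, τ.IsSymmetry ι := by
  have hg := hN.1
  choose D hD using hN.1
  choose g t y hyc hyb hyD hyF using hN.exists_face_map hF hZ hD
  obtain ⟨ε, hε, hsign⟩ := exists_sign hg
  have hvex : ∀ φ i, ∃ j, y φ (vtx i) = vtx j := by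
    intro φ i
    rw [← τ.mem_iff (g φ), ← hyF, hZ]
    exact τ.char_vtx_mem φ i
  choose σ hσ using hvex
  have hσinj : ∀ φ, Injective (σ φ) := fun φ i j hij =>
    vtx_injective ((hyb φ).1 (by rw [hσ, hσ, hij]))
  have hverts : ∀ φ i, verts (D (g φ)) (σ φ i) = -verts (D φ) i + t φ := by
    intro φ i
    rw [verts, ← hσ, hyD]; rfl
  have hrot : ∀ φ, ∃ s, ∀ i, σ φ i = i + s := by
    intro φ
    rcases fin3_injective_cases (σ φ) (hσinj φ) with h | ⟨s, hs⟩
    · exact h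
    exfalso
    have h1 := area_reflect (verts (D (g φ))) s
    have h2 := area_neg_add (verts (D φ)) (t φ)
    have h3 : (fun i => verts (D (g φ)) (s - i)) = fun i => -verts (D φ) i + t φ := by
      funext i; rw [← hs, hverts]
    rw [h3, h2] at h1
    have p1 := hsign φ _ (hD φ)
    have p2 := hsign (g φ) _ (hD (g φ))
    rw [h1] at p1
    linarith
  choose s hs using hrot
  have hP : ∀ φ, (fun i => verts (D (g φ)) (i + s φ)) = fun i => -verts (D φ) i + t φ := by
    intro φ; funext i; rw [← hs, hverts]
  have hzero : ∀ φ x i, (y φ x).1 (i + s φ) = 0 ↔ x.1 i = 0 := by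
    intro φ x i
    rw [← (hD (g φ)).bary_eq_zero_iff, ← (hD φ).bary_eq_zero_iff, hyD, ← bary_rotate, hP,
      bary_neg_add]
  set ι : τ.Corner → τ.Corner := fun h => (g h.1, h.2 + s h.1) with hι
  have hginj : Injective g := by
    intro φ ψ h
    obtain ⟨b, hb⟩ := dense_interior.nonempty
    obtain ⟨x, hx⟩ := (hyb ψ).2 (y φ b)
    have h1 : F (τ.char φ b) = F (τ.char ψ x) := by rw [hyF, hyF, hx, h]
    exact (τ.face_inj φ ψ b x hb (F.injective h1)).1
  have hιinj : Injective ι := by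
    rintro ⟨φ, i⟩ ⟨ψ, j⟩ h
    simp only [hι, Prod.mk.injEq] at h
    obtain rfl := hginj h.1
    rw [add_right_cancel h.2]
  have hιbij : Bijective ι := ⟨hιinj, Finite.injective_iff_surjective.1 hιinj⟩
  have hrotate : ∀ f i j, ι (f, i + j) = ((ι (f, i)).1, (ι (f, i)).2 + j) := by
    intro f i j
    simp only [hι]
    rw [add_right_comm]
  have hside : ∀ (h : τ.Corner) (u : 𝕀), 0 < u → u < 1 →
      ∃ w : 𝕀, 0 < w ∧ w < 1 ∧ y h.1 (side h.2 u) = side (ι h).2 w := by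
    intro h u h0 h1
    have hz : (y h.1 (side h.2 u)).1 (ι h).2 = 0 := (hzero h.1 _ h.2).2 (side_apply_self _ _)
    obtain ⟨w, hw⟩ := exists_side hz
    have hnv : ∀ j, side (ι h).2 w ≠ vtx j := by
      intro j hj
      have : F (τ.char h.1 (side h.2 u)) ∈ Z := by rw [hyF, hw, hj]; exact τ.char_vtx_mem _ _
      rw [hZ, τ.mem_iff] at this
      obtain ⟨k, hk⟩ := this
      exact side_ne_vtx h0 h1 hk
    refine ⟨w, ?_, ?_, hw⟩
    · exact lt_of_le_of_ne w.2.1 fun h => hnv ((ι _).2 + 1) (by rw [← side_zero, ← h])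
    · exact lt_of_le_of_ne w.2.2 fun h => hnv ((ι _).2 + 2) (by rw [← side_one, h])
  have hopp : ∀ h, ι (τ.opp h) = τ.opp (ι h) := by
    intro h
    obtain ⟨u, h0, h1⟩ := exists_between (zero_lt_one' 𝕀)
    obtain ⟨w, w0, w1, hw⟩ := hside h u h0 h1
    obtain ⟨w', w0', w1', hw'⟩ := hside (τ.opp h) (σ₀ u) (symm_pos h1)
      (symm_lt_one h0)
    have heq : τ.char (ι h).1 (side (ι h).2 w) =
        τ.char (ι (τ.opp h)).1 (side (ι (τ.opp h)).2 w') := by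
      have e1 := hyF h.1 (side h.2 u)
      rw [τ.glue, hyF, hw, hw'] at e1
      exact e1.symm
    rcases τ.edge_inj _ _ w w' w0 w1 heq with ⟨h2, -⟩ | ⟨h2, -⟩
    · exact absurd (hιinj h2) (τ.opp_ne h)
    · exact h2
  refine ⟨ι, hιbij, hrotate, hopp, fun α hα => ?_⟩
  have himg : ∀ h, integral hα ((F : C(S, S)).comp (τ.edgeSimplex h)) = α (ι h) := by
    intro h
    have := integral_path hα (γ := (F : C(S, S)).comp (τ.edgePath h)) (g := g h.1)
      (y := fun u => y h.1 (side h.2 u)) ((hyc h.1).comp (continuous_side h.2))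
      fun u => hyF h.1 (side h.2 u)
    rw [edgeSimplex, ← ContinuousMap.comp_assoc, this, side_zero, side_one, hσ, hσ, hs, hs,
      add_right_comm h.2 2, add_right_comm h.2 1, aff_vtx_add_two hα]
    simp [hι]
  have hend0 : ∀ h, τ.edgeSimplex h (vertex 0) = τ.edgePath h 0 := fun h => by
    rw [edgeSimplex, ContinuousMap.comp_apply, simplexToInterval_zero]
  have hend1 : ∀ h, τ.edgeSimplex h (vertex 1) = τ.edgePath h 1 := fun h => by
    rw [edgeSimplex, ContinuousMap.comp_apply, simplexToInterval_one]
  have hloop : ∀ h, τ.edgePath h 0 = τ.edgePath h 1 → α (ι h) = -α h := by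
    intro h hl
    have h1 := cocycle_comp_of_homology_neg (F : C(S, S)) hH (integral hα) (integral_boundary hα)
      (τ.edgeSimplex h) (τ.edgeSimplex h) (by rw [hend0, hend1, hl]) (by rw [hend0, hend1, hl])
    rw [himg, integral_edgeSimplex] at h1
    linear_combination h1 / 2
  rcases hcard with hc | ⟨hc, hswap⟩
  · exact fun h => hloop h (Finset.card_le_one.1 hc.le _ (τ.edgePath_zero_mem h) _
      (τ.edgePath_one_mem h))
  have hι0 : ∀ h, τ.edgePath (ι h) 0 = F (τ.edgePath h 0) := by
    intro h
    change τ.char (g h.1) (side _ 0) = F (τ.char h.1 (side h.2 0))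
    rw [side_zero, side_zero, hyF, hσ, hs, add_right_comm]
  have hι1 : ∀ h, τ.edgePath (ι h) 1 = F (τ.edgePath h 1) := by
    intro h
    change τ.char (g h.1) (side _ 1) = F (τ.char h.1 (side h.2 1))
    rw [side_one, side_one, hyF, hσ, hs, add_right_comm]
  have hstep : ∀ h, α (ι (ι h)) + α (ι h) = -(α (ι h) + α h) := by
    intro h
    by_cases hl : τ.edgePath h 0 = τ.edgePath h 1
    · have e1 := hloop h hl
      have e2 := hloop (ι h) (by rw [hι0, hι1, hl])
      rw [e2, e1]; ring
    have m0 := τ.edgePath_zero_mem h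
    have m1 := τ.edgePath_one_mem h
    have f0 : F (τ.edgePath h 0) = τ.edgePath h 1 :=
      exists_two_of_card hc m0 (hswap _ m0).1 m1 (hswap _ m0).2.symm hl
    have f1 : F (τ.edgePath h 1) = τ.edgePath h 0 :=
      exists_two_of_card hc m1 (hswap _ m1).1 m0 (hswap _ m1).2.symm (Ne.symm hl)
    have h1 := cocycle_comp_of_homology_neg (F : C(S, S)) hH (integral hα) (integral_boundary hα)
      (τ.edgeSimplex h) (τ.edgeSimplex (ι h)) (by rw [hend0, hend1, hι0, f0])
      (by rw [hend0, hend1, hι1, f1])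
    rw [himg, himg, integral_edgeSimplex, integral_edgeSimplex] at h1
    linear_combination h1
  intro h
  have hn : ∀ n : ℕ, (-1 : ℂ) ^ n * α (ι^[n] h) = α h - n * (α (ι h) + α h) ∧
      α (ι (ι^[n] h)) + α (ι^[n] h) = (-1 : ℂ) ^ n * (α (ι h) + α h) := by
    intro n
    induction n with
    | zero => simp
    | succ n ih =>
      rw [iterate_succ_apply']
      have e := hstep (ι^[n] h)
      constructor
      · have hsq : (-1 : ℂ) ^ n * (-1) ^ n = 1 := by rw [← mul_pow]; norm_num
        push_cast
        rw [pow_succ]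
        linear_combination ih.1 - (-1 : ℂ) ^ n * ih.2 - (α (ι h) + α h) * hsq
      · rw [e, ih.2, pow_succ]; ring
  obtain ⟨N, hN0, hN1⟩ : ∃ N : ℕ, 0 < N ∧ ι^[N] h = h := by
    exact Injective.mem_periodicPts hιinj h
  have h2N : ι^[N + N] h = h := by rw [Function.iterate_add_apply, hN1, hN1]
  have h3 := (hn (N + N)).1
  rw [h2N, ← two_mul, pow_mul, neg_one_sq, one_pow, one_mul] at h3
  have h4 : ((2 * N : ℕ) : ℂ) * (α (ι h) + α h) = 0 := by linear_combination h3
  have h5 := (mul_eq_zero.1 h4).resolve_left (Nat.cast_ne_zero.2 (by omega))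
  linear_combination h5

lemma exists_isSymmetry_of_two_faces [T2Space S] [ConnectedSpace S] (hg : τ.IsGeometric X)
    (hcard : Nat.card τ.Face = 2) : τ.IsSymmetry τ.opp := by
  have e1 : ∀ s : Fin 3, s - 0 + 2 = s - 1 := by decide
  have e2 : ∀ s : Fin 3, s - 0 + 1 = s - 2 := by decide
  obtain ⟨ε, hε, hsign⟩ := exists_sign hg
  choose D hD using hg
  have hne : ∀ h, (τ.opp h).1 ≠ h.1 := fun h => (hD h.1).opp_fst_ne h.2
  refine ⟨Function.Involutive.bijective τ.opp_opp, ?_, fun h => rfl, fun α hα => hα.opp⟩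
  have htwo : ∀ f g g' : τ.Face, g ≠ f → g' ≠ f → g = g' := by
    have := Fintype.ofFinite τ.Face
    rw [Nat.card_eq_fintype_card] at hcard
    intro f g g' h1 h2
    exact exists_two_of_card (Z := Finset.univ) hcard (Finset.mem_univ f) (Finset.mem_univ g)
      (Finset.mem_univ g') (Ne.symm h1) (Ne.symm h2)
  intro f
  set g := (τ.opp (f, 0)).1 with hgd
  have hg1 : ∀ i, (τ.opp (f, i)).1 = g := fun i => htwo f _ _ (hne _) (hne _)
  set σ : Fin 3 → Fin 3 := fun i => (τ.opp (f, i)).2 with hσ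
  have hop : ∀ i, τ.opp (f, i) = (g, σ i) := fun i => Prod.ext (hg1 i) rfl
  have hσinj : Injective σ := by
    intro i j hij
    have : τ.opp (f, i) = τ.opp (f, j) := by rw [hop, hop, hij]
    have h2 := congrArg τ.opp this
    rw [τ.opp_opp, τ.opp_opp] at h2
    exact (Prod.mk.inj h2).2
  rcases fin3_injective_cases σ hσinj with ⟨s, hs⟩ | ⟨s, hs⟩
  · intro i j
    rw [hop, hop, hs, hs, add_right_comm]
  exfalso
  have hv : ∀ i, τ.edgeVec X (g, s - i) = -τ.edgeVec X (f, i) := by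
    intro i
    rw [← edgeVec_opp, hop, hs]
  have p1 := hsign f _ (hD f)
  have p2 := hsign g _ (hD g)
  rw [(hD f).area_eq_cross 0] at p1
  rw [(hD g).area_eq_cross (s - 0)] at p2
  rw [e1, e2, hv, hv] at p2
  simp only [zero_add, cross, neg_re, neg_im, neg_neg] at p1 p2
  linarith

/-! ### Triangles from angles -/

lemma IsOriented.ne_zero {v : τ.Corner → ℂ} {ε : ℝ} (h : τ.IsOriented ε v) (a : τ.Corner) :
    v a ≠ 0 := by
  simpa only [fin3_add_one_add_two] using (ne_zero_of_cross (h (a.1, a.2 + 1))).1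

/-- The law of sines, with directions. -/
lemma IsOriented.neg_mul_sin {v : τ.Corner → ℂ} {ε : ℝ} (hε : ε = 1 ∨ ε = -1)
    (hv : τ.IsCocycle v) (ho : τ.IsOriented ε v) (f : τ.Face) (i : Fin 3) :
    -v (f, i + 1) * sin (τ.cornerAngle v (f, i + 2)) = sin (τ.cornerAngle v (f, i + 1)) *
        exp (I * (ε * τ.cornerAngle v (f, i))) * v (f, i + 2) := by
  have h0 := eq_exp_mul hε (ho (f, i))
  have s1 := sin_angle_mul (v (f, i + 1 + 2)) (-v (f, i + 1 + 1))
  have s2 := sin_angle_mul (v (f, i + 2 + 2)) (-v (f, i + 2 + 1))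
  have n0 := ne_zero_of_cross (ho (f, i))
  have n1 := ne_zero_of_cross (ho (f, i + 1))
  simp only at h0 n0 n1
  rw [fin3_add_one_add_two] at n1
  have hsum := hv.sum' f i
  have hcr : |cross (v (f, i + 1 + 2)) (-v (f, i + 1 + 1))| =
      |cross (v (f, i + 2 + 2)) (-v (f, i + 2 + 1))| := by
    congr 1
    rw [fin3_add_one_add_one, fin3_add_one_add_two, fin3_add_two_add_one, fin3_add_two_add_two]
    have e : v (f, i + 2) = -v (f, i) - v (f, i + 1) := by linear_combination hsum
    rw [e]
    simp only [cross, neg_re, neg_im, sub_re, sub_im]; ring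
  rw [hcr, ← s2, norm_neg, norm_neg] at s1
  have a1 : τ.cornerAngle v (f, i + 1) =
    InnerProductGeometry.angle (v (f, i + 1 + 2)) (-v (f, i + 1 + 1)) := rfl
  have a2 : τ.cornerAngle v (f, i + 2) =
    InnerProductGeometry.angle (v (f, i + 2 + 2)) (-v (f, i + 2 + 1)) := rfl
  have a0 : τ.cornerAngle v (f, i) =
    InnerProductGeometry.angle (v (f, i + 2)) (-v (f, i + 1)) := rfl
  rw [← a1, ← a2, fin3_add_one_add_one, fin3_add_one_add_two, fin3_add_two_add_one,
    fin3_add_two_add_two] at s1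
  rw [← a0] at h0
  have hn : ‖v (f, i)‖ ≠ 0 := norm_ne_zero_iff.2 n1.1
  have s3 : sin (τ.cornerAngle v (f, i + 1)) * ‖v (f, i + 2)‖ =
      sin (τ.cornerAngle v (f, i + 2)) * ‖v (f, i + 1)‖ := by
    apply mul_right_cancel₀ hn
    linear_combination s1
  have hnu : (‖v (f, i + 2)‖ : ℂ) ≠ 0 := by exact_mod_cast norm_ne_zero_iff.2 n0.1
  apply mul_left_cancel₀ hnu
  have s4 : (sin (τ.cornerAngle v (f, i + 1)) : ℂ) * ‖v (f, i + 2)‖ =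
      sin (τ.cornerAngle v (f, i + 2)) * ‖v (f, i + 1)‖ := by exact_mod_cast s3
  rw [norm_neg] at h0
  linear_combination (sin (τ.cornerAngle v (f, i + 2)) : ℂ) * h0 -
    exp (I * (ε * τ.cornerAngle v (f, i))) * v (f, i + 2) * s4

/-- Triangles in which the sides satisfy the law of sines close up. -/
lemma sum_eq_zero_of_sin {θ : Fin 3 → ℝ} {V : Fin 3 → ℂ} {ε : ℝ} (hε : ε = 1 ∨ ε = -1)
    (hθ : ∀ i, θ i ∈ Ioo 0 π) (hsum : ∑ i, θ i = π)
    (hV : ∀ i, -V (i + 1) * sin (θ (i + 2)) =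
      sin (θ (i + 1)) * exp (I * (ε * θ i)) * V (i + 2)) :
    V 0 + V 1 + V 2 = 0 := by
  have hε2 : (ε : ℂ) * ε = 1 := by rcases hε with rfl | rfl <;> norm_num
  have r0 := hV 0
  have r1 := hV 1
  have e1 : (1 : Fin 3) + 1 = 2 := rfl
  have e2 : (1 : Fin 3) + 2 = 0 := rfl
  rw [zero_add, zero_add] at r0
  rw [e1, e2] at r1
  have hs : ∀ i, (sin (θ i) : ℂ) ≠ 0 := fun i => by
    exact_mod_cast (sin_pos_of_pos_of_lt_pi (hθ i).1 (hθ i).2).ne'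
  rw [exp_I_mul_re_im _ _ hε] at r0 r1
  have h2 : sin (θ 2) = sin (θ 0) * cos (θ 1) + cos (θ 0) * sin (θ 1) := by
    rw [← Real.sin_add]
    rw [Fin.sum_univ_three] at hsum
    have : θ 0 + θ 1 = π - θ 2 := by linarith
    rw [this, Real.sin_pi_sub]
  have hadd : (sin (θ 2) : ℂ) = sin (θ 0) * cos (θ 1) + cos (θ 0) * sin (θ 1) := by exact_mod_cast h2
  have hsc : (sin (θ 1) : ℂ) ^ 2 + (cos (θ 1) : ℂ) ^ 2 = 1 := by
    exact_mod_cast Real.sin_sq_add_cos_sq (θ 1)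
  have r1' : sin (θ 2) * V 0 = -(sin (θ 0) * (cos (θ 1) - ε * sin (θ 1) * I) * V 2) := by
    linear_combination (-(cos (θ 1) : ℂ) + ε * sin (θ 1) * I) * r1 +
      (-(sin (θ 2) : ℂ) * V 0) * hsc - (sin (θ 2) : ℂ) * V 0 * sin (θ 1) ^ 2 * hε2 +
      (ε * ε * (sin (θ 1) : ℂ) ^ 2 * sin (θ 2) * V 0) * Complex.I_sq
  apply mul_left_cancel₀ (hs 2)
  linear_combination r1' - r0 + V 2 * hadd

/-- Rescaling and rotating the sides of a triangle so that the angles change from `θ` to `φ`. -/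
lemma rescale_sin {θ φ : Fin 3 → ℝ} {v V : Fin 3 → ℂ} {ε : ℝ} {s : ℂ}
    (hθ : ∀ i, θ i ∈ Ioo 0 π) (hφ : ∀ i, φ i ∈ Ioo 0 π)
    (hθs : ∑ i, θ i = π) (hφs : ∑ i, φ i = π)
    (hv : ∀ i, -v (i + 1) * sin (θ (i + 2)) =
      sin (θ (i + 1)) * exp (I * (ε * θ i)) * v (i + 2))
    (hV : ∀ i, V i = v i * exp ((Real.log (sin (φ i) / sin (θ i)) : ℝ) +
      I * (ε * (((φ (i + 2) - θ (i + 2)) - (φ (i + 1) - θ (i + 1))) / 3 : ℝ)) + s))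
    (i : Fin 3) : -V (i + 1) * sin (φ (i + 2)) =
      sin (φ (i + 1)) * exp (I * (ε * φ i)) * V (i + 2) := by
  have hsθ : ∀ i, 0 < sin (θ i) := fun i => sin_pos_of_pos_of_lt_pi (hθ i).1 (hθ i).2
  have hsφ : ∀ i, 0 < sin (φ i) := fun i => sin_pos_of_pos_of_lt_pi (hφ i).1 (hφ i).2
  have hcθ : ∀ i, (sin (θ i) : ℂ) ≠ 0 := fun i => by exact_mod_cast (hsθ i).ne'
  have hV' : ∀ i, V i * sin (θ i) = v i * sin (φ i) * exp (I *
      (ε * (((φ (i + 2) - θ (i + 2)) - (φ (i + 1) - θ (i + 1))) / 3 : ℝ))) * exp s := by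
    intro i
    rw [hV, exp_add, exp_add, ← Complex.ofReal_exp, Real.exp_log (div_pos (hsφ i) (hsθ i))]
    push_cast
    have := hcθ i
    push_cast at this
    field_simp
  have h1 := hV' (i + 1)
  have h2 := hV' (i + 2)
  rw [fin3_add_one_add_one, fin3_add_one_add_two] at h1
  rw [fin3_add_two_add_one, fin3_add_two_add_two] at h2
  have hs1 := sum_fin3 θ i
  have hs2 := sum_fin3 φ i
  rw [hθs] at hs1
  rw [hφs] at hs2
  have hexp : exp (I * (ε * θ i)) * exp (I *
      (ε * (((φ i - θ i) - (φ (i + 2) - θ (i + 2))) / 3 : ℝ))) =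
      exp (I * (ε * φ i)) * exp (I *
      (ε * (((φ (i + 1) - θ (i + 1)) - (φ i - θ i)) / 3 : ℝ))) := by
    rw [← exp_add, ← exp_add]
    congr 1
    have : θ i + ((φ i - θ i) - (φ (i + 2) - θ (i + 2))) / 3 =
        φ i + ((φ (i + 1) - θ (i + 1)) - (φ i - θ i)) / 3 := by linarith
    have hc : (θ i : ℂ) + (((φ i - θ i) - (φ (i + 2) - θ (i + 2))) / 3 : ℝ) =
        φ i + (((φ (i + 1) - θ (i + 1)) - (φ i - θ i)) / 3 : ℝ) := by exact_mod_cast this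
    linear_combination (I * ε) * hc
  apply mul_left_cancel₀ (mul_ne_zero (hcθ (i + 1)) (hcθ (i + 2)))
  have hvi := hv i
  generalize exp (I * (ε * (((φ i - θ i) - (φ (i + 2) - θ (i + 2))) / 3 : ℝ))) = E1 at *
  generalize exp (I * (ε * (((φ (i + 1) - θ (i + 1)) - (φ i - θ i)) / 3 : ℝ))) = E2 at *
  generalize exp (I * (ε * φ i)) = E3 at *
  generalize exp (I * (ε * θ i)) = E4 at *
  generalize exp s = E5 at *
  linear_combination (-(sin (θ (i + 2)) : ℂ) * sin (φ (i + 2))) * h1 -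
    (sin (θ (i + 1)) : ℂ) * sin (φ (i + 1)) * E3 * h2 +
    (sin (φ (i + 1)) : ℂ) * sin (φ (i + 2)) * E1 * E5 * hvi +
    (sin (θ (i + 1)) : ℂ) * sin (φ (i + 1)) * sin (φ (i + 2)) * v (i + 2) * E5 * hexp

lemma IsSymmetry.cornerAngle_comp {ι : τ.Corner → τ.Corner} (hι : τ.IsSymmetry ι)
    {v : τ.Corner → ℂ} (hv : τ.IsCocycle v) (a : τ.Corner) :
    τ.cornerAngle v (ι a) = τ.cornerAngle v a := by
  rw [cornerAngle, cornerAngle]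
  have h1 := hι.rotate a.1 a.2 2
  have h2 := hι.rotate a.1 a.2 1
  rw [← h1, ← h2, hι.neg v hv, hι.neg v hv, InnerProductGeometry.angle_neg_neg]

/-- The coboundary of a function on the faces. -/
def faceDiff (τ : Triangulation Z) : (τ.Face → ℂ) →ₗ[ℂ] (τ.Corner → ℂ) where
  toFun s h := s h.1 - s (τ.opp h).1
  map_add' s t := by funext h; simp only [Pi.add_apply]; ring
  map_smul' c s := by funext h; simp only [Pi.smul_apply, smul_eq_mul, RingHom.id_apply]; ring

lemma IsSymmetry.mem_range_faceDiff {ι : τ.Corner → τ.Corner}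
    (hι : τ.IsSymmetry ι) {l : τ.Corner → ℂ} (hopp : ∀ h, l (τ.opp h) = -l h)
    (hinv : ∀ h, l (ι h) = l h) : l ∈ LinearMap.range τ.faceDiff := by
  classical
  have := Fintype.ofFinite τ.Face
  by_contra hcon
  obtain ⟨φ, hφ, hker⟩ := Submodule.exists_le_ker_of_notMem hcon
  set α : τ.Corner → ℂ := fun h => φ (Pi.single h 1) with hα
  have hφα : ∀ x, φ x = ∑ h, x h * α h := by
    intro x
    rw [LinearMap.pi_apply_eq_sum_univ φ x]
    simp only [smul_eq_mul, hα]
    congr 1; funext h; congr 2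
    funext j
    simp [Pi.single_apply, eq_comm]
  have hoppE : Bijective τ.opp := Function.Involutive.bijective τ.opp_opp
  have hβ : τ.IsCocycle fun h => α h - α (τ.opp h) := by
    refine ⟨fun h => by rw [τ.opp_opp]; ring, fun f => ?_⟩
    have h0 : φ (τ.faceDiff (Pi.single f 1)) = 0 := hker (LinearMap.mem_range_self _ _)
    rw [hφα] at h0
    have h1 : ∑ h : τ.Corner, (Pi.single f 1 : τ.Face → ℂ) (τ.opp h).1 * α h =
        ∑ h : τ.Corner, (Pi.single f 1 : τ.Face → ℂ) h.1 * α (τ.opp h) := by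
      rw [← hoppE.sum_comp]
      simp only [τ.opp_opp]
    have h2 : ∑ h : τ.Corner, (Pi.single f 1 : τ.Face → ℂ) h.1 * (α h - α (τ.opp h)) = 0 := by
      rw [← h0]
      simp only [mul_sub]
      rw [Finset.sum_sub_distrib, ← h1, ← Finset.sum_sub_distrib]
      refine Finset.sum_congr rfl fun h _ => ?_
      simp only [faceDiff, LinearMap.coe_mk, AddHom.coe_mk]; ring
    rw [Fintype.sum_prod_type, Finset.sum_eq_single f] at h2
    · simp only [Pi.single_eq_same, one_mul, Fin.sum_univ_three] at h2
      exact h2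
    · intro g _ hgf
      simp [hgf]
    · intro h; exact absurd (Finset.mem_univ f) h
  apply hφ
  rw [hφα]
  have h3 : ∑ h, l h * α h = -∑ h, l h * α (τ.opp h) := by
    rw [← hoppE.sum_comp, ← Finset.sum_neg_distrib]
    refine Finset.sum_congr rfl fun h _ => ?_
    rw [hopp]; ring
  have h4 : ∑ h, l h * (α h - α (τ.opp h)) = 0 := by
    have h5 : ∑ h, l h * (α h - α (τ.opp h)) = -∑ h, l h * (α h - α (τ.opp h)) := by
      conv_lhs => rw [← hι.bijective.sum_comp]
      rw [← Finset.sum_neg_distrib]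
      refine Finset.sum_congr rfl fun h _ => ?_
      have := hι.neg _ hβ h
      rw [this, hinv]; ring
    linear_combination h5 / 2
  simp only [mul_sub] at h4
  rw [Finset.sum_sub_distrib] at h4
  linear_combination (h3 + h4) / 2

lemma exists_section_faceDiff (τ : Triangulation Z) : ∃ G : (τ.Corner → ℂ) →ₗ[ℂ] (τ.Face → ℂ),
      ∀ l ∈ LinearMap.range τ.faceDiff, τ.faceDiff (G l) = l := by
  obtain ⟨g, hg⟩ := τ.faceDiff.rangeRestrict.exists_rightInverse_of_surjective
    τ.faceDiff.range_rangeRestrict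
  obtain ⟨G, hG⟩ := LinearMap.exists_extend g
  refine ⟨G, fun l hl => ?_⟩
  have h1 : G l = g ⟨l, hl⟩ := by rw [← hG]; rfl
  have h2 := congrArg Subtype.val (LinearMap.congr_fun hg ⟨l, hl⟩)
  rw [h1]
  exact h2

/-- Edge vectors with prescribed angles. -/
lemma IsSymmetry.exists_edgeVec {ι : τ.Corner → τ.Corner} (hι : τ.IsSymmetry ι)
    {v : τ.Corner → ℂ} {ε : ℝ} (hε : ε = 1 ∨ ε = -1) (hv : τ.IsCocycle v)
    (ho : τ.IsOriented ε v) (hva : τ.cornerAngle v ∈ angleSpace τ) :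
    ∃ V : (τ.Corner → ℝ) → τ.Corner → ℂ, (∀ h, ContinuousOn (fun θ => V θ h) (angleSpace τ)) ∧
      ∀ θ ∈ angleSpace τ, (∀ a, θ (ι a) = θ a) → τ.IsCocycle (V θ) ∧ τ.IsOriented ε (V θ) ∧
        τ.cornerAngle (V θ) = θ := by
  obtain ⟨G, hG⟩ := τ.exists_section_faceDiff
  have := Fintype.ofFinite τ.Face
  have hGc : Continuous G := G.continuous_of_finiteDimensional
  set φ := τ.cornerAngle v with hφ
  let a : (τ.Corner → ℝ) → τ.Corner → ℂ := fun θ h =>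
    (Real.log (sin (θ h) / sin (φ h)) : ℝ) + I * (ε * (((θ (h.1, h.2 + 2) -
      φ (h.1, h.2 + 2)) - (θ (h.1, h.2 + 1) - φ (h.1, h.2 + 1))) / 3 : ℝ))
  let l : (τ.Corner → ℝ) → τ.Corner → ℂ := fun θ h => a θ (τ.opp h) - a θ h
  have hsin : ∀ θ ∈ angleSpace τ, ∀ h, 0 < sin (θ h) := fun θ hθ h =>
    sin_pos_of_pos_of_lt_pi (hθ.1 h).1 (hθ.1 h).2
  have hac : ∀ h, ContinuousOn (fun θ => a θ h) (angleSpace τ) := by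
    intro h
    refine ContinuousOn.add ?_ (by fun_prop)
    refine continuous_ofReal.comp_continuousOn (ContinuousOn.log (by fun_prop) ?_)
    intro θ hθ
    exact (div_pos (hsin θ hθ h) (hsin _ hva h)).ne'
  have hlc : ContinuousOn l (angleSpace τ) := continuousOn_pi.2 fun h => (hac _).sub (hac _)
  refine ⟨fun θ h => v h * exp (a θ h + G (l θ) h.1), fun h => ?_, fun θ hθ hinv => ?_⟩
  · refine continuousOn_const.mul (Complex.continuous_exp.comp_continuousOn ((hac h).add ?_))
    exact ((continuous_apply h.1).comp hGc).comp_continuousOn hlc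
  have hφinv : ∀ b, φ (ι b) = φ b := hι.cornerAngle_comp hv
  have hainv : ∀ h, a θ (ι h) = a θ h := by
    intro h
    simp only [a]
    have h1 := hι.rotate h.1 h.2 2
    have h2 := hι.rotate h.1 h.2 1
    rw [← h1, ← h2, hinv, hinv, hinv, hφinv, hφinv, hφinv]
  have hl : τ.faceDiff (G (l θ)) = l θ := by
    refine hG _ (hι.mem_range_faceDiff (fun h => ?_) fun h => ?_)
    · simp only [l, τ.opp_opp]; ring
    · simp only [l]; rw [← hι.opp, hainv, hainv]
  set V : τ.Corner → ℂ := fun h => v h * exp (a θ h + G (l θ) h.1) with hV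
  have hrel : ∀ f i, -V (f, i + 1) * sin (θ (f, i + 2)) = sin (θ (f, i + 1)) *
      exp (I * (ε * θ (f, i))) * V (f, i + 2) := by
    intro f
    exact rescale_sin (θ := fun i => φ (f, i)) (φ := fun i => θ (f, i)) (v := fun i => v (f, i))
      (V := fun i => V (f, i)) (s := G (l θ) f) (fun i => hva.1 _) (fun i => hθ.1 _) (hva.2 f)
      (hθ.2 f) (fun i => ho.neg_mul_sin hε hv f i) fun i => rfl
  have hne : ∀ h, V h ≠ 0 := by
    intro h
    have h1 := (ne_zero_of_cross (ho (h.1, h.2 + 1))).1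
    simp only [fin3_add_one_add_two] at h1
    exact mul_ne_zero h1 (exp_ne_zero _)
  have hrel' : ∀ f i, -V (f, i + 1) = (sin (θ (f, i + 1)) / sin (θ (f, i + 2)) : ℝ) *
      exp (I * (ε * θ (f, i))) * V (f, i + 2) := by
    intro f i
    have h1 := hrel f i
    have h2 : (sin (θ (f, i + 2)) : ℂ) ≠ 0 := by exact_mod_cast (hsin θ hθ _).ne'
    rw [Complex.ofReal_div, div_mul_eq_mul_div, div_mul_eq_mul_div, eq_div_iff h2]
    exact h1
  have hρ : ∀ f i, 0 < sin (θ (f, i + 1)) / sin (θ (f, i + 2)) := fun f i =>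
    div_pos (hsin θ hθ _) (hsin θ hθ _)
  refine ⟨⟨fun h => ?_, fun f => ?_⟩, fun b => ?_, ?_⟩
  · have h1 := congrFun hl h
    simp only [faceDiff, LinearMap.coe_mk, AddHom.coe_mk, l] at h1
    simp only
    rw [hv.opp]
    have : a θ (τ.opp h) + G (l θ) (τ.opp h).1 = a θ h + G (l θ) h.1 := by
      simp only [l]
      linear_combination -h1
    rw [this]; ring
  · exact sum_eq_zero_of_sin (θ := fun i => θ (f, i)) (V := fun i => V (f, i)) hε
      (fun i => hθ.1 _) (hθ.2 f) fun i => hrel f i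
  · rw [hrel', cross_exp_mul hε]
    have := normSq_pos.2 (hne (b.1, b.2 + 2))
    have h2 := hsin θ hθ (b.1, b.2)
    have h3 := hρ b.1 b.2
    positivity
  · funext b
    rw [cornerAngle, hrel']
    exact angle_exp_mul (hne _) hε (hρ _ _) (hθ.1 _)

/-- The angles determine the edge vectors up to a common factor. -/
lemma exists_smul_of_cornerAngle_eq [T2Space S] [ConnectedSpace S] (o : SurfaceOrientation S)
    {v w : τ.Corner → ℂ} {ε : ℝ} (hε : ε = 1 ∨ ε = -1) (hv : τ.IsCocycle v)
    (hw : τ.IsCocycle w) (hov : τ.IsOriented ε v) (how : τ.IsOriented ε w)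
    (h : τ.cornerAngle v = τ.cornerAngle w) : ∃ c : ℂˣ, ∀ a, w a = c * v a := by
  have hrat : ∀ f i, w (f, i + 1) / v (f, i + 1) = w (f, i + 2) / v (f, i + 2) := by
    intro f i
    have h1 := hov.neg_mul_sin hε hv f i
    have h2 := how.neg_mul_sin hε hw f i
    rw [← h] at h2
    have hs : (sin (τ.cornerAngle v (f, i + 2)) : ℂ) ≠ 0 := by
      have hm : τ.cornerAngle v (f, i + 2) ∈ Ioo 0 π := angle_mem_Ioo hε (hov (f, i + 2))
      exact_mod_cast (sin_pos_of_pos_of_lt_pi hm.1 hm.2).ne'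
    rw [div_eq_div_iff (hov.ne_zero _) (hov.ne_zero _)]
    apply mul_left_cancel₀ hs
    linear_combination w (f, i + 2) * h1 - v (f, i + 2) * h2
  have hface : ∀ f i, w (f, i) / v (f, i) = w (f, 0) / v (f, 0) := by
    intro f i
    have h0 := hrat f 0
    have h1 := hrat f 1
    simp at h0 h1
    fin_cases i
    · rfl
    · exact h0.trans h1
    · exact h1
  have hadj : ∀ k : τ.Corner, w ((τ.opp k).1, 0) / v ((τ.opp k).1, 0) =
      w (k.1, 0) / v (k.1, 0) := by
    intro k
    rw [← hface (τ.opp k).1 (τ.opp k).2, ← hface k.1 k.2]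
    change w (τ.opp k) / v (τ.opp k) = w k / v k
    rw [hw.opp, hv.opp, neg_div_neg_eq]
  have hconst := eq_of_adjacent o τ (fun f => w (f, 0) / v (f, 0)) hadj
  by_cases hF : Nonempty τ.Face
  · obtain ⟨f₀⟩ := hF
    refine ⟨Units.mk0 (w (f₀, 0) / v (f₀, 0)) (div_ne_zero (how.ne_zero _) (hov.ne_zero _)), fun a => ?_⟩
    rw [Units.val_mk0, hconst f₀ a.1, ← hface a.1 a.2, div_mul_cancel₀ _ (hov.ne_zero _)]
  · exact ⟨1, fun a => absurd ⟨a.1⟩ hF⟩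

/-! ### Reparametrized faces -/

/-- Homeomorphisms of the standard triangle, one for each face, that preserve the sides and are
compatible with the gluing. -/
structure IsFaceHomeo (τ : Triangulation Z) (β : τ.Face → Tri ≃ₜ Tri) : Prop where
  zero_iff : ∀ f y i, (β f y).1 i = 0 ↔ y.1 i = 0
  glue : ∀ (h : τ.Corner) s t, β h.1 (side h.2 s) = side h.2 t →
    β (τ.opp h).1 (side (τ.opp h).2 (σ₀ s)) = side (τ.opp h).2 (σ₀ t)

namespace IsFaceHomeo

variable {β γ : τ.Face → Tri ≃ₜ Tri}

lemma symm (hβ : τ.IsFaceHomeo β) : τ.IsFaceHomeo fun f => (β f).symm where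
  zero_iff f y i := by rw [← hβ.zero_iff f, Homeomorph.apply_symm_apply]
  glue h s t hst := by
    rw [Homeomorph.symm_apply_eq] at hst ⊢
    exact (hβ.glue h t s hst.symm).symm

lemma exists_side (hβ : τ.IsFaceHomeo β) (f : τ.Face) (i : Fin 3) (s : 𝕀) :
    ∃ t, β f (side i s) = side i t :=
  IsoDelaunay.exists_side ((hβ.zero_iff f _ i).2 (side_apply_self i s))

lemma trans (hβ : τ.IsFaceHomeo β) (hγ : τ.IsFaceHomeo γ) :
    τ.IsFaceHomeo fun f => (β f).trans (γ f) where
  zero_iff f y i := by rw [Homeomorph.trans_apply, hγ.zero_iff, hβ.zero_iff]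
  glue h s t hst := by
    obtain ⟨r, hr⟩ := hβ.exists_side h.1 h.2 s
    rw [Homeomorph.trans_apply, hr] at hst
    rw [Homeomorph.trans_apply, hβ.glue h s r hr, hγ.glue h r t hst]

lemma apply_vtx (hβ : τ.IsFaceHomeo β) (f : τ.Face) (i : Fin 3) : β f (vtx i) = vtx i := by
  refine Tri.ext_of i ?_ ?_
  · rw [vtx_apply_add_one, hβ.zero_iff, vtx_apply_add_one]
  · rw [vtx_apply_add_two, hβ.zero_iff, vtx_apply_add_two]

lemma pos_iff (hβ : τ.IsFaceHomeo β) (f : τ.Face) (y : Tri) (i : Fin 3) :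
    0 < (β f y).1 i ↔ 0 < y.1 i := by
  rw [(Tri.nonneg _ i).lt_iff_ne', (Tri.nonneg _ i).lt_iff_ne', Ne, Ne, hβ.zero_iff]

lemma eq_vtx_iff (hβ : τ.IsFaceHomeo β) (f : τ.Face) (y : Tri) (i : Fin 3) :
    β f y = vtx i ↔ y = vtx i := by
  rw [← hβ.apply_vtx f i, (β f).injective.eq_iff, hβ.apply_vtx]

lemma side_bounds (hβ : τ.IsFaceHomeo β) {f : τ.Face} {i : Fin 3} {s t : 𝕀}
    (h : β f (side i s) = side i t) (h0 : 0 < s) (h1 : s < 1) : 0 < t ∧ t < 1 := by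
  have h0' := (hβ.pos_iff f (side i s) (i + 2)).2 (by rw [side_apply_add_two]; exact h0)
  have h1' := (hβ.pos_iff f (side i s) (i + 1)).2 (by rw [side_apply_add_one]; exact sub_pos.2 h1)
  rw [h, side_apply_add_two] at h0'
  rw [h, side_apply_add_one] at h1'
  exact ⟨h0', Subtype.coe_lt_coe.1 (sub_pos.1 h1')⟩

end IsFaceHomeo

/-- The triangulation with the same cells and reparametrized characteristic maps. -/
abbrev reparam (τ : Triangulation Z) {β : τ.Face → Tri ≃ₜ Tri} (hβ : τ.IsFaceHomeo β) :
    Triangulation Z where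
  Face := τ.Face
  finite_face := τ.finite_face
  char f := (τ.char f).comp ⟨(β f).symm, (β f).symm.continuous⟩
  opp := τ.opp
  opp_opp := τ.opp_opp
  opp_ne := τ.opp_ne
  cover p := by
    obtain ⟨f, x, h⟩ := τ.cover p
    exact ⟨f, β f x, by simpa using h⟩
  face_inj f g x y hx h := by
    obtain ⟨rfl, h2⟩ := τ.face_inj f g _ _ (fun i => (hβ.symm.pos_iff f x i).2 (hx i)) h
    exact ⟨rfl, (β f).symm.injective h2⟩
  glue h t := by
    obtain ⟨s, hs⟩ := hβ.symm.exists_side h.1 h.2 t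
    change τ.char h.1 ((β h.1).symm _) = τ.char _ ((β (τ.opp h).1).symm _)
    rw [hs, hβ.symm.glue h t s hs, τ.glue]
  edge_inj h k s t h0 h1 he := by
    obtain ⟨s', hs⟩ := hβ.symm.exists_side h.1 h.2 s
    obtain ⟨t', ht⟩ := hβ.symm.exists_side k.1 k.2 t
    obtain ⟨a, b⟩ := hβ.symm.side_bounds hs h0 h1
    change τ.char h.1 ((β h.1).symm _) = τ.char k.1 ((β k.1).symm _) at he
    rw [hs, ht] at he
    obtain ⟨rfl, rfl⟩ | ⟨rfl, rfl⟩ := τ.edge_inj h k s' t' a b he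
    · exact Or.inl ⟨rfl, side_injective k.2 ((β k.1).symm.injective (ht.trans hs.symm))⟩
    · exact Or.inr ⟨rfl, side_injective _ ((β _).symm.injective
        (ht.trans (hβ.symm.glue h s s' hs).symm))⟩
  mem_iff f x := by
    change τ.char f ((β f).symm x) ∈ Z ↔ _
    rw [τ.mem_iff]
    exact exists_congr fun i => hβ.symm.eq_vtx_iff f x i

lemma IsDevelopment.of_reparam {β : τ.Face → Tri ≃ₜ Tri} (hβ : τ.IsFaceHomeo β) {f : τ.Face}
    {D : Tri → ℂ} (hD : (τ.reparam hβ).IsDevelopment X f D) :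
    τ.IsDevelopment X f (D ∘ β f) := by
  have hv : ∀ i, D (β f (vtx i)) = D (vtx i) := fun i => by rw [hβ.apply_vtx]
  obtain ⟨h1, h2, h3, h4, h5⟩ := hD
  refine ⟨?_, ?_, h3.comp (β f).injective, ?_, fun i => ?_⟩
  · have := h1.comp (β f).continuous
    refine fun t => ?_
    obtain ⟨U, hU, ht, F, hF, hD⟩ := this t
    exact ⟨U, hU, by simpa using ht, F, hF, by simpa using hD⟩
  · simpa only [comp_apply, hv] using h2
  · rw [(β f).surjective.range_comp, h4]
    simp only [comp_apply, hv]
  · simp only [comp_apply, hv]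
    rw [← h5]
    refine Subset.antisymm ?_ ?_
    · rintro _ ⟨s, rfl⟩
      obtain ⟨t, ht⟩ := hβ.exists_side f i s
      exact ⟨t, by simp only [ht]⟩
    · rintro _ ⟨s, rfl⟩
      obtain ⟨t, ht⟩ := hβ.symm.exists_side f i s
      exact ⟨t, by simp only [← ht, Homeomorph.apply_symm_apply]⟩

/-- A cochain is realized by `X` if every face is developed by the affine map with these edges. -/
def IsRealizedBy (τ : Triangulation Z) (v : τ.Corner → ℂ) (X : TranslationSurface o Z κ) :
    Prop := ∀ f, τ.IsDevelopment X f (τ.aff v f)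

lemma verts_aff {v : τ.Corner → ℂ} (hv : τ.IsCocycle v) (f : τ.Face) (i : Fin 3) :
    verts (τ.aff v f) (i + 2) - verts (τ.aff v f) (i + 1) = v (f, i) := by
  rw [verts, verts, aff_vtx_add_two hv, add_sub_cancel_left]

lemma affTri_verts_aff {v : τ.Corner → ℂ} (f : τ.Face) (x : Tri) :
    affTri (verts (τ.aff v f)) x = τ.aff v f x := by
  simp [affTri, verts, aff, Fin.sum_univ_three, vtx_apply_self, vtx_apply_of_ne]
  ring

lemma isDevelopment_aff {v : τ.Corner → ℂ} (hv : τ.IsCocycle v) (f : τ.Face)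
    (h : X.IsPrimitiveAlong (τ.char f) (τ.aff v f))
    (ha : cross (v (f, 0 + 2)) (-v (f, 0 + 1)) ≠ 0) : τ.IsDevelopment X f (τ.aff v f) := by
  have hA : area (verts (τ.aff v f)) ≠ 0 := by
    have h1 := aff_vtx_add_one hv f 0
    have h2 := aff_vtx_add_two hv f 1
    simp at h1 h2
    have h3 : τ.aff v f (vtx 2) - τ.aff v f (vtx 0) = -v (f, 0 + 1) := by
      rw [zero_add]; linear_combination -h2
    rwa [area, verts, verts, verts, h3, h1, add_sub_cancel_left]
  have haff : τ.aff v f = affTri (verts (τ.aff v f)) := funext fun x => (affTri_verts_aff f x).symm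
  refine ⟨h, affineIndependent_of_area hA, ?_, ?_, fun i => ?_⟩
  · rw [haff]; exact affTri_injective hA
  · rw [show (fun i => τ.aff v f (vtx i)) = verts (τ.aff v f) from rfl,
      convexHull_eq_range_affTri, ← haff]
  · rw [segment_eq_image']
    ext z
    simp only [mem_range, mem_image]
    have key : ∀ t : 𝕀, τ.aff v f (side i t) = τ.aff v f (vtx (i + 1)) +
        (t : ℝ) • (τ.aff v f (vtx (i + 2)) - τ.aff v f (vtx (i + 1))) := fun t => by
      rw [aff_vtx_add_two hv, add_sub_cancel_left, real_smul]
      exact aff_side hv (f, i) t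
    constructor
    · rintro ⟨t, rfl⟩
      exact ⟨t, t.2, (key t).symm⟩
    · rintro ⟨t, ht, rfl⟩
      exact ⟨⟨t, ht⟩, key ⟨t, ht⟩⟩

/-- Every geometric triangulation is affine after reparametrization of its faces. -/
lemma IsGeometric.exists_reparam (hg : τ.IsGeometric X) :
    ∃ β, ∃ hβ : τ.IsFaceHomeo β, (τ.reparam hβ).IsRealizedBy (τ.edgeVec X) X := by
  choose D hD using hg
  have hA := fun f => (hD f).area_ne_zero
  have hex : ∀ f x, ∃ y, affTri (verts (D f)) y = D f x := fun f x => by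
    have := mem_range_self (f := D f) x
    rwa [(hD f).range_eq] at this
  choose b hb using hex
  have hcoord : ∀ f x i, (b f x).1 i = bary (verts (D f)) i (D f x) := fun f x i => by
    rw [← hb f x, bary_affTri (hA f)]
  have hbc : ∀ f, Continuous (b f) := fun f => by
    refine Continuous.subtype_mk (continuous_pi fun i => ?_) _
    have : (fun x => (b f x).1 i) = fun x => bary (verts (D f)) i (D f x) :=
      funext fun x => hcoord f x i
    change Continuous fun x => (b f x).1 i
    rw [this]
    exact (continuous_bary _ i).comp (hD f).continuous
  have hbij : ∀ f, Bijective (b f) := fun f => by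
    refine ⟨fun x y hxy => (hD f).2.2.1 ?_, fun y => ?_⟩
    · rw [← hb, ← hb, hxy]
    · obtain ⟨x, hx⟩ : affTri (verts (D f)) y ∈ range (D f) := (hD f).range_eq ▸ mem_range_self y
      exact ⟨x, affTri_injective (hA f) ((hb f x).trans hx)⟩
  let β : τ.Face → Tri ≃ₜ Tri := fun f =>
    Continuous.homeoOfEquivCompactToT2 (f := Equiv.ofBijective (b f) (hbij f)) (hbc f)
  have hβ' : ∀ f x, β f x = b f x := fun _ _ => rfl
  have hedge := fun f i => (hD f).edgeVec_eq i
  have hβ : τ.IsFaceHomeo β := by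
    refine ⟨fun f y i => ?_, fun h s t hst => ?_⟩
    · rw [hβ', hcoord, (hD f).bary_eq_zero_iff]
    · rw [hβ'] at hst ⊢
      have h1 := (hD h.1).sub_side_eq (hD (τ.opp h).1) s 0
      rw [← hb h.1, hst, affTri_side, unitInterval.symm_zero, side_zero, side_one] at h1
      change verts (D h.1) (h.2 + 1) + _ - _ = verts (D h.1) (h.2 + 1) -
        verts (D (τ.opp h).1) ((τ.opp h).2 + 2) at h1
      apply affTri_injective (hA (τ.opp h).1)
      have h2 := edgeVec_opp (X := X) h
      rw [show τ.opp h = ((τ.opp h).1, (τ.opp h).2) from rfl, hedge,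
        show τ.edgeVec X h = _ from hedge h.1 h.2] at h2
      rw [hb, affTri_side, unitInterval.coe_symm_eq]
      push_cast
      linear_combination -h1 + (t : ℂ) * h2
  refine ⟨β, hβ, fun f => ?_⟩
  have hcoc := isCocycle_edgeVec (X := X) (τ := τ) fun f => ⟨D f, hD f⟩
  have hc : (τ.reparam hβ).IsCocycle (τ.edgeVec X) := ⟨hcoc.opp, hcoc.sum⟩
  have key : ∀ y, (τ.reparam hβ).aff (τ.edgeVec X) f y = D f ((β f).symm y) - D f (vtx 0) := by
    intro y
    have h1 := hb f ((β f).symm y)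
    rw [← hβ', Homeomorph.apply_symm_apply, affTri_eq _ _ 0] at h1
    have e1 := (hD f).edgeVec_add_two 0
    have e2 := (hD f).neg_edgeVec_add_one 0
    simp only [zero_add] at e1 e2 h1
    rw [← h1, aff, e1, neg_eq_iff_eq_neg.1 e2]
    simp only [verts]
    ring
  refine isDevelopment_aff hc f ?_ ?_
  · intro t
    obtain ⟨U, hU, ht, F, hF, hE⟩ := ((hD f).1.comp (β f).symm.continuous) t
    refine ⟨U, hU, ht, _, hF.add_const (-D f (vtx 0)), ?_⟩
    filter_upwards [hE] with y hy
    rw [key, sub_eq_add_neg]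
    exact congrArg (· + _) hy
  · rw [← (hD f).area_eq_cross]
    exact hA f

end Triangulation

/-! ### Comparison of local degrees -/

section Degree

/-- The functions `F` and `G` have the same local degree at `p`. -/
def SameDegree (F G : S → ℂ) (p : S) : Prop :=
  ∃ U : Set S, IsOpen U ∧ p ∈ U ∧ ∃ L : S → ℂ, ContinuousOn L (U \ {p}) ∧
    ∀ q ∈ U \ {p}, G q - G p = (F q - F p) * exp (L q)

lemma SameDegree.symm {F G : S → ℂ} {p : S} (h : SameDegree F G p) : SameDegree G F p := by
  obtain ⟨U, hU, hp, L, hL, hLq⟩ := h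
  refine ⟨U, hU, hp, fun q => -L q, hL.neg, fun q hq => ?_⟩
  rw [hLq q hq, mul_assoc, ← exp_add, add_neg_cancel, Complex.exp_zero, mul_one]

lemma SameDegree.trans {F G H : S → ℂ} {p : S} (h : SameDegree F G p) (h' : SameDegree G H p) :
    SameDegree F H p := by
  obtain ⟨U, hU, hp, L, hL, hLq⟩ := h
  obtain ⟨V, hV, hpV, M, hM, hMq⟩ := h'
  refine ⟨U ∩ V, hU.inter hV, ⟨hp, hpV⟩, fun q => L q + M q, ?_, fun q hq => ?_⟩
  · exact (hL.mono fun q hq => ⟨hq.1.1, hq.2⟩).add (hM.mono fun q hq => ⟨hq.1.2, hq.2⟩)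
  · rw [hMq q ⟨hq.1.2, hq.2⟩, hLq q ⟨hq.1.1, hq.2⟩, mul_assoc, ← exp_add]

lemma SameDegree.congr_right {F G G' : S → ℂ} {p : S} (h : SameDegree F G p)
    (hG : ∀ᶠ q in 𝓝 p, G' q = G q) : SameDegree F G' p := by
  obtain ⟨U, hU, hp, L, hL, hLq⟩ := h
  obtain ⟨V, hV, hVo, hpV⟩ := eventually_nhds_iff.1 hG
  refine ⟨U ∩ V, hU.inter hVo, ⟨hp, hpV⟩, L, hL.mono fun q hq => ⟨hq.1.1, hq.2⟩, fun q hq => ?_⟩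
  rw [hV q hq.1.2, hV p hpV, hLq q ⟨hq.1.1, hq.2⟩]

lemma sameDegree_of_slitPlane {F G : S → ℂ} {p : S} {U : Set S} (hU : IsOpen U) (hp : p ∈ U)
    (hF : ContinuousOn F U) (hG : ContinuousOn G U) (hne : ∀ q ∈ U, q ≠ p → F q ≠ F p) {c : ℂ}
    (hc : c ≠ 0)
    (h : ∀ q ∈ U, q ≠ p → (G q - G p) / (c * (F q - F p)) ∈ slitPlane) :
    SameDegree F G p := by
  refine ⟨U, hU, hp, fun q => log c + log ((G q - G p) / (c * (F q - F p))),
    continuousOn_const.add (ContinuousOn.clog ?_ fun q hq => h q hq.1 hq.2), fun q hq => ?_⟩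
  · refine ((hG.sub continuousOn_const).mono sdiff_subset).div
      (continuousOn_const.mul ((hF.sub continuousOn_const).mono sdiff_subset)) fun q hq => ?_
    exact mul_ne_zero hc (sub_ne_zero.2 (hne q hq.1 hq.2))
  · have h1 := sub_ne_zero.2 (hne q hq.1 hq.2)
    rw [exp_add, exp_log hc, exp_log (slitPlane_ne_zero (h q hq.1 hq.2))]
    field_simp

lemma isPositiveAt_iff_sameDegree {φ : OpenPartialHomeomorph S ℂ} {G : S → ℂ} {p : S}
    (hp : p ∈ φ.source) : IsPositiveAt (G ∘ φ.symm) (φ p) ↔ SameDegree φ G p := by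
  constructor
  · rintro ⟨r, hr, L, hL, h⟩
    refine ⟨φ.source ∩ φ ⁻¹' ball (φ p) r, φ.isOpen_inter_preimage isOpen_ball,
      ⟨hp, mem_ball_self hr⟩, fun q => L (φ q - φ p), ?_, ?_⟩
    · refine hL.comp ((φ.continuousOn.mono fun q hq => hq.1.1).sub continuousOn_const)
        fun q hq => ⟨?_, ?_⟩
      · rw [mem_ball_zero_iff, ← dist_eq_norm]; exact hq.1.2
      · exact sub_ne_zero.2 fun h => hq.2 (φ.injOn hq.1.1 hp h)
    · intro q hq
      have := h (φ q - φ p) ⟨by rw [mem_ball_zero_iff, ← dist_eq_norm]; exact hq.1.2,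
        sub_ne_zero.2 fun h => hq.2 (φ.injOn hq.1.1 hp h)⟩
      simpa only [comp_apply, add_sub_cancel, φ.left_inv hq.1.1, φ.left_inv hp] using this
  · rintro ⟨U, hU, hpU, L, hL, h⟩
    have hopen : IsOpen (φ.target ∩ φ.symm ⁻¹' U) := φ.symm.isOpen_inter_preimage hU
    obtain ⟨r, hr, hball⟩ := Metric.isOpen_iff.1 hopen (φ p)
      ⟨φ.map_source hp, by simpa [φ.left_inv hp] using hpU⟩
    have hmem : ∀ z ∈ ball (0 : ℂ) r \ {0}, φ p + z ∈ φ.target ∧ φ.symm (φ p + z) ∈ U \ {p} := by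
      intro z hz
      have h1 := hball (show φ p + z ∈ ball (φ p) r by simpa using hz.1)
      refine ⟨h1.1, h1.2, fun h2 => hz.2 ?_⟩
      have h3 : φ (φ.symm (φ p + z)) = φ p := by rw [h2]
      rw [φ.right_inv h1.1] at h3
      exact left_eq_add.1 h3.symm
    refine ⟨r, hr, fun z => L (φ.symm (φ p + z)), ?_, fun z hz => ?_⟩
    · exact hL.comp (φ.symm.continuousOn.comp (continuousOn_const.add continuousOn_id)
        fun z hz => (hmem z hz).1) fun z hz => (hmem z hz).2
    · have h1 := h _ (hmem z hz).2
      rw [φ.right_inv (hmem z hz).1, add_sub_cancel_left] at h1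
      simpa only [comp_apply, φ.left_inv hp] using h1

lemma mem_slitPlane_of_near {z : ℂ} (h : dist z 1 < 1) : z ∈ slitPlane :=
  Complex.ball_one_subset_slitPlane h

/-- A function with nonzero complex derivative in a chart has the degree of the chart. -/
lemma sameDegree_of_hasDerivAt {φ : OpenPartialHomeomorph S ℂ} {G : S → ℂ} {p : S}
    (hp : p ∈ φ.source) {c : ℂ} (hc : c ≠ 0) (h : HasDerivAt (G ∘ φ.symm) c (φ p))
    {V : Set S} (hV : IsOpen V) (hpV : p ∈ V) (hG : ContinuousOn G V) : SameDegree φ G p := by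
  have h1 := hasDerivAt_iff_tendsto_slope.1 h
  have h2 : ∀ᶠ z in 𝓝[≠] (φ p), dist (slope (G ∘ φ.symm) (φ p) z / c) 1 < 1 := by
    have : Tendsto (fun z => slope (G ∘ φ.symm) (φ p) z / c) (𝓝[≠] (φ p)) (𝓝 1) := by
      simpa [hc] using h1.div_const c
    exact this (ball_mem_nhds 1 one_pos)
  rw [eventually_nhdsWithin_iff] at h2
  obtain ⟨W, hW, hWo, hpW⟩ := eventually_nhds_iff.1 h2
  have hne : ∀ q ∈ φ.source ∩ φ ⁻¹' W ∩ V, q ≠ p → φ q ≠ φ p := fun q hq hqp h =>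
    hqp (φ.injOn hq.1.1 hp h)
  refine sameDegree_of_slitPlane ((φ.isOpen_inter_preimage hWo).inter hV) ⟨⟨hp, hpW⟩, hpV⟩
    (φ.continuousOn.mono fun q hq => hq.1.1) (hG.mono fun q hq => hq.2) hne hc fun q hq hqp => ?_
  have h3 := mem_slitPlane_of_near (hW (φ q) hq.1.2 (hne q hq hqp))
  have h4 := sub_ne_zero.2 (hne q hq hqp)
  rw [slope_def_field, comp_apply, comp_apply, φ.left_inv hq.1.1, φ.left_inv hp] at h3
  convert h3 using 1
  field_simp

/-- A chart and its complex conjugate have different degrees. -/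
lemma not_sameDegree_conj {φ : OpenPartialHomeomorph S ℂ} {p : S} (hp : p ∈ φ.source) :
    ¬ SameDegree φ (fun q => (starRingEnd ℂ) (φ q)) p := by
  intro h
  obtain ⟨r, hr, L, hL, h⟩ := (isPositiveAt_iff_sameDegree hp).2 h
  obtain ⟨r', hr', hball⟩ := Metric.isOpen_iff.1 φ.open_target (φ p) (φ.map_source hp)
  have hm := lt_min hr hr'
  let γ : ℝ → ℂ := fun t => (min r r' / 2 : ℝ) * exp (t * I)
  have hγc : Continuous γ := by fun_prop
  have hγb : ∀ t, ‖γ t‖ < min r r' := fun t => by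
    rw [norm_mul, Complex.norm_exp_ofReal_mul_I, mul_one, norm_real,
      Real.norm_eq_abs, abs_of_pos (half_pos hm)]
    exact half_lt_self hm
  have hγ : ∀ t, γ t ∈ ball (0 : ℂ) r \ {0} := fun t =>
    ⟨mem_ball_zero_iff.2 ((hγb t).trans_le (min_le_left _ _)),
      mul_ne_zero (by exact_mod_cast (half_pos hm).ne') (exp_ne_zero _)⟩
  have hk : ∀ t : ℝ, exp (L (γ t) + 2 * t * I) = 1 := fun t => by
    have h1 := h (γ t) (hγ t)
    have hmem : φ p + γ t ∈ φ.target := hball (by simpa using (hγb t).trans_le (min_le_right _ _))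
    simp only [comp_apply, φ.right_inv hmem, φ.left_inv hp, map_add, add_sub_cancel_left] at h1
    have h2 : (starRingEnd ℂ) (γ t) = (min r r' / 2 : ℝ) * exp (-(t * I)) := by
      rw [map_mul, Complex.conj_ofReal, ← Complex.exp_conj]
      simp
    have h3 : ((min r r' / 2 : ℝ) : ℂ) ≠ 0 := by exact_mod_cast (half_pos hm).ne'
    rw [h2] at h1
    simp only [γ, mul_assoc] at h1
    have h4 := mul_left_cancel₀ h3 h1
    rw [exp_add, show (2 : ℂ) * t * I = t * I + t * I by ring,
      exp_add, mul_comm, mul_assoc, ← h4, ← exp_add]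
    simp
  let k : ℝ → ℝ := fun t => (L (γ t)).im + 2 * t
  have hkc : Continuous k := by
    have : Continuous fun t => L (γ t) := hL.comp_continuous hγc hγ
    exact (Complex.continuous_im.comp this).add (by fun_prop)
  have hkn : ∀ t, ∃ n : ℤ, k t = n * (2 * π) := fun t => by
    obtain ⟨n, hn⟩ := Complex.exp_eq_one_iff.1 (hk t)
    refine ⟨n, ?_⟩
    have := congrArg Complex.im hn
    simpa [k] using this
  have hper : k (2 * π) = k 0 + 4 * π := by
    have : γ (2 * π) = γ 0 := by simp [γ]
    simp only [k, this]
    ring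
  have hπ := pi_pos
  obtain ⟨t, -, ht⟩ := intermediate_value_Icc (by positivity : (0 : ℝ) ≤ 2 * π)
    hkc.continuousOn (show k 0 + π ∈ Icc (k 0) (k (2 * π)) by rw [hper]; constructor <;> linarith)
  obtain ⟨m, hm⟩ := hkn t
  obtain ⟨n, hn⟩ := hkn 0
  rw [hm, hn] at ht
  have h5 : (2 * m : ℝ) = 2 * n + 1 := by
    apply mul_right_cancel₀ hπ.ne'
    linear_combination ht
  have h6 : 2 * m = 2 * n + 1 := by exact_mod_cast h5
  omega

end Degree

/-! ### Piecewise linear maps across an edge -/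

/-- The map that is the identity on the real axis and takes `I` to `w₁` on one side of it and to
`w₂` on the other. -/
def bend (ε : ℝ) (w₁ w₂ z : ℂ) : ℂ := z.re + z.im * (if 0 ≤ ε * z.im then w₁ else w₂)

lemma bend_of_nonneg {ε : ℝ} {w₁ w₂ z : ℂ} (h : 0 ≤ ε * z.im) :
    bend ε w₁ w₂ z = z.re + z.im * w₁ := by rw [bend, if_pos h]

lemma bend_of_nonpos {ε : ℝ} (hε : ε ≠ 0) {w₁ w₂ z : ℂ} (h : ε * z.im ≤ 0) :
    bend ε w₁ w₂ z = z.re + z.im * w₂ := by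
  rcases h.eq_or_lt with h | h
  · have : z.im = 0 := (mul_eq_zero.1 h).resolve_left hε
    simp [bend, this]
  · rw [bend, if_neg h.not_ge]

lemma continuous_bend {ε : ℝ} (hε : ε ≠ 0) (w₁ w₂ : ℂ) : Continuous (bend ε w₁ w₂) := by
  have : bend ε w₁ w₂ = fun z => if 0 ≤ ε * z.im then z.re + z.im * w₁ else z.re + z.im * w₂ := by
    funext z; rw [bend]; split_ifs <;> rfl
  rw [this]
  refine Continuous.if_le (by fun_prop) (by fun_prop) (by fun_prop) (by fun_prop) fun z hz => ?_
  have : z.im = 0 := (mul_eq_zero.1 hz.symm).resolve_left hε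
  simp [this]

lemma bend_bend {ε : ℝ} (hε : ε ≠ 0) {w₁ w₂ : ℂ} (h₁ : 0 < w₁.im) (h₂ : 0 < w₂.im) (z : ℂ) :
    bend ε ((I - w₁.re) / w₁.im) ((I - w₂.re) / w₂.im) (bend ε w₁ w₂ z) = z := by
  have key : ∀ w : ℂ, 0 < w.im → ((z.re + z.im * w : ℂ).re : ℂ) +
      ((z.re + z.im * w : ℂ).im : ℂ) * ((I - w.re) / w.im) = z := by
    intro w hw
    have : (w.im : ℂ) ≠ 0 := by exact_mod_cast hw.ne'
    simp only [add_re, add_im, re_ofReal_mul, im_ofReal_mul, ofReal_re, ofReal_im]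
    push_cast
    field_simp
    linear_combination (w.im : ℂ) * Complex.re_add_im z
  have him : ∀ w : ℂ, (z.re + z.im * w : ℂ).im = z.im * w.im := fun w => by simp
  rcases le_total 0 (ε * z.im) with h | h
  · rw [bend_of_nonneg h, bend_of_nonneg (by rw [him, ← mul_assoc]; positivity), key _ h₁]
  · rw [bend_of_nonpos hε h, bend_of_nonpos hε (by
      rw [him, ← mul_assoc]; exact mul_nonpos_of_nonpos_of_nonneg h h₂.le), key _ h₂]

/-- `bend` as a homeomorphism. -/
def bendHomeo {ε : ℝ} (hε : ε ≠ 0) {w₁ w₂ : ℂ} (h₁ : 0 < w₁.im) (h₂ : 0 < w₂.im) : ℂ ≃ₜ ℂ where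
  toFun := bend ε w₁ w₂
  invFun := bend ε ((I - w₁.re) / w₁.im) ((I - w₂.re) / w₂.im)
  left_inv := bend_bend hε h₁ h₂
  right_inv z := by
    have him : ∀ w : ℂ, ((I - w.re) / w.im).im = w.im⁻¹ := fun w => by simp [Complex.div_ofReal_im]
    have hre : ∀ w : ℂ, ((I - w.re) / w.im).re = -w.re / w.im := fun w => by
      simp [Complex.div_ofReal_re]
    have hinv : ∀ w : ℂ, 0 < w.im → (I - ((I - w.re) / w.im : ℂ).re) /
        ((I - w.re) / w.im : ℂ).im = w := fun w hw => by
      have : (w.im : ℂ) ≠ 0 := by exact_mod_cast hw.ne'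
      rw [him, hre]
      push_cast
      field_simp
      linear_combination Complex.re_add_im w
    have := bend_bend hε (w₁ := (I - w₁.re) / w₁.im) (w₂ := (I - w₂.re) / w₂.im)
      (by rw [him]; positivity) (by rw [him]; positivity) z
    rwa [hinv _ h₁, hinv _ h₂] at this
  continuous_toFun := continuous_bend hε _ _
  continuous_invFun := continuous_bend hε _ _

lemma bend_div_mem_slitPlane {ε : ℝ} {w₁ w₂ z : ℂ} (h₁ : 0 < w₁.im)
    (h₂ : 0 < w₂.im) (hz : z ≠ 0) : bend ε w₁ w₂ z / z ∈ slitPlane := by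
  have key : ∀ w : ℂ, 0 < w.im → (z.re + z.im * w) / z ∈ slitPlane := by
    intro w hw
    rw [Complex.mem_slitPlane_iff]
    by_contra! hcon
    set q := (z.re + z.im * w) / z with hq
    have h1 : (z.re + z.im * w : ℂ) = q.re * z := by
      have : (q.re : ℂ) = q := Complex.ext rfl (by simp [hcon.2])
      rw [this, hq, div_mul_cancel₀ _ hz]
    have him := congrArg Complex.im h1
    have hre := congrArg Complex.re h1
    simp at him hre
    rcases eq_or_ne z.im 0 with h | h
    · have hr : z.re ≠ 0 := fun h' => hz (Complex.ext h' h)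
      have : q.re = 1 := by
        apply mul_right_cancel₀ hr
        rw [← hre, h]; ring
      linarith [hcon.1]
    · have : w.im = q.re := mul_left_cancel₀ h (by linarith)
      linarith [hcon.1]
  rw [bend]
  split_ifs
  · exact key _ h₁
  · exact key _ h₂

namespace Triangulation

variable {v v₁ v₂ : τ.Corner → ℂ}
variable {ε : ℝ}

/-- The slope of a face over one of its sides. -/
def slope (τ : Triangulation Z) (v : τ.Corner → ℂ) (k : τ.Corner) : ℂ := -v (k.1, k.2 + 2) / v k

lemma IsOriented.slope_im (h : τ.IsOriented ε v) (k : τ.Corner) : 0 < ε * (τ.slope v k).im := by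
  have h1 := h (k.1, k.2 + 1)
  simp only [fin3_add_one_add_two, fin3_add_one_add_one] at h1
  have h2 : (τ.slope v k).im = cross (v k) (-v (k.1, k.2 + 2)) / normSq (v k) := by
    rw [slope, Complex.div_im, cross]
    simp only [neg_re, neg_im]
    ring
  rw [h2, ← mul_div_assoc]
  exact div_pos h1 (normSq_pos.2 (h.ne_zero k))

lemma aff_sub (hv : τ.IsCocycle v) (k : τ.Corner) (hk : v k ≠ 0) (x y : Tri) :
    τ.aff v k.1 y - τ.aff v k.1 x = v k *
      ((y.1 (k.2 + 2) - x.1 (k.2 + 2) : ℝ) + (y.1 k.2 - x.1 k.2 : ℝ) * τ.slope v k) := by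
  rw [aff_eq hv k.1 (k.2 + 1) y, aff_eq hv k.1 (k.2 + 1) x, slope]
  simp only [fin3_add_one_add_two, fin3_add_one_add_one]
  push_cast
  field_simp
  ring

/-- The bending parameter that takes the face over `k` from the shape `v₁` to the shape `v₂`. -/
def bendParam (τ : Triangulation Z) (v₁ v₂ : τ.Corner → ℂ) (k : τ.Corner) : ℂ :=
  (τ.slope v₂ k - (τ.slope v₁ k).re) / (τ.slope v₁ k).im

lemma bendParam_im (h₁ : τ.IsOriented ε v₁) (h₂ : τ.IsOriented ε v₂)
    (hε : ε = 1 ∨ ε = -1) (k : τ.Corner) : 0 < (τ.bendParam v₁ v₂ k).im := by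
  have e : (τ.bendParam v₁ v₂ k).im = (τ.slope v₂ k).im / (τ.slope v₁ k).im := by
    simp [bendParam, Complex.div_ofReal_im]
  have a := h₁.slope_im k
  have b := h₂.slope_im k
  rw [e]
  rcases hε with rfl | rfl
  · exact div_pos (by linarith) (by linarith)
  · exact div_pos_of_neg_of_neg (by linarith) (by linarith)

lemma add_mul_slope (h₁ : τ.IsOriented ε v₁) (k : τ.Corner) (a b : ℝ) :
    (a + b * τ.slope v₂ k : ℂ) = ((a + b * τ.slope v₁ k : ℂ).re : ℂ) +
      ((a + b * τ.slope v₁ k : ℂ).im : ℂ) * τ.bendParam v₁ v₂ k := by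
  have h : ((τ.slope v₁ k).im : ℂ) ≠ 0 := by
    exact_mod_cast (right_ne_zero_of_mul (h₁.slope_im k).ne')
  rw [bendParam]
  simp only [add_re, add_im, re_ofReal_mul, im_ofReal_mul, ofReal_re, ofReal_im]
  push_cast
  field_simp
  ring

/-- Two piecewise linear primitives differ locally by a bending map, away from the vertices. -/
lemma exists_bend [T2Space S] (hε : ε = 1 ∨ ε = -1) (hv₁ : τ.IsCocycle v₁)
    (hv₂ : τ.IsCocycle v₂) (h₁ : τ.IsOriented ε v₁) (h₂ : τ.IsOriented ε v₂) {p : S} (hp : p ∉ Z)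
    {F₁ F₂ : S → ℂ} {U : Set S} (hpU : p ∈ U) (hF₁ : τ.IsPLPrimitive v₁ F₁ U)
    (hF₂ : τ.IsPLPrimitive v₂ F₂ U) : ∃ u₁ u₂ w₁ w₂ : ℂ, u₁ ≠ 0 ∧ u₂ ≠ 0 ∧ 0 < w₁.im ∧ 0 < w₂.im ∧
      ∀ᶠ q in 𝓝 p, F₂ q - F₂ p = u₂ * bend ε w₁ w₂ ((F₁ q - F₁ p) / u₁) := by
  have hε0 : ε ≠ 0 := by rcases hε with rfl | rfl <;> norm_num
  have hb := bendParam_im h₁ h₂ hε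
  obtain ⟨f, x, rfl⟩ := τ.cover p
  rcases x.cases with hx | ⟨i, s, hs0, hs1, rfl⟩ | ⟨i, rfl⟩
  · refine ⟨v₁ (f, 0), v₂ (f, 0), _, _, h₁.ne_zero _, h₂.ne_zero _, hb (f, 0), hb (f, 0),
      eventually_of_char τ fun g y hgy => ?_⟩
    obtain ⟨rfl, rfl⟩ := τ.face_inj f g x y hx hgy.symm
    filter_upwards [hF₁ f x hpU, hF₂ f x hpU] with y e₁ e₂
    rw [e₁, e₂, aff_sub hv₁ (f, 0) (h₁.ne_zero _), aff_sub hv₂ (f, 0) (h₂.ne_zero _),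
      mul_div_cancel_left₀ _ (h₁.ne_zero _), add_mul_slope h₁, bend]
    split_ifs <;> rfl
  · refine ⟨v₁ (f, i), v₂ (f, i), _, _, h₁.ne_zero _, h₂.ne_zero _, hb (f, i), hb (τ.opp (f, i)),
      eventually_of_char τ fun g y hgy => ?_⟩
    rcases y.cases with hy | ⟨j, t, ht0, ht1, rfl⟩ | ⟨j, rfl⟩
    · obtain ⟨-, rfl⟩ := τ.face_inj g f y _ hy hgy
      exact absurd (hy i) (by simp [side_apply_self])
    · rcases τ.edge_inj (f, i) (g, j) s t hs0 hs1 hgy.symm with ⟨h, rfl⟩ | ⟨h, rfl⟩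
      · obtain ⟨rfl, rfl⟩ := Prod.mk.inj h
        filter_upwards [hF₁ g _ hpU, hF₂ g _ hpU] with y e₁ e₂
        rw [e₁, e₂, aff_sub hv₁ (g, j) (h₁.ne_zero _), aff_sub hv₂ (g, j) (h₂.ne_zero _),
          mul_div_cancel_left₀ _ (h₁.ne_zero _), bend_of_nonneg, ← add_mul_slope h₁]
        have := mul_nonneg (y.nonneg j) (h₁.slope_im (g, j)).le
        simp only [side_apply_self, sub_zero, add_im, ofReal_im, zero_add, im_ofReal_mul]
        linarith
      · have hg : (g, j) = τ.opp (f, i) := h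
        obtain ⟨rfl, rfl⟩ : g = (τ.opp (f, i)).1 ∧ j = (τ.opp (f, i)).2 := by simp [← hg]
        have e0 := hgy ▸ hpU
        filter_upwards [hF₁ _ _ e0, hF₂ _ _ e0] with y e₁ e₂
        rw [hgy] at e₁ e₂
        rw [e₁, e₂, aff_sub hv₁ (τ.opp (f, i)) (h₁.ne_zero _),
          aff_sub hv₂ (τ.opp (f, i)) (h₂.ne_zero _), hv₁.opp, hv₂.opp, neg_mul, neg_mul, neg_div,
          mul_div_cancel_left₀ _ (h₁.ne_zero _), bend_of_nonpos hε0, add_mul_slope h₁]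
        · simp only [neg_re, neg_im]
          push_cast
          ring
        · have := mul_nonneg (y.nonneg (τ.opp (f, i)).2) (h₁.slope_im (τ.opp (f, i))).le
          simp only [side_apply_self, sub_zero, add_im, ofReal_im, zero_add, im_ofReal_mul, neg_im]
          linarith
    · exact absurd (hgy ▸ τ.char_vtx_mem g j) hp
  · exact absurd (τ.char_vtx_mem f i) hp

lemma IsRealizedBy.isPLPrimitive (hr : τ.IsRealizedBy v X) {F : S → ℂ} {U : Set S}
    (hU : IsOpen U) (hF : X.IsPrimitiveOn F U) : τ.IsPLPrimitive v F U := by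
  intro f y hy
  obtain ⟨V, hV, hyV, G, hG, hD⟩ := (hr f).1 y
  have h1 := (τ.char f).continuous.continuousAt.eventually
    (hF.sub_const hG hU hV (τ.char f y) ⟨hy, hyV⟩)
  filter_upwards [h1, hD] with y' e1 e2
  rw [e2, hD.self_of_nhds]
  linear_combination e1

/-- Away from the vertices the piecewise linear primitives of `v` are local homeomorphisms, of the
degree of the charts of `X`. -/
lemma IsRealizedBy.exists_chart [T2Space S] (hε : ε = 1 ∨ ε = -1) (hv₁ : τ.IsCocycle v₁)
    (hv : τ.IsCocycle v) (h₁ : τ.IsOriented ε v₁) (h : τ.IsOriented ε v)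
    (hr : τ.IsRealizedBy v₁ X) {p : S} (hp : p ∉ Z) {F : S → ℂ} {U : Set S} (hU : IsOpen U)
    (hpU : p ∈ U) (hF : τ.IsPLPrimitive v F U) :
    (∃ e : OpenPartialHomeomorph S ℂ, p ∈ e.source ∧ e.source ⊆ U ∧ EqOn e F e.source) ∧
      ∀ φ ∈ o.charts, p ∈ φ.source → SameDegree φ F p := by
  have hε0 : ε ≠ 0 := by rcases hε with rfl | rfl <;> norm_num
  obtain ⟨V, hV, hpV, G, hG⟩ := X.exists_primitive p
  have hG' := hG.mono (inter_subset_right (s := U))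
  have hUV := hU.inter hV
  obtain ⟨u₁, u₂, w₁, w₂, hu₁, hu₂, hw₁, hw₂, hb⟩ := exists_bend hε hv₁ hv h₁ h hp
    (U := U ∩ V) ⟨hpU, hpV⟩ (hr.isPLPrimitive hUV hG') fun f y hy => hF f y hy.1
  obtain ⟨e, hpe, heU, he⟩ := hG'.exists_openPartialHomeomorph hUV ⟨hpU, hpV⟩ hp
  obtain ⟨W, hW, hWo, hpW⟩ := eventually_nhds_iff.1 hb
  let A : ℂ ≃ₜ ℂ := (Homeomorph.subRight (G p)).trans <| (Homeomorph.mulRight₀ u₁⁻¹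
    (inv_ne_zero hu₁)).trans <| (bendHomeo hε0 hw₁ hw₂).trans <|
    (Homeomorph.mulLeft₀ u₂ hu₂).trans (Homeomorph.addRight (F p))
  have hA : ∀ q ∈ W, A (G q) = F q := fun q hq => by
    have : A (G q) = u₂ * bend ε w₁ w₂ ((G q - G p) * u₁⁻¹) + F p := rfl
    rw [this, ← div_eq_mul_inv, ← hW q hq, sub_add_cancel]
  have hFA : EqOn (A ∘ G) F W := hA
  have hFc : ContinuousOn F (U ∩ V ∩ W) := by
    refine ContinuousOn.congr (f := A ∘ G) (A.continuous.comp_continuousOn ?_)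
      fun q hq => (hA q hq.2).symm
    exact hG'.continuousOn.mono inter_subset_left
  refine ⟨⟨(e.trans A.toOpenPartialHomeomorph).restrOpen W hWo, ?_, ?_, ?_⟩, fun φ hφ hpφ => ?_⟩
  · simp [hpe, hpW]
  · intro q hq
    simp at hq
    exact (heU hq.1).1
  · intro q hq
    simp at hq
    simp [he q hq.1, hA q hq.2]
  · obtain ⟨φ', hφ', hpφ'⟩ := X.exists_chart p
    have s1 := (isPositiveAt_iff_sameDegree hpφ).1 (X.positive φ hφ φ' hφ' p ⟨hpφ, hpφ'⟩)
    have s2 : SameDegree φ' G p := sameDegree_of_hasDerivAt hpφ' (X.ne_zero φ' hφ' p hpφ' hp)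
      (hG φ' hφ' p ⟨hpφ', hpV⟩) hV hpV hG.continuousOn
    refine (s1.trans s2).trans (sameDegree_of_slitPlane (U := e.source ∩ W) (c := u₂ / u₁)
      (e.open_source.inter hWo) ⟨hpe, hpW⟩ (hG'.continuousOn.mono fun q hq => heU hq.1)
      (hFc.mono fun q hq => ⟨heU hq.1, hq.2⟩) (fun q hq hqp h => hqp ?_) (div_ne_zero hu₂ hu₁)
      fun q hq hqp => ?_)
    · rw [← he q hq.1, ← he p hpe] at h
      exact e.injOn hq.1 hpe h
    · have hne : G q - G p ≠ 0 := fun h => hqp (e.injOn hq.1 hpe (by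
        rw [he q hq.1, he p hpe]; exact sub_eq_zero.1 h))
      have := bend_div_mem_slitPlane (ε := ε) hw₁ hw₂ (div_ne_zero hne hu₁)
      rw [hW q hq.2]
      convert this using 1
      field_simp

/-! ### The corners around a vertex -/

/-- The next corner around a vertex. -/
def rot (τ : Triangulation Z) (c : τ.Corner) : τ.Corner :=
  ((τ.opp (c.1, c.2 + 1)).1, (τ.opp (c.1, c.2 + 1)).2 + 1)

/-- The vertex of a corner. -/
def tip (τ : Triangulation Z) (c : τ.Corner) : S := τ.char c.1 (vtx c.2)

lemma rot_injective : Injective τ.rot := by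
  intro a b h
  have h1 := congrArg Prod.fst h
  have h2 := add_right_cancel (congrArg Prod.snd h)
  have h3 : τ.opp (a.1, a.2 + 1) = τ.opp (b.1, b.2 + 1) := Prod.ext h1 h2
  have h4 := congrArg τ.opp h3
  rw [τ.opp_opp, τ.opp_opp] at h4
  exact Prod.ext (congrArg Prod.fst h4 :) (add_right_cancel (congrArg Prod.snd h4 :))

lemma tip_rot (c : τ.Corner) : τ.tip (τ.rot c) = τ.tip c := by
  have := τ.glue (c.1, c.2 + 1) 1
  rw [side_one, unitInterval.symm_one, side_zero, fin3_add_one_add_two] at this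
  exact this.symm

lemma tip_mem (c : τ.Corner) : τ.tip c ∈ Z := τ.char_vtx_mem _ _

/-- Functions on the corners at a vertex that agree along the common sides can be glued. -/
lemma exists_vertex_glue [T2Space S] {E : Type*} (z : S) (hz : z ∈ Z)
    (g : τ.Corner → Tri → E) (e₀ : E) (hbase : ∀ c, τ.tip c = z → g c (vtx c.2) = e₀)
    (hglue : ∀ c, τ.tip c = z → ∀ s, g c (side (c.2 + 1) s) =
      g (τ.rot c) (side (τ.opp (c.1, c.2 + 1)).2 (σ₀ s))) :
    ∃ F : S → E, ∃ δ > 0, ∀ c, τ.tip c = z → ∀ y, dist y (vtx c.2) < δ →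
      F (τ.char c.1 y) = g c y := by
  classical
  let G : τ.Face → Tri → Tri → E := fun f x y => if h : ∃ i, x = vtx i then g (f, h.choose) y
    else e₀
  have hG : ∀ f i y, G f (vtx i) y = g (f, i) y := fun f i y => by
    have h : ∃ j, vtx i = vtx j := ⟨i, rfl⟩
    simp only [G, dif_pos h, ← vtx_injective h.choose_spec]
  have hside : ∀ (h : τ.Corner), τ.char h.1 (vtx (h.2 + 2)) = z → ∀ s,
      G h.1 (vtx (h.2 + 2)) (side h.2 s) = G (τ.opp h).1 (vtx ((τ.opp h).2 + 1))
        (side (τ.opp h).2 (σ₀ s)) := fun h hh s => by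
    have := hglue (h.1, h.2 + 2) hh s
    simp only [rot, fin3_add_two_add_one] at this
    rw [hG, hG, this]
  obtain ⟨F, δ, hδ, hF⟩ := τ.exists_glue z G e₀ (fun f x hx => by
      obtain ⟨i, rfl⟩ := (τ.mem_iff f x).1 (hx ▸ hz)
      rw [hG]; exact hbase (f, i) hx) fun h s₀ hs₀ s => by
      obtain ⟨j, hj⟩ := (τ.mem_iff h.1 (side h.2 s₀)).1 (hs₀ ▸ hz)
      rcases side_eq_vtx hj with rfl | rfl
      · rw [side_zero, unitInterval.symm_zero, side_one]
        have h1 : τ.char (τ.opp h).1 (vtx ((τ.opp h).2 + 2)) = z := by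
          rw [← hs₀, τ.glue, unitInterval.symm_zero, side_one]
        have := hside (τ.opp h) h1 (σ₀ s)
        rw [τ.opp_opp, unitInterval.symm_symm] at this
        exact this.symm
      · rw [side_one] at hs₀
        rw [side_one, unitInterval.symm_one, side_zero]
        exact hside h hs₀ s
  exact ⟨F, δ, hδ, fun c hc y hy => by rw [hF c.1 (vtx c.2) hc y hy, hG]⟩

lemma continuousAt_of_vertex_glue [T2Space S] {E : Type*} [TopologicalSpace E] {z : S}
    (hz : z ∈ Z) {g : τ.Corner → Tri → E} {F : S → E} {δ : ℝ}
    (hF : ∀ c, τ.tip c = z → ∀ y, dist y (vtx c.2) < δ → F (τ.char c.1 y) = g c y) {q : S}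
    (hq : q ∈ τ.star z δ)
    (hg : ∀ c, τ.tip c = z → ∀ y, τ.char c.1 y = q → ContinuousAt (g c) y) :
    ContinuousAt F q := by
  refine τ.continuousAt_of_char fun f y hy => ?_
  obtain ⟨x, hx, hd⟩ := hq f y hy
  obtain ⟨i, rfl⟩ := (τ.mem_iff f x).1 (hx ▸ hz)
  refine (hg (f, i) hx y hy).congr ?_
  have : ∀ᶠ y' in 𝓝 y, dist y' (vtx i) < δ :=
    (continuous_id.dist continuous_const).continuousAt.eventually_lt continuousAt_const hd
  filter_upwards [this] with y' hy'
  exact (hF (f, i) hx y' hy').symm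

/-- The corners at a vertex form one cycle. -/
lemma exists_iterate_rot [T2Space S] (o : SurfaceOrientation S) {c c' : τ.Corner}
    (h : τ.tip c' = τ.tip c) : ∃ j, τ.rot^[j] c = c' := by
  classical
  let O : Set (τ.Corner) := {d | ∃ j, τ.rot^[j] c = d}
  have hOrot : ∀ d, τ.rot d ∈ O ↔ d ∈ O := by
    intro d
    constructor
    · rintro ⟨j, hj⟩
      obtain ⟨n, hn, hper⟩ := (rot_injective (τ := τ)).mem_periodicPts c
      cases j with
      | zero =>
        refine ⟨n - 1, rot_injective ?_⟩
        rw [← iterate_succ_apply' τ.rot, Nat.succ_eq_add_one, Nat.sub_add_cancel hn]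
        exact hper.trans hj
      | succ j => exact ⟨j, rot_injective (by rwa [iterate_succ_apply'] at hj)⟩
    · rintro ⟨j, hj⟩
      exact ⟨j + 1, by rw [iterate_succ_apply', hj]⟩
  let g : τ.Corner → Tri → Bool := fun d y => if y = vtx d.2 then true else decide (d ∈ O)
  have hz := tip_mem (τ := τ) c
  obtain ⟨F, δ, hδ, hF⟩ := exists_vertex_glue (τ.tip c) hz g true (fun d _ => by simp [g])
    fun d _ s => by
      have e1 : side (d.2 + 1) s = vtx d.2 ↔ s = 1 := by
        rw [← (side_injective (d.2 + 1)).eq_iff (a := s), side_one, fin3_add_one_add_two]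
      have e2 : side (τ.opp (d.1, d.2 + 1)).2 (σ₀ s) =
          vtx ((τ.opp (d.1, d.2 + 1)).2 + 1) ↔ s = 1 := by
        rw [← side_zero, (side_injective _).eq_iff, ← unitInterval.symm_one, unitInterval.symm_inj]
      simp only [g, rot, e1, e2]
      simp only [show (((τ.opp (d.1, d.2 + 1)).1, (τ.opp (d.1, d.2 + 1)).2 + 1) ∈ O) = (d ∈ O)
        from propext (hOrot d)]
  obtain ⟨N, hN, hpN, hNV, hconn⟩ := exists_punctured_nhd o (τ.tip c)
    ((τ.isOpen_star (τ.tip c) δ).mem_nhds (τ.mem_star _ hδ))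
  have hcont : ContinuousOn F (N \ {τ.tip c}) := fun q hq => by
    refine (continuousAt_of_vertex_glue hz hF (hNV hq.1) fun d hd y hy => ?_).continuousWithinAt
    have hne : y ≠ vtx d.2 := by
      rintro rfl
      exact hq.2 (hy.symm.trans hd)
    refine (continuousAt_const (y := decide (d ∈ O))).congr ?_
    filter_upwards [isOpen_ne.mem_nhds hne] with y' hy'
    simp only [g, if_neg hy']
  have hval : ∀ d, τ.tip d = τ.tip c → ∃ q ∈ N \ {τ.tip c}, F q = decide (d ∈ O) := by
    intro d hd
    have : (𝓝[<] (1 : 𝕀)).NeBot := by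
      refine mem_closure_iff_nhdsWithin_neBot.1 ?_
      rw [closure_Iio' ⟨0, one_pos⟩]
      exact le_refl (1 : 𝕀)
    have h1 : side (d.2 + 1) 1 = vtx d.2 := by rw [side_one, fin3_add_one_add_two]
    have hc1 := (continuous_side (d.2 + 1)).continuousAt (x := 1)
    have hc2 := ((τ.char d.1).continuous.comp (continuous_side (d.2 + 1))).continuousAt (x := 1)
    have e1 : ∀ᶠ t in 𝓝 (1 : 𝕀), dist (side (d.2 + 1) t) (vtx d.2) < δ := by
      refine hc1.eventually (p := fun y => dist y (vtx d.2) < δ) ?_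
      rw [h1]
      exact ball_mem_nhds _ hδ
    have e2 : ∀ᶠ t in 𝓝 (1 : 𝕀), τ.char d.1 (side (d.2 + 1) t) ∈ N := by
      refine hc2.eventually (p := fun q => q ∈ N) (hN.mem_nhds ?_)
      rw [comp_apply, h1]
      exact (show τ.tip d ∈ N from hd ▸ hpN)
    have e3 : ∀ᶠ t in 𝓝 (1 : 𝕀), 0 < t := Ioi_mem_nhds one_pos
    obtain ⟨t, ⟨h2, h3, h4⟩, h5⟩ := (((e1.and (e2.and e3)).filter_mono nhdsWithin_le_nhds).and
      (self_mem_nhdsWithin (s := Iio (1 : 𝕀)))).exists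
    refine ⟨_, ⟨h3, fun h => ?_⟩, (hF d hd _ h2).trans (if_neg (side_ne_vtx h4 h5))⟩
    obtain ⟨j, hj⟩ := (τ.mem_iff _ _).1 (mem_singleton_iff.1 h ▸ hz)
    exact side_ne_vtx h4 h5 hj
  obtain ⟨q, hq, hFq⟩ := hval c rfl
  obtain ⟨q', hq', hFq'⟩ := hval c' h
  have := hconn.constant hcont hq hq'
  rw [hFq, hFq'] at this
  have h0 : c ∈ O := ⟨0, rfl⟩
  rw [decide_eq_true h0] at this
  exact of_decide_eq_true this.symm

/-- The corners at a vertex. -/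
def cornersAt (τ : Triangulation Z) (z : S) : Finset (τ.Corner) :=
  (Set.toFinite {c | τ.tip c = z}).toFinset

lemma mem_cornersAt {z : S} {c : τ.Corner} : c ∈ τ.cornersAt z ↔ τ.tip c = z := by simp [cornersAt]

lemma sum_cornersAt [T2Space S] (o : SurfaceOrientation S) (c : τ.Corner)
    (θ : τ.Corner → ℝ) : ∑ d ∈ τ.cornersAt (τ.tip c), θ d =
      ∑ j ∈ Finset.range (minimalPeriod τ.rot c), θ (τ.rot^[j] c) := by
  classical
  rw [← Finset.sum_image (f := θ) (g := fun j => τ.rot^[j] c)]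
  · congr 1
    ext d
    rw [mem_cornersAt, Finset.mem_image]
    have tipj : ∀ j, τ.tip (τ.rot^[j] c) = τ.tip c := fun j => by
      induction j with
      | zero => rfl
      | succ j ih => rw [iterate_succ_apply', tip_rot, ih]
    constructor
    · intro h
      obtain ⟨j, hj⟩ := exists_iterate_rot o h
      refine ⟨j % minimalPeriod τ.rot c, Finset.mem_range.2 (Nat.mod_lt _ ?_), ?_⟩
      · exact Function.minimalPeriod_pos_of_mem_periodicPts (rot_injective.mem_periodicPts c)
      · rw [Function.iterate_mod_minimalPeriod_eq, hj]
    · rintro ⟨j, -, rfl⟩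
      exact tipj j
  · intro i hi j hj h
    exact Function.iterate_injOn_Iio_minimalPeriod (by simpa using hi) (by simpa using hj) h

end Triangulation

/-! ### Charts at the vertices -/

lemma exists_openPartialHomeomorph_of_injOn {S : Type*} [TopologicalSpace S] [T2Space S]
    {F : S → ℂ} {K : Set S} {p : S} (hK : IsCompact K) (hpK : K ∈ 𝓝 p) (hc : ContinuousOn F K)
    (hi : InjOn F K) (hs : ∀ᶠ ζ in 𝓝 (F p), ζ ∈ F '' K) :
    ∃ e : OpenPartialHomeomorph S ℂ, ⇑e = F ∧ p ∈ e.source ∧ e.source ⊆ K := by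
  have hp : p ∈ K := mem_of_mem_nhds hpK
  have : Nonempty S := ⟨p⟩
  have hb : IsClosed (F '' (K \ interior K)) :=
    ((hK.diff isOpen_interior).image_of_continuousOn (hc.mono sdiff_subset)).isClosed
  have hpb : F p ∉ F '' (K \ interior K) := by
    rintro ⟨q, hq, h⟩
    rw [hi hq.1 hp h] at hq
    exact hq.2 (mem_interior_iff_mem_nhds.2 hpK)
  obtain ⟨B, hB, hBo, hpB⟩ := eventually_nhds_iff.1 (hs.and (hb.isOpen_compl.mem_nhds hpb))
  have hsrc : ∀ ζ ∈ B, ∃ q ∈ interior K, F q = ζ := fun ζ hζ => by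
    obtain ⟨q, hq, rfl⟩ := (hB ζ hζ).1
    exact ⟨q, by_contra fun h => (hB _ hζ).2 ⟨q, ⟨hq, h⟩, rfl⟩, rfl⟩
  have hinv : ∀ q ∈ K, Function.invFunOn F K (F q) = q := fun q hq => hi.leftInvOn_invFunOn hq
  refine ⟨⟨⟨⟨F, Function.invFunOn F K, interior K ∩ F ⁻¹' B, B, fun q hq => hq.2, fun ζ hζ => ?_,
    fun q hq => hinv q (interior_subset hq.1), fun ζ hζ => ?_⟩,
    hc.mono fun q hq => interior_subset hq.1, ?_⟩,
    (hc.mono interior_subset).isOpen_inter_preimage isOpen_interior hBo, hBo⟩, rfl,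
    ⟨mem_interior_iff_mem_nhds.2 hpK, hpB⟩, fun q hq => interior_subset hq.1⟩
  · obtain ⟨q, hq, rfl⟩ := hsrc ζ hζ
    rw [hinv q (interior_subset hq)]
    exact ⟨hq, hζ⟩
  · obtain ⟨q, hq, rfl⟩ := hsrc ζ hζ
    rw [hinv q (interior_subset hq)]
  · change ContinuousOn (Function.invFunOn F K) B
    rw [continuousOn_iff_isClosed]
    intro C hC
    refine ⟨F '' (K ∩ C), ((hK.inter_right hC).image_of_continuousOn
      (hc.mono inter_subset_left)).isClosed, ?_⟩
    ext ζ
    constructor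
    · rintro ⟨h1, h2⟩
      obtain ⟨q, hq, rfl⟩ := hsrc ζ h2
      rw [mem_preimage, hinv q (interior_subset hq)] at h1
      exact ⟨⟨q, ⟨interior_subset hq, h1⟩, rfl⟩, h2⟩
    · rintro ⟨⟨q, hq, rfl⟩, h2⟩
      refine ⟨?_, h2⟩
      rw [mem_preimage, hinv q hq.1]
      exact hq.2

section Wedge

variable {ρ : ℂ} {a b : ℝ}

lemma wedge_mem_slitPlane (hρ : 0 < ρ.im) (hb : 0 ≤ b) (hab : 0 < a + b) :
    (a + b * ρ : ℂ) ∈ slitPlane := by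
  rw [Complex.mem_slitPlane_iff]
  rcases hb.eq_or_lt with rfl | hb
  · left; simpa using hab
  · right; simp [hb.ne', hρ.ne']

lemma arg_mem_Ioo_of_im_pos (hρ : 0 < ρ.im) : ρ.arg ∈ Ioo 0 π := by
  have h0 := Complex.arg_nonneg_iff.2 hρ.le
  refine ⟨h0.lt_of_ne' fun h => ?_, (Complex.arg_le_pi ρ).lt_of_ne fun h => ?_⟩
  · exact hρ.ne' (Complex.arg_eq_zero_iff.1 h).2
  · exact hρ.ne' (Complex.arg_eq_pi_iff.1 h).2

lemma wedge_polar (r φ : ℝ) (hρ : 0 < ρ.im) :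
    ((r * ‖ρ‖ * sin (ρ.arg - φ) / ρ.im : ℝ) + (r * sin φ / ρ.im : ℝ) * ρ : ℂ) =
      r * exp (φ * I) := by
  have h1 := Complex.norm_mul_cos_arg ρ
  have h2 := Complex.norm_mul_sin_arg ρ
  rw [exp_mul_I, ← Complex.ofReal_cos, ← Complex.ofReal_sin]
  apply Complex.ext
  · simp only [add_re, ofReal_re, mul_re, I_re, I_im, ofReal_im]
    rw [Real.sin_sub]
    field_simp
    linear_combination r * cos φ * h2 - r * sin φ * h1
  · simp only [add_im, ofReal_re, mul_im, I_re, I_im, ofReal_im]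
    field_simp
    ring

lemma wedge_inj (hρ : 0 < ρ.im) {a' b' : ℝ} (h : (a + b * ρ : ℂ) = a' + b' * ρ) :
    a = a' ∧ b = b' := by
  have him := congrArg Complex.im h
  have hre := congrArg Complex.re h
  simp at him hre
  have : b = b' := him.resolve_right hρ.ne'
  exact ⟨by rw [this] at hre; linarith, this⟩

lemma arg_wedge (hρ : 0 < ρ.im) (hb : 0 ≤ b) (hab : 0 < a + b) :
    0 ≤ (a + b * ρ : ℂ).arg ∧ (0 < a → (a + b * ρ : ℂ).arg < ρ.arg) := by
  have h0 : 0 ≤ (a + b * ρ : ℂ).arg := Complex.arg_nonneg_iff.2 (by simp; positivity)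
  refine ⟨h0, fun ha' => ?_⟩
  have hw := slitPlane_ne_zero (wedge_mem_slitPlane hρ hb hab)
  have hp := wedge_polar ‖(a + b * ρ : ℂ)‖ (a + b * ρ : ℂ).arg hρ
  rw [Complex.norm_mul_exp_arg_mul_I] at hp
  have h1 := (wedge_inj hρ hp).1
  have hρ' := arg_mem_Ioo_of_im_pos hρ
  by_contra! hle
  have hn : 0 < ‖(a + b * ρ : ℂ)‖ := norm_pos_iff.2 hw
  have hs : sin (ρ.arg - (a + b * ρ : ℂ).arg) ≤ 0 :=
    Real.sin_nonpos_of_nonpos_of_neg_pi_le (by linarith)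
      (by linarith [Complex.arg_le_pi (a + b * ρ : ℂ), hρ'.1])
  have : ‖(a + b * ρ : ℂ)‖ * ‖ρ‖ * sin (ρ.arg - (a + b * ρ : ℂ).arg) / ρ.im ≤ 0 :=
    div_nonpos_of_nonpos_of_nonneg (mul_nonpos_of_nonneg_of_nonpos (by positivity) hs) hρ.le
  linarith

end Wedge

lemma exists_step {α : ℕ → ℝ} {x : ℝ} {n : ℕ} (h0 : α 0 ≤ x) (hn : x < α n) :
    ∃ j < n, α j ≤ x ∧ x < α (j + 1) := by
  induction n with
  | zero => exact absurd hn h0.not_gt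
  | succ n ih =>
    by_cases h : x < α n
    · obtain ⟨j, hj, h⟩ := ih h
      exact ⟨j, hj.trans n.lt_succ_self, h⟩
    · exact ⟨n, n.lt_succ_self, not_lt.1 h, hn⟩

lemma dist_vtx_le (y : Tri) (i : Fin 3) : dist y (vtx i) ≤ y.1 (i + 1) + y.1 (i + 2) := by
  have h := y.sum_eq i
  have h1 := y.nonneg (i + 1)
  have h2 := y.nonneg (i + 2)
  rw [Subtype.dist_eq, dist_pi_le_iff (by linarith)]
  intro j
  rw [Real.dist_eq]
  rcases fin3_cases i j with rfl | rfl | rfl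
  · rw [vtx_apply_self, abs_le]; constructor <;> linarith
  · rw [vtx_apply_add_one, sub_zero, abs_of_nonneg h1]; linarith
  · rw [vtx_apply_add_two, sub_zero, abs_of_nonneg h2]; linarith

lemma Tri.add_pos {y : Tri} {i : Fin 3} (hy : y ≠ vtx i) : 0 < y.1 (i + 1) + y.1 (i + 2) := by
  by_contra! h
  have h1 := y.nonneg (i + 1)
  have h2 := y.nonneg (i + 2)
  exact hy (Tri.ext_of i (by rw [vtx_apply_add_one]; linarith)
    (by rw [vtx_apply_add_two]; linarith))

lemma exists_tri (i : Fin 3) {a b : ℝ} (ha : 0 ≤ a) (hb : 0 ≤ b) (hab : a + b ≤ 1) :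
    ∃ y : Tri, y.1 (i + 1) = a ∧ y.1 (i + 2) = b := by
  refine ⟨⟨fun j => if j = i + 1 then a else if j = i + 2 then b else 1 - a - b,
    fun j => by dsimp only; split_ifs <;> linarith, ?_⟩, if_pos rfl, ?_⟩
  · rw [sum_fin3 _ i]
    simp
    ring
  · simp

namespace Triangulation

variable {v : τ.Corner → ℂ}

/-- The first side of a corner, as a vector from its vertex. -/
def ray (τ : Triangulation Z) (v : τ.Corner → ℂ) (c : τ.Corner) : ℂ := v (c.1, c.2 + 2)

lemma ray_rot (hv : τ.IsCocycle v) (c : τ.Corner) : τ.ray v (τ.rot c) = -v (c.1, c.2 + 1) := by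
  rw [ray, rot, ← hv.opp]
  simp only [fin3_add_one_add_two]

/-- The quotient of the two sides of a corner. -/
def ratio (τ : Triangulation Z) (v : τ.Corner → ℂ) (c : τ.Corner) : ℂ :=
  τ.ray v (τ.rot c) / τ.ray v c

lemma IsOriented.ray_ne_zero (ho : τ.IsOriented 1 v) (c : τ.Corner) : τ.ray v c ≠ 0 := ho.ne_zero _

lemma IsOriented.ratio_im (hv : τ.IsCocycle v) (ho : τ.IsOriented 1 v) (c : τ.Corner) :
    0 < (τ.ratio v c).im := by
  have h := ho c
  have h2 : (τ.ratio v c).im = cross (v (c.1, c.2 + 2)) (-v (c.1, c.2 + 1)) /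
      normSq (τ.ray v c) := by
    rw [ratio, ray_rot hv, Complex.div_im, cross, ray]
    simp only [neg_re, neg_im]
    ring
  rw [h2]
  exact div_pos (by linarith) (normSq_pos.2 (ho.ray_ne_zero c))

lemma IsOriented.cornerAngle_eq_arg (hv : τ.IsCocycle v) (ho : τ.IsOriented 1 v)
    (c : τ.Corner) : τ.cornerAngle v c = (τ.ratio v c).arg := by
  rw [cornerAngle, ← ray_rot hv, InnerProductGeometry.angle_comm]
  rw [Complex.angle_eq_abs_arg (ho.ray_ne_zero _) (ho.ne_zero _)]
  exact abs_of_pos (arg_mem_Ioo_of_im_pos (ho.ratio_im hv c)).1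

/-- The position of a point of a corner in units of the first side. -/
def wedge (τ : Triangulation Z) (v : τ.Corner → ℂ) (c : τ.Corner) (y : Tri) : ℂ :=
  y.1 (c.2 + 1) + y.1 (c.2 + 2) * τ.ratio v c

lemma continuous_wedge (c : τ.Corner) : Continuous (τ.wedge v c) := by
  have h : ∀ i, Continuous fun x : Tri => (x.1 i : ℂ) := fun i =>
    continuous_ofReal.comp ((continuous_apply i).comp continuous_subtype_val)
  exact (h _).add ((h _).mul continuous_const)

lemma IsOriented.wedge_mem (hv : τ.IsCocycle v) (ho : τ.IsOriented 1 v) {c : τ.Corner}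
    {y : Tri} (hy : y ≠ vtx c.2) : τ.wedge v c y ∈ slitPlane :=
  wedge_mem_slitPlane (ho.ratio_im hv c) (y.nonneg _) (Tri.add_pos hy)

lemma IsOriented.ray_mul_wedge (hv : τ.IsCocycle v) (ho : τ.IsOriented 1 v)
    (c : τ.Corner) (y : Tri) :
    τ.ray v c * τ.wedge v c y = τ.aff v c.1 y - τ.aff v c.1 (vtx c.2) := by
  have := ho.ray_ne_zero c
  rw [aff_eq hv c.1 c.2 y, wedge, ratio, ray_rot hv]
  field_simp
  rw [ray]
  ring

/-- The logarithm of the `j`-th side around the vertex of the corner `c`. -/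
def pot (τ : Triangulation Z) (v : τ.Corner → ℂ) (c : τ.Corner) (j : ℕ) : ℂ :=
  log (τ.ray v c) + ∑ k ∈ Finset.range j, log (τ.ratio v (τ.rot^[k] c))

lemma pot_succ (c : τ.Corner) (j : ℕ) :
    τ.pot v c (j + 1) = τ.pot v c j + log (τ.ratio v (τ.rot^[j] c)) := by
  rw [pot, pot, Finset.sum_range_succ, add_assoc]

lemma IsOriented.exp_pot (ho : τ.IsOriented 1 v) (c : τ.Corner) (j : ℕ) :
    exp (τ.pot v c j) = τ.ray v (τ.rot^[j] c) := by
  induction j with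
  | zero => simp [pot, exp_log (ho.ray_ne_zero c)]
  | succ j ih =>
    have h := ho.ray_ne_zero (τ.rot^[j] c)
    have h' := ho.ray_ne_zero (τ.rot (τ.rot^[j] c))
    rw [pot_succ, exp_add, ih, ratio, exp_log (div_ne_zero h' h), iterate_succ_apply']
    field_simp

lemma pot_im (hv : τ.IsCocycle v) (ho : τ.IsOriented 1 v) (c : τ.Corner) (j : ℕ) :
    (τ.pot v c j).im = (τ.pot v c 0).im + ∑ k ∈ Finset.range j, τ.cornerAngle v (τ.rot^[k] c) := by
  simp only [pot, add_im, Finset.range_zero, Finset.sum_empty, add_zero, Complex.im_sum,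
    log_im, ho.cornerAngle_eq_arg hv]

open Classical in
/-- The position of the corner `d` in the cycle of `c`. -/
def idx (τ : Triangulation Z) (c d : τ.Corner) : ℕ :=
  if h : ∃ j < minimalPeriod τ.rot c, τ.rot^[j] c = d then h.choose else 0

lemma period_pos (c : τ.Corner) : 0 < minimalPeriod τ.rot c :=
  Function.minimalPeriod_pos_of_mem_periodicPts (rot_injective.mem_periodicPts c)

lemma tip_iterate (c : τ.Corner) (j : ℕ) : τ.tip (τ.rot^[j] c) = τ.tip c := by
  induction j with
  | zero => rfl
  | succ j ih => rw [iterate_succ_apply', tip_rot, ih]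

lemma idx_spec [T2Space S] (o : SurfaceOrientation S) {c d : τ.Corner} (h : τ.tip d = τ.tip c) :
    τ.idx c d < minimalPeriod τ.rot c ∧ τ.rot^[τ.idx c d] c = d := by
  have h' : ∃ j < minimalPeriod τ.rot c, τ.rot^[j] c = d := by
    obtain ⟨j, hj⟩ := exists_iterate_rot o h
    exact ⟨j % _, Nat.mod_lt _ (period_pos c), by rw [Function.iterate_mod_minimalPeriod_eq, hj]⟩
  rw [idx, dif_pos h']
  exact h'.choose_spec

lemma idx_iterate [T2Space S] (o : SurfaceOrientation S) {c : τ.Corner} {j : ℕ}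
    (hj : j < minimalPeriod τ.rot c) : τ.idx c (τ.rot^[j] c) = j := by
  obtain ⟨h1, h2⟩ := idx_spec o (tip_iterate c j)
  exact Function.iterate_injOn_Iio_minimalPeriod h1 hj h2

/-- The branch of the logarithm of the developing map on the corner `d`. -/
def branch (τ : Triangulation Z) (v : τ.Corner → ℂ) (c d : τ.Corner) (y : Tri) : ℂ :=
  τ.pot v c (τ.idx c d) + log (τ.wedge v d y)

lemma idx_rot [T2Space S] (o : SurfaceOrientation S) {c d : τ.Corner}
    (h : τ.tip d = τ.tip c) : τ.idx c (τ.rot d) = if τ.idx c d + 1 =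
      minimalPeriod τ.rot c then 0 else τ.idx c d + 1 := by
  obtain ⟨h1, h2⟩ := idx_spec o h
  have h3 : τ.rot d = τ.rot^[τ.idx c d + 1] c := by rw [iterate_succ_apply', h2]
  split_ifs with h4
  · have : τ.rot d = τ.rot^[0] c := by rw [h3, h4, Function.iterate_minimalPeriod]; rfl
    rw [this]
    exact idx_iterate o (period_pos c)
  · rw [h3]
    exact idx_iterate o (by omega)

/-- The branches on consecutive corners agree up to the monodromy. -/
lemma branch_glue [T2Space S] (o : SurfaceOrientation S) (hv : τ.IsCocycle v)
    (ho : τ.IsOriented 1 v) {c d : τ.Corner} (h : τ.tip d = τ.tip c) {y y' : Tri}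
    (hy : y.1 (d.2 + 1) = 0) (hy' : y'.1 ((τ.rot d).2 + 2) = 0)
    (he : y.1 (d.2 + 2) = y'.1 ((τ.rot d).2 + 1)) (hpos : 0 < y.1 (d.2 + 2)) :
    τ.branch v c d y = τ.branch v c (τ.rot d) y' + if τ.idx c d + 1 = minimalPeriod τ.rot c then
        τ.pot v c (minimalPeriod τ.rot c) - τ.pot v c 0 else 0 := by
  have hr : τ.ratio v d ≠ 0 := fun h0 => by
    have := ho.ratio_im hv d
    simp [h0] at this
  have h1 : log (τ.wedge v d y) = log (y.1 (d.2 + 2)) +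
      log (τ.ratio v d) := by
    rw [wedge, hy, ofReal_zero, zero_add, Complex.log_ofReal_mul hpos hr,
      Complex.ofReal_log hpos.le]
  have h2 : log (τ.wedge v (τ.rot d) y') = log (y.1 (d.2 + 2)) := by
    rw [wedge, hy', ← he]; simp
  obtain ⟨-, h3⟩ := idx_spec o h
  have h4 := pot_succ (v := v) c (τ.idx c d)
  rw [h3] at h4
  rw [branch, branch, h1, h2, idx_rot o h]
  split_ifs with h5
  · rw [← h5, h4]; ring
  · rw [h4]; ring

variable {v : τ.Corner → ℂ}

/-- The coordinates of a common point of two consecutive corners. -/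
lemma side_rot_coord (d : τ.Corner) (s : 𝕀) : (side (d.2 + 1) s).1 (d.2 + 1) = 0 ∧
    (side (τ.opp (d.1, d.2 + 1)).2 (σ₀ s)).1 ((τ.rot d).2 + 2) = 0 ∧
    (side (d.2 + 1) s).1 (d.2 + 2) = 1 - s ∧
    (side (τ.opp (d.1, d.2 + 1)).2 (σ₀ s)).1 ((τ.rot d).2 + 1) = 1 - s := by
  refine ⟨side_apply_self _ _, ?_, ?_, ?_⟩
  · rw [rot, fin3_add_one_add_two, side_apply_self]
  · rw [← fin3_add_one_add_one, side_apply_add_one]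
  · rw [rot, fin3_add_one_add_one, side_apply_add_two, unitInterval.coe_symm_eq]

/-- Functions on the punctured corners at a vertex that agree along the common sides can be
glued. -/
lemma exists_punctured_glue [T2Space S] {z : S} (hz : z ∈ Z) (G : τ.Corner → Tri → ℂ)
    (hglue : ∀ d, τ.tip d = z → ∀ s : 𝕀, s < 1 → G d (side (d.2 + 1) s) =
      G (τ.rot d) (side (τ.opp (d.1, d.2 + 1)).2 (σ₀ s)))
    (hG : ∀ d, τ.tip d = z → ∀ y, y ≠ vtx d.2 → ContinuousAt (G d) y) :
    ∃ F : S → ℂ, F z = 0 ∧ ∃ δ > 0, ContinuousOn F (τ.star z δ \ {z}) ∧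
      (∀ d, τ.tip d = z → ∀ y, dist y (vtx d.2) < δ → y ≠ vtx d.2 → F (τ.char d.1 y) = G d y) ∧
      ((∀ d, τ.tip d = z → Tendsto (G d) (𝓝[≠] (vtx d.2)) (𝓝 0)) →
        ContinuousOn F (τ.star z δ)) := by
  classical
  let g : τ.Corner → Tri → ℂ := fun d y => if y = vtx d.2 then 0 else G d y
  obtain ⟨F, δ, hδ, hF⟩ := exists_vertex_glue z hz g 0 (fun d _ => if_pos rfl) fun d hd s => by
    by_cases hs : s = 1
    · subst hs
      have e1 : side (d.2 + 1) 1 = vtx d.2 := by rw [side_one, fin3_add_one_add_two]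
      rw [e1, unitInterval.symm_one, side_zero]
      simp only [g, rot, if_true]
    · have hs1 : s < 1 := lt_of_le_of_ne unitInterval.le_one' hs
      have hp : (0 : ℝ) < 1 - s := sub_pos.2 hs1
      obtain ⟨-, -, h3, h4⟩ := side_rot_coord d s
      have n1 : side (d.2 + 1) s ≠ vtx d.2 := fun h => by rw [h, vtx_apply_add_two] at h3; linarith
      have n2 : side (τ.opp (d.1, d.2 + 1)).2 (σ₀ s) ≠ vtx (τ.rot d).2 := fun h => by
        rw [h, vtx_apply_add_one] at h4; linarith
      simp only [g, if_neg n1, if_neg n2, hglue d hd s hs1]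
  have hgc : ∀ d, τ.tip d = z → ∀ y, y ≠ vtx d.2 → ContinuousAt (g d) y := fun d hd y hy => by
    refine (hG d hd y hy).congr ?_
    filter_upwards [isOpen_ne.mem_nhds hy] with y' hy'
    simp only [g, if_neg hy']
  have hne : ∀ {q}, q ≠ z → ∀ d, τ.tip d = z → ∀ y, τ.char d.1 y = q → y ≠ vtx d.2 := by
    rintro q hq d hd y hy rfl
    exact hq (hy.symm.trans hd)
  obtain ⟨f, x, hx⟩ := τ.cover z
  obtain ⟨i, rfl⟩ := (τ.mem_iff f x).1 (hx ▸ hz)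
  refine ⟨F, ?_, δ, hδ, fun q hq => ?_, fun d hd y hy hne => ?_, fun h q hq => ?_⟩
  · have := hF (f, i) hx (vtx i) (by simpa using hδ)
    rw [← hx, this]
    exact if_pos rfl
  · exact (continuousAt_of_vertex_glue hz hF hq.1 fun d hd y hy =>
      hgc d hd y (hne hq.2 d hd y hy)).continuousWithinAt
  · rw [hF d hd y hy]; exact if_neg hne
  · refine (continuousAt_of_vertex_glue hz hF hq fun d hd y hy => ?_).continuousWithinAt
    by_cases hyv : y = vtx d.2
    · subst hyv
      rw [continuousAt_iff_punctured_nhds]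
      have h0 : g d (vtx d.2) = 0 := if_pos rfl
      rw [h0]
      refine (h d hd).congr' ?_
      filter_upwards [self_mem_nhdsWithin] with y' hy'
      exact (if_neg hy').symm
    · exact hgc d hd y hyv

lemma IsOriented.continuousAt_branch (hv : τ.IsCocycle v) (ho : τ.IsOriented 1 v)
    (c d : τ.Corner) {y : Tri} (hy : y ≠ vtx d.2) : ContinuousAt (τ.branch v c d) y :=
  continuousAt_const.add ((continuous_wedge d).continuousAt.clog (ho.wedge_mem hv hy))

lemma IsOriented.exp_branch [T2Space S] (o : SurfaceOrientation S) (hv : τ.IsCocycle v)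
    (ho : τ.IsOriented 1 v) {c d : τ.Corner} (hd : τ.tip d = τ.tip c) {y : Tri}
    (hy : y ≠ vtx d.2) : exp (τ.branch v c d y) =
      τ.aff v d.1 y - τ.aff v d.1 (vtx d.2) := by
  rw [branch, exp_add, ho.exp_pot, (idx_spec o hd).2,
    exp_log (slitPlane_ne_zero (ho.wedge_mem hv hy)), ho.ray_mul_wedge hv]

/-- The total angle at a vertex is a multiple of `2π`. -/
lemma IsOriented.exists_multiplicity [T2Space S] (o : SurfaceOrientation S)
    (hv : τ.IsCocycle v) (ho : τ.IsOriented 1 v) (c : τ.Corner) :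
    ∃ m : ℕ, 0 < m ∧ ∑ d ∈ τ.cornersAt (τ.tip c), τ.cornerAngle v d = 2 * π * m ∧
      τ.pot v c (minimalPeriod τ.rot c) - τ.pot v c 0 = m * (2 * π * I) := by
  have h1 := ho.exp_pot c (minimalPeriod τ.rot c)
  rw [Function.iterate_minimalPeriod] at h1
  have h2 := ho.exp_pot c 0
  obtain ⟨k, hk⟩ := Complex.exp_eq_exp_iff_exists_int.1 (h1.trans h2.symm)
  have him := pot_im hv ho c (minimalPeriod τ.rot c)
  rw [← sum_cornersAt o c] at him
  have hsum : ∑ d ∈ τ.cornersAt (τ.tip c), τ.cornerAngle v d = 2 * π * k := by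
    have := congrArg Complex.im hk
    simp at this
    linarith
  have hpos : 0 < ∑ d ∈ τ.cornersAt (τ.tip c), τ.cornerAngle v d :=
    Finset.sum_pos (fun d _ => (angle_mem_Ioo (Or.inl rfl) (ho d)).1)
      ⟨c, mem_cornersAt.2 rfl⟩
  have hkpos : 0 < k := by
    rw [hsum] at hpos
    have := pos_of_mul_pos_right hpos (by positivity)
    exact_mod_cast this
  lift k to ℕ using hkpos.le
  refine ⟨k, by exact_mod_cast hkpos, by simpa using hsum, ?_⟩
  rw [hk]
  push_cast
  ring

/-- The chart at a vertex in which the developing map is a power. -/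
lemma IsOriented.exists_vertexChart [T2Space S] [CompactSpace S] (o : SurfaceOrientation S)
    (hv : τ.IsCocycle v) (ho : τ.IsOriented 1 v) (c : τ.Corner) {m : ℕ} (hm : 0 < m)
    (hpot : τ.pot v c (minimalPeriod τ.rot c) - τ.pot v c 0 = m * (2 * π * I)) :
    ∃ ψ : OpenPartialHomeomorph S ℂ, τ.tip c ∈ ψ.source ∧ ψ (τ.tip c) = 0 ∧
      ∃ δ > 0, ψ.source ⊆ τ.star (τ.tip c) δ ∧ ∀ d, τ.tip d = τ.tip c → ∀ y,
        dist y (vtx d.2) < δ → y ≠ vtx d.2 →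
        ψ (τ.char d.1 y) = exp (τ.branch v c d y / m) := by
  have hm0 : (m : ℂ) ≠ 0 := by exact_mod_cast hm.ne'
  have hmR : (0 : ℝ) < m := by exact_mod_cast hm
  have hz := tip_mem (τ := τ) c
  obtain ⟨F, hFz, δ, hδ, -, hF, hFc⟩ := exists_punctured_glue hz
    (fun d y => exp (τ.branch v c d y / m)) (fun d hd s hs => by
      obtain ⟨h1, h2, h3, h4⟩ := side_rot_coord d s
      have hp : (0 : ℝ) < 1 - s := sub_pos.2 hs
      rw [branch_glue o hv ho hd h1 h2 (h3.trans h4.symm) (by rwa [h3])]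
      split_ifs with h
      · rw [hpot, add_div, mul_div_cancel_left₀ _ hm0, exp_add, Complex.exp_two_pi_mul_I, mul_one]
      · rw [add_zero])
    fun d hd y hy => ((ho.continuousAt_branch hv c d hy).div_const _).cexp
  have hpow : ∀ d, τ.tip d = τ.tip c → ∀ y, y ≠ vtx d.2 →
      exp (τ.branch v c d y / m) ^ m = τ.aff v d.1 y - τ.aff v d.1 (vtx d.2) := by
    intro d hd y hy
    rw [← exp_nat_mul, mul_div_cancel₀ _ hm0, ho.exp_branch o hv hd hy]
  replace hFc := hFc fun d hd => by
    rw [Metric.tendsto_nhds]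
    intro η hη
    have hc : Tendsto (fun y => τ.aff v d.1 y - τ.aff v d.1 (vtx d.2)) (𝓝[≠] (vtx d.2)) (𝓝 0) := by
      have := ((continuous_aff (α := v) d.1).sub
        (continuous_const (y := τ.aff v d.1 (vtx d.2)))).tendsto (vtx d.2)
      rw [Pi.sub_apply, sub_self] at this
      exact this.mono_left nhdsWithin_le_nhds
    filter_upwards [Metric.tendsto_nhds.1 hc (η ^ m) (by positivity), self_mem_nhdsWithin]
      with y hy hne
    rw [dist_zero_right] at hy ⊢
    rw [← hpow d hd y hne, norm_pow] at hy
    exact lt_of_pow_lt_pow_left₀ m hη.le hy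
  obtain ⟨K, hK, hzK, hKs⟩ := exists_compact_subset (τ.isOpen_star (τ.tip c) δ) (τ.mem_star _ hδ)
  have hKn : K ∈ 𝓝 (τ.tip c) := mem_interior_iff_mem_nhds.1 hzK
  have hα : StrictMono fun j => (τ.pot v c j).im := strictMono_nat_of_lt_succ fun j => by
    rw [pot_succ, add_im, log_im]
    linarith [(arg_mem_Ioo_of_im_pos (ho.ratio_im hv (τ.rot^[j] c))).1]
  have hαn : (τ.pot v c (minimalPeriod τ.rot c)).im = (τ.pot v c 0).im + 2 * π * m := by
    have := congrArg Complex.im hpot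
    simp at this
    linarith
  have hhalf : ∀ q ∈ τ.star (τ.tip c) δ, q ≠ τ.tip c → ∃ d y, τ.tip d = τ.tip c ∧
      y ≠ vtx d.2 ∧ dist y (vtx d.2) < δ ∧ τ.char d.1 y = q ∧ 0 < y.1 (d.2 + 1) := by
    intro q hq hne
    obtain ⟨f, y, rfl⟩ := τ.cover q
    obtain ⟨x, hx, hd⟩ := hq f y rfl
    obtain ⟨i, rfl⟩ := (τ.mem_iff f x).1 (hx ▸ hz)
    have hy : y ≠ vtx i := by rintro rfl; exact hne hx
    rcases (y.nonneg (i + 1)).eq_or_lt with h0 | h0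
    · obtain ⟨s, rfl⟩ := exists_side h0.symm
      obtain ⟨h1, h2, h3, h4⟩ := side_rot_coord (τ := τ) (f, i) s
      have hs : s ≠ 1 := by
        rintro rfl
        exact hy (by rw [side_one, fin3_add_one_add_two])
      have hs1 : s < 1 := lt_of_le_of_ne unitInterval.le_one' hs
      have hp : (0 : ℝ) < 1 - s := sub_pos.2 hs1
      refine ⟨τ.rot (f, i), _, (tip_rot _).trans hx, ?_, ?_, (τ.glue (f, i + 1) s).symm,
        by rw [h4]; exact hp⟩
      · intro h
        rw [h, vtx_apply_add_one] at h4
        linarith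
      · have e1 : vtx i = side (i + 1) 1 := by rw [side_one, fin3_add_one_add_two]
        rw [e1, dist_side] at hd
        rw [rot, ← side_zero, dist_side, unitInterval.coe_symm_eq]
        rw [abs_sub_comm] at hd
        simpa using hd
    · exact ⟨(f, i), y, hx, hy, hd, rfl, h0⟩
  have hinj : InjOn F K := by
    have him : ∀ d y, τ.tip d = τ.tip c → y ≠ vtx d.2 → 0 < y.1 (d.2 + 1) →
        (τ.pot v c (τ.idx c d)).im ≤ (τ.branch v c d y).im ∧
        (τ.branch v c d y).im < (τ.pot v c (τ.idx c d + 1)).im := by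
      intro d y hd hy hpos
      obtain ⟨h1, h2⟩ := arg_wedge (ho.ratio_im hv d) (y.nonneg (d.2 + 2)) (Tri.add_pos hy)
      have h3 := h2 hpos
      rw [pot_succ, (idx_spec o hd).2, branch, add_im, add_im, log_im, log_im, wedge]
      constructor <;> linarith
    intro q hq q' hq' h
    have hF0 : ∀ q ∈ K, q ≠ τ.tip c → F q ≠ 0 := fun q hq hne => by
      obtain ⟨d, y, hd, hy, hdist, rfl, -⟩ := hhalf q (hKs hq) hne
      rw [hF d hd y hdist hy]
      exact exp_ne_zero _
    by_cases hqz : q = τ.tip c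
    · by_contra hne
      rw [hqz, hFz] at h
      exact hF0 q' hq' (fun h' => hne (hqz.trans h'.symm)) h.symm
    by_cases hqz' : q' = τ.tip c
    · rw [hqz', hFz] at h
      exact absurd h (hF0 q hq hqz)
    obtain ⟨d, y, hd, hy, hdist, rfl, hpos⟩ := hhalf q (hKs hq) hqz
    obtain ⟨d', y', hd', hy', hdist', rfl, hpos'⟩ := hhalf q' (hKs hq') hqz'
    rw [hF d hd y hdist hy, hF d' hd' y' hdist' hy'] at h
    obtain ⟨a1, a2⟩ := him d y hd hy hpos
    obtain ⟨b1, b2⟩ := him d' y' hd' hy' hpos'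
    have hj := (idx_spec o hd).1
    have hj' := (idx_spec o hd').1
    have r1 := hα.monotone (Nat.zero_le (τ.idx c d))
    have r2 := hα.monotone (Nat.zero_le (τ.idx c d'))
    have r3 := hα.monotone (Nat.succ_le_of_lt hj)
    have r4 := hα.monotone (Nat.succ_le_of_lt hj')
    simp only [Nat.succ_eq_add_one] at r1 r2 r3 r4
    have hbr : τ.branch v c d y = τ.branch v c d' y' := by
      obtain ⟨k, hk⟩ := Complex.exp_eq_exp_iff_exists_int.1 h
      have h1 : τ.branch v c d y = τ.branch v c d' y' + (k * m : ℝ) * (2 * π) * I := by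
        push_cast
        field_simp at hk
        linear_combination hk
      have h2 := congrArg Complex.im h1
      simp at h2
      have hπ := pi_pos
      have h3 : (k : ℝ) * m < 1 * m := by nlinarith
      have h4 : (-1 : ℝ) * m < k * m := by nlinarith
      have h5 := lt_of_mul_lt_mul_right h3 hmR.le
      have h6 := lt_of_mul_lt_mul_right h4 hmR.le
      have : k = 0 := by
        have h7 : k < 1 := by exact_mod_cast h5
        have h8 : -1 < k := by exact_mod_cast h6
        omega
      rw [h1, this]
      simp
    have hidx : τ.idx c d = τ.idx c d' := by
      rw [hbr] at a1 a2
      rcases lt_trichotomy (τ.idx c d) (τ.idx c d') with hlt | h | hlt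
      · have := hα.monotone (Nat.succ_le_of_lt hlt)
        simp only [Nat.succ_eq_add_one] at this
        linarith
      · exact h
      · have := hα.monotone (Nat.succ_le_of_lt hlt)
        simp only [Nat.succ_eq_add_one] at this
        linarith
    have hdd : d = d' := by rw [← (idx_spec o hd).2, hidx, (idx_spec o hd').2]
    subst hdd
    rw [branch, branch, add_right_inj] at hbr
    have hw : τ.wedge v d y = τ.wedge v d y' := by
      rw [← exp_log (slitPlane_ne_zero (ho.wedge_mem hv hy)), hbr,
        exp_log (slitPlane_ne_zero (ho.wedge_mem hv hy'))]
    obtain ⟨w1, w2⟩ := wedge_inj (ho.ratio_im hv d) hw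
    rw [Tri.ext_of d.2 w1 w2]
  have hsurj : ∀ᶠ ζ in 𝓝 (F (τ.tip c)), ζ ∈ F '' K := by
    rw [hFz]
    have hnear : ∀ d, τ.tip d = τ.tip c → ∃ η > 0, η ≤ 1 ∧ ∀ y : Tri,
        y.1 (d.2 + 1) + y.1 (d.2 + 2) < η → τ.char d.1 y ∈ K ∧ dist y (vtx d.2) < δ := by
      intro d hd
      have hev : ∀ᶠ y in 𝓝 (vtx d.2), τ.char d.1 y ∈ K ∧ dist y (vtx d.2) < δ :=
        ((τ.char d.1).continuous.continuousAt.eventually_mem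
          (show K ∈ 𝓝 (τ.tip d) from hd ▸ hKn)).and (ball_mem_nhds _ hδ)
      obtain ⟨η, hη, hball⟩ := Metric.eventually_nhds_iff.1 hev
      refine ⟨min η 1, lt_min hη one_pos, min_le_right _ _, fun y hy => hball ?_⟩
      exact (dist_vtx_le y d.2).trans_lt (hy.trans_le (min_le_left _ _))
    choose! η hη hη1 hηK using hnear
    let M : τ.Corner → ℝ := fun d => (‖τ.ratio v d‖ + 1) / ((τ.ratio v d).im * ‖τ.ray v d‖)
    have hsmall : ∀ d, τ.tip d = τ.tip c → ∀ᶠ ζ in 𝓝 (0 : ℂ), ‖ζ‖ ^ m * M d < η d := by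
      intro d hd
      have : Tendsto (fun ζ : ℂ => ‖ζ‖ ^ m * M d) (𝓝 0) (𝓝 0) := by
        have h : Continuous fun ζ : ℂ => ‖ζ‖ ^ m * M d := by fun_prop
        simpa [hm.ne'] using h.tendsto 0
      exact this.eventually_lt_const (hη d hd)
    have hall : ∀ᶠ ζ in 𝓝 (0 : ℂ), ∀ d, τ.tip d = τ.tip c → ‖ζ‖ ^ m * M d < η d := by
      rw [eventually_all]
      intro d
      by_cases hd : τ.tip d = τ.tip c
      · filter_upwards [hsmall d hd] with ζ h _ using h
      · exact Eventually.of_forall fun ζ h => absurd h hd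
    filter_upwards [hall] with ζ hζ
    by_cases hζ0 : ζ = 0
    · exact ⟨τ.tip c, mem_of_mem_nhds hKn, by rw [hFz, hζ0]⟩
    obtain ⟨k, hk, -⟩ := existsUnique_add_zsmul_mem_Ico Real.two_pi_pos ζ.arg
      ((τ.pot v c 0).im / m)
    set A : ℂ := m * (log ζ + k * (2 * π * I)) with hA
    have hexpA : exp (A / m) = ζ := by
      rw [hA, mul_div_cancel_left₀ _ hm0, exp_add, exp_log hζ0,
        Complex.exp_int_mul_two_pi_mul_I, mul_one]
    have hAim : A.im = m * (ζ.arg + k • (2 * π)) := by simp [hA, log_im]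
    obtain ⟨j, hj, hj1, hj2⟩ := exists_step (α := fun j => (τ.pot v c j).im) (x := A.im)
      (n := minimalPeriod τ.rot c) (by
        have := (div_le_iff₀ hmR).1 hk.1
        rw [hAim]; linarith) (by
        have := hk.2
        rw [div_add' _ _ _ hmR.ne', lt_div_iff₀ hmR] at this
        rw [hαn, hAim]; linarith)
    set d := τ.rot^[j] c with hd
    have hdt : τ.tip d = τ.tip c := tip_iterate c j
    have hidx : τ.idx c d = j := idx_iterate o hj
    have hρ := ho.ratio_im hv d
    have hρa := arg_mem_Ioo_of_im_pos hρ
    set φ := A.im - (τ.pot v c j).im with hφ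
    set r := Real.exp (A.re - (τ.pot v c j).re) with hr
    have hφ1 : φ < (τ.ratio v d).arg := by
      rw [pot_succ, add_im, log_im] at hj2
      linarith
    have hφ0 : 0 ≤ φ := sub_nonneg.2 hj1
    have hr0 : 0 < r := Real.exp_pos _
    have hs1 : 0 < sin ((τ.ratio v d).arg - φ) :=
      sin_pos_of_pos_of_lt_pi (by linarith) (by linarith [hρa.2])
    have hs2 : 0 ≤ sin φ := Real.sin_nonneg_of_nonneg_of_le_pi hφ0 (by linarith [hρa.2])
    have hpolar := wedge_polar r φ hρ
    set a := r * ‖τ.ratio v d‖ * sin ((τ.ratio v d).arg - φ) / (τ.ratio v d).im with ha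
    set b := r * sin φ / (τ.ratio v d).im with hb
    have hρ0 : τ.ratio v d ≠ 0 := fun h => by simp [h] at hρ
    have ha0 : 0 < a := by
      have := norm_pos_iff.2 hρ0
      positivity
    have hb0 : 0 ≤ b := by positivity
    have hrζ : r * ‖τ.ray v d‖ = ‖ζ‖ ^ m := by
      have h1 : ‖τ.ray v d‖ = Real.exp (τ.pot v c j).re := by
        rw [← ho.exp_pot c j, Complex.norm_exp]
      have h2 : ‖ζ‖ ^ m = Real.exp A.re := by
        rw [← Complex.norm_exp, ← norm_pow, ← hexpA, ← exp_nat_mul, mul_div_cancel₀ _ hm0]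
      rw [h1, h2, hr, ← Real.exp_add, sub_add_cancel]
    have hab : a + b < η d := by
      refine lt_of_le_of_lt ?_ (hζ d hdt)
      have hray := norm_pos_iff.2 (ho.ray_ne_zero d)
      have e : ‖ζ‖ ^ m * M d = r * ‖τ.ratio v d‖ / (τ.ratio v d).im + r / (τ.ratio v d).im := by
        rw [← hrζ]
        simp only [M]
        field_simp
      rw [e]
      refine add_le_add ?_ ?_
      · exact div_le_div_of_nonneg_right (mul_le_of_le_one_right (by positivity)
          (Real.sin_le_one _)) hρ.le
      · exact div_le_div_of_nonneg_right (mul_le_of_le_one_right hr0.le (Real.sin_le_one _)) hρ.le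
    obtain ⟨y, hy1, hy2⟩ := exists_tri d.2 ha0.le hb0 (hab.le.trans (hη1 d hdt))
    have hyv : y ≠ vtx d.2 := fun h => by
      rw [h, vtx_apply_add_one] at hy1
      exact ha0.ne hy1
    obtain ⟨hK1, hK2⟩ := hηK d hdt y (by rwa [hy1, hy2])
    refine ⟨_, hK1, ?_⟩
    rw [hF d hdt y hK2 hyv, ← hexpA]
    congr 2
    have hwedge : τ.wedge v d y = r * exp (φ * I) := by rw [wedge, hy1, hy2, hpolar]
    have hlog : log (τ.wedge v d y) = (A.re - (τ.pot v c j).re : ℝ) + φ * I := by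
      rw [hwedge, hr, Complex.ofReal_exp, ← exp_add, Complex.log_exp]
      · simp; linarith [pi_pos]
      · simp; linarith [hρa.2]
    rw [branch, hlog, hidx, hφ]
    apply Complex.ext <;> simp
  obtain ⟨ψ, hψ, hzψ, hψK⟩ := exists_openPartialHomeomorph_of_injOn hK hKn (hFc.mono hKs) hinj hsurj
  exact ⟨ψ, hzψ, by rw [hψ, hFz], δ, hδ, hψK.trans hKs, fun d hd y hy hne => by
    rw [hψ]; exact hF d hd y hy hne⟩

end Triangulation

/-! ### Roots of holomorphic functions -/

lemma _root_.HasDerivAt.of_comp {g h : ℂ → ℂ} {a b c : ℂ} (hh : ContinuousAt h a)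
    (hg : HasStrictDerivAt g b (h a)) (hb : b ≠ 0) (hc : HasDerivAt (g ∘ h) c a) :
    DifferentiableAt ℂ h a := by
  have h1 := (hg.to_localInverse hb).hasDerivAt
  refine ((HasDerivAt.comp a h1 hc).congr_of_eventuallyEq ?_).differentiableAt
  filter_upwards [hh.eventually
    (hg.hasStrictFDerivAt_equiv hb).eventually_left_inverse] with z hz
  exact hz.symm

lemma differentiableOn_of_pow {W : Set ℂ} (hW : IsOpen W) {h g : ℂ → ℂ} (hc : ContinuousOn h W)
    {m : ℕ} (hm : m ≠ 0) (hg : ∀ b ∈ W, DifferentiableAt ℂ g b) (hpow : ∀ b ∈ W, h b ^ m = g b)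
    {a : ℂ} (h0 : ∀ b ∈ W, b ≠ a → h b ≠ 0) : DifferentiableOn ℂ h W := by
  have hoff : ∀ b ∈ W, b ≠ a → DifferentiableAt ℂ h b := fun b hb hba => by
    refine HasDerivAt.of_comp (hc.continuousAt (hW.mem_nhds hb)) (hasStrictDerivAt_pow m (h b))
      (mul_ne_zero (Nat.cast_ne_zero.2 hm) (pow_ne_zero _ (h0 b hb hba)))
      ((hg b hb).hasDerivAt.congr_of_eventuallyEq ?_)
    filter_upwards [hW.mem_nhds hb] with x hx using hpow x hx
  by_cases ha : a ∈ W
  · exact (Complex.differentiableOn_compl_singleton_and_continuousAt_iff (hW.mem_nhds ha)).1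
      ⟨fun b hb => (hoff b hb.1 hb.2).differentiableWithinAt, hc.continuousAt (hW.mem_nhds ha)⟩
  · exact fun b hb => (hoff b hb fun h => ha (h ▸ hb)).differentiableWithinAt

lemma deriv_ne_zero_of_openPartialHomeomorph {e : OpenPartialHomeomorph ℂ ℂ}
    (hd : DifferentiableOn ℂ e e.source) {a : ℂ} (ha : a ∈ e.source)
    (h : ∀ b ∈ e.source, b ≠ a → deriv e b ≠ 0) : deriv e a ≠ 0 := by
  have hda : ∀ b ∈ e.source, HasDerivAt e (deriv e b) b := fun b hb =>
    ((hd b hb).differentiableAt (e.open_source.mem_nhds hb)).hasDerivAt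
  have hinv : DifferentiableOn ℂ e.symm e.target := by
    refine (Complex.differentiableOn_compl_singleton_and_continuousAt_iff
      (e.open_target.mem_nhds (e.map_source ha))).1 ⟨fun w hw => ?_,
        e.continuousAt_symm (e.map_source ha)⟩
    have h1 := e.map_target hw.1
    exact (e.hasDerivAt_symm hw.1 (h _ h1 fun h2 => hw.2 (by rw [← h2, e.right_inv hw.1]; rfl))
      (hda _ h1)).differentiableAt.differentiableWithinAt
  have h1 := ((hinv _ (e.map_source ha)).differentiableAt
    (e.open_target.mem_nhds (e.map_source ha))).hasDerivAt.comp a (hda a ha)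
  have h2 : HasDerivAt (e.symm ∘ e) 1 a := (hasDerivAt_id a).congr_of_eventuallyEq (by
    filter_upwards [e.open_source.mem_nhds ha] with b hb using e.left_inv hb)
  intro h3
  have h4 := h1.unique h2
  rw [h3, mul_zero] at h4
  exact zero_ne_one h4

namespace Triangulation

variable {v v₁ v₂ : τ.Corner → ℂ} {ε : ℝ}

/-- A chart at the vertex `z` whose `m`-th power is a piecewise linear primitive. -/
structure IsVertexChart (τ : Triangulation Z) (v : τ.Corner → ℂ) (z : S) (m : ℕ)
    (ψ : OpenPartialHomeomorph S ℂ) : Prop where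
  mem : z ∈ ψ.source
  zero : ψ z = 0
  only : ∀ q ∈ ψ.source, q ∈ Z → q = z
  prim : τ.IsPLPrimitive v (fun q => ψ q ^ m) ψ.source

lemma IsRealizedBy.isPrimitiveOn [T2Space S] (hv : τ.IsCocycle v) (hr : τ.IsRealizedBy v X)
    {F : S → ℂ} {U : Set S} (hU : IsOpen U) (hF : τ.IsPLPrimitive v F U) : X.IsPrimitiveOn F U := by
  intro φ hφ p hp
  obtain ⟨V, hV, hpV, G, hG⟩ := X.exists_primitive p
  have h1 := (plSystem hv).sub_const hF (hr.isPLPrimitive hV hG) hU hV p ⟨hp.2, hpV⟩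
  have h2 := (φ.continuousAt_symm (φ.map_source hp.1)).eventually (by rwa [φ.left_inv hp.1])
  refine ((hG φ hφ p ⟨hp.1, hpV⟩).add_const (F p - G p)).congr_of_eventuallyEq ?_
  filter_upwards [h2] with w hw
  simp only [comp_apply]
  linear_combination hw

/-- The vertex charts of a realized cochain are charts of the Riemann surface, and the total angle
is determined by the multiplicity. -/
lemma IsVertexChart.compat [T2Space S] (hv : τ.IsCocycle v) (hr : τ.IsRealizedBy v X) {z : Z}
    {m : ℕ} (hm : m ≠ 0) {ψ : OpenPartialHomeomorph S ℂ} (hψ : τ.IsVertexChart v z m ψ) :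
    m = κ z + 1 ∧ ∀ φ ∈ X.charts, (z : S) ∈ φ.source → SameDegree φ ψ z := by
  have hF := hr.isPrimitiveOn hv ψ.open_source hψ.prim
  have key : ∀ φ ∈ X.charts, (z : S) ∈ φ.source → m = κ z + 1 ∧ SameDegree φ ψ z := by
    intro φ hφ hz
    let e := φ.symm.trans ψ
    have hsrc : ∀ b ∈ e.source, b ∈ φ.target ∧ φ.symm b ∈ ψ.source := fun b hb => by
      simpa [e] using hb
    have hez : φ z ∈ e.source := by simp [e, hz, φ.left_inv hz, hψ.mem]
    have hpow : ∀ b ∈ e.source, HasDerivAt (fun b => e b ^ m) (X.coeff φ b) b := fun b hb => by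
      obtain ⟨h1, h2⟩ := hsrc b hb
      have := hF φ hφ (φ.symm b) ⟨φ.map_target h1, h2⟩
      rwa [φ.right_inv h1] at this
    have hne : ∀ b ∈ e.source, b ≠ φ z → φ.symm b ≠ z := fun b hb hbz h => hbz (by
      rw [← h, φ.right_inv (hsrc b hb).1])
    have h0 : ∀ b ∈ e.source, b ≠ φ z → e b ≠ 0 := fun b hb hbz h => by
      refine hne b hb hbz (ψ.injOn (hsrc b hb).2 hψ.mem ?_)
      rw [hψ.zero]; exact h
    have hd := differentiableOn_of_pow e.open_source e.continuousOn hm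
      (fun b hb => (hpow b hb).differentiableAt) (fun b _ => rfl) h0
    have hda : ∀ b ∈ e.source, HasDerivAt e (deriv e b) b := fun b hb =>
      ((hd b hb).differentiableAt (e.open_source.mem_nhds hb)).hasDerivAt
    have hd0 := deriv_ne_zero_of_openPartialHomeomorph hd hez fun b hb hbz h => by
      have h1 := ((hda b hb).pow m).unique (hpow b hb)
      rw [h, mul_zero] at h1
      obtain ⟨h2, h3⟩ := hsrc b hb
      have h4 := X.ne_zero φ hφ (φ.symm b) (φ.map_target h2) fun h5 =>
        hne b hb hbz (hψ.only _ h3 h5)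
      rw [φ.right_inv h2] at h4
      exact h4 h1.symm
    have he : e (φ z) = 0 := by simp [e, φ.left_inv hz, hψ.zero]
    have han : AnalyticAt ℂ e (φ z) := hd.analyticAt (e.open_source.mem_nhds hez)
    refine ⟨?_, sameDegree_of_hasDerivAt hz hd0 (hda _ hez) ψ.open_source hψ.mem ψ.continuousOn⟩
    have h1 := hF.analyticOrderAt_sub ψ.open_source hψ.mem hφ hz
    have h2 := han.analyticOrderAt_sub_eq_one_of_deriv_ne_zero hd0
    have h3 := analyticOrderAt_pow han m
    simp only [he, sub_zero] at h2
    rw [h2] at h3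
    simp only [hψ.zero, zero_pow hm, sub_zero] at h1
    have h4 := h3.symm.trans h1
    rw [nsmul_one] at h4
    exact_mod_cast h4
  obtain ⟨φ, hφ, hz⟩ := X.exists_chart z
  exact ⟨(key φ hφ hz).1, fun φ hφ hz => (key φ hφ hz).2⟩

/-- Vertex charts for two shapes with the same total angle have the same degree. -/
lemma exists_vertexCharts_of_pos [T2Space S] [CompactSpace S] (o : SurfaceOrientation S)
    {β : τ.Face → Tri ≃ₜ Tri} (hβ : τ.IsFaceHomeo β) (hv₁ : τ.IsCocycle v₁)
    (hv₂ : τ.IsCocycle v₂) (ho₁ : τ.IsOriented 1 v₁) (ho₂ : τ.IsOriented 1 v₂) (c : τ.Corner)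
    (hsum : ∑ d ∈ τ.cornersAt (τ.tip c), τ.cornerAngle v₁ d =
      ∑ d ∈ τ.cornersAt (τ.tip c), τ.cornerAngle v₂ d) :
    ∃ (m : ℕ) (ψ₁ ψ₂ : _), 0 < m ∧ ∑ d ∈ τ.cornersAt (τ.tip c), τ.cornerAngle v₁ d = 2 * π * m ∧
      τ.IsVertexChart v₁ (τ.tip c) m ψ₁ ∧ (τ.reparam hβ).IsVertexChart v₂ (τ.tip c) m ψ₂ ∧
      SameDegree ψ₁ ψ₂ (τ.tip c) := by
  obtain ⟨m, hm, hs₁, hp₁⟩ := ho₁.exists_multiplicity o hv₁ c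
  obtain ⟨m', hm', hs₂, hp₂⟩ := ho₂.exists_multiplicity o hv₂ c
  obtain rfl : m = m' := by
    have := pi_pos
    rw [hs₁, hs₂] at hsum
    exact_mod_cast mul_left_cancel₀ (by positivity) hsum
  have hm0 : (m : ℂ) ≠ 0 := by exact_mod_cast hm.ne'
  have main : ∀ (τ' : Triangulation Z) (v : τ'.Corner → ℂ), τ'.IsCocycle v → τ'.IsOriented 1 v →
      ∀ c : τ'.Corner, τ'.pot v c (minimalPeriod τ'.rot c) - τ'.pot v c 0 =
        m * (2 * π * I) → ∃ ψ, τ'.IsVertexChart v (τ'.tip c) m ψ ∧ ∃ δ > 0,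
        ∀ d, τ'.tip d = τ'.tip c → ∀ y, dist y (vtx d.2) < δ → y ≠ vtx d.2 →
        ψ (τ'.char d.1 y) = exp (τ'.branch v c d y / m) := by
    intro τ' v hv ho c hp
    obtain ⟨ψ, hz, h0, δ, hδ, hsub, hψ⟩ := ho.exists_vertexChart o hv c hm hp
    have hO : IsOpen ((Z : Set S) \ {τ'.tip c})ᶜ :=
      (Z.finite_toSet.subset sdiff_subset).isClosed.isOpen_compl
    refine ⟨ψ.restrOpen _ hO, ⟨?_, h0, ?_, ?_⟩, δ, hδ, hψ⟩
    · simpa using hz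
    · intro q hq hqZ
      by_contra h
      simp only [ψ.restrOpen_source] at hq
      exact hq.2 ⟨hqZ, h⟩
    · intro f y hy
      simp only [ψ.restrOpen_source] at hy
      obtain ⟨x, hx, hd⟩ := hsub hy.1 f y rfl
      obtain ⟨i, rfl⟩ := (τ'.mem_iff f x).1 (hx ▸ tip_mem c)
      have key : ∀ y', dist y' (vtx i) < δ → ψ (τ'.char f y') ^ m =
          τ'.aff v f y' - τ'.aff v f (vtx i) := fun y' hy' => by
        by_cases h : y' = vtx i
        · rw [h, hx, h0, zero_pow hm.ne', sub_self]
        · rw [hψ (f, i) hx y' hy' h, ← exp_nat_mul, mul_div_cancel₀ _ hm0,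
            ho.exp_branch (d := (f, i)) o hv hx h]
      have : ∀ᶠ y' in 𝓝 y, dist y' (vtx i) < δ :=
        (continuous_id.dist continuous_const).continuousAt.eventually_lt continuousAt_const hd
      filter_upwards [this] with y' hy'
      change ψ _ ^ m - ψ _ ^ m = _
      rw [key y' hy', key y hd]
      ring
  have htip : ∀ d : τ.Corner, (τ.reparam hβ).tip d = τ.tip d := fun d =>
    congrArg (τ.char d.1) (hβ.symm.apply_vtx d.1 d.2)
  obtain ⟨ψ₁, h₁, δ₁, hδ₁, hψ₁⟩ := main τ v₁ hv₁ ho₁ c hp₁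
  obtain ⟨ψ₂, h₂, δ₂, hδ₂, hψ₂⟩ := main (τ.reparam hβ) v₂ ⟨hv₂.opp, hv₂.sum⟩ ho₂ c hp₂
  simp only [htip] at h₂ hψ₂
  refine ⟨m, ψ₁, ψ₂, hm, hs₁, h₁, h₂, ?_⟩
  have hz := tip_mem (τ := τ) c
  obtain ⟨L, -, δ, hδ, hLc, hL, -⟩ := exists_punctured_glue hz
    (fun d y => (τ.branch v₂ c d (β d.1 y) - τ.branch v₁ c d y) / m) (fun d hd s hs => by
      obtain ⟨t, ht⟩ := hβ.exists_side d.1 (d.2 + 1) s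
      obtain ⟨a1, a2, a3, a4⟩ := side_rot_coord d s
      obtain ⟨b1, b2, b3, b4⟩ := side_rot_coord d t
      have hp : (0 : ℝ) < 1 - s := sub_pos.2 hs
      have ht1 : 0 < (side (d.2 + 1) t).1 (d.2 + 2) := by rw [← ht, hβ.pos_iff, a3]; exact hp
      rw [ht, show β (τ.rot d).1 _ = _ from hβ.glue (d.1, d.2 + 1) s t ht,
        branch_glue o hv₂ ho₂ hd b1 b2 (b3.trans b4.symm) ht1,
        branch_glue o hv₁ ho₁ hd a1 a2 (a3.trans a4.symm) (by rwa [a3]), hp₁, hp₂]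
      ring) fun d hd y hy => by
      refine ContinuousAt.div_const (ContinuousAt.sub ?_ (ho₁.continuousAt_branch hv₁ c d hy)) _
      exact (ho₂.continuousAt_branch hv₂ c d (fun h => hy ((hβ.eq_vtx_iff d.1 y d.2).1 h))).comp
        (f := β d.1) (β d.1).continuous.continuousAt
  have hev : ∀ᶠ q in 𝓝 (τ.tip c), q ≠ τ.tip c → ψ₂ q = ψ₁ q * exp (L q) := by
    refine eventually_of_char τ fun f x hx => ?_
    obtain ⟨i, rfl⟩ := (τ.mem_iff f x).1 (hx ▸ hz)
    have hb : ∀ᶠ y in 𝓝 (vtx i), dist (β f y) (vtx i) < δ₂ := by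
      have := (β f).continuous.continuousAt (x := vtx i)
      rw [ContinuousAt, hβ.apply_vtx] at this
      exact this (ball_mem_nhds _ hδ₂)
    filter_upwards [hb, ball_mem_nhds (vtx i) hδ₁, ball_mem_nhds (vtx i) hδ]
      with y y2 y1 y0 hne
    have hy : y ≠ vtx i := by rintro rfl; exact hne hx
    have e2 := hψ₂ (f, i) hx (β f y) y2 fun h => hy ((hβ.eq_vtx_iff f y i).1 h)
    have e2' : (τ.reparam hβ).char f (β f y) = τ.char f y :=
      congrArg (τ.char f) ((β f).symm_apply_apply y)
    rw [e2'] at e2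
    rw [e2, hψ₁ (f, i) hx y y1 hy, hL (f, i) hx y y0 hy, ← exp_add]
    congr 1
    change τ.branch v₂ c (f, i) (β f y) / m = _
    ring
  obtain ⟨U, hU, hUo, hzU⟩ := eventually_nhds_iff.1 hev
  refine ⟨U ∩ τ.star (τ.tip c) δ, hUo.inter (τ.isOpen_star _ _), ⟨hzU, τ.mem_star _ hδ⟩, L,
    hLc.mono fun q hq => ⟨hq.1.2, hq.2⟩, fun q hq => ?_⟩
  rw [h₁.zero, h₂.zero, sub_zero, sub_zero, hU q hq.1.1 hq.2]

/-- The complex conjugate shape. -/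
def conj (v : τ.Corner → ℂ) (a : τ.Corner) : ℂ := Complex.conjLIE (v a)

lemma IsCocycle.conj (hv : τ.IsCocycle v) : τ.IsCocycle (conj v) :=
  ⟨fun h => by simp only [Triangulation.conj, hv.opp, map_neg], fun f => by
    simp only [Triangulation.conj]; rw [← map_add, ← map_add, hv.sum, map_zero]⟩

lemma IsOriented.conj (ho : τ.IsOriented ε v) : τ.IsOriented (-ε) (conj v) := fun a => by
  have := ho a
  simp only [Triangulation.conj, cross, Complex.conjLIE_apply, Complex.conj_re, Complex.conj_im,
    neg_re, neg_im] at this ⊢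
  linarith

lemma cornerAngle_conj (a : τ.Corner) : τ.cornerAngle (conj v) a = τ.cornerAngle v a := by
  simp only [cornerAngle, conj, ← map_neg]
  exact LinearIsometry.angle_map Complex.conjLIE.toLinearIsometry _ _

lemma IsVertexChart.conj {z : S} {m : ℕ} {ψ : OpenPartialHomeomorph S ℂ}
    (h : τ.IsVertexChart v z m ψ) : τ.IsVertexChart (conj v) z m
      (ψ.transHomeomorph Complex.conjLIE.toHomeomorph) := by
  have e : ∀ q, ψ.transHomeomorph Complex.conjLIE.toHomeomorph q = (starRingEnd ℂ) (ψ q) :=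
    fun _ => rfl
  refine ⟨h.mem, by rw [e, h.zero, map_zero], h.only, fun f y hy => ?_⟩
  filter_upwards [h.prim f y hy] with y' hy'
  rw [e, e, ← map_pow, ← map_pow, ← map_sub, hy']
  simp [aff, Triangulation.conj]

lemma SameDegree.conj {F G : S → ℂ} {p : S} (h : SameDegree F G p) :
    SameDegree (fun q => (starRingEnd ℂ) (F q)) (fun q => (starRingEnd ℂ) (G q)) p := by
  obtain ⟨U, hU, hp, L, hL, hLq⟩ := h
  refine ⟨U, hU, hp, fun q => (starRingEnd ℂ) (L q), Complex.continuous_conj.comp_continuousOn hL,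
    fun q hq => ?_⟩
  rw [← map_sub, hLq q hq, map_mul, map_sub, Complex.exp_conj]

lemma exists_vertexCharts [T2Space S] [CompactSpace S] (o : SurfaceOrientation S)
    (hε : ε = 1 ∨ ε = -1) (hv₁ : τ.IsCocycle v₁) (hv₂ : τ.IsCocycle v₂)
    (ho₁ : τ.IsOriented ε v₁) (ho₂ : τ.IsOriented ε v₂) (c : τ.Corner)
    (hsum : ∑ d ∈ τ.cornersAt (τ.tip c), τ.cornerAngle v₁ d =
      ∑ d ∈ τ.cornersAt (τ.tip c), τ.cornerAngle v₂ d) :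
    ∃ (m : ℕ) (ψ₁ ψ₂ : _), 0 < m ∧ ∑ d ∈ τ.cornersAt (τ.tip c), τ.cornerAngle v₁ d = 2 * π * m ∧
      τ.IsVertexChart v₁ (τ.tip c) m ψ₁ ∧ τ.IsVertexChart v₂ (τ.tip c) m ψ₂ ∧
      SameDegree ψ₁ ψ₂ (τ.tip c) := by
  have hβ : τ.IsFaceHomeo fun _ => Homeomorph.refl _ := ⟨fun _ _ _ => Iff.rfl, fun h s t hst => by
    rw [side_injective _ hst]; rfl⟩
  rcases hε with rfl | rfl
  · obtain ⟨m, ψ₁, ψ₂, hm, hs, h₁, h₂, h⟩ := exists_vertexCharts_of_pos o hβ hv₁ hv₂ ho₁ ho₂ c hsum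
    exact ⟨m, ψ₁, ψ₂, hm, hs, h₁, ⟨h₂.mem, h₂.zero, h₂.only, h₂.prim⟩, h⟩
  · have p₁ := ho₁.conj
    have p₂ := ho₂.conj
    rw [neg_neg] at p₁ p₂
    obtain ⟨m, ψ₁, ψ₂, hm, hs, h₁, h₂, h⟩ := exists_vertexCharts_of_pos o hβ hv₁.conj hv₂.conj
      p₁ p₂ c (by simpa only [cornerAngle_conj] using hsum)
    have e : ∀ v : τ.Corner → ℂ, conj (conj v) = v := fun v => by funext a; simp [conj]
    have h₂' : τ.IsVertexChart (conj v₂) (τ.tip c) m ψ₂ := ⟨h₂.mem, h₂.zero, h₂.only, h₂.prim⟩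
    have k₁ := h₁.conj
    have k₂ := h₂'.conj
    rw [e] at k₁ k₂
    exact ⟨m, _, _, hm, by simpa only [cornerAngle_conj] using hs, k₁, k₂, SameDegree.conj h⟩

/-! ### Realization of shapes -/

variable {v v₁ : τ.Corner → ℂ} {ε : ℝ}

/-- The charts of the translation surface with shape `v`, with their exponents. -/
structure IsAdapted (o : SurfaceOrientation S) (κ : Z → ℕ) (τ : Triangulation Z)
    (v : τ.Corner → ℂ) (m : ℕ) (e : OpenPartialHomeomorph S ℂ) : Prop where
  pos : m ≠ 0
  prim : τ.IsPLPrimitive v (fun q => e q ^ m) e.source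
  zero_iff : ∀ q ∈ e.source, e q = 0 ↔ q ∈ Z
  order : ∀ z : Z, (z : S) ∈ e.source → m = κ z + 1
  positive : ∀ φ ∈ o.charts, ∀ p ∈ φ.source ∩ e.source, SameDegree φ e p

lemma IsPLPrimitive.sub_const [T2Space S] (hv : τ.IsCocycle v) {F G : S → ℂ} {U V : Set S}
    (hF : τ.IsPLPrimitive v F U) (hG : τ.IsPLPrimitive v G V) (hU : IsOpen U) (hV : IsOpen V)
    {p : S} (hp : p ∈ U ∩ V) : ∀ᶠ q in 𝓝 p, F q - G q = F p - G p :=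
  (plSystem hv).sub_const (F := F) (G := G) (U := U) (V := V) hF hG hU hV p hp

lemma IsAdapted.transition [T2Space S] (hv : τ.IsCocycle v) {m m' : ℕ}
    {e e' : OpenPartialHomeomorph S ℂ} (h : IsAdapted o κ τ v m e) (h' : IsAdapted o κ τ v m' e') :
    DifferentiableOn ℂ (e' ∘ e.symm) (e.symm ≫ₕ e').source ∧ ∀ p ∈ e.source ∩ e'.source,
      (m : ℂ) * e p ^ (m - 1) = m' * e' p ^ (m' - 1) * deriv (e' ∘ e.symm) (e p) := by
  have hpow : ∀ p ∈ e.source ∩ e'.source,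
      HasDerivAt (fun b => (e' ∘ e.symm) b ^ m') (m * e p ^ (m - 1)) (e p) := by
    intro p hp
    have h1 := h'.prim.sub_const hv h.prim e'.open_source e.open_source hp.symm
    have h2 := (e.continuousAt_symm (e.map_source hp.1)).eventually (by rwa [e.left_inv hp.1])
    refine ((hasDerivAt_pow m (e p)).add_const (e' p ^ m' - e p ^ m)).congr_of_eventuallyEq ?_
    filter_upwards [h2, e.open_target.mem_nhds (e.map_source hp.1)] with b hb hbt
    rw [e.right_inv hbt] at hb
    simp only [comp_apply]
    linear_combination hb
  have hsrc : ∀ b ∈ (e.symm ≫ₕ e').source, b ∈ e.target ∧ e.symm b ∈ e.source ∩ e'.source :=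
    fun b hb => by
      have : b ∈ e.target ∧ e.symm b ∈ e'.source := by simpa using hb
      exact ⟨this.1, e.map_target this.1, this.2⟩
  have hd : DifferentiableOn ℂ (e' ∘ e.symm) (e.symm ≫ₕ e').source :=
    differentiableOn_of_pow (e.symm ≫ₕ e').open_source (e.symm ≫ₕ e').continuousOn h'.pos
      (g := fun b => (e' ∘ e.symm) b ^ m') (a := 0) (fun b hb => by
        obtain ⟨h1, h2⟩ := hsrc b hb
        have := hpow _ h2
        rw [e.right_inv h1] at this
        exact this.differentiableAt) (fun _ _ => rfl) fun b hb hb0 h0 => hb0 (by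
        obtain ⟨h1, h2⟩ := hsrc b hb
        rw [← e.right_inv h1]
        exact (h.zero_iff _ h2.1).2 ((h'.zero_iff _ h2.2).1 h0))
  refine ⟨hd, fun p hp => ?_⟩
  have hmem : e p ∈ (e.symm ≫ₕ e').source := by simp [hp.1, e.left_inv hp.1, hp.2]
  have h1 := ((hd _ hmem).differentiableAt
    ((e.symm ≫ₕ e').open_source.mem_nhds hmem)).hasDerivAt.pow m'
  rw [(hpow p hp).unique h1, comp_apply, e.left_inv hp.1]

lemma exists_tip_eq {z : S} (hz : z ∈ Z) : ∃ c : τ.Corner, τ.tip c = z := by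
  obtain ⟨f, x, rfl⟩ := τ.cover z
  obtain ⟨i, rfl⟩ := (τ.mem_iff f x).1 hz
  exact ⟨(f, i), rfl⟩

/-- The orientation of a realized surface at a vertex. -/
lemma IsVertexChart.sameDegree [T2Space S] (hv : τ.IsCocycle v) (hr : τ.IsRealizedBy v X)
    {z : S} (hz : z ∈ Z) {m : ℕ} (hm : m ≠ 0) {ψ : OpenPartialHomeomorph S ℂ}
    (hψ : τ.IsVertexChart v z m ψ) {φ : OpenPartialHomeomorph S ℂ} (hφ : φ ∈ o.charts)
    (hzφ : z ∈ φ.source) : SameDegree φ ψ z := by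
  obtain ⟨φ', hφ', hz'⟩ := X.exists_chart z
  exact ((isPositiveAt_iff_sameDegree hzφ).1 (X.positive φ hφ φ' hφ' z ⟨hzφ, hz'⟩)).trans
    ((IsVertexChart.compat (z := ⟨z, hz⟩) hv hr hm hψ).2 φ' hφ' hz')

lemma exists_isAdapted [T2Space S] [CompactSpace S] (hε : ε = 1 ∨ ε = -1)
    (hr : τ.IsRealizedBy v₁ X) (hv₁ : τ.IsCocycle v₁) (hv : τ.IsCocycle v)
    (ho₁ : τ.IsOriented ε v₁) (ho : τ.IsOriented ε v)
    (hsum : ∀ z ∈ Z, ∑ d ∈ τ.cornersAt z, τ.cornerAngle v₁ d =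
      ∑ d ∈ τ.cornersAt z, τ.cornerAngle v d) (p : S) :
    ∃ m e, IsAdapted o κ τ v m e ∧ p ∈ e.source := by
  by_cases hp : p ∈ Z
  · obtain ⟨c, rfl⟩ := exists_tip_eq (τ := τ) hp
    obtain ⟨m, ψ₁, ψ, hm, -, h₁, h, hdeg⟩ := exists_vertexCharts o hε hv₁ hv ho₁ ho c (hsum _ hp)
    have hzero : ∀ q ∈ ψ.source, ψ q = 0 ↔ q ∈ Z := fun q hq => by
      constructor
      · intro h0
        rwa [ψ.injOn hq h.mem (h0.trans h.zero.symm)]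
      · intro hqZ
        rw [h.only q hq hqZ, h.zero]
    refine ⟨m, ψ, ⟨hm.ne', h.prim, hzero, fun z hz => ?_, fun φ hφ q hq => ?_⟩, h.mem⟩
    · obtain rfl : z = ⟨τ.tip c, hp⟩ := Subtype.ext (h.only z hz z.2)
      exact (IsVertexChart.compat hv₁ hr hm.ne' h₁).1
    · by_cases hqZ : q ∈ Z
      · obtain rfl := h.only q hq.2 hqZ
        exact (h₁.sameDegree hv₁ hr hp hm.ne' hφ hq.1).trans hdeg
      · have h0 : ψ q ≠ 0 := fun h0 => hqZ ((hzero q hq.2).1 h0)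
        refine ((hr.exists_chart hε hv₁ hv ho₁ ho hqZ ψ.open_source hq.2 h.prim).2 φ hφ
          hq.1).trans (sameDegree_of_hasDerivAt (φ := ψ) hq.2
          (mul_ne_zero (Nat.cast_ne_zero.2 hm.ne') (pow_ne_zero (m - 1) h0)) ?_ ψ.open_source hq.2
          (ψ.continuousOn.pow m)).symm
        refine (hasDerivAt_pow m (ψ q)).congr_of_eventuallyEq ?_
        filter_upwards [ψ.open_target.mem_nhds (ψ.map_source hq.2)] with b hb
        rw [comp_apply, Pi.pow_apply, ψ.right_inv hb]
  · obtain ⟨U, hU, hpU, F, hF⟩ := (plSystem hv).exists_prim p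
    have hF' : τ.IsPLPrimitive v (fun q => F q + (1 - F p)) U :=
      (plSystem hv).add_const hF (1 - F p)
    obtain ⟨⟨e, hpe, heU, he⟩, -⟩ := hr.exists_chart hε hv₁ hv ho₁ ho hp hU hpU hF'
    have hO : IsOpen (e.source ∩ e ⁻¹' {0}ᶜ ∩ (Z : Set S)ᶜ) :=
      (e.isOpen_inter_preimage isOpen_compl_singleton).inter
        Z.finite_toSet.isClosed.isOpen_compl
    have hsub : ∀ q ∈ (e.restrOpen _ hO).source, q ∈ e.source ∧ e q ≠ 0 ∧ q ∉ Z := fun q hq => by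
      simp only [e.restrOpen_source] at hq
      exact ⟨hq.1, hq.2.1.2, hq.2.2⟩
    refine ⟨1, e.restrOpen _ hO, ⟨one_ne_zero, fun f y hy => ?_, fun q hq => ?_, fun z hz => ?_,
      fun φ hφ q hq => ?_⟩, ?_⟩
    · have h1 := (hsub _ hy).1
      filter_upwards [hF' f y (heU h1), (τ.char f).continuous.continuousAt.eventually
        (e.open_source.mem_nhds h1)] with y' h2 h3
      change e _ ^ 1 - e _ ^ 1 = _
      rw [pow_one, pow_one, he h3, he h1, h2]
    · exact ⟨fun h => absurd h (hsub q hq).2.1, fun h => absurd h (hsub q hq).2.2⟩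
    · exact absurd z.2 (hsub z hz).2.2
    · obtain ⟨h1, -, h3⟩ := hsub q hq.2
      refine ((hr.exists_chart hε hv₁ hv ho₁ ho h3 hU (heU h1) hF').2 φ hφ hq.1).congr_right ?_
      filter_upwards [e.open_source.mem_nhds h1] with q' hq' using he hq'
    · simp only [e.restrOpen_source]
      exact ⟨hpe, ⟨hpe, by simp [he hpe]⟩, hp⟩

/-- Every shape with the right total angles is realized by a translation surface. -/
lemma exists_realization [T2Space S] [CompactSpace S] (hε : ε = 1 ∨ ε = -1)
    (hr : τ.IsRealizedBy v₁ X) (hv₁ : τ.IsCocycle v₁) (hv : τ.IsCocycle v)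
    (ho₁ : τ.IsOriented ε v₁) (ho : τ.IsOriented ε v)
    (hsum : ∀ z ∈ Z, ∑ d ∈ τ.cornersAt z, τ.cornerAngle v₁ d =
      ∑ d ∈ τ.cornersAt z, τ.cornerAngle v d) :
    ∃ Y : TranslationSurface o Z κ, τ.IsRealizedBy v Y := by
  classical
  choose m₀ e₀ he₀ hp₀ using exists_isAdapted hε hr hv₁ hv ho₁ ho hsum
  let A : Set (OpenPartialHomeomorph S ℂ) := {e | ∃ m, IsAdapted o κ τ v m e}
  let cs : ChartedSpace ℂ S := ⟨A, e₀, hp₀, fun p => ⟨_, he₀ p⟩⟩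
  have hA : ∀ e ∈ atlas ℂ S, ∃ m, IsAdapted o κ τ v m e := fun e he => he
  have im : IsManifold 𝓘(ℂ) ω S := by
    refine isManifold_of_contDiffOn _ _ _ fun e e' he he' => ?_
    obtain ⟨m, h⟩ := hA e he
    obtain ⟨m', h'⟩ := hA e' he'
    simpa using (h.transition hv h').1.contDiffOn (e.symm ≫ₕ e').open_source
  let M : OpenPartialHomeomorph S ℂ → ℕ := fun e =>
    if h : ∃ m, IsAdapted o κ τ v m e then h.choose else 1
  have hM : ∀ e ∈ atlas ℂ S, IsAdapted o κ τ v (M e) e := fun e he => by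
    simp only [M, dif_pos (hA e he)]
    exact (hA e he).choose_spec
  let Y : TranslationSurface o Z κ :=
    { chartedSpace := cs
      isManifold := im
      coeff := fun e b => M e * b ^ (M e - 1)
      holomorphic := fun e _ => by fun_prop
      coeff_change := fun e he e' he' p hp => ((hM e he).transition hv (hM e' he')).2 p hp
      order_eq := fun e he z hz => by
        have h := hM e he
        have h1 := h.order z hz
        rw [(h.zero_iff z hz).2 z.2, h1, Nat.add_sub_cancel]
        refine ((by fun_prop : AnalyticAt ℂ (fun b : ℂ => ((κ z + 1 : ℕ) : ℂ) * b ^ κ z)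
          0).analyticOrderAt_eq_natCast).2 ⟨fun _ => ((κ z + 1 : ℕ) : ℂ), analyticAt_const, ?_, ?_⟩
        · exact Nat.cast_ne_zero.2 (Nat.succ_ne_zero _)
        · exact Eventually.of_forall fun b => by simp [mul_comm]
      ne_zero := fun e he p hp hpZ => by
        have h := hM e he
        exact mul_ne_zero (Nat.cast_ne_zero.2 h.pos)
          (pow_ne_zero _ fun h0 => hpZ ((h.zero_iff p hp).1 h0))
      positive := fun φ hφ e he p hp =>
        (isPositiveAt_iff_sameDegree hp.1).2 ((hM e he).positive φ hφ p hp) }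
  have hprim : ∀ F U, IsOpen U → τ.IsPLPrimitive v F U → Y.IsPrimitiveOn F U := by
    intro F U hU hF e he p hp
    have h := hM e he
    have h1 := hF.sub_const hv h.prim hU e.open_source ⟨hp.2, hp.1⟩
    have h2 := (e.continuousAt_symm (e.map_source hp.1)).eventually (by rwa [e.left_inv hp.1])
    refine ((hasDerivAt_pow (M e) (e p)).add_const (F p - e p ^ M e)).congr_of_eventuallyEq ?_
    filter_upwards [h2, e.open_target.mem_nhds (e.map_source hp.1)] with b hb hbt
    rw [e.right_inv hbt] at hb
    simp only [comp_apply]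
    linear_combination hb
  refine ⟨Y, fun f => isDevelopment_aff hv f (fun t => ?_) (right_ne_zero_of_mul (ho (f, 0)).ne')⟩
  obtain ⟨U, hU, ht, F, hF, hD⟩ := along_char_aff hv f t
  exact ⟨U, hU, ht, F, hprim F U hU hF, hD⟩

lemma tip_reparam {β : τ.Face → Tri ≃ₜ Tri} (hβ : τ.IsFaceHomeo β) (d : τ.Corner) :
    (τ.reparam hβ).tip d = τ.tip d := congrArg (τ.char d.1) (hβ.symm.apply_vtx d.1 d.2)

lemma cornersAt_reparam {β : τ.Face → Tri ≃ₜ Tri} (hβ : τ.IsFaceHomeo β) (z : S) :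
    (τ.reparam hβ).cornersAt z = τ.cornersAt z := by
  ext d
  rw [mem_cornersAt, tip_reparam, ← mem_cornersAt]

/-- The total angle at a singularity of multiplicity `κ z` is `2π (κ z + 1)`. -/
lemma IsGeometric.sum_angle [T2Space S] [CompactSpace S] [ConnectedSpace S]
    (hg : τ.IsGeometric X) (z : Z) :
    ∑ d ∈ τ.cornersAt z, τ.angle X d = 2 * π * (κ z + 1) := by
  obtain ⟨β, hβ, hr⟩ := hg.exists_reparam
  have hv := isCocycle_edgeVec hg
  have hv' : (τ.reparam hβ).IsCocycle (τ.edgeVec X) := ⟨hv.opp, hv.sum⟩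
  obtain ⟨ε, hε, ho⟩ := exists_isOriented hg
  obtain ⟨c, hc⟩ := exists_tip_eq (τ := τ.reparam hβ) z.2
  obtain ⟨m, ψ, -, hm, hs, h, -⟩ := exists_vertexCharts (τ := τ.reparam hβ) o hε hv' hv' ho ho c rfl
  rw [hc] at hs h
  rw [cornersAt_reparam, (h.compat hv' hr hm.ne').1] at hs
  simp only [angle_eq_cornerAngle hg]
  rw [show (κ z + 1 : ℝ) = (κ z + 1 : ℕ) by push_cast; rfl]
  exact hs

/-- Two surfaces with the same orientation cannot develop the faces with opposite orientations. -/
lemma IsGeometric.not_opposite [T2Space S] [CompactSpace S] [ConnectedSpace S]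
    (hX : τ.IsGeometric X) (hY : τ.IsGeometric Y) (ho₁ : τ.IsOriented 1 (τ.edgeVec X))
    (ho₂ : τ.IsOriented (-1) (τ.edgeVec Y)) : False := by
  obtain ⟨β, hβ, hrX⟩ := hX.exists_reparam
  obtain ⟨γ, hγ, hrY⟩ := hY.exists_reparam
  have hv₁ := isCocycle_edgeVec hX
  have hv₂ := isCocycle_edgeVec hY
  have hδ := hβ.symm.trans hγ
  have hδ' : (τ.reparam hβ).IsFaceHomeo fun f => (β f).symm.trans (γ f) := ⟨hδ.zero_iff, hδ.glue⟩
  have p₂ := ho₂.conj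
  rw [neg_neg] at p₂
  obtain ⟨f, -⟩ := τ.cover (Classical.arbitrary S)
  have htip := tip_reparam hβ (f, 0)
  have hz : (τ.reparam hβ).tip (f, 0) ∈ Z := tip_mem (τ := τ.reparam hβ) _
  obtain ⟨m, ψ₁, ψ₂, hm, -, h₁, h₂, hdeg⟩ := exists_vertexCharts_of_pos (τ := τ.reparam hβ) o hδ'
    (v₁ := τ.edgeVec X) (v₂ := conj (τ.edgeVec Y)) ⟨hv₁.opp, hv₁.sum⟩ ⟨hv₂.conj.opp, hv₂.conj.sum⟩
    ho₁ p₂ (f, 0) (by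
      have e1 := hX.sum_angle ⟨_, hz⟩
      have e2 := hY.sum_angle ⟨_, hz⟩
      simp only [angle_eq_cornerAngle hX, angle_eq_cornerAngle hY] at e1 e2
      rw [cornersAt_reparam]
      refine (e1.trans e2.symm).trans (Finset.sum_congr rfl fun d _ => ?_)
      exact (cornerAngle_conj (τ := τ) d).symm)
  have h₂' : (τ.reparam hγ).IsVertexChart (conj (τ.edgeVec Y)) ((τ.reparam hβ).tip (f, 0)) m ψ₂ := by
    refine ⟨h₂.mem, h₂.zero, h₂.only, fun g y hy => ?_⟩
    have e : ∀ y, ((τ.reparam hβ).reparam hδ').char g y = (τ.reparam hγ).char g y := fun y =>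
      congrArg (τ.char g) ((β g).symm_apply_apply _)
    rw [← e] at hy ⊢
    filter_upwards [h₂.prim g y hy] with y' hy'
    rw [← e]
    exact hy'
  have h₃ := h₂'.conj
  rw [show conj (τ := τ.reparam hγ) (conj (τ.edgeVec Y)) = τ.edgeVec Y by
    funext a; simp [conj]] at h₃
  obtain ⟨φ, hφ, hzφ⟩ := o.cover ((τ.reparam hβ).tip (f, 0))
  have d₁ := IsVertexChart.sameDegree (τ := τ.reparam hβ) ⟨hv₁.opp, hv₁.sum⟩ hrX hz hm.ne' h₁ hφ hzφ
  have d₂ := IsVertexChart.sameDegree (τ := τ.reparam hγ) ⟨hv₂.opp, hv₂.sum⟩ hrY hz hm.ne' h₃ hφ hzφ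
  exact not_sameDegree_conj h₂.mem ((d₁.trans hdeg).symm.trans d₂)

end Triangulation

/-! ### Isotopies of the triangle -/

/-- The homothety ratio at which a point lies on the boundary. -/
def level (x : Tri) : ℝ := max (max (1 - 3 * x.1 0) (1 - 3 * x.1 1)) (1 - 3 * x.1 2)

lemma level_le_iff {x : Tri} {s : ℝ} : level x ≤ s ↔ ∀ i, 1 - 3 * x.1 i ≤ s := by
  simp [level, Fin.forall_fin_succ, and_assoc]

lemma level_mem (x : Tri) : level x ∈ 𝕀 := by
  refine ⟨?_, level_le_iff.2 fun i => by linarith [x.nonneg i]⟩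
  have h := fun i => level_le_iff.1 (le_refl (level x)) i
  have := x.sum_eq 0
  simp only [zero_add] at this
  linarith [h 0, h 1, h 2]

lemma level_eq_one {x : Tri} : level x = 1 ↔ ∃ i, x.1 i = 0 := by
  constructor
  · intro h
    by_contra! hne
    have : ∀ i, 0 < x.1 i := fun i => (x.nonneg i).lt_of_ne' (hne i)
    have h2 : level x < 1 := by
      simp only [level, max_lt_iff]
      exact ⟨⟨by linarith [this 0], by linarith [this 1]⟩, by linarith [this 2]⟩
    exact h2.ne h
  · rintro ⟨i, hi⟩
    have := level_le_iff.1 (le_refl (level x)) i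
    rw [hi] at this
    exact le_antisymm (level_mem x).2 (by linarith)

lemma level_mix (s : 𝕀) (y : Tri) : level (mix s y) = s * level y := by
  have : ∀ i, 1 - 3 * (mix s y).1 i = s * (1 - 3 * y.1 i) := fun i => by simp only [mix]; ring
  simp only [level, this]
  rw [mul_max_of_nonneg _ _ s.2.1, mul_max_of_nonneg _ _ s.2.1]

lemma continuous_level : Continuous level := by
  have h : ∀ i, Continuous fun x : Tri => 1 - 3 * x.1 i := fun i =>
    continuous_const.sub (continuous_const.mul ((continuous_apply i).comp continuous_subtype_val))
  exact ((h 0).max (h 1)).max (h 2)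

lemma exists_mix {x : Tri} {s : 𝕀} (h : level x ≤ s) : ∃ y, mix s y = x := by
  rcases s.2.1.eq_or_lt with h0 | h0
  · refine ⟨x, Subtype.ext (funext fun i => ?_)⟩
    have h1 := fun j => (level_le_iff.1 h j).trans_eq h0.symm
    have h2 := x.sum_eq i
    simp only [mix, ← h0]
    linarith [h1 i, h1 (i + 1), h1 (i + 2)]
  · refine ⟨⟨fun i => 1 / 3 + (x.1 i - 1 / 3) / s, fun i => ?_, ?_⟩, Subtype.ext (funext fun i => ?_)⟩
    · have := level_le_iff.1 h i
      have h2 : -(1 / 3) ≤ (x.1 i - 1 / 3) / s := (le_div_iff₀ h0).2 (by linarith)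
      dsimp only
      linarith
    · have := x.sum_eq 0
      rw [sum_fin3 _ 0]
      field_simp
      linear_combination 3 * this
    · simp only [mix]
      field_simp
      ring

lemma mix_injective {s : 𝕀} (hs : 0 < (s : ℝ)) : Injective (mix s) := by
  intro y y' h
  refine Subtype.ext (funext fun i => ?_)
  have h1 : 1 / 3 + (s : ℝ) * (y.1 i - 1 / 3) = 1 / 3 + s * (y'.1 i - 1 / 3) :=
    congrFun (congrArg Subtype.val h) i
  exact sub_left_injective (mul_left_cancel₀ hs.ne' (add_left_cancel h1))

lemma mix_zero (y y' : Tri) : mix 0 y = mix 0 y' := by simp [mix]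

/-- A homeomorphism of the triangle that preserves the sides. -/
def IsSideHomeo (k : Tri ≃ₜ Tri) : Prop := ∀ y i, (k y).1 i = 0 ↔ y.1 i = 0

lemma IsSideHomeo.symm {k : Tri ≃ₜ Tri} (hk : IsSideHomeo k) : IsSideHomeo k.symm := fun y i => by
  rw [← hk, k.apply_symm_apply]

/-- The scale of a point in the Alexander isotopy. -/
def scale (t : 𝕀) (x : Tri) : 𝕀 := max ⟨level x, level_mem x⟩ t

lemma scale_mix {k : Tri ≃ₜ Tri} (hk : IsSideHomeo k) {t : 𝕀} {y : Tri}
    {s : 𝕀} (h : scale t (mix s y) = s) : scale t (mix s (k y)) = s := by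
  have hval : ∀ z, (scale t (mix s z) : ℝ) = max (s * level z) t := fun z => by
    rw [← level_mix]; rfl
  apply Subtype.ext
  rw [hval]
  have h' : max (s * level y) (t : ℝ) = s := by rw [← hval, h]
  have hle : (s : ℝ) * level (k y) ≤ s := mul_le_of_le_one_right s.2.1 (level_mem _).2
  rcases max_choice ((s : ℝ) * level y) t with h1 | h1
  · have hts : (t : ℝ) ≤ s := h' ▸ le_max_right _ _
    rw [h1] at h'
    rcases s.2.1.eq_or_lt with h0 | h0
    · rw [← h0] at hts ⊢
      rw [zero_mul, max_eq_left hts]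
    · have : level y = 1 := mul_left_cancel₀ h0.ne' (h'.trans (mul_one _).symm)
      obtain ⟨i, hi⟩ := level_eq_one.1 this
      rw [level_eq_one.2 ⟨i, (hk y i).2 hi⟩, mul_one, max_eq_left hts]
  · rw [h1] at h'
    rw [← h'] at hle ⊢
    exact max_eq_right hle

lemma exists_scale (t : 𝕀) (x : Tri) : ∃ y, mix (scale t x) y = x :=
  exists_mix (le_max_left (⟨level x, level_mem x⟩ : 𝕀) t)

/-- The Alexander isotopy from the cone of `k` to `k`. -/
def alexander (k : Tri ≃ₜ Tri) (t : 𝕀) (x : Tri) : Tri :=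
  mix (scale t x) (k (exists_scale t x).choose)

lemma alexander_mix (k : Tri ≃ₜ Tri) {t s : 𝕀} {y : Tri}
    (h : scale t (mix s y) = s) : alexander k t (mix s y) = mix s (k y) := by
  have h1 := (exists_scale t (mix s y)).choose_spec
  rw [alexander]
  generalize (exists_scale t (mix s y)).choose = y' at h1 ⊢
  rw [h] at h1 ⊢
  rcases s.2.1.eq_or_lt with h0 | h0
  · obtain rfl : s = 0 := Subtype.ext h0.symm
    exact mix_zero _ _
  · rw [mix_injective h0 h1]

lemma continuous_alexander (k : Tri ≃ₜ Tri) :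
    Continuous fun q : 𝕀 × Tri => alexander k q.1 q.2 := by
  let P := {r : 𝕀 × 𝕀 × Tri // scale r.1 (mix r.2.1 r.2.2) = r.2.1}
  have hm : Continuous fun r : 𝕀 × 𝕀 × Tri => mix r.2.1 r.2.2 := continuous_mix.comp continuous_snd
  have hsc : Continuous fun q : 𝕀 × Tri => scale q.1 q.2 :=
    (Continuous.subtype_mk (continuous_level.comp continuous_snd) _).max continuous_fst
  have : CompactSpace P := isCompact_iff_compactSpace.1 (IsClosed.isCompact
    (isClosed_eq (hsc.comp (continuous_fst.prodMk hm)) (continuous_fst.comp continuous_snd)))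
  let pr : P → 𝕀 × Tri := fun r => (r.1.1, mix r.1.2.1 r.1.2.2)
  have hπ : Continuous pr := (continuous_fst.prodMk hm).comp continuous_subtype_val
  have hsurj : Function.Surjective pr := fun q => by
    obtain ⟨y, hy⟩ := exists_scale q.1 q.2
    exact ⟨⟨(q.1, scale q.1 q.2, y), by rw [hy]⟩, Prod.ext rfl hy⟩
  rw [(hπ.isClosedMap.isQuotientMap hπ hsurj).continuous_iff]
  have : (fun q : 𝕀 × Tri => alexander k q.1 q.2) ∘ pr =
      fun r => mix r.1.2.1 (k r.1.2.2) := funext fun r => alexander_mix k r.2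
  rw [this]
  exact (continuous_mix.comp ((continuous_fst.comp continuous_snd).prodMk
    (k.continuous.comp (continuous_snd.comp continuous_snd)))).comp continuous_subtype_val

lemma alexander_symm {k : Tri ≃ₜ Tri} (hk : IsSideHomeo k) (t : 𝕀) (x : Tri) :
    alexander k.symm t (alexander k t x) = x := by
  obtain ⟨y, hy⟩ := exists_scale t x
  have h : scale t (mix (scale t x) y) = scale t x := by rw [hy]
  have h1 := alexander_mix k h
  rw [hy] at h1
  rw [h1, alexander_mix k.symm (scale_mix hk h), k.symm_apply_apply, hy]

lemma alexander_of_scale_one (k : Tri ≃ₜ Tri) {t : 𝕀} {x : Tri} (h : scale t x = 1) :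
    alexander k t x = k x := by
  have h1 : ∀ y, mix 1 y = y := fun y => Subtype.ext (funext fun i => by simp [mix])
  have := alexander_mix k (t := t) (s := 1) (y := x) (by rw [h1, h])
  rwa [h1, h1] at this

lemma scale_of_mem_side {t : 𝕀} {x : Tri} {i : Fin 3} (h : x.1 i = 0) : scale t x = 1 :=
  le_antisymm unitInterval.le_one' (le_max_of_le_left (level_eq_one.2 ⟨i, h⟩).ge)

/-- The stages of the Alexander isotopy. -/
def alexanderHomeo {k : Tri ≃ₜ Tri} (hk : IsSideHomeo k) (t : 𝕀) : Tri ≃ₜ Tri where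
  toFun := alexander k t
  invFun := alexander k.symm t
  left_inv := alexander_symm hk t
  right_inv := alexander_symm hk.symm t
  continuous_toFun := (continuous_alexander k).comp (Continuous.prodMk_right t)
  continuous_invFun := (continuous_alexander k.symm).comp (Continuous.prodMk_right t)

/-- The point that divides a segment in the triangle in the ratio `t`. -/
def lerp (t : 𝕀) (x y : Tri) : Tri := ⟨fun i => (1 - t) * x.1 i + t * y.1 i, fun i => add_nonneg
    (mul_nonneg (sub_nonneg.2 t.2.2) (x.nonneg i)) (mul_nonneg t.2.1 (y.nonneg i)), by
    have h1 := x.sum_eq 0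
    have h2 := y.sum_eq 0
    rw [sum_fin3 _ 0]
    linear_combination (1 - t : ℝ) * h1 + (t : ℝ) * h2⟩

lemma continuous_lerp {k : Tri ≃ₜ Tri} : Continuous fun q : 𝕀 × Tri => lerp q.1 q.2 (k q.2) := by
  have h : ∀ i, Continuous fun x : Tri => x.1 i := fun i =>
    (continuous_apply i).comp continuous_subtype_val
  have ht : Continuous fun q : 𝕀 × Tri => (q.1 : ℝ) := continuous_subtype_val.comp continuous_fst
  exact Continuous.subtype_mk (continuous_pi fun i =>
    ((continuous_const.sub ht).mul ((h i).comp continuous_snd)).add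
      (ht.mul ((h i).comp (k.continuous.comp continuous_snd)))) _

lemma lerp_eq_zero {k : Tri ≃ₜ Tri} (hk : IsSideHomeo k) (t : 𝕀) (x : Tri)
    (i : Fin 3) : (lerp t x (k x)).1 i = 0 ↔ x.1 i = 0 := by
  constructor
  · intro h
    by_contra hx
    have h1 := (x.nonneg i).lt_of_ne' hx
    have h2 := ((k x).nonneg i).lt_of_ne' fun h => hx ((hk x i).1 h)
    have h3 : (1 - t : ℝ) * x.1 i + t * (k x).1 i = 0 := h
    have h4 := sub_nonneg.2 t.2.2
    have h5 := t.2.1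
    nlinarith [mul_nonneg h4 h1.le, mul_nonneg h5 h2.le]
  · intro h
    change (1 - t : ℝ) * x.1 i + t * (k x).1 i = 0
    rw [h, (hk x i).2 h]; ring

lemma lerp_mix (t s : 𝕀) (x y : Tri) : lerp t (mix s x) (mix s y) = mix s (lerp t x y) :=
  Subtype.ext (funext fun i => by simp only [lerp, mix]; ring)

lemma lerp_side (t s r : 𝕀) (i : Fin 3) : ∃ u : 𝕀,
    (u : ℝ) = (1 - t) * s + t * r ∧ lerp t (side i s) (side i r) = side i u := by
  have h0 : (lerp t (side i s) (side i r)).1 i = 0 := by simp [lerp, side_apply_self]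
  obtain ⟨u, hu⟩ := exists_side h0
  refine ⟨u, ?_, hu⟩
  have := congrArg (fun y : Tri => y.1 (i + 2)) hu
  simp only [lerp, side_apply_add_two] at this
  exact this.symm

/-- The straight line homotopy from the identity is bijective on the boundary. -/
lemma exists_lerp_boundary {k : Tri ≃ₜ Tri} (hk : IsSideHomeo k) (t : 𝕀) (i : Fin 3) :
    ∃ g : 𝕀 → 𝕀, Bijective g ∧ ∀ s, lerp t (side i s) (k (side i s)) = side i (g s) := by
  have hex : ∀ s, ∃ r, k (side i s) = side i r := fun s =>
    exists_side ((hk _ i).2 (side_apply_self i s))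
  choose r hr using hex
  have hrv : ∀ s, (r s : ℝ) = (k (side i s)).1 (i + 2) := fun s => by rw [hr, side_apply_add_two]
  have hrc : Continuous r := Continuous.subtype_mk (f := fun s => (k (side i s)).1 (i + 2))
    (((continuous_apply _).comp continuous_subtype_val).comp
      (k.continuous.comp (continuous_side i))) (fun s => hrv s ▸ (r s).2) |>.congr fun s =>
      Subtype.ext (hrv s).symm
  have hv : ∀ j, k (vtx j) = vtx j := fun j => Tri.ext_of j
    (by rw [vtx_apply_add_one, hk, vtx_apply_add_one])
    (by rw [vtx_apply_add_two, hk, vtx_apply_add_two])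
  have h0 : r 0 = 0 := side_injective i (by rw [← hr, side_zero, hv])
  have h1 : r 1 = 1 := side_injective i (by rw [← hr, side_one, hv])
  have hmono : StrictMono r := hrc.strictMono_of_inj_boundedOrder
    (by rw [show (⊥ : 𝕀) = 0 from rfl, h0]; exact unitInterval.nonneg')
    fun s s' h => side_injective i (k.injective (by rw [hr, hr, h]))
  choose g hg hg' using fun s => lerp_side t s (r s) i
  have hgm : StrictMono g := fun s s' hs => by
    rw [← Subtype.coe_lt_coe, hg, hg]
    have a1 : (s : ℝ) < s' := hs
    have a2 : (r s : ℝ) < r s' := hmono hs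
    have a3 := sub_nonneg.2 t.2.2
    have a4 := t.2.1
    nlinarith [mul_nonneg a3 (sub_pos.2 a1).le, mul_nonneg a4 (sub_pos.2 a2).le]
  have hgc : Continuous g := Continuous.subtype_mk (f := fun s => (1 - t : ℝ) * s + t * r s)
    (by fun_prop) (fun s => hg s ▸ (g s).2) |>.congr fun s => Subtype.ext (hg s).symm
  refine ⟨g, ⟨hgm.injective, fun u => ?_⟩, fun s => by rw [hr, hg']⟩
  have e0 : g 0 = 0 := Subtype.ext (by rw [hg, h0]; simp)
  have e1 : g 1 = 1 := Subtype.ext (by rw [hg, h1]; simp)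
  have := intermediate_value_univ (0 : 𝕀) 1 hgc
  rw [e0, e1] at this
  exact this ⟨unitInterval.nonneg', unitInterval.le_one'⟩

lemma lerp_bijective {k : Tri ≃ₜ Tri} (hk : IsSideHomeo k) (t : 𝕀) :
    Bijective fun x => lerp t x (alexanderHomeo hk 0 x) := by
  have hcone : ∀ x : Tri, ∃ s y, x = mix s y ∧ level x = s ∧ ((s : ℝ) ≠ 0 → ∃ i, y.1 i = 0) ∧
      lerp t x (alexanderHomeo hk 0 x) = mix s (lerp t y (k y)) := fun x => by
    obtain ⟨y, hy⟩ := exists_scale 0 x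
    have hs : (scale 0 x : ℝ) = level x := max_eq_left (level_mem x).1
    refine ⟨_, y, hy.symm, hs.symm, fun h0 => level_eq_one.1 ?_, ?_⟩
    · have := level_mix (scale 0 x) y
      rw [hy, ← hs] at this
      exact mul_left_cancel₀ h0 (by rw [← this, mul_one])
    · have h := alexander_mix k (t := 0) (s := scale 0 x) (y := y) (by rw [hy])
      rw [hy] at h
      rw [show alexanderHomeo hk 0 x = _ from h, ← lerp_mix, hy]
  have hlev : ∀ x, level (lerp t x (alexanderHomeo hk 0 x)) = level x := fun x => by
    obtain ⟨s, y, -, hs, hb, h⟩ := hcone x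
    rw [h, level_mix, hs]
    by_cases h0 : (s : ℝ) = 0
    · rw [h0, zero_mul]
    · obtain ⟨i, hi⟩ := hb h0
      rw [level_eq_one.2 ⟨i, (lerp_eq_zero hk t y i).2 hi⟩, mul_one]
  constructor
  · intro x x' h
    have h : lerp t x (alexanderHomeo hk 0 x) = lerp t x' (alexanderHomeo hk 0 x') := h
    have hl := hlev x
    rw [h, hlev] at hl
    obtain ⟨s, y, hx, hs, hb, e⟩ := hcone x
    obtain ⟨s', y', hx', hs', hb', e'⟩ := hcone x'
    obtain rfl : s = s' := Subtype.ext (by rw [← hs, ← hs', hl])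
    rw [hx, hx']
    rcases s.2.1.eq_or_lt with h0 | h0
    · obtain rfl : s = 0 := Subtype.ext h0.symm
      exact mix_zero _ _
    · obtain ⟨i, hi⟩ := hb h0.ne'
      rw [e, e'] at h
      have h1 := mix_injective h0 h
      have hi' : y'.1 i = 0 := by rw [← lerp_eq_zero hk t, ← h1, lerp_eq_zero hk t, hi]
      obtain ⟨u, rfl⟩ := exists_side hi
      obtain ⟨u', rfl⟩ := exists_side hi'
      obtain ⟨g, hg, hgs⟩ := exists_lerp_boundary hk t i
      rw [hgs, hgs] at h1
      rw [hg.1 (side_injective i h1)]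
  · intro w
    obtain ⟨z, hz⟩ := exists_scale 0 w
    have hsw : (scale 0 w : ℝ) = level w := max_eq_left (level_mem w).1
    have key : ∃ y, scale 0 (mix (scale 0 w) y) = scale 0 w ∧
        mix (scale 0 w) (lerp t y (k y)) = w := by
      rcases (scale 0 w).2.1.eq_or_lt with h0 | h0
      · refine ⟨z, by rw [hz], ?_⟩
        conv_rhs => rw [← hz]
        rw [show scale 0 w = 0 from Subtype.ext h0.symm]
        exact mix_zero _ _
      · have h1 : level z = 1 := by
          have := level_mix (scale 0 w) z
          rw [hz, ← hsw] at this
          exact mul_left_cancel₀ h0.ne' (by rw [← this, mul_one])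
        obtain ⟨i, hi⟩ := level_eq_one.1 h1
        obtain ⟨u, rfl⟩ := exists_side hi
        obtain ⟨g, hg, hgs⟩ := exists_lerp_boundary hk t i
        obtain ⟨u', rfl⟩ := hg.2 u
        refine ⟨side i u', Subtype.ext ?_, by rw [hgs, hz]⟩
        have h2 : level (mix (scale 0 w) (side i u')) = scale 0 w := by
          rw [level_mix, level_eq_one.2 ⟨i, side_apply_self i u'⟩, mul_one]
        exact (max_eq_left (level_mem _).1).trans h2
    obtain ⟨y, hy, hw⟩ := key
    refine ⟨mix (scale 0 w) y, ?_⟩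
    change lerp t _ (alexander k 0 _) = w
    rw [alexander_mix k hy, lerp_mix, hw]

/-- The stages of the straight line isotopy from the identity to the cone of `k`. -/
def lerpHomeo {k : Tri ≃ₜ Tri} (hk : IsSideHomeo k) (t : 𝕀) : Tri ≃ₜ Tri :=
  Continuous.homeoOfEquivCompactToT2 (f := Equiv.ofBijective _ (lerp_bijective hk t))
    (continuous_lerp.comp (Continuous.prodMk_right t))

/-! ### Homeomorphisms that preserve the faces -/

namespace Triangulation

variable {k : τ.Face → Tri ≃ₜ Tri}

/-- The map of the surface that is given by maps of the faces. -/
def faceMap (τ : Triangulation Z) (k : τ.Face → Tri ≃ₜ Tri) (p : S) : S :=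
  τ.char (τ.cover p).choose (k (τ.cover p).choose (τ.cover p).choose_spec.choose)

lemma IsFaceHomeo.faceMap_char (hk : τ.IsFaceHomeo k) (f : τ.Face) (y : Tri) :
    τ.faceMap k (τ.char f y) = τ.char f (k f y) := by
  have h := (τ.cover (τ.char f y)).choose_spec.choose_spec
  rw [faceMap]
  generalize (τ.cover (τ.char f y)).choose_spec.choose = x at h ⊢
  generalize (τ.cover (τ.char f y)).choose = g at h ⊢
  rcases τ.char_eq_cases h with ⟨rfl, rfl⟩ | ⟨e, s, -, -, rfl, rfl, rfl, rfl⟩ | ⟨i, j, rfl, rfl⟩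
  · rfl
  · obtain ⟨t, ht⟩ := hk.exists_side e.1 e.2 s
    rw [ht, hk.glue e s t ht, τ.glue]
  · rw [hk.apply_vtx, hk.apply_vtx, h]

lemma IsFaceHomeo.faceMap_symm (hk : τ.IsFaceHomeo k) (p : S) :
    τ.faceMap (fun f => (k f).symm) (τ.faceMap k p) = p := by
  obtain ⟨f, y, rfl⟩ := τ.cover p
  rw [hk.faceMap_char, hk.symm.faceMap_char, Homeomorph.symm_apply_apply]

lemma IsFaceHomeo.continuous_faceMap [T2Space S] (hk : τ.IsFaceHomeo k) :
    Continuous (τ.faceMap k) :=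
  τ.continuous_of_char fun f => by
    simp only [hk.faceMap_char]
    exact (τ.char f).continuous.comp (k f).continuous

/-- The homeomorphism of the surface that is given by homeomorphisms of the faces. -/
def faceHomeo [T2Space S] (hk : τ.IsFaceHomeo k) : S ≃ₜ S where
  toFun := τ.faceMap k
  invFun := τ.faceMap fun f => (k f).symm
  left_inv := hk.faceMap_symm
  right_inv := hk.symm.faceMap_symm
  continuous_toFun := hk.continuous_faceMap
  continuous_invFun := hk.symm.continuous_faceMap

lemma continuous_of_char_prod [T2Space S] {E : Type*} [TopologicalSpace E]
    {F : 𝕀 × S → E} (h : ∀ f, Continuous fun q : 𝕀 × Tri =>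
      F (q.1, τ.char f q.2)) : Continuous F := by
  let pr : (Σ _ : τ.Face, 𝕀 × Tri) → 𝕀 × S := fun q => (q.2.1, τ.char q.1 q.2.2)
  have hπ : Continuous pr := continuous_sigma fun f =>
    continuous_fst.prodMk ((τ.char f).continuous.comp continuous_snd)
  have hs : Function.Surjective pr := fun q => by
    obtain ⟨f, y, hy⟩ := τ.cover q.2
    exact ⟨⟨f, q.1, y⟩, Prod.ext rfl hy⟩
  rw [(hπ.isClosedMap.isQuotientMap hπ hs).continuous_iff]
  exact continuous_sigma h

lemma alexanderHomeo_side {k : Tri ≃ₜ Tri} (hk : IsSideHomeo k) (t : 𝕀) {x : Tri}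
    {i : Fin 3} (h : x.1 i = 0) : alexanderHomeo hk t x = k x :=
  alexander_of_scale_one k (scale_of_mem_side h)

lemma isSideHomeo_alexanderHomeo {k : Tri ≃ₜ Tri} (hk : IsSideHomeo k) (t : 𝕀) :
    IsSideHomeo (alexanderHomeo hk t) := fun x i => by
  constructor
  · intro h
    rw [← (alexanderHomeo hk t).symm_apply_apply x]
    change (alexanderHomeo hk.symm t _).1 i = 0
    rwa [alexanderHomeo_side _ _ h, hk.symm]
  · intro h
    rwa [alexanderHomeo_side _ _ h, hk]

lemma IsFaceHomeo.isSideHomeo (hk : τ.IsFaceHomeo k) (f : τ.Face) : IsSideHomeo (k f) :=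
  hk.zero_iff f

lemma IsFaceHomeo.alexander (hk : τ.IsFaceHomeo k) (t : 𝕀) :
    τ.IsFaceHomeo fun f => alexanderHomeo (hk.isSideHomeo f) t where
  zero_iff f := isSideHomeo_alexanderHomeo _ t
  glue h s r hr := by
    rw [alexanderHomeo_side _ _ (side_apply_self _ _)] at hr ⊢
    exact hk.glue h s r hr

lemma IsFaceHomeo.lerp (hk : τ.IsFaceHomeo k) (t : 𝕀) :
    τ.IsFaceHomeo fun f => lerpHomeo (hk.isSideHomeo f) t where
  zero_iff f := lerp_eq_zero (isSideHomeo_alexanderHomeo _ 0) t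
  glue h s r hr := by
    obtain ⟨u, hu⟩ := (hk.alexander 0).exists_side h.1 h.2 s
    have hu' := (hk.alexander 0).glue h s u hu
    have hr : IsoDelaunay.lerp t _ (alexanderHomeo (hk.isSideHomeo h.1) 0 _) = _ := hr
    change IsoDelaunay.lerp t _ (alexanderHomeo (hk.isSideHomeo (τ.opp h).1) 0 _) = _
    obtain ⟨a, ha, ha'⟩ := lerp_side t s u h.2
    obtain ⟨b, hb, hb'⟩ := lerp_side t (σ₀ s) (σ₀ u) (τ.opp h).2
    rw [hu, ha'] at hr
    rw [hu', hb', ← side_injective _ hr]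
    congr 1
    apply Subtype.ext
    rw [hb, unitInterval.coe_symm_eq, unitInterval.coe_symm_eq, unitInterval.coe_symm_eq, ha]
    ring

lemma IsFaceHomeo.isotopicToIdRel [T2Space S] (hk : τ.IsFaceHomeo k) :
    IsotopicToIdRel Z (faceHomeo hk) := by
  have hst := fun t => (hk.lerp t).trans ((hk.alexander 0).symm.trans (hk.alexander t))
  have happ : ∀ t f y, faceHomeo (hst t) (τ.char f y) =
      τ.char f (IsoDelaunay.alexander (k f) t (IsoDelaunay.alexander (k f).symm 0
        (IsoDelaunay.lerp t y (alexanderHomeo (hk.isSideHomeo f) 0 y)))) :=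
    fun t f y => (hst t).faceMap_char f y
  refine ⟨fun t => faceHomeo (hst t), τ.continuous_of_char_prod fun f => ?_, ?_, ?_, ?_⟩
  · simp only [happ]
    exact (τ.char f).continuous.comp ((continuous_alexander (k f)).comp (continuous_fst.prodMk
      ((continuous_alexander (k f).symm).comp (continuous_const.prodMk continuous_lerp))))
  · ext p
    obtain ⟨f, y, rfl⟩ := τ.cover p
    rw [happ, show IsoDelaunay.lerp 0 y _ = y from Subtype.ext (funext fun i => by
      simp [IsoDelaunay.lerp])]
    exact congrArg _ (alexander_symm (IsSideHomeo.symm (hk.isSideHomeo f)) 0 y)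
  · ext p
    obtain ⟨f, y, rfl⟩ := τ.cover p
    rw [happ, show IsoDelaunay.lerp 1 y _ = IsoDelaunay.alexander (k f) 0 y from
      Subtype.ext (funext fun i => by simp [IsoDelaunay.lerp]; rfl),
      alexander_symm (hk.isSideHomeo f), alexander_of_scale_one _ (max_eq_right unitInterval.le_one')]
    exact (hk.faceMap_char f y).symm
  · intro t z hz
    obtain ⟨f, y, rfl⟩ := τ.cover z
    obtain ⟨i, rfl⟩ := (τ.mem_iff f y).1 hz
    exact ((hst t).faceMap_char f _).trans (by rw [(hst t).apply_vtx])

/-! ### The edge vectors determine the surface -/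

lemma _root_.IsoDelaunay.TranslationSurface.pullsBack_of_isPrimitiveOn [T2Space S] {Ψ : S → S}
    (hΨ : Continuous Ψ) (hZ : ∀ p, Ψ p ∈ Z ↔ p ∈ Z)
    (hP : ∀ G U, IsOpen U → Y.IsPrimitiveOn G U → X.IsPrimitiveOn (G ∘ Ψ) (Ψ ⁻¹' U)) :
    PullsBack X Y Ψ := by
  intro φ hφ φ' hφ' p hp hp'
  obtain ⟨U, hU, hpU, G, hG⟩ := Y.exists_primitive (Ψ p)
  let W := φ.source ∩ Ψ ⁻¹' (φ'.source ∩ U)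
  have hW : IsOpen W := φ.open_source.inter ((φ'.open_source.inter hU).preimage hΨ)
  have hpW : p ∈ W := ⟨hp, hp', hpU⟩
  have hnhds : ∀ q ∈ W, ∀ᶠ z in 𝓝 (φ q), φ.symm z ∈ W ∧ φ (φ.symm z) = z := fun q hq => by
    refine ((φ.continuousAt_symm (φ.map_source hq.1)).eventually_mem ?_).and
      (φ.eventually_right_inverse' hq.1)
    rw [φ.left_inv hq.1]
    exact hW.mem_nhds hq
  have hcont : ∀ q ∈ W, ContinuousAt (φ' ∘ Ψ ∘ φ.symm) (φ q) := fun q hq => by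
    refine ContinuousAt.comp ?_ (hΨ.continuousAt.comp (φ.continuousAt_symm (φ.map_source hq.1)))
    simp only [comp_apply, φ.left_inv hq.1]
    exact φ'.continuousAt hq.2.1
  have hcomp : ∀ q ∈ W, HasDerivAt ((G ∘ φ'.symm) ∘ (φ' ∘ Ψ ∘ φ.symm)) (X.coeff φ (φ q)) (φ q) := by
    intro q hq
    refine (hP G U hU hG φ hφ q ⟨hq.1, hq.2.2⟩).congr_of_eventuallyEq ?_
    filter_upwards [hnhds q hq] with z hz
    simp only [comp_apply]
    rw [φ'.left_inv hz.1.2.1]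
  have heq : ∀ q ∈ W, (φ' ∘ Ψ ∘ φ.symm) (φ q) = φ' (Ψ q) := fun q hq => by simp [φ.left_inv hq.1]
  have hdiff : ∀ q ∈ W, q ∉ Z → DifferentiableAt ℂ (φ' ∘ Ψ ∘ φ.symm) (φ q) := by
    intro q hq hqZ
    have h1 := (hG.analyticAt hU hφ' hq.2.1 hq.2.2).hasStrictDerivAt
    rw [(hG φ' hφ' _ ⟨hq.2.1, hq.2.2⟩).deriv, ← heq q hq] at h1
    refine HasDerivAt.of_comp (hcont q hq) h1 ?_ (hcomp q hq)
    rw [heq q hq]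
    exact Y.ne_zero φ' hφ' _ hq.2.1 fun h => hqZ ((hZ q).1 h)
  have hd : DifferentiableAt ℂ (φ' ∘ Ψ ∘ φ.symm) (φ p) := by
    by_cases hpZ : p ∈ Z
    · refine (Complex.analyticAt_of_differentiable_on_punctured_nhds_of_continuousAt ?_
        (hcont p hpW)).differentiableAt
      have h2 : ∀ᶠ z in 𝓝[≠] φ p, φ.symm z ∉ (Z : Set S) \ {p} :=
        nhdsWithin_le_nhds ((φ.continuousAt_symm (φ.map_source hp)).eventually_mem
          ((Z.finite_toSet.subset sdiff_subset).isClosed.isOpen_compl.mem_nhds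
            (by simp [φ.left_inv hp])))
      filter_upwards [nhdsWithin_le_nhds (hnhds p hpW), h2, self_mem_nhdsWithin] with z hz h2 h3
      have := hdiff _ hz.1 fun hZ => h2 ⟨hZ, fun h => h3 ?_⟩
      · rwa [hz.2] at this
      · rw [mem_singleton_iff, ← hz.2, mem_singleton_iff.1 h]
    · exact hdiff p hpW hpZ
  refine ⟨_, hd.hasDerivAt, ?_⟩
  have h1 := hG φ' hφ' _ ⟨hp', hpU⟩
  rw [← heq p hpW] at h1
  rw [← heq p hpW]
  exact (hcomp p hpW).unique (h1.comp _ hd.hasDerivAt)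

lemma IsGeometric.teichEquiv [T2Space S] (hX : τ.IsGeometric X) (hY : τ.IsGeometric Y)
    (h : τ.edgeVec X = τ.edgeVec Y) : TeichEquiv X Y := by
  have key : ∀ {X Y : TranslationSurface o Z κ} {β γ} (hβ : τ.IsFaceHomeo β) (hγ : τ.IsFaceHomeo γ),
      τ.IsGeometric X → (τ.reparam hβ).IsRealizedBy (τ.edgeVec X) X →
      (τ.reparam hγ).IsRealizedBy (τ.edgeVec X) Y → PullsBack X Y (faceHomeo (hβ.trans hγ.symm)) := by
    intro X Y β γ hβ hγ hX hrX hrY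
    have happ : ∀ f y, faceHomeo (hβ.trans hγ.symm) ((τ.reparam hβ).char f y) =
        (τ.reparam hγ).char f y := fun f y =>
      ((hβ.trans hγ.symm).faceMap_char f _).trans (by simp)
    refine pullsBack_of_isPrimitiveOn (faceHomeo _).continuous (fun p => ?_) fun G U hU hG => ?_
    · obtain ⟨f, y, rfl⟩ := (τ.reparam hβ).cover p
      rw [happ, Triangulation.mem_iff, Triangulation.mem_iff]
    · have hv := isCocycle_edgeVec hX
      refine IsRealizedBy.isPrimitiveOn (τ := τ.reparam hβ) ⟨hv.opp, hv.sum⟩ hrX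
        (hU.preimage (faceHomeo _).continuous) fun f y hy => ?_
      simp only [comp_apply, happ]
      exact hrY.isPLPrimitive hU hG f y (by rwa [← happ])
  obtain ⟨β, hβ, hrX⟩ := hX.exists_reparam
  obtain ⟨γ, hγ, hrY⟩ := hY.exists_reparam
  exact ⟨faceHomeo (hβ.trans hγ.symm), ⟨key hβ hγ hX hrX (h ▸ hrY), key hγ hβ hY hrY (h ▸ hrX)⟩,
    (hβ.trans hγ.symm).isotopicToIdRel⟩

end Triangulation

/-! ### Strata -/

section

variable {W : TranslationSurface o Z κ}

lemma TranslationSurface.IsIso.trans {f g : S ≃ₜ S} (hf : IsIso X Y f) (hg : IsIso Y W g) :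
    IsIso X W (f.trans g) :=
  ⟨PullsBack.comp (f := f) (g := g) f.continuous hg.1 hf.1,
    PullsBack.comp (f := g.symm) (g := f.symm) g.symm.continuous hf.2 hg.2⟩

lemma Stratum.period_mk {γ : C(𝕀, S)} (h0 : γ 0 ∈ Z) (h1 : γ 1 ∈ Z) :
    Stratum.period γ (Stratum.mk X) = X.period γ :=
  (Quotient.exact (Quotient.out_eq (Stratum.mk X)) : TeichEquiv _ X).period_eq h0 h1

lemma Stratum.continuous_period {γ : C(𝕀, S)} (h0 : γ 0 ∈ Z) (h1 : γ 1 ∈ Z) :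
    Continuous (Stratum.period γ : Stratum o Z κ → ℂ) :=
  continuous_iInf_dom (i := ⟨γ, h0, h1⟩) continuous_induced_dom

lemma Stratum.continuous_iff {T : Type*} [TopologicalSpace T] {F : T → Stratum o Z κ} :
    Continuous F ↔ ∀ γ : C(𝕀, S), γ 0 ∈ Z → γ 1 ∈ Z →
      Continuous fun t => Stratum.period γ (F t) := by
  refine ⟨fun h γ h0 h1 => (continuous_period h0 h1).comp h, fun h => ?_⟩
  exact continuous_iInf_rng.2 fun γ => continuous_induced_rng.2 (h γ.1 γ.2.1 γ.2.2)

lemma Stratum.smul_mk (c : ℂˣ) : c • Stratum.mk X = Stratum.mk (c • X) := rfl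

instance : ContinuousConstSMul ℂˣ (Stratum o Z κ) where
  continuous_const_smul c := Stratum.continuous_iff.2 fun γ h0 h1 => by
    refine ((Stratum.continuous_period h0 h1).const_smul (c : ℂ)).congr fun M => ?_
    induction M using Quotient.inductionOn with | h X =>
    change _ = Stratum.period γ (c • Stratum.mk X)
    rw [Stratum.smul_mk, Stratum.period_mk h0 h1, period_smul, ← Stratum.period_mk (X := X) h0 h1]
    rfl

lemma PStratum.mk_eq_iff : PStratum.mk X = PStratum.mk Y ↔ ∃ c : ℂˣ, TeichEquiv (c • X) Y := by
  refine eq_comm.trans (Quotient.eq (r := MulAction.orbitRel ℂˣ (Stratum o Z κ)) |>.trans ?_)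
  exact exists_congr fun c => Quotient.eq (r := teichSetoid o Z κ)

/-- The symmetries of a surface that act as `-1` do not depend on its Teichmüller class. -/
lemma exists_neg_iso {c : ℂˣ} (h : TeichEquiv (c • X) Y) (hX : LiesInHyperellipticComponent X) :
    ∃ F : S ≃ₜ S, IsIso ((-1 : ℂˣ) • Y) Y F ∧
    ((AlgebraicTopology.singularHomologyFunctor (ModuleCat.{0} ℤ) 1).obj (ModuleCat.of ℤ ℤ)).map
      (TopCat.ofHom (F : C(S, S))) = -CategoryTheory.CategoryStruct.id _ ∧
    (Z.card = 1 ∨ (Z.card = 2 ∧ ∀ z ∈ Z, F z ∈ Z ∧ F z ≠ z)) := by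
  obtain ⟨ψ, hψ, H, -, -, rfl, hHZ⟩ := h
  obtain ⟨F, ⟨-, hH⟩, hF, hZ⟩ := hX
  have hfix := hHZ 1
  generalize H 1 = ψ at hψ hfix
  have hF' : IsIso ((-1 : ℂˣ) • c • X) (c • X) F := by
    constructor <;> intro φ hφ φ' hφ' p hp hp'
    · obtain ⟨d, hd, e⟩ := hF.1 φ hφ φ' hφ' p hp hp'
      exact ⟨d, hd, by simp only [smul_coeff] at e ⊢; linear_combination (c : ℂ) * e⟩
    · obtain ⟨d, hd, e⟩ := hF.2 φ hφ φ' hφ' p hp hp'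
      exact ⟨d, hd, by simp only [smul_coeff] at e ⊢; linear_combination (c : ℂ) * e⟩
  have hψ' : IsIso ((-1 : ℂˣ) • Y) ((-1 : ℂˣ) • c • X) ψ.symm := ⟨hψ.2.smul _, hψ.1.smul _⟩
  refine ⟨ψ.symm.trans (F.trans ψ), hψ'.trans (hF'.trans hψ), ?_, hZ.imp id fun ⟨h, hz⟩ =>
    ⟨h, fun z hz' => ?_⟩⟩
  · have e : TopCat.ofHom ((ψ.symm.trans (F.trans ψ) : S ≃ₜ S) : C(S, S)) =
        CategoryTheory.CategoryStruct.comp (TopCat.ofHom (ψ.symm : C(S, S)))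
          (CategoryTheory.CategoryStruct.comp (TopCat.ofHom (F : C(S, S)))
            (TopCat.ofHom (ψ : C(S, S)))) := rfl
    rw [e, CategoryTheory.Functor.map_comp, CategoryTheory.Functor.map_comp, hH,
      CategoryTheory.Preadditive.neg_comp, CategoryTheory.Preadditive.comp_neg,
      CategoryTheory.Category.id_comp, ← CategoryTheory.Functor.map_comp]
    rw [show CategoryTheory.CategoryStruct.comp (TopCat.ofHom (ψ.symm : C(S, S)))
      (TopCat.ofHom (ψ : C(S, S))) = CategoryTheory.CategoryStruct.id (TopCat.of S) by
        ext x; exact ψ.apply_symm_apply x, CategoryTheory.Functor.map_id]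
  · have : (ψ.symm.trans (F.trans ψ)) z = F z := by
      rw [Homeomorph.trans_apply, (ψ.symm_apply_eq).2 (hfix z hz').symm, Homeomorph.trans_apply,
        hfix _ (hz z hz').1]
    rw [this]
    exact hz z hz'

lemma TranslationSurface.PullsBack.mem_of_apply_mem {f : S → S} (h : PullsBack X Y f)
    (hκ : ∀ z, 0 < κ z) {p : S} (hp : f p ∈ Z) : p ∈ Z := by
  by_contra hpZ
  obtain ⟨φ, hφ, hpφ⟩ := X.exists_chart p
  obtain ⟨φ', hφ', hpφ'⟩ := Y.exists_chart (f p)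
  obtain ⟨c, -, hc⟩ := h φ hφ φ' hφ' p hpφ hpφ'
  refine X.ne_zero φ hφ p hpφ hpZ ?_
  have := Y.order_eq φ' hφ' ⟨_, hp⟩ hpφ'
  have h0 : Y.coeff φ' (φ' (f p)) = 0 := by
    apply apply_eq_zero_of_analyticOrderAt_ne_zero
    rw [this]
    exact_mod_cast (hκ _).ne'
  rw [hc, h0, zero_mul]

end

namespace Triangulation

variable {v : τ.Corner → ℂ}

lemma IsNondegenerateDelaunay.exists_isSymmetry_of_neg [T2Space S] [CompactSpace S]
    [ConnectedSpace S] (hN : τ.IsNondegenerateDelaunay X) {F : S ≃ₜ S}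
    (hF : IsIso ((-1 : ℂˣ) • X) X F)
    (hH : ((AlgebraicTopology.singularHomologyFunctor (ModuleCat.{0} ℤ) 1).obj
      (ModuleCat.of ℤ ℤ)).map (TopCat.ofHom (F : C(S, S))) = -CategoryTheory.CategoryStruct.id _)
    (hcard : Z.card = 1 ∨ (Z.card = 2 ∧ ∀ z ∈ Z, F z ∈ Z ∧ F z ≠ z)) :
    ∃ ι, τ.IsSymmetry ι := by
  classical
  by_cases hκ : Z.card = 1 ∧ ∃ z, κ z = 0
  · obtain ⟨h1, z, hz⟩ := hκ
    have hall : ∀ d, d ∈ τ.cornersAt z := fun d =>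
      mem_cornersAt.2 (Finset.card_le_one.1 h1.le _ (tip_mem d) _ z.2)
    refine ⟨τ.opp, exists_isSymmetry_of_two_faces hN.1 ?_⟩
    have hsum := hN.1.sum_angle z
    have := Fintype.ofFinite τ.Face
    rw [Finset.sum_subset (Finset.subset_univ _) fun d _ hd => (hd (hall d)).elim,
      Fintype.sum_prod_type, Finset.sum_congr rfl fun f _ => (angle_mem_angleSpace hN.1).2 f, hz,
      Finset.sum_const, nsmul_eq_mul, Nat.cast_zero, zero_add, mul_one, Finset.card_univ] at hsum
    rw [Nat.card_eq_fintype_card]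
    exact_mod_cast mul_right_cancel₀ Real.pi_ne_zero hsum
  · refine hN.exists_isSymmetry hF (fun p => ?_) hH hcard
    have hZ : ∀ p ∈ Z, F p ∈ Z := by
      rcases hcard with h | h
      · intro p hp
        refine hF.2.mem_of_apply_mem (fun z => Nat.pos_of_ne_zero fun hz => hκ ⟨h, z, hz⟩) ?_
        rwa [F.symm_apply_apply]
      · exact fun p hp => (h.2 p hp).1
    have himg : Z.image F = Z := Finset.eq_of_subset_of_card_le
      (Finset.image_subset_iff.2 hZ) (Finset.card_image_of_injective _ F.injective).ge
    refine ⟨fun h => ?_, hZ p⟩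
    rw [← himg, Finset.mem_image] at h
    obtain ⟨q, hq, e⟩ := h
    rwa [← F.injective e]

/-! ### Scaling -/

lemma cornerAngle_smul (c : ℂˣ) (a : τ.Corner) :
    τ.cornerAngle (fun h => c * v h) a = τ.cornerAngle v a := by
  rw [cornerAngle, ← mul_neg, Complex.angle_mul_left c.ne_zero]
  rfl

lemma edgeVec_smul (c : ℂˣ) : τ.edgeVec (c • X) = fun h => c * τ.edgeVec X h :=
  funext fun _ => period_smul c _

lemma IsGeometric.of_reparam {β : τ.Face → Tri ≃ₜ Tri} {hβ : τ.IsFaceHomeo β}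
    (hr : (τ.reparam hβ).IsRealizedBy v Y) : τ.IsGeometric Y :=
  fun f => ⟨_, (hr f).of_reparam hβ⟩

lemma edgeVec_of_reparam {β : τ.Face → Tri ≃ₜ Tri} {hβ : τ.IsFaceHomeo β} (hv : τ.IsCocycle v)
    (hr : (τ.reparam hβ).IsRealizedBy v Y) : τ.edgeVec Y = v := by
  funext h
  rw [show h = (h.1, h.2) from rfl, ((hr h.1).of_reparam hβ).edgeVec_eq]
  simp only [verts, comp_apply, hβ.apply_vtx]
  exact verts_aff (τ := τ.reparam hβ) ⟨hv.opp, hv.sum⟩ h.1 h.2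

lemma IsCocycle.smul (hv : τ.IsCocycle v) (c : ℂ) : τ.IsCocycle fun h => c * v h :=
  ⟨fun h => by rw [hv.opp, mul_neg], fun f => by rw [← mul_add, ← mul_add, hv.sum, mul_zero]⟩

lemma IsGeometric.smul [T2Space S] [ConnectedSpace S] (hg : τ.IsGeometric X) (c : ℂˣ) :
    τ.IsGeometric (c • X) := by
  obtain ⟨β, hβ, hr⟩ := hg.exists_reparam
  have hv := (isCocycle_edgeVec hg).smul c
  refine IsGeometric.of_reparam (hβ := hβ) (v := fun h => c * τ.edgeVec X h) fun f =>
    isDevelopment_aff (τ := τ.reparam hβ) ⟨hv.opp, hv.sum⟩ f ?_ ?_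
  · have := (hr f).1.smul c
    rwa [show (fun t => (c : ℂ) * (τ.reparam hβ).aff (τ.edgeVec X) f t) =
      (τ.reparam hβ).aff (fun h => c * τ.edgeVec X h) f from
        funext fun t => by simp only [aff]; ring] at this
  · obtain ⟨ε, -, ho⟩ := exists_isOriented hg
    have e : ∀ a b : ℂ, cross (c * a) (-(c * b)) = normSq c * cross a (-b) := fun a b => by
      simp [cross, normSq_apply]; ring
    rw [e]
    exact mul_ne_zero (normSq_pos.2 c.ne_zero).ne' (right_ne_zero_of_mul (ho (f, 0)).ne')

lemma IsOriented.of_isGeometric [T2Space S] [CompactSpace S] [ConnectedSpace S] {ε : ℝ}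
    (hε : ε = 1 ∨ ε = -1) (ho : τ.IsOriented ε (τ.edgeVec X)) (hX : τ.IsGeometric X)
    (hY : τ.IsGeometric Y) : τ.IsOriented ε (τ.edgeVec Y) := by
  obtain ⟨δ, hδ, h⟩ := exists_isOriented hY
  rcases hε with rfl | rfl <;> rcases hδ with rfl | rfl
  · exact h
  · exact (hX.not_opposite hY ho h).elim
  · exact (hY.not_opposite hX h ho).elim
  · exact h

lemma angle_eq_of_mk_eq (hX : τ.IsGeometric X) (hY : τ.IsGeometric Y)
    (h : PStratum.mk X = PStratum.mk Y) : τ.angle X = τ.angle Y := by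
  obtain ⟨c, hc⟩ := PStratum.mk_eq_iff.1 h
  funext a
  have : τ.edgeVec Y = fun h => c * τ.edgeVec X h := by
    rw [← edgeVec_smul]
    exact funext fun h => (hc.period_eq (edgePath_zero_mem h) (edgePath_one_mem h)).symm
  rw [angle_eq_cornerAngle hX, angle_eq_cornerAngle hY, this, cornerAngle_smul]

lemma mk_eq_of_angle_eq [T2Space S] [CompactSpace S] [ConnectedSpace S]
    (hX : τ.IsGeometric X) (hY : τ.IsGeometric Y) (h : τ.angle X = τ.angle Y) :
    PStratum.mk X = PStratum.mk Y := by
  obtain ⟨ε, hε, ho⟩ := exists_isOriented hX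
  obtain ⟨c, hc⟩ := exists_smul_of_cornerAngle_eq o hε (isCocycle_edgeVec hX)
    (isCocycle_edgeVec hY) ho (ho.of_isGeometric hε hX hY)
    (funext fun a => by rw [← angle_eq_cornerAngle hX, h, angle_eq_cornerAngle hY])
  exact PStratum.mk_eq_iff.2 ⟨c, (hX.smul c).teichEquiv hY (by rw [edgeVec_smul, ← funext hc])⟩

/-! ### Periods of realized cochains -/

/-- The space of closed cochains. -/
def cocycles (τ : Triangulation Z) : Submodule ℂ (τ.Corner → ℂ) where
  carrier := {v | τ.IsCocycle v}
  add_mem' {v w} hv hw := ⟨fun h => by simp only [Pi.add_apply, hv.opp, hw.opp]; ring,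
    fun f => by simp only [Pi.add_apply]; linear_combination hv.sum f + hw.sum f⟩
  zero_mem' := ⟨fun h => by simp, fun f => by simp⟩
  smul_mem' c v hv := hv.smul c

/-- The increments of the primitives along a path depend linearly on the cochain. -/
lemma exists_linear_increment [T2Space S] (γ : C(𝕀, S)) :
    ∃ L : τ.cocycles →ₗ[ℂ] ℂ, ∀ (v : τ.cocycles) D, (plSystem v.2).Along γ D → D 1 - D 0 = L v := by
  choose D hD using fun v : τ.cocycles => (plSystem v.2).exists_along γ.continuous
  have huniq : ∀ (v : τ.cocycles) D', (plSystem v.2).Along γ D' → D' 1 - D' 0 = D v 1 - D v 0 :=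
    fun v D' h => by linear_combination h.sub_eq γ.continuous (hD v) 1 0
  refine ⟨{ toFun := fun v => D v 1 - D v 0, map_add' := fun v w => ?_, map_smul' := fun c v => ?_ },
    huniq⟩
  · rw [← huniq (v + w) (fun t => D v t + D w t) fun t => ?_]
    · ring
    · obtain ⟨U, hU, hm, F, hF, he⟩ := hD v t
      obtain ⟨U', hU', hm', F', hF', he'⟩ := hD w t
      refine ⟨U ∩ U', hU.inter hU', ⟨hm, hm'⟩, fun p => F p + F' p, fun f y hy => ?_, ?_⟩
      · filter_upwards [hF f y hy.1, hF' f y hy.2] with y' h h'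
        simp only [aff, Submodule.coe_add, Pi.add_apply] at h h' ⊢
        linear_combination h + h'
      · filter_upwards [he, he'] with s h h'
        rw [h, h']
  · rw [← huniq (c • v) (fun t => c * D v t) fun t => ?_]
    · simp only [RingHom.id_apply, smul_eq_mul]; ring
    · obtain ⟨U, hU, hm, F, hF, he⟩ := hD v t
      refine ⟨U, hU, hm, fun p => c * F p, fun f y hy => ?_, ?_⟩
      · filter_upwards [hF f y hy] with y' h
        simp only [aff, Submodule.coe_smul, Pi.smul_apply, smul_eq_mul] at h ⊢
        linear_combination c * h
      · filter_upwards [he] with s h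
        rw [h]

lemma continuous_period_of_isRealizedBy [T2Space S] {T : Type*} [TopologicalSpace T]
    {V : T → τ.Corner → ℂ} (hV : Continuous V) (hc : ∀ t, τ.IsCocycle (V t))
    {Y : T → TranslationSurface o Z κ} (hr : ∀ t, τ.IsRealizedBy (V t) (Y t))
    (γ : C(𝕀, S)) : Continuous fun t => (Y t).period γ := by
  obtain ⟨L, hL⟩ := exists_linear_increment (τ := τ) γ
  have h1 : Continuous fun t => L ⟨V t, hc t⟩ :=
    L.continuous_of_finiteDimensional.comp (hV.subtype_mk _)
  refine h1.congr fun t => ?_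
  obtain ⟨D, hD⟩ := (Y t).exists_isPrimitiveAlong γ.continuous
  rw [period_eq hD]
  refine (hL ⟨V t, hc t⟩ D fun s => ?_).symm
  obtain ⟨U, hU, hm, F, hF, he⟩ := hD s
  exact ⟨U, hU, hm, F, (hr t).isPLPrimitive hU hF, he⟩

/-! ### Iso-Delaunay regions in angle coordinates -/

lemma angleMapDelaunay_eq {M : isoDelaunayRegion o κ τ} (hX : τ.IsGeometric X)
    (h : PStratum.mk X = M.1) : angleMapDelaunay τ M = τ.angle X :=
  angle_eq_of_mk_eq (isoDelaunayRegion_subset τ M.2).choose_spec.2 hX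
    ((isoDelaunayRegion_subset τ M.2).choose_spec.1.trans h.symm)

lemma continuous_angleMapDelaunay [T2Space S] [ConnectedSpace S] :
    Continuous (angleMapDelaunay τ : isoDelaunayRegion o κ τ → τ.Corner → ℝ) := by
  let q : Stratum o Z κ → PStratum o Z κ := Quotient.mk _
  have hq : IsOpenQuotientMap q := MulAction.isOpenQuotientMap_quotientMk
  have hq' := (hq.restrictPreimage (isoDelaunayRegion o κ τ)).isQuotientMap
  rw [hq'.continuous_iff]
  let w : q ⁻¹' isoDelaunayRegion o κ τ → τ.Corner → ℂ := fun M h =>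
    Stratum.period (τ.edgePath h) M.1
  have hw : ∀ M, ∃ X : TranslationSurface o Z κ, ∃ hX : τ.IsGeometric X, PStratum.mk X = q M.1 ∧
      w M = τ.edgeVec X := fun M => by
    obtain ⟨X, hXM, hX⟩ := M.2
    obtain ⟨Y, hY⟩ := Quotient.exists_rep M.1
    have e : PStratum.mk X = PStratum.mk Y := hXM.trans (congrArg q hY.symm)
    obtain ⟨c, hc⟩ := PStratum.mk_eq_iff.1 e
    refine ⟨c • X, hX.1.smul c, ?_, funext fun h => ?_⟩
    · rw [← hXM, eq_comm]
      exact PStratum.mk_eq_iff.2 ⟨c, teichEquiv_equivalence.refl _⟩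
    · have h0 := edgePath_zero_mem h
      have h1 := edgePath_one_mem h
      have : Stratum.period (τ.edgePath h) (Stratum.mk Y) = _ := Stratum.period_mk h0 h1
      rw [edgeVec, hc.period_eq h0 h1, ← this]
      exact congrArg (Stratum.period _) hY.symm
  have hcomp : ∀ M, angleMapDelaunay τ ((isoDelaunayRegion o κ τ).restrictPreimage q M) =
      τ.cornerAngle (w M) := fun M => by
    obtain ⟨X, hX, h1, h2⟩ := hw M
    rw [angleMapDelaunay_eq (X := X) hX h1, h2]
    exact funext (angle_eq_cornerAngle hX)
  refine Continuous.congr ?_ fun M => (hcomp M).symm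
  refine continuous_pi fun a => continuous_iff_continuousAt.2 fun M => ?_
  have hwc : ∀ h, Continuous fun M => w M h := fun h =>
    (Stratum.continuous_period (edgePath_zero_mem h) (edgePath_one_mem h)).comp
      continuous_subtype_val
  obtain ⟨X, hX, -, h2⟩ := hw M
  obtain ⟨ε, -, ho⟩ := exists_isOriented hX
  have hne := ho.ne_zero
  rw [← h2] at hne
  exact ContinuousAt.comp (f := fun M => (w M (a.1, a.2 + 2), -w M (a.1, a.2 + 1)))
    (InnerProductGeometry.continuousAt_angle (hne _) (neg_ne_zero.2 (hne _)))
    ((hwc _).prodMk (hwc _).neg).continuousAt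

/-- The angle assignments that are invariant under `ι`, satisfy the Delaunay condition and have the
total angles of the stratum. -/
def delaunayAngles (τ : Triangulation Z) (κ : Z → ℕ) (ι : τ.Corner → τ.Corner) :
    Set (τ.Corner → ℝ) :=
  {θ | θ ∈ angleSpace τ ∧ (∀ a, θ (ι a) = θ a) ∧ (∀ h, θ h + θ (τ.opp h) < π) ∧
    ∀ z : Z, ∑ d ∈ τ.cornersAt z, θ d = 2 * π * (κ z + 1)}

lemma convex_delaunayAngles (ι : τ.Corner → τ.Corner) : Convex ℝ (τ.delaunayAngles κ ι) := by
  rintro θ ⟨⟨h1, h2⟩, h3, h4, h5⟩ η ⟨⟨k1, k2⟩, k3, k4, k5⟩ a b ha hb hab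
  have hcomb : ∀ {s : Finset τ.Corner} {c : ℝ}, ∑ d ∈ s, θ d = c → ∑ d ∈ s, η d = c →
      ∑ d ∈ s, (a • θ + b • η) d = c := fun {s c} h k => by
    simp only [Pi.add_apply, Pi.smul_apply, smul_eq_mul, Finset.sum_add_distrib, ← Finset.mul_sum,
      h, k, ← add_mul, hab, one_mul]
  refine ⟨⟨fun c => convex_Ioo 0 π (h1 c) (k1 c) ha hb hab, fun f => ?_⟩, fun c => ?_,
    fun h => ?_, fun z => hcomb (h5 z) (k5 z)⟩
  · have h := h2 f
    have k := k2 f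
    simp only [Fin.sum_univ_three, Pi.add_apply, Pi.smul_apply, smul_eq_mul] at h k ⊢
    linear_combination a * h + b * k + π * hab
  · simp only [Pi.add_apply, Pi.smul_apply, h3, k3]
  · have := convex_Iio π (h4 h) (k4 h) ha hb hab
    simp only [smul_eq_mul, mem_Iio] at this
    simp only [Pi.add_apply, Pi.smul_apply, smul_eq_mul]
    linarith

lemma IsSymmetry.isEmbedding_angleMapDelaunay [T2Space S] [CompactSpace S] [ConnectedSpace S]
    {ι : τ.Corner → τ.Corner} (hι : τ.IsSymmetry ι) (hX : τ.IsGeometric X) :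
    IsEmbedding (angleMapDelaunay τ : isoDelaunayRegion o κ τ → τ.Corner → ℝ) ∧
      range (angleMapDelaunay τ : isoDelaunayRegion o κ τ → τ.Corner → ℝ) =
        τ.delaunayAngles κ ι := by
  obtain ⟨ε, hε, ho⟩ := exists_isOriented hX
  have hv := isCocycle_edgeVec hX
  obtain ⟨V, hVc, hV⟩ := hι.exists_edgeVec hε hv ho (by
    rw [← funext (angle_eq_cornerAngle hX)]; exact angle_mem_angleSpace hX)
  obtain ⟨β, hβ, hr⟩ := hX.exists_reparam
  have hmem : ∀ M : isoDelaunayRegion o κ τ, angleMapDelaunay τ M ∈ τ.delaunayAngles κ ι := by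
    intro M
    obtain ⟨Y, hM, hY⟩ := M.2
    rw [angleMapDelaunay_eq hY.1 hM]
    refine ⟨angle_mem_angleSpace hY.1, fun a => ?_, (isNondegenerateDelaunay_iff hY.1).1 hY,
      hY.1.sum_angle⟩
    rw [angle_eq_cornerAngle hY.1, angle_eq_cornerAngle hY.1,
      hι.cornerAngle_comp (isCocycle_edgeVec hY.1)]
  have hex : ∀ θ : τ.delaunayAngles κ ι, ∃ Y : TranslationSurface o Z κ,
      (τ.reparam hβ).IsRealizedBy (V θ.1) Y := fun θ => by
    obtain ⟨hc, ho', ha⟩ := hV θ.1 θ.2.1 θ.2.2.1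
    refine exists_realization (τ := τ.reparam hβ) hε hr ⟨hv.opp, hv.sum⟩ ⟨hc.opp, hc.sum⟩ ho ho'
      fun z hz => ?_
    have h1 := hX.sum_angle ⟨z, hz⟩
    rw [← θ.2.2.2.2 ⟨z, hz⟩, ← ha, funext (angle_eq_cornerAngle hX)] at h1
    rw [cornersAt_reparam]
    exact h1
  choose Y hY using hex
  have hg : ∀ θ, τ.IsGeometric (Y θ) := fun θ => IsGeometric.of_reparam (hY θ)
  have hangle : ∀ θ, τ.angle (Y θ) = θ.1 := fun θ => by
    obtain ⟨hc, -, ha⟩ := hV θ.1 θ.2.1 θ.2.2.1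
    rw [funext (angle_eq_cornerAngle (hg θ)), edgeVec_of_reparam hc (hY θ)]
    exact ha
  have hN : ∀ θ, τ.IsNondegenerateDelaunay (Y θ) := fun θ =>
    (isNondegenerateDelaunay_iff (hg θ)).2 (by rw [hangle]; exact θ.2.2.2.1)
  let g : τ.delaunayAngles κ ι → isoDelaunayRegion o κ τ := fun θ =>
    ⟨PStratum.mk (Y θ), Y θ, rfl, hN θ⟩
  have hVc' : Continuous fun θ : τ.delaunayAngles κ ι => V θ.1 := continuous_pi fun h =>
    (hVc h).comp_continuous continuous_subtype_val fun θ => θ.2.1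
  have hgc : Continuous g := by
    refine Continuous.subtype_mk (continuous_quotient_mk'.comp (f := fun θ => Stratum.mk (Y θ))
      (Stratum.continuous_iff.2 fun γ h0 h1 => ?_)) _
    simp only [Stratum.period_mk h0 h1]
    refine continuous_period_of_isRealizedBy (τ := τ.reparam hβ) hVc' (fun θ => ?_) hY γ
    obtain ⟨hc, -⟩ := hV θ.1 θ.2.1 θ.2.2.1
    exact ⟨hc.opp, hc.sum⟩
  have hleft : Function.LeftInverse g fun M => ⟨angleMapDelaunay τ M, hmem M⟩ := fun M => by
    obtain ⟨W, hM, hW⟩ := M.2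
    refine Subtype.ext ((mk_eq_of_angle_eq (hg _) hW.1 ?_).trans hM)
    rw [hangle]
    exact angleMapDelaunay_eq hW.1 hM
  refine ⟨IsEmbedding.subtypeVal.comp
    (hleft.isEmbedding hgc (continuous_angleMapDelaunay.subtype_mk hmem)), ?_⟩
  refine Subset.antisymm (range_subset_iff.2 hmem) fun θ hθ => ⟨g ⟨θ, hθ⟩, ?_⟩
  rw [angleMapDelaunay_eq (hg ⟨θ, hθ⟩) rfl, hangle]

end Triangulation

end IsoDelaunay

end

theorem corollaryB {S : Type} [TopologicalSpace S] [T2Space S] [CompactSpace S] [ConnectedSpace S]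
    (o : IsoDelaunay.SurfaceOrientation S) (Z : Finset S) (κ : Z → ℕ)
    (τ : IsoDelaunay.Triangulation Z)
    (hτ : (IsoDelaunay.isoDelaunayRegion o κ τ ∩ IsoDelaunay.hyperellipticLocus o Z κ).Nonempty) :
    Topology.IsEmbedding
      (IsoDelaunay.angleMapDelaunay τ : IsoDelaunay.isoDelaunayRegion o κ τ → τ.Corner → ℝ) ∧
    Set.range
      (IsoDelaunay.angleMapDelaunay τ : IsoDelaunay.isoDelaunayRegion o κ τ → τ.Corner → ℝ) ⊆
      IsoDelaunay.angleSpace τ ∧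
    Convex ℝ (Set.range
      (IsoDelaunay.angleMapDelaunay τ : IsoDelaunay.isoDelaunayRegion o κ τ → τ.Corner → ℝ)) := by
  obtain ⟨M, ⟨X, hXM, hX⟩, W, hWM, hW⟩ := hτ
  obtain ⟨c, hc⟩ := IsoDelaunay.PStratum.mk_eq_iff.1 (hWM.trans hXM.symm)
  obtain ⟨F, hF, hH, hZ⟩ := IsoDelaunay.exists_neg_iso hc hW
  obtain ⟨ι, hι⟩ := hX.exists_isSymmetry_of_neg hF hH hZ
  obtain ⟨h1, h2⟩ := hι.isEmbedding_angleMapDelaunay hX.1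
  refine ⟨h1, ?_⟩
  rw [h2]
  exact ⟨fun θ hθ => hθ.1, IsoDelaunay.Triangulation.convex_delaunayAngles ι⟩
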